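/- Let $p>2$ be a prime, let $\mathbb K$ be an algebraically closed field of characteristic $p$ with a nontrivial valuation $v:\mathbb K^*\to\mathbb R$, and let $n\ge 0$. A vector $a=(a_0,\dots,a_n)$, viewed as the tropical polynomial $f=a_0\oplus a_1x\oplus\dots\oplus a_nx^n$, is \emph{singular with double root} $b$ if there are $F=\sum_i A_iX^i\in\mathbb K[X]$ and $B\in\mathbb K^*$ with $v(A_i)=a_i$ for all $i$, $v(B)=b$ and $F(B)=F'(B)=0$; for real $a,b$, $b$ is called a double root of $f$ if $(b,a)$ lies in the closure in $\mathbb R\times\mathbb R^{n+1}$ of the set of these pairs. The tropical discriminant $\Delta_{p,n}\subseteq\mathbb R^{n+1}$ is the closure of the set of singular $f$. Its maximal cones are those of its coarsest fan structure (dual to the edges of the Newton polytope of the discriminant), that is, the closures of the connected components of the set of points of $\Delta_{p,n}$ near which $\Delta_{p,n}$ is a hyperplane. Write $[i]$ for the class of $i$ modulo $p$. A maximal cone $C$ is of * type I, denoted $\{i,j,k\}$, where $[i],[j],[k]$ are pairwise different, if for every $f\in C$ there is $b$ such that $\min_m(a_m+mb)$ is attained at $m=i,j,k$; * type II, denoted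 $[\{i,j\},\{k,l\}]$, where $i\ne j$, $[i]=[j]$ and $[i],[k],[l]$ are pairwise different, if for every $f\in C$ there is $b$ such that $\min_m(a_m+mb)$ is attained at $i,j$ and $\min_{[m]\neq[i]}(a_m+mb)$ is attained at $k,l$; * type III, denoted $\{\{i,j\},\{k,l\}\}$, where $i\neq j$, $k\ne l$ and $[i]=[j]\neq[k]=[l]$, if for every $f\in C$ there is $b$ such that the condition displayed for type II holds, possibly with the two pairs exchanged. Let $C_1\neq C_2$ be maximal cones of $\Delta_{p,n}$ such that $D=C_1\cap C_2$ has dimension $n-1$. Then $D$ has a nonempty relative interior, and either every $f$ in the relative interior of $D$ has exactly two double roots $a_1\ne a_2$, or every such $f$ has exactly one double root (the case $a_1=a_2$). Moreover: 1. If $a_1\neq a_2$, then $D$ is a face of exactly $4$ maximal cones of $\Delta_{p,n}$. Here $C_1$ and $C_2$ can be of any types: for each of the nine ordered pairs of types and all sufficiently large $n$, such $C_1,C_2$ with these types exist. 2. If $a_1=a_2$, then: (a) It is impossible that one of $C_1,C_2$ is of type I and the other of type III. For every other ordered pair of types and all sufficiently large $n$, such $C_1,C_2$ with these types exist. (b)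 If $C_1=\{i,j,k\}$ and $C_2=\{i,j,l\}$ are both of type I with $[i],[j],[k],[l]$ pairwise different, then $D$ is a face of exactly $4$ maximal cones of $\Delta_{p,n}$; otherwise it is a face of exactly $3$. -/

import Mathlib

open Topology

/-- The univariate polynomial `∑ Aᵢ Xⁱ`, `0 ≤ i ≤ n`, with the given coefficients. -/
noncomputable def polyOf {K : Type*} [Field K] {n : ℕ} (A : Fin (n + 1) → K) : Polynomial K :=
  ∑ i : Fin (n + 1), Polynomial.C (A i) * Polynomial.X ^ (i : ℕ)

/-- The pairs `(b, a)` for which there are `F = ∑ Aᵢ Xⁱ` and `B` with `v(Aᵢ) = aᵢ` and `v(B) = b`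
such that `B` is a singular point of `F`, that is `F(B) = F'(B) = 0`. As the values are real,
all the `Aᵢ` and `B` are nonzero. -/
def singularPairs {K : Type*} [Field K] (v : AddValuation K (WithTop ℝ)) (n : ℕ) :
    Set (ℝ × (Fin (n + 1) → ℝ)) :=
  {q | ∃ (A : Fin (n + 1) → K) (B : K),
    (∀ i, v (A i) = ((q.2 i : ℝ) : WithTop ℝ)) ∧ v B = ((q.1 : ℝ) : WithTop ℝ) ∧
    (polyOf A).eval B = 0 ∧ (polyOf A).derivative.eval B = 0}

/-- The tropical discriminant of degree `n`: the closure in `ℝⁿ⁺¹` of the set of coefficient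
vectors of singular tropical polynomials `a₀ ⊕ a₁x ⊕ ⋯ ⊕ aₙxⁿ`. -/
def tropDisc {K : Type*} [Field K] (v : AddValuation K (WithTop ℝ)) (n : ℕ) :
    Set (Fin (n + 1) → ℝ) :=
  closure {a | ∃ b : ℝ, (b, a) ∈ singularPairs v n}

/-- The tropical double roots of `f`. The closure extends the notion from coefficients in the value
group to real coefficients. -/
def doubleRoots {K : Type*} [Field K] (v : AddValuation K (WithTop ℝ)) {n : ℕ}
    (f : Fin (n + 1) → ℝ) : Set ℝ :=
  {b | (b, f) ∈ closure (singularPairs v n)}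

/-- The points of `X ⊆ ℝⁿ⁺¹` near which `X` coincides with a hyperplane. -/
def regularPoints {n : ℕ} (X : Set (Fin (n + 1) → ℝ)) : Set (Fin (n + 1) → ℝ) :=
  {f | f ∈ X ∧ ∃ L : Submodule ℝ (Fin (n + 1) → ℝ),
    Module.finrank ℝ L = n ∧ ∀ᶠ g in 𝓝 f, (g ∈ X ↔ g - f ∈ L)}

/-- The maximal cones of (the coarsest fan structure on) a tropical hypersurface `X`: the closures
of the connected components of its regular locus. For the tropical hypersurface of a polynomial
`G` they are the cones dual to the edges of the Newton polytope of `G`: the tropical hypersurface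
is a hyperplane near the relative interior of such a cone, and at a point of a cone that is dual to
a face of dimension at least `2` it is not, as its complement has at least three local
components there. -/
def IsMaximalCone {n : ℕ} (X C : Set (Fin (n + 1) → ℝ)) : Prop :=
  ∃ f ∈ regularPoints X, C = closure (connectedComponentIn (regularPoints X) f)

/-- `C₁` and `C₂` are different maximal cones of the tropical discriminant in `ℝⁿ⁺¹` and
`C₁ ∩ C₂` has dimension `n - 1`. -/
def AreAdjacent {K : Type*} [Field K] (v : AddValuation K (WithTop ℝ)) {n : ℕ}
    (C₁ C₂ : Set (Fin (n + 1) → ℝ)) : Prop :=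
  IsMaximalCone (tropDisc v n) C₁ ∧ IsMaximalCone (tropDisc v n) C₂ ∧ C₁ ≠ C₂ ∧
    Module.finrank ℝ (Submodule.span ℝ (C₁ ∩ C₂)) + 1 = n

/-- The maximal cones of the tropical discriminant that have `D` as a face. -/
def conesWithFace {K : Type*} [Field K] (v : AddValuation K (WithTop ℝ)) {n : ℕ}
    (D : Set (Fin (n + 1) → ℝ)) : Set (Set (Fin (n + 1) → ℝ)) :=
  {C | IsMaximalCone (tropDisc v n) C ∧ IsExposed ℝ C D}

/-- Monomials with the same residue class modulo `p`. -/
def SameClass (p : ℕ) {n : ℕ} (i j : Fin (n + 1)) : Prop :=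
  (i : ℕ) ≡ (j : ℕ) [MOD p]

/-- Coefficients of `f(b x)`; the point `b` is moved to `0`. -/
def shiftRoot {n : ℕ} (b : ℝ) (f : Fin (n + 1) → ℝ) : Fin (n + 1) → ℝ :=
  fun i => f i + ((i : ℕ) : ℝ) * b

/-- The minimum is attained at `i, j, k`. -/
def minAtThree {n : ℕ} (i j k : Fin (n + 1)) : Set (Fin (n + 1) → ℝ) :=
  {a | a i = a j ∧ a j = a k ∧ ∀ m, a i ≤ a m}

/-- The minimum is attained at `i, j` and, once the monomials congruent to `i` modulo `p` are
removed, the minimum is attained at `k, l`. -/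
def minAtPairs (p : ℕ) {n : ℕ} (i j k l : Fin (n + 1)) : Set (Fin (n + 1) → ℝ) :=
  {a | a i = a j ∧ (∀ m, a i ≤ a m) ∧ a k = a l ∧ ∀ m, ¬ SameClass p m i → a k ≤ a m}

/-- All polynomials in `C` have, after moving a suitable point to `0`, coefficients in `S`. -/
def LiesOver {n : ℕ} (C S : Set (Fin (n + 1) → ℝ)) : Prop :=
  ∀ f ∈ C, ∃ b : ℝ, shiftRoot b f ∈ S

/-- `C` is of type I, denoted `{i, j, k}`. -/
def IsCellI (p : ℕ) {n : ℕ} (C : Set (Fin (n + 1) → ℝ)) (i j k : Fin (n + 1)) : Prop :=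
  ¬ SameClass p i j ∧ ¬ SameClass p i k ∧ ¬ SameClass p j k ∧ LiesOver C (minAtThree i j k)

/-- `C` is of type II, denoted `[{i, j}, {k, l}]`. -/
def IsCellII (p : ℕ) {n : ℕ} (C : Set (Fin (n + 1) → ℝ)) (i j k l : Fin (n + 1)) : Prop :=
  i ≠ j ∧ SameClass p i j ∧ ¬ SameClass p k i ∧ ¬ SameClass p l i ∧ ¬ SameClass p k l ∧
    LiesOver C (minAtPairs p i j k l)

/-- `C` is of type III, denoted `{{i, j}, {k, l}}`; the order of the two pairs is immaterial: a
cone of this type contains the polynomials with either pair as the lower one. -/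
def IsCellIII (p : ℕ) {n : ℕ} (C : Set (Fin (n + 1) → ℝ)) (i j k l : Fin (n + 1)) : Prop :=
  i ≠ j ∧ SameClass p i j ∧ k ≠ l ∧ SameClass p k l ∧ ¬ SameClass p k i ∧
    LiesOver C (minAtPairs p i j k l ∪ minAtPairs p k l i j)

inductive ConeType
  | I
  | II
  | III

def HasType (p : ℕ) {n : ℕ} (C : Set (Fin (n + 1) → ℝ)) : ConeType → Prop
  | ConeType.I => ∃ i j k, IsCellI p C i j k
  | ConeType.II => ∃ i j k l, IsCellII p C i j k l
  | ConeType.III => ∃ i j k l, IsCellIII p C i j k l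

/-- `C₁ = {i, j, k}` and `C₂ = {i, j, l}` are of type I and the classes of `i, j, k, l` are
pairwise different. -/
def FourClassesI (p : ℕ) {n : ℕ} (C₁ C₂ : Set (Fin (n + 1) → ℝ)) : Prop :=
  ∃ i j k l : Fin (n + 1), IsCellI p C₁ i j k ∧ IsCellI p C₂ i j l ∧ ¬ SameClass p k l

/-- The generic (relative interior) points of `D` have two different tropical double roots. -/
def TwoRoots {K : Type*} [Field K] (v : AddValuation K (WithTop ℝ)) {n : ℕ}
    (D : Set (Fin (n + 1) → ℝ)) : Prop :=
  ∀ f ∈ intrinsicInterior ℝ D, ∃ a₁ a₂ : ℝ, a₁ ≠ a₂ ∧ doubleRoots v f = {a₁, a₂}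

/-- The generic points of `D` have only one tropical double root. -/
def OneRoot {K : Type*} [Field K] (v : AddValuation K (WithTop ℝ)) {n : ℕ}
    (D : Set (Fin (n + 1) → ℝ)) : Prop :=
  ∀ f ∈ intrinsicInterior ℝ D, ∃ a : ℝ, doubleRoots v f = {a}

/-! ### Minimizers -/

/-- The points of `A` at which `w` attains its minimum over `A`. -/
def argminOn {α : Type*} (A : Set α) (w : α → ℝ) : Set α := {i | i ∈ A ∧ ∀ m ∈ A, w i ≤ w m}

section argmin
variable {α : Type*} {A B : Set α} {w w' : α → ℝ}

lemma argminOn_subset : argminOn A w ⊆ A := fun _ h => h.1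

lemma argminOn_nonempty (hA : A.Finite) (hne : A.Nonempty) : (argminOn A w).Nonempty := by
  obtain ⟨i, hi, h⟩ := Set.exists_min_image A w hA hne
  exact ⟨i, hi, h⟩

lemma eq_of_mem_argminOn {i j : α} (hi : i ∈ argminOn A w) (hj : j ∈ argminOn A w) : w i = w j :=
  le_antisymm (hi.2 j hj.1) (hj.2 i hi.1)

lemma argminOn_eq_of_subset (hA : A.Finite) (hBA : B ⊆ A) (h : argminOn A w ⊆ B) :
    argminOn A w = argminOn B w := by
  ext i
  refine ⟨fun hi => ⟨h hi, fun m hm => hi.2 m (hBA hm)⟩, fun hi => ⟨hBA hi.1, fun m hm => ?_⟩⟩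
  obtain ⟨j, hj⟩ := argminOn_nonempty (w := w) hA ⟨i, hBA hi.1⟩
  exact (hi.2 j (h hj)).trans (hj.2 m hm)

lemma argminOn_inter_of_nonempty {S T : Set α} (h : (argminOn S w ∩ T).Nonempty) (hT : T ⊆ S) :
    argminOn T w = argminOn S w ∩ T := by
  obtain ⟨j, hj, hjT⟩ := h
  ext i
  exact ⟨fun hi => ⟨⟨hT hi.1, fun m hm => (hi.2 j hjT).trans (hj.2 m hm)⟩, hi.1⟩,
    fun hi => ⟨hi.2, fun m hm => hi.1.2 m (hT hm)⟩⟩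

lemma argminOn_add_argminOn : argminOn (argminOn A w) (fun i => w i + w' i) =
    argminOn (argminOn A w) w' := by
  ext i
  constructor
  · rintro ⟨hi, h⟩
    refine ⟨hi, fun m hm => ?_⟩
    have := h m hm
    have e := eq_of_mem_argminOn hi hm
    simp only at this
    linarith
  · rintro ⟨hi, h⟩
    refine ⟨hi, fun m hm => ?_⟩
    have := h m hm
    have e := eq_of_mem_argminOn hi hm
    simp only
    linarith

lemma argminOn_eventually_subset {X : Type*} {l : Filter X} (hA : A.Finite) {φ : X → α → ℝ}
    (h : ∀ i ∈ A, Filter.Tendsto (fun x => φ x i) l (𝓝 (w i))) :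
    ∀ᶠ x in l, argminOn A (φ x) ⊆ argminOn A w := by
  have key : ∀ i ∈ A, ∀ᶠ x in l, i ∈ argminOn A (φ x) → i ∈ argminOn A w := by
    intro i hi
    by_cases hi' : i ∈ argminOn A w
    · exact Filter.Eventually.of_forall fun _ _ => hi'
    · have : ∃ m ∈ A, w m < w i := by
        by_contra hcon
        push Not at hcon
        exact hi' ⟨hi, hcon⟩
      obtain ⟨m, hm, hlt⟩ := this
      filter_upwards [(h m hm).eventually_lt (h i hi) hlt] with x hx hxi
      exact absurd (hxi.2 m hm) (not_le.2 hx)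
  filter_upwards [(Filter.eventually_all_finite hA).2 key] with x hx i hi
  exact hx i hi.1 hi

lemma argminOn_eventually_eq {X : Type*} {l : Filter X} (hA : A.Finite) {φ : X → α → ℝ}
    (h : ∀ i ∈ A, Filter.Tendsto (fun x => φ x i) l (𝓝 (w i))) :
    ∀ᶠ x in l, argminOn A (φ x) = argminOn (argminOn A w) (φ x) := by
  filter_upwards [argminOn_eventually_subset hA h] with x hx
  exact argminOn_eq_of_subset hA argminOn_subset hx

end argmin

/-! ### The tropical linear space of singular coefficient vectors -/

/-- The tropical linear space `{∑ cᵢ = ∑ i cᵢ = 0}`: for each residue class the minimum over the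
complement of the class is attained at least twice. -/
def singularSpace (p n : ℕ) : Set (Fin (n + 1) → ℝ) :=
  {w | ∀ t : Fin (n + 1), (argminOn {m | ¬ SameClass p m t} w).Nontrivial}

section classes
variable {p n : ℕ} {i j k : Fin (n + 1)}

lemma SameClass.refl' (i : Fin (n + 1)) : SameClass p i i := Nat.ModEq.refl _
lemma SameClass.symm' (h : SameClass p i j) : SameClass p j i := Nat.ModEq.symm h
lemma SameClass.trans' (h : SameClass p i j) (h' : SameClass p j k) : SameClass p i k :=
  Nat.ModEq.trans h h'

end classes

/-- The minimum of `w` is attained exactly on `M`, which meets three residue classes. -/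
structure IsTri (p : ℕ) {n : ℕ} (w : Fin (n + 1) → ℝ) (M : Set (Fin (n + 1))) : Prop where
  eq : M = argminOn Set.univ w
  three : ∃ i ∈ M, ∃ j ∈ M, ∃ k ∈ M, ¬ SameClass p i j ∧ ¬ SameClass p i k ∧ ¬ SameClass p j k

/-- The minimum of `w` over the class of `r` is attained on `M`, the minimum over the complement
is attained on `N`, both at least twice, and the former minimum is not larger. -/
structure IsPair (p : ℕ) {n : ℕ} (w : Fin (n + 1) → ℝ) (r : Fin (n + 1))
    (M N : Set (Fin (n + 1))) : Prop where
  eqM : M = argminOn {m | SameClass p m r} w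
  eqN : N = argminOn {m | ¬ SameClass p m r} w
  nontrivM : M.Nontrivial
  nontrivN : N.Nontrivial
  le : ∀ i ∈ M, ∀ j ∈ N, w i ≤ w j
  single : ∀ i ∈ M, ∀ j ∈ N, w i = w j → ∀ l ∈ N, SameClass p j l

section space
variable {p n : ℕ} {w : Fin (n + 1) → ℝ}

lemma argminOn_not_class_of_mem {t m : Fin (n + 1)} (hm : m ∈ argminOn Set.univ w)
    (hmt : ¬ SameClass p m t) :
    argminOn {m | ¬ SameClass p m t} w = argminOn Set.univ w ∩ {m | ¬ SameClass p m t} :=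
  argminOn_inter_of_nonempty ⟨m, hm, hmt⟩ (Set.subset_univ _)

lemma isTri_or_isPair (hw : w ∈ singularSpace p n) :
    (∃ M, IsTri p w M) ∨ ∃ r M N, IsPair p w r M N := by
  obtain ⟨r, hr⟩ := argminOn_nonempty (w := w) (Set.finite_univ) Set.univ_nonempty
  by_cases h1 : ∀ m ∈ argminOn Set.univ w, SameClass p m r
  · right
    refine ⟨r, _, _, rfl, rfl, ?_, hw r, ?_, ?_⟩
    · obtain ⟨t, ht⟩ := (hw r).nonempty
      have hrt : ¬ SameClass p r t := fun h => ht.1 h.symm'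
      have := hw t
      rw [argminOn_not_class_of_mem hr hrt] at this
      refine this.mono fun m hm => ?_
      rw [argminOn_inter_of_nonempty ⟨r, hr, SameClass.refl' r⟩ (Set.subset_univ _)]
      exact ⟨hm.1, h1 m hm.1⟩
    · intro i hi j hj
      exact (hi.2 r (SameClass.refl' r)).trans (hr.2 j trivial)
    · intro i hi j hj hij
      exact absurd (h1 j ⟨trivial, fun m _ => by
        rw [← hij]; exact (hi.2 r (SameClass.refl' r)).trans (hr.2 m trivial)⟩) hj.1
  · push Not at h1
    obtain ⟨s, hs, hsr⟩ := h1
    have hrs : ¬ SameClass p r s := fun h => hsr h.symm'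
    by_cases h2 : ∀ m ∈ argminOn Set.univ w, SameClass p m r ∨ SameClass p m s
    · right
      refine ⟨r, _, _, rfl, rfl, ?_, hw r, ?_, ?_⟩
      · have := hw s
        rw [argminOn_not_class_of_mem hr hrs] at this
        refine this.mono fun m hm => ?_
        rw [argminOn_inter_of_nonempty ⟨r, hr, SameClass.refl' r⟩ (Set.subset_univ _)]
        exact ⟨hm.1, (h2 m hm.1).resolve_right hm.2⟩
      · intro i hi j hj
        exact (hi.2 r (SameClass.refl' r)).trans (hr.2 j trivial)
      · intro i hi j hj _ l hl
        rw [argminOn_not_class_of_mem hs hsr] at hj hl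
        exact ((h2 j hj.1).resolve_left hj.2).trans' ((h2 l hl.1).resolve_left hl.2).symm'
    · push Not at h2
      obtain ⟨q, hq, hqr, hqs⟩ := h2
      exact Or.inl ⟨_, rfl, r, hr, s, hs, q, hq, hrs, fun h => hqr h.symm', fun h => hqs h.symm'⟩

lemma mem_singularSpace_of_three {i j k : Fin (n + 1)} (hij : ¬ SameClass p i j)
    (hik : ¬ SameClass p i k) (hjk : ¬ SameClass p j k) (h : w ∈ minAtThree i j k) :
    w ∈ singularSpace p n := by
  obtain ⟨h1, h2, h3⟩ := h
  have nij : i ≠ j := fun h => hij (h ▸ SameClass.refl' i)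
  have nik : i ≠ k := fun h => hik (h ▸ SameClass.refl' i)
  have njk : j ≠ k := fun h => hjk (h ▸ SameClass.refl' j)
  intro t
  by_cases hi : SameClass p i t
  · refine ⟨j, ⟨fun h => hij (hi.trans' h.symm'), fun m _ => h1 ▸ h3 m⟩, k,
      ⟨fun h => hik (hi.trans' h.symm'), fun m _ => h2 ▸ h1 ▸ h3 m⟩, njk⟩
  · by_cases hj : SameClass p j t
    · exact ⟨i, ⟨hi, fun m _ => h3 m⟩, k,
        ⟨fun h => hjk (hj.trans' h.symm'), fun m _ => h2 ▸ h1 ▸ h3 m⟩, nik⟩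
    · exact ⟨i, ⟨hi, fun m _ => h3 m⟩, j, ⟨hj, fun m _ => h1 ▸ h3 m⟩, nij⟩

lemma mem_singularSpace_of_pairs {i j k l : Fin (n + 1)} (nij : i ≠ j) (hij : SameClass p i j)
    (nkl : k ≠ l) (hk : ¬ SameClass p k i) (hl : ¬ SameClass p l i) (h : w ∈ minAtPairs p i j k l) :
    w ∈ singularSpace p n := by
  obtain ⟨h1, h2, h3, h4⟩ := h
  intro t
  by_cases hi : SameClass p i t
  · refine ⟨k, ⟨fun h => hk (h.trans' hi.symm'), fun m hm => h4 m fun h => hm (h.trans' hi)⟩, l,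
      ⟨fun h => hl (h.trans' hi.symm'), fun m hm => h3 ▸ h4 m fun h => hm (h.trans' hi)⟩, nkl⟩
  · exact ⟨i, ⟨hi, fun m _ => h2 m⟩, j, ⟨fun h => hi (hij.trans' h), fun m _ => h1 ▸ h2 m⟩, nij⟩

lemma isClosed_singularSpace : IsClosed (singularSpace p n) := by
  have : singularSpace p n = ⋂ t : Fin (n + 1), ⋃ q : {q : Fin (n + 1) × Fin (n + 1) //
      q.1 ≠ q.2 ∧ ¬ SameClass p q.1 t ∧ ¬ SameClass p q.2 t}, ⋂ m : {m // ¬ SameClass p m t},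
      {w : Fin (n + 1) → ℝ | w q.1.1 ≤ w m ∧ w q.1.2 ≤ w m} := by
    ext w
    simp only [singularSpace, Set.mem_ofPred_eq, Set.mem_iInter, Set.mem_iUnion]
    refine forall_congr' fun t => ⟨?_, ?_⟩
    · rintro ⟨i, hi, j, hj, hij⟩
      exact ⟨⟨(i, j), hij, hi.1, hj.1⟩, fun m => ⟨hi.2 m m.2, hj.2 m m.2⟩⟩
    · rintro ⟨⟨⟨i, j⟩, hij, hi, hj⟩, h⟩
      exact ⟨i, ⟨hi, fun m hm => (h ⟨m, hm⟩).1⟩, j, ⟨hj, fun m hm => (h ⟨m, hm⟩).2⟩, hij⟩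
  rw [this]
  refine isClosed_iInter fun t => isClosed_iUnion_of_finite fun q => isClosed_iInter fun m => ?_
  have hcl : ∀ i, IsClosed {w : Fin (n + 1) → ℝ | w i ≤ w m} := fun i =>
    isClosed_le (continuous_apply i) (continuous_apply m.1)
  exact (hcl q.1.1).inter (hcl q.1.2)

lemma comp_mem_singularSpace {ρ : ℝ → ℝ} (hρ : Monotone ρ) (hw : w ∈ singularSpace p n) :
    (fun i => ρ (w i)) ∈ singularSpace p n := fun t =>
  (hw t).mono fun _ hm => ⟨hm.1, fun m' hm' => hρ (hm.2 m' hm')⟩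

end space

section roots
variable {p n : ℕ}

lemma continuous_shiftRoot : Continuous fun q : ℝ × (Fin (n + 1) → ℝ) => shiftRoot q.1 q.2 := by
  unfold shiftRoot
  fun_prop

/-- The slope of the segment from `i` to `j` of the graph of `f`, with the sign of the double
root it determines. -/
noncomputable def slopeRoot (f : Fin (n + 1) → ℝ) (i j : Fin (n + 1)) : ℝ :=
  -(f i - f j) / ((i : ℕ) - (j : ℕ) : ℝ)

lemma continuous_slopeRoot (i j : Fin (n + 1)) :
    Continuous fun f : Fin (n + 1) → ℝ => slopeRoot f i j := by
  unfold slopeRoot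
  fun_prop

lemma natCast_sub_ne_zero {i j : Fin (n + 1)} (h : i ≠ j) : ((i : ℕ) - (j : ℕ) : ℝ) ≠ 0 := by
  rw [sub_ne_zero]
  exact_mod_cast fun e => h (Fin.ext e)

lemma shiftRoot_eq_iff {f : Fin (n + 1) → ℝ} {b : ℝ} {i j : Fin (n + 1)} (h : i ≠ j) :
    shiftRoot b f i = shiftRoot b f j ↔ b = slopeRoot f i j := by
  have := natCast_sub_ne_zero h
  simp only [shiftRoot, slopeRoot]
  rw [eq_div_iff this]
  constructor <;> intro h <;> linarith

lemma exists_eq_slopeRoot {f : Fin (n + 1) → ℝ} {b : ℝ} (h : shiftRoot b f ∈ singularSpace p n) :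
    ∃ i j, i ≠ j ∧ b = slopeRoot f i j := by
  obtain ⟨i, hi, j, hj, hij⟩ := h 0
  exact ⟨i, j, hij, (shiftRoot_eq_iff hij).1 (eq_of_mem_argminOn hi hj)⟩

/-- The double roots of `g` close to `f` are close to double roots of `f`. -/
lemma eventually_root_near (f : Fin (n + 1) → ℝ) {ε : ℝ} (hε : 0 < ε) :
    ∀ᶠ g in 𝓝 f, ∀ b', shiftRoot b' g ∈ singularSpace p n →
      ∃ b, shiftRoot b f ∈ singularSpace p n ∧ |b' - b| < ε := by
  have key : ∀ i j : Fin (n + 1), ∀ᶠ g in 𝓝 f,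
      shiftRoot (slopeRoot g i j) g ∈ singularSpace p n →
        shiftRoot (slopeRoot f i j) f ∈ singularSpace p n ∧
          |slopeRoot g i j - slopeRoot f i j| < ε := by
    intro i j
    by_cases h : shiftRoot (slopeRoot f i j) f ∈ singularSpace p n
    · have := (continuous_slopeRoot i j).continuousAt (x := f)
      filter_upwards [Metric.tendsto_nhds.1 this ε hε] with g hg _
      exact ⟨h, hg⟩
    · have hc : Continuous fun g : Fin (n + 1) → ℝ => shiftRoot (slopeRoot g i j) g :=
        continuous_shiftRoot.comp ((continuous_slopeRoot i j).prodMk continuous_id)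
      filter_upwards [(isClosed_singularSpace.preimage hc).isOpen_compl.mem_nhds h] with g hg hg'
      exact absurd hg' hg
  filter_upwards [Filter.eventually_all.2 fun i => Filter.eventually_all.2 (key i)] with g hg b' hb'
  obtain ⟨i, j, -, rfl⟩ := exists_eq_slopeRoot hb'
  exact ⟨_, hg i j hb'⟩

lemma isClosed_setOf_exists_root :
    IsClosed {f : Fin (n + 1) → ℝ | ∃ b, shiftRoot b f ∈ singularSpace p n} := by
  rw [← isOpen_compl_iff, isOpen_iff_mem_nhds]
  intro f hf
  filter_upwards [eventually_root_near (p := p) f one_pos] with g hg ⟨b', hb'⟩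
  obtain ⟨b, hb, -⟩ := hg b' hb'
  exact hf ⟨b, hb⟩

end roots

/-! ### Valuations of solutions of the two linear equations -/

section valuation
variable {K : Type*} [Field K] (v : AddValuation K (WithTop ℝ))

lemma exists_val_eq {x : K} (hx : x ≠ 0) : ∃ r : ℝ, v x = r := by
  obtain ⟨r, hr⟩ := WithTop.ne_top_iff_exists.1 ((AddValuation.ne_top_iff v).2 hx)
  exact ⟨r, hr.symm⟩

lemma ne_zero_of_val_eq {x : K} {r : ℝ} (h : v x = r) : x ≠ 0 := by
  rintro rfl
  rw [AddValuation.map_zero] at h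
  exact WithTop.coe_ne_top h.symm

lemma val_eq_zero_of_pow_eq_self {z : K} {q : ℕ} (hq : 1 < q) (hz : z ≠ 0) (h : z ^ q = z) :
    v z = 0 := by
  obtain ⟨r, hr⟩ := exists_val_eq v hz
  have h1 := v.map_pow z q
  rw [h, hr, ← WithTop.coe_nsmul, WithTop.coe_inj, nsmul_eq_mul] at h1
  have hq' : (1 : ℝ) < q := by exact_mod_cast hq
  have : r = 0 := by
    have : ((q : ℝ) - 1) * r = 0 := by linarith
    exact (mul_eq_zero.1 this).resolve_left (by linarith)
  rw [hr, this]; rfl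

lemma val_sum_eq_of_unique {ι : Type*} {s : Finset ι} {x : ι → K} {w : ι → ℝ}
    (hv : ∀ i ∈ s, v (x i) = w i) {i₀ : ι} (hi₀ : i₀ ∈ s) (h : ∀ i ∈ s, i ≠ i₀ → w i₀ < w i) :
    v (∑ i ∈ s, x i) = w i₀ := by
  classical
  rw [← Finset.add_sum_erase s x hi₀, ← hv i₀ hi₀]
  apply AddValuation.map_add_eq_of_lt_left
  rw [hv i₀ hi₀]
  refine v.map_lt_sum' (WithTop.coe_lt_top _) fun i hi => ?_
  obtain ⟨h1, h2⟩ := Finset.mem_erase.1 hi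
  rw [hv i h2]
  exact_mod_cast h i h2 h1

lemma argminOn_nontrivial_of_sum_eq_zero {ι : Type*} {s : Finset ι} (hs : s.Nonempty) {x : ι → K}
    {w : ι → ℝ} (hv : ∀ i ∈ s, v (x i) = w i) (h : ∑ i ∈ s, x i = 0) :
    (argminOn (s : Set ι) w).Nontrivial := by
  obtain ⟨i₀, hi₀⟩ := argminOn_nonempty (w := w) s.finite_toSet (by simpa using hs)
  by_contra hcon
  rw [Set.not_nontrivial_iff] at hcon
  have := val_sum_eq_of_unique v hv (i₀ := i₀) (by simpa using hi₀.1) (fun i hi hne => by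
    refine lt_of_le_of_ne (hi₀.2 i (by simpa using hi)) fun e => hne ?_
    exact hcon ⟨by simpa using hi, fun m hm => e ▸ hi₀.2 m hm⟩ hi₀)
  exact ne_zero_of_val_eq v this h

lemma val_natCast_sub (p : ℕ) [Fact p.Prime] [CharP K p] {i j : ℕ} (h : ¬ i ≡ j [MOD p]) : v ((i : K) - (j : K)) = 0 := by
  have hp : p.Prime := Fact.out
  refine val_eq_zero_of_pow_eq_self v hp.one_lt ?_ ?_
  · rw [sub_ne_zero, Ne, CharP.natCast_eq_natCast K p]
    exact h
  · rw [sub_pow_char, ← frobenius_def, ← frobenius_def, map_natCast, map_natCast]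

/-- An element `z` of valuation `0` such that there is no cancellation in two given sums
`z x + y`. -/
lemma exists_unit_avoid (p : ℕ) [Fact p.Prime] [CharP K p] [IsAlgClosed K] {x y : Fin 2 → K} {α : Fin 2 → ℝ}
    (hx : ∀ s, v (x s) = α s) (hy : ∀ s, (α s : WithTop ℝ) ≤ v (y s)) :
    ∃ z : K, v z = 0 ∧ ∀ s, v (z * x s + y s) = α s := by
  classical
  have hp : p.Prime := Fact.out
  have h4 : 2 ^ 2 ≤ p ^ 2 := Nat.pow_le_pow_left hp.two_le 2
  set F : Polynomial K := Polynomial.X ^ (p ^ 2) - Polynomial.X with hF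
  have hdeg : F.natDegree = p ^ 2 := FiniteField.X_pow_card_sub_X_natDegree_eq K (by omega)
  have hF0 : F ≠ 0 := by
    intro h
    rw [h, Polynomial.natDegree_zero] at hdeg
    omega
  have hcard : F.roots.toFinset.card = p ^ 2 := by
    rw [Multiset.toFinset_card_of_nodup
      (Polynomial.nodup_roots (galois_poly_separable p _ (dvd_pow_self p two_ne_zero))),
      Polynomial.splits_iff_card_roots.1 (IsAlgClosed.splits F), hdeg]
  have hroot : ∀ z ∈ F.roots.toFinset, z ^ p ^ 2 = z := by
    intro z hz
    have : F.eval z = 0 := by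
      simpa using (Polynomial.mem_roots hF0).1 (Multiset.mem_toFinset.1 hz)
    simpa [hF, sub_eq_zero] using this
  have hval : ∀ z ∈ F.roots.toFinset, ∀ z' ∈ F.roots.toFinset, z ≠ z' → v (z - z') = 0 := by
    intro z hz z' hz' hne
    refine val_eq_zero_of_pow_eq_self v (q := p ^ 2) (by omega) (sub_ne_zero.2 hne) ?_
    rw [sub_pow_char_pow, hroot z hz, hroot z' hz']
  have h0 : (0 : K) ∈ F.roots.toFinset := by
    rw [Multiset.mem_toFinset, Polynomial.mem_roots hF0]
    have : p ^ 2 ≠ 0 := by omega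
    simp [hF, hp.ne_zero]
  by_contra hcon
  push Not at hcon
  have hbad : ∀ z ∈ F.roots.toFinset.erase 0, ∃ s, v (z * x s + y s) ≠ α s := by
    intro z hz
    obtain ⟨hz0, hz⟩ := Finset.mem_erase.1 hz
    exact hcon z (by simpa using hval z hz 0 h0 hz0)
  choose! φ hφ using hbad
  obtain ⟨z, hz, z', hz', hne, he⟩ := Finset.exists_ne_map_eq_of_card_lt_of_maps_to
    (s := F.roots.toFinset.erase 0) (t := Finset.univ) (f := φ)
    (by rw [Finset.card_erase_of_mem h0, hcard, Finset.card_univ, Fintype.card_fin]; omega)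
    (fun _ _ => Finset.mem_coe.2 (Finset.mem_univ _))
  have hlt : ∀ z ∈ F.roots.toFinset.erase 0, (α (φ z) : WithTop ℝ) < v (z * x (φ z) + y (φ z)) := by
    intro z hz
    refine lt_of_le_of_ne ?_ (hφ z hz).symm
    obtain ⟨hz0, hz'⟩ := Finset.mem_erase.1 hz
    refine v.map_le_add ?_ (hy _)
    rw [v.map_mul, hx, show v z = 0 by simpa using hval z hz' 0 h0 hz0, zero_add]
  have h1 := hlt z hz
  have h2 := hlt z' hz'
  rw [← he] at h2
  have h3 : (α (φ z) : WithTop ℝ) < v ((z * x (φ z) + y (φ z)) - (z' * x (φ z) + y (φ z))) := by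
    rw [sub_eq_add_neg]
    exact v.map_lt_add h1 (by rwa [v.map_neg])
  rw [show (z * x (φ z) + y (φ z)) - (z' * x (φ z) + y (φ z)) = (z - z') * x (φ z) by ring,
    v.map_mul, hx, hval z (Finset.mem_of_mem_erase hz) z' (Finset.mem_of_mem_erase hz') hne,
    zero_add] at h3
  exact lt_irrefl _ h3

/-- A linear equation has a solution with prescribed valuations when the minimum is attained
twice. -/
lemma exists_sum_eq (p : ℕ) [Fact p.Prime] [CharP K p] [IsAlgClosed K] {ι : Type*} {s : Finset ι} {i j : ι} (hi : i ∈ s) (hj : j ∈ s) (hij : i ≠ j)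
    {w : ι → ℝ} {x l : ι → K} (hx : ∀ m ∈ s, v (x m) = w m) (hl : ∀ m ∈ s, v (l m) = 0)
    (hwij : w i = w j) (hw : ∀ m ∈ s, w i ≤ w m) {R : K} (hR : (w i : WithTop ℝ) ≤ v R) :
    ∃ c : ι → K, (∀ m ∈ s, v (c m) = w m) ∧ ∑ m ∈ s, l m * c m = R := by
  classical
  set P : K := ∑ m ∈ (s.erase i).erase j, l m * x m with hP
  have hvP : (w i : WithTop ℝ) ≤ v P := by
    refine v.map_le_sum fun m hm => ?_
    have hm' : m ∈ s := Finset.mem_of_mem_erase (Finset.mem_of_mem_erase hm)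
    rw [v.map_mul, hl m hm', zero_add, hx m hm']
    exact_mod_cast hw m hm'
  obtain ⟨z, hz, hav⟩ := exists_unit_avoid v p (x := ![-(l i * x i), -(l i * x i)])
    (y := ![R - P, R - P]) (α := ![w i, w i])
    (by
      have : v (-(l i * x i)) = w i := by rw [v.map_neg, v.map_mul, hl i hi, hx i hi, zero_add]
      exact Fin.forall_fin_two.2 ⟨this, this⟩)
    (Fin.forall_fin_two.2 ⟨v.map_le_sub hR hvP, v.map_le_sub hR hvP⟩)
  have hav' := hav 0
  simp only [Matrix.cons_val_zero] at hav'
  have hlj : l j ≠ 0 := ne_zero_of_val_eq v (r := 0) (hl j hj)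
  have hlj' : v (l j)⁻¹ = 0 := by
    have h := v.map_mul (l j) (l j)⁻¹
    rw [mul_inv_cancel₀ hlj, v.map_one, hl j hj, zero_add] at h
    exact h.symm
  have hj' : j ∈ s.erase i := Finset.mem_erase.2 ⟨hij.symm, hj⟩
  refine ⟨Function.update (Function.update x i (z * x i)) j
    ((l j)⁻¹ * (z * -(l i * x i) + (R - P))), fun m hm => ?_, ?_⟩
  · by_cases hmj : m = j
    · subst hmj
      rw [Function.update_self, v.map_mul, hlj', zero_add, hav', hwij]
    · rw [Function.update_of_ne hmj]
      by_cases hmi : m = i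
      · subst hmi
        rw [Function.update_self, v.map_mul, hz, zero_add, hx m hm]
      · rw [Function.update_of_ne hmi, hx m hm]
  · rw [← Finset.add_sum_erase s _ hi, ← Finset.add_sum_erase _ _ hj', Function.update_self,
      Function.update_of_ne hij, Function.update_self,
      Finset.sum_congr rfl (g := fun m => l m * x m), ← hP]
    · field_simp
      ring
    · intro m hm
      obtain ⟨h1, h2⟩ := Finset.mem_erase.1 hm
      rw [Function.update_of_ne h1, Function.update_of_ne (Finset.ne_of_mem_erase h2)]

end valuation

section solve
variable {K : Type*} [Field K] [IsAlgClosed K] (v : AddValuation K (WithTop ℝ))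
  (p : ℕ) [Fact p.Prime] [CharP K p] {n : ℕ} {w : Fin (n + 1) → ℝ}

lemma exists_solution_of_isPair {r : Fin (n + 1)} {M N : Set (Fin (n + 1))}
    (h : IsPair p w r M N) {x : Fin (n + 1) → K} (hx : ∀ i, v (x i) = w i) :
    ∃ c : Fin (n + 1) → K, (∀ i, v (c i) = w i) ∧ ∑ i, c i = 0 ∧ ∑ i : Fin (n + 1), ((i : ℕ) : K) * c i = 0 := by
  classical
  obtain ⟨i, hi, j, hj, hij⟩ := h.nontrivM
  obtain ⟨k, hk, l, hl, hkl⟩ := h.nontrivN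
  have hik := h.le i hi k hk
  rw [h.eqM] at hi hj
  rw [h.eqN] at hk hl
  have hr : ∀ m : Fin (n + 1), ¬ SameClass p m r → v (((m : ℕ) : K) - ((r : ℕ) : K)) = 0 :=
    fun m hm => val_natCast_sub v p hm
  set s : Finset (Fin (n + 1)) := Finset.univ.filter fun m => ¬ SameClass p m r with hs
  set s' : Finset (Fin (n + 1)) := Finset.univ.filter fun m => SameClass p m r with hs'
  obtain ⟨c, hc, hc0⟩ := exists_sum_eq v p (s := s) (i := k) (j := l) (w := w) (x := x)
    (l := fun m => ((m : ℕ) : K) - ((r : ℕ) : K)) (by simpa [hs] using hk.1)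
    (by simpa [hs] using hl.1) hkl (fun m _ => hx m) (fun m hm => hr m (by simpa [hs] using hm))
    (eq_of_mem_argminOn hk hl) (fun m hm => hk.2 m (by simpa [hs] using hm)) (R := 0) (by simp)
  obtain ⟨c', hc', hc0'⟩ := exists_sum_eq v p (s := s') (i := i) (j := j) (w := w) (x := x)
    (l := fun _ => 1) (by simpa [hs'] using hi.1)
    (by simpa [hs'] using hj.1) hij (fun m _ => hx m) (fun m hm => v.map_one)
    (eq_of_mem_argminOn hi hj) (fun m hm => hi.2 m (by simpa [hs'] using hm))
    (R := -∑ m ∈ s, c m) (by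
      rw [v.map_neg]
      refine v.map_le_sum fun m hm => ?_
      rw [hc m hm]
      exact_mod_cast hik.trans (hk.2 m (by simpa [hs] using hm)))
  have hsum : ∀ F : Fin (n + 1) → K, ∑ m, F m = ∑ m ∈ s', F m + ∑ m ∈ s, F m := fun F =>
    (Finset.sum_filter_add_sum_filter_not _ _ _).symm
  have hs1 : ∀ m ∈ s', (if SameClass p m r then c' m else c m) = c' m := fun m hm =>
    if_pos (by simpa [hs'] using hm)
  have hs2 : ∀ m ∈ s, (if SameClass p m r then c' m else c m) = c m := fun m hm =>
    if_neg (by simpa [hs] using hm)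
  have h1 : ∑ m, (if SameClass p m r then c' m else c m) = 0 := by
    rw [hsum, Finset.sum_congr rfl hs1, Finset.sum_congr rfl hs2]
    simp only [one_mul] at hc0'
    rw [hc0', neg_add_cancel]
  have h2 : ∑ m : Fin (n + 1), (((m : ℕ) : K) - ((r : ℕ) : K)) *
      (if SameClass p m r then c' m else c m) = 0 := by
    rw [hsum, Finset.sum_congr (s₁ := s) rfl fun m hm => by rw [hs2 m hm], hc0, add_zero]
    refine Finset.sum_eq_zero fun m hm => ?_
    have : SameClass p m r := by simpa [hs'] using hm
    rw [(CharP.natCast_eq_natCast K p).2 this, sub_self, zero_mul]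
  refine ⟨fun m => if SameClass p m r then c' m else c m, fun m => ?_, h1, ?_⟩
  · by_cases hm : SameClass p m r
    · simpa only [if_pos hm] using hc' m (by simpa [hs'] using hm)
    · simpa only [if_neg hm] using hc m (by simpa [hs] using hm)
  · simp only [sub_mul, Finset.sum_sub_distrib, ← Finset.mul_sum, h1, mul_zero, sub_zero] at h2
    exact h2

lemma exists_solution_of_isTri {M : Set (Fin (n + 1))}
    (h : IsTri p w M) {x : Fin (n + 1) → K} (hx : ∀ i, v (x i) = w i) :
    ∃ c : Fin (n + 1) → K, (∀ i, v (c i) = w i) ∧ ∑ i, c i = 0 ∧ ∑ i : Fin (n + 1), ((i : ℕ) : K) * c i = 0 := by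
  classical
  obtain ⟨i, hi, j, hj, k, hk, hij, hik, hjk⟩ := h.three
  rw [h.eq] at hi hj hk
  have nij : i ≠ j := fun h => hij (h ▸ SameClass.refl' i)
  have nik : i ≠ k := fun h => hik (h ▸ SameClass.refl' i)
  have njk : j ≠ k := fun h => hjk (h ▸ SameClass.refl' j)
  have eij : w i = w j := eq_of_mem_argminOn hi hj
  have eik : w i = w k := eq_of_mem_argminOn hi hk
  set s : Finset (Fin (n + 1)) := ((Finset.univ.erase i).erase j).erase k with hs
  have hsum : ∀ F : Fin (n + 1) → K, ∑ m, F m = F i + (F j + (F k + ∑ m ∈ s, F m)) := by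
    intro F
    rw [← Finset.add_sum_erase _ _ (Finset.mem_univ i),
      ← Finset.add_sum_erase (Finset.univ.erase i) _
        (Finset.mem_erase.2 ⟨nij.symm, Finset.mem_univ j⟩),
      ← Finset.add_sum_erase ((Finset.univ.erase i).erase j) _
        (Finset.mem_erase.2 ⟨njk.symm, Finset.mem_erase.2 ⟨nik.symm, Finset.mem_univ k⟩⟩)]
  have hnat : ∀ m : ℕ, 0 ≤ v (m : K) := by
    intro m
    by_cases hm : (m : K) = 0
    · rw [hm, v.map_zero]; exact le_top
    · refine (val_eq_zero_of_pow_eq_self v (q := p) (Fact.out : p.Prime).one_lt hm ?_).ge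
      rw [← frobenius_def, map_natCast]
  have hPQ : ∀ e : Fin (n + 1) → ℕ, (w i : WithTop ℝ) ≤ v (∑ m ∈ s, (e m : K) * x m) := by
    intro e
    refine v.map_le_sum fun m _ => ?_
    rw [v.map_mul, hx m]
    calc (w i : WithTop ℝ) ≤ w m := by exact_mod_cast hi.2 m trivial
      _ = 0 + w m := (zero_add _).symm
      _ ≤ _ := by gcongr; exact hnat _
  set P : K := ∑ m ∈ s, x m with hP
  set Q : K := ∑ m ∈ s, ((m : ℕ) : K) * x m with hQ
  have hvP : (w i : WithTop ℝ) ≤ v P := by simpa using hPQ fun _ => 1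
  have hvQ : (w i : WithTop ℝ) ≤ v Q := hPQ fun m => m
  have hmul : ∀ m : ℕ, (w i : WithTop ℝ) ≤ v ((m : K) * P) := by
    intro m
    rw [v.map_mul]
    calc (w i : WithTop ℝ) = 0 + w i := (zero_add _).symm
      _ ≤ _ := by gcongr; exact hnat _
  set δ : K := ((i : ℕ) : K) - ((j : ℕ) : K) with hδ
  have hvδ : v δ = 0 := val_natCast_sub v p hij
  have hδ0 : δ ≠ 0 := ne_zero_of_val_eq v (r := 0) hvδ
  have hvδ' : v δ⁻¹ = 0 := by
    have h := v.map_mul δ δ⁻¹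
    rw [mul_inv_cancel₀ hδ0, v.map_one, hvδ, zero_add] at h
    exact h.symm
  obtain ⟨z, hz, hav⟩ := exists_unit_avoid v p
    (x := ![(((j : ℕ) : K) - ((k : ℕ) : K)) * x k, (((i : ℕ) : K) - ((k : ℕ) : K)) * x k])
    (y := ![((j : ℕ) : K) * P - Q, ((i : ℕ) : K) * P - Q]) (α := ![w i, w i])
    (Fin.forall_fin_two.2
      ⟨by
        simp only [Matrix.cons_val_zero]
        rw [v.map_mul, val_natCast_sub v p hjk, hx k, eik, zero_add], by
        simp only [Matrix.cons_val_one, Matrix.cons_val_fin_one]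
        rw [v.map_mul, val_natCast_sub v p hik, hx k, eik, zero_add]⟩)
    (Fin.forall_fin_two.2 ⟨v.map_le_sub (hmul _) hvQ, v.map_le_sub (hmul _) hvQ⟩)
  have hav0 := hav 0
  have hav1 := hav 1
  simp only [Matrix.cons_val_zero, Matrix.cons_val_one, Matrix.cons_val_fin_one] at hav0 hav1
  set ci : K := δ⁻¹ * (z * ((((j : ℕ) : K) - ((k : ℕ) : K)) * x k) + (((j : ℕ) : K) * P - Q))
    with hci
  set cj : K := -(δ⁻¹ * (z * ((((i : ℕ) : K) - ((k : ℕ) : K)) * x k) + (((i : ℕ) : K) * P - Q)))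
    with hcj
  set c : Fin (n + 1) → K :=
    Function.update (Function.update (Function.update x i ci) j cj) k (z * x k) with hc
  have hck : c k = z * x k := Function.update_self ..
  have hcj' : c j = cj := by rw [hc, Function.update_of_ne njk, Function.update_self]
  have hci' : c i = ci := by
    rw [hc, Function.update_of_ne nik, Function.update_of_ne nij, Function.update_self]
  have hcm : ∀ m ∈ s, c m = x m := by
    intro m hm
    obtain ⟨h1, h2⟩ := Finset.mem_erase.1 hm
    obtain ⟨h2, h3⟩ := Finset.mem_erase.1 h2
    rw [hc, Function.update_of_ne h1, Function.update_of_ne h2,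
      Function.update_of_ne (Finset.ne_of_mem_erase h3)]
  refine ⟨c, fun m => ?_, ?_, ?_⟩
  · by_cases hmk : m = k
    · subst hmk
      rw [hck, v.map_mul, hz, zero_add, hx]
    by_cases hmj : m = j
    · subst hmj
      rw [hcj', hcj, v.map_neg, v.map_mul, hvδ', zero_add, hav1, eij]
    by_cases hmi : m = i
    · subst hmi
      rw [hci', hci, v.map_mul, hvδ', zero_add, hav0]
    · rw [hcm m (by simp [hs, hmk, hmj, hmi]), hx]
  · rw [hsum, hck, hcj', hci', Finset.sum_congr rfl hcm, ← hP, hci, hcj]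
    field_simp
    rw [hδ]
    ring
  · rw [hsum, hck, hcj', hci', Finset.sum_congr rfl fun m hm => by rw [hcm m hm], ← hQ, hci, hcj]
    field_simp
    rw [hδ]
    ring

/-- A point of the tropical linear space with coordinates in the value group lifts. -/
lemma exists_solution (hw : w ∈ singularSpace p n) {x : Fin (n + 1) → K}
    (hx : ∀ i, v (x i) = w i) :
    ∃ c : Fin (n + 1) → K, (∀ i, v (c i) = w i) ∧ ∑ i, c i = 0 ∧ ∑ i : Fin (n + 1), ((i : ℕ) : K) * c i = 0 := by
  rcases isTri_or_isPair hw with ⟨M, h⟩ | ⟨r, M, N, h⟩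
  · exact exists_solution_of_isTri v p h hx
  · exact exists_solution_of_isPair v p h hx

end solve

/-! ### The closure of the set of singular pairs -/

section closure
variable {K : Type*} [Field K] (v : AddValuation K (WithTop ℝ))

lemma val_inv {x : K} {r : ℝ} (h : v x = r) : v x⁻¹ = ((-r : ℝ) : WithTop ℝ) := by
  have hx := ne_zero_of_val_eq v h
  obtain ⟨r', hr'⟩ := exists_val_eq v (inv_ne_zero hx)
  have := v.map_mul x x⁻¹
  rw [mul_inv_cancel₀ hx, v.map_one, h, hr', ← WithTop.coe_add, ← WithTop.coe_zero,
    WithTop.coe_inj] at this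
  rw [hr', WithTop.coe_inj]
  linarith

lemma val_pow {x : K} {r : ℝ} (h : v x = r) (k : ℕ) : v (x ^ k) = ((k * r : ℝ) : WithTop ℝ) := by
  rw [v.map_pow, h, ← WithTop.coe_nsmul, nsmul_eq_mul]

lemma val_mul {x y : K} {r s : ℝ} (h : v x = r) (h' : v y = s) :
    v (x * y) = ((r + s : ℝ) : WithTop ℝ) := by
  rw [v.map_mul, h, h', WithTop.coe_add]

lemma val_zpow {x : K} {r : ℝ} (h : v x = r) (k : ℤ) :
    ∃ y : K, v y = ((k * r : ℝ) : WithTop ℝ) := by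
  obtain ⟨m, rfl | rfl⟩ := k.eq_nat_or_neg
  · exact ⟨x ^ m, by simpa using val_pow v h m⟩
  · exact ⟨(x ^ m)⁻¹, by simpa using val_inv v (val_pow v h m)⟩

variable {n : ℕ}

lemma eval_polyOf (A : Fin (n + 1) → K) (B : K) :
    (polyOf A).eval B = ∑ i : Fin (n + 1), A i * B ^ (i : ℕ) := by
  simp [polyOf, Polynomial.eval_finsetSum]

lemma mul_eval_derivative_polyOf (A : Fin (n + 1) → K) (B : K) :
    B * (polyOf A).derivative.eval B =
      ∑ i : Fin (n + 1), ((i : ℕ) : K) * (A i * B ^ (i : ℕ)) := by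
  simp only [polyOf, Polynomial.derivative_sum, Polynomial.derivative_C_mul_X_pow,
    Polynomial.eval_finsetSum, Finset.mul_sum]
  refine Finset.sum_congr rfl fun i _ => ?_
  rcases Nat.eq_zero_or_pos (i : ℕ) with h | h
  · simp [h]
  · obtain ⟨m, hm⟩ := Nat.exists_eq_add_of_lt h
    rw [hm]
    simp
    ring

lemma mem_singularPairs_iff {q : ℝ × (Fin (n + 1) → ℝ)} :
    q ∈ singularPairs v n ↔ ∃ (c : Fin (n + 1) → K) (B : K), v B = q.1 ∧
      (∀ i, v (c i) = shiftRoot q.1 q.2 i) ∧ ∑ i, c i = 0 ∧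
        ∑ i : Fin (n + 1), ((i : ℕ) : K) * c i = 0 := by
  constructor
  · rintro ⟨A, B, hA, hB, h1, h2⟩
    refine ⟨fun i => A i * B ^ (i : ℕ), B, hB, fun i => ?_, ?_, ?_⟩
    · exact val_mul v (hA i) (val_pow v hB i)
    · rw [← eval_polyOf, h1]
    · rw [← mul_eval_derivative_polyOf, h2, mul_zero]
  · rintro ⟨c, B, hB, hc, h1, h2⟩
    have hB0 := ne_zero_of_val_eq v hB
    have hcA : ∀ i : Fin (n + 1), c i * (B ^ (i : ℕ))⁻¹ * B ^ (i : ℕ) = c i := fun i => by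
      field_simp
    refine ⟨fun i => c i * (B ^ (i : ℕ))⁻¹, B, fun i => ?_, hB, ?_, ?_⟩
    · rw [val_mul v (hc i) (val_inv v (val_pow v hB i)), WithTop.coe_inj, shiftRoot]
      ring
    · rw [eval_polyOf, Finset.sum_congr rfl fun i _ => hcA i, h1]
    · have := mul_eval_derivative_polyOf (fun i : Fin (n + 1) => c i * (B ^ (i : ℕ))⁻¹) B
      rw [Finset.sum_congr rfl fun i _ => by rw [hcA i], h2] at this
      exact (mul_eq_zero.1 this).resolve_left hB0

lemma shiftRoot_mem_of_mem_singularPairs (p : ℕ) [Fact p.Prime] [CharP K p] (hp : 2 < p)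
    {q : ℝ × (Fin (n + 1) → ℝ)} (hq : q ∈ singularPairs v n) :
    shiftRoot q.1 q.2 ∈ singularSpace p n := by
  classical
  obtain ⟨c, B, -, hc, h1, h2⟩ := (mem_singularPairs_iff v).1 hq
  intro t
  set s : Finset (Fin (n + 1)) := Finset.univ.filter fun m => ¬ SameClass p m t with hs
  have hcoe : (s : Set (Fin (n + 1))) = {m | ¬ SameClass p m t} := by ext; simp [hs]
  have h3 : ∑ m ∈ s, (((m : ℕ) : K) - ((t : ℕ) : K)) * c m = 0 := by
    have h4 : ∑ m : Fin (n + 1), (((m : ℕ) : K) - ((t : ℕ) : K)) * c m = 0 := by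
      simp only [sub_mul, Finset.sum_sub_distrib, ← Finset.mul_sum, h1, h2, mul_zero, sub_zero]
    rw [← h4]
    refine Finset.sum_subset (Finset.subset_univ _) fun m _ hm => ?_
    have : SameClass p m t := by simpa [hs] using hm
    rw [(CharP.natCast_eq_natCast K p).2 this, sub_self, zero_mul]
  have hne : s.Nonempty := by
    rw [Finset.nonempty_iff_ne_empty]
    intro hemp
    have hall : ∀ m, SameClass p m t := by
      intro m
      by_contra hm
      have : m ∈ s := by simpa [hs] using hm
      simp [hemp] at this
    rcases Nat.eq_zero_or_pos n with rfl | hn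
    · rw [Fin.sum_univ_one] at h1
      exact ne_zero_of_val_eq v (hc 0) h1
    · have := (hall 0).trans' (hall ⟨1, by omega⟩).symm'
      have := Nat.ModEq.eq_of_lt_of_lt this (by simp; omega) (by simp; omega)
      simp at this
  rw [← hcoe]
  refine argminOn_nontrivial_of_sum_eq_zero v hne (fun m hm => ?_) h3
  have hm' : ¬ SameClass p m t := by simpa [hs] using hm
  rw [v.map_mul, val_natCast_sub v p hm', zero_add, hc]

variable [IsAlgClosed K]

lemma exists_small_val (hv : ∃ x : K, x ≠ 0 ∧ v x ≠ 0) {ε : ℝ} (hε : 0 < ε) :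
    ∃ (z : K) (δ : ℝ), v z = δ ∧ 0 < δ ∧ δ < ε := by
  have hpos : ∃ (y : K) (γ : ℝ), v y = γ ∧ 0 < γ := by
    obtain ⟨x, hx, hx0⟩ := hv
    obtain ⟨r, hr⟩ := exists_val_eq v hx
    rcases lt_trichotomy r 0 with h | h | h
    · exact ⟨x⁻¹, -r, val_inv v hr, by linarith⟩
    · rw [hr, h] at hx0; exact absurd rfl hx0
    · exact ⟨x, r, hr, h⟩
  obtain ⟨y, γ, hy, hγ⟩ := hpos
  obtain ⟨N, hN⟩ := exists_nat_gt (γ / ε)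
  have hN0 : (0 : ℝ) < N := lt_trans (by positivity) hN
  obtain ⟨z, hz⟩ := IsAlgClosed.exists_pow_nat_eq y (n := N) (by exact_mod_cast hN0)
  have hz0 : z ≠ 0 := by
    rintro rfl
    rw [zero_pow (by exact_mod_cast hN0.ne')] at hz
    exact ne_zero_of_val_eq v hy hz.symm
  obtain ⟨δ, hδ⟩ := exists_val_eq v hz0
  have h1 := val_pow v hδ N
  rw [hz, hy, WithTop.coe_inj] at h1
  refine ⟨z, δ, hδ, ?_, ?_⟩
  · rw [h1] at hγ
    exact pos_of_mul_pos_right hγ hN0.le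
  · rw [div_lt_iff₀ hε, h1] at hN
    exact lt_of_mul_lt_mul_left hN hN0.le

lemma exists_rounding (hv : ∃ x : K, x ≠ 0 ∧ v x ≠ 0) {ε : ℝ} (hε : 0 < ε) :
    ∃ ρ : ℝ → ℝ, Monotone ρ ∧ (∀ x, |ρ x - x| < ε) ∧ ∀ x, ∃ z : K, v z = ρ x := by
  obtain ⟨z, δ, hz, hδ, hδε⟩ := exists_small_val v hv hε
  refine ⟨fun x => ⌊x / δ⌋ * δ, fun x y hxy => ?_, fun x => ?_, fun x => val_zpow v hz _⟩
  · have : ⌊x / δ⌋ ≤ ⌊y / δ⌋ := Int.floor_mono (by gcongr)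
    have : (⌊x / δ⌋ : ℝ) ≤ ⌊y / δ⌋ := by exact_mod_cast this
    simp only
    gcongr
  · have h1 := Int.floor_le (x / δ)
    have h2 := Int.lt_floor_add_one (x / δ)
    rw [le_div_iff₀ hδ] at h1
    rw [div_lt_iff₀ hδ] at h2
    rw [abs_lt]
    constructor <;> linarith

/-- The value group is dense. -/
lemma exists_val_mem_Ioo (hv : ∃ x : K, x ≠ 0 ∧ v x ≠ 0) {c d : ℝ} (h : c < d) :
    ∃ (z : K) (r : ℝ), v z = r ∧ c < r ∧ r < d := by
  obtain ⟨ρ, -, h1, h2⟩ := exists_rounding v hv (ε := (d - c) / 2) (by linarith)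
  obtain ⟨z, hz⟩ := h2 ((c + d) / 2)
  have := abs_lt.1 (h1 ((c + d) / 2))
  exact ⟨z, _, hz, by linarith, by linarith⟩

theorem closure_singularPairs (p : ℕ) [Fact p.Prime] [CharP K p] (hp : 2 < p)
    (hv : ∃ x : K, x ≠ 0 ∧ v x ≠ 0) :
    closure (singularPairs v n) =
      {q : ℝ × (Fin (n + 1) → ℝ) | shiftRoot q.1 q.2 ∈ singularSpace p n} := by
  apply Set.Subset.antisymm
  · exact closure_minimal (fun q hq => shiftRoot_mem_of_mem_singularPairs v p hp hq)
      (isClosed_singularSpace.preimage continuous_shiftRoot)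
  · intro q hq
    rw [Metric.mem_closure_iff]
    intro ε hε
    obtain ⟨ρ, hρ, hρε, hρv⟩ := exists_rounding v hv (ε := ε / (n + 1)) (by positivity)
    have hN : (0 : ℝ) < n + 1 := by positivity
    choose z hz using hρv
    set w := shiftRoot q.1 q.2 with hw
    set w' : Fin (n + 1) → ℝ := fun i => ρ (w i) with hw'
    set q' : ℝ × (Fin (n + 1) → ℝ) := (ρ q.1, fun i => w' i - (i : ℕ) * ρ q.1) with hq'
    have hsh : shiftRoot q'.1 q'.2 = w' := by
      ext i
      simp [shiftRoot, hq']
    obtain ⟨c, hc, h1, h2⟩ := exists_solution v p (w := w') (comp_mem_singularSpace hρ hq)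
      (x := fun i => z (w i)) (fun i => hz (w i))
    refine ⟨q', (mem_singularPairs_iff v).2 ⟨c, z q.1, hz q.1, ?_, h1, h2⟩, ?_⟩
    · rw [hsh]; exact hc
    · have hεn : ε / (n + 1) ≤ ε := div_le_self hε.le (by linarith [n.cast_nonneg (α := ℝ)])
      rw [Prod.dist_eq, max_lt_iff]
      constructor
      · rw [Real.dist_eq, abs_sub_comm]
        exact (hρε q.1).trans_le hεn
      · rw [dist_pi_lt_iff hε]
        intro i
        have hi : ((i : ℕ) : ℝ) ≤ n := by exact_mod_cast Nat.lt_succ_iff.1 i.2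
        have e1 := hρε (w i)
        have e2 := hρε q.1
        have : q.2 i - q'.2 i = (w i - ρ (w i)) + (i : ℕ) * (ρ q.1 - q.1) := by
          simp only [hq', hw', hw, shiftRoot]; ring
        rw [Real.dist_eq, this]
        calc _ ≤ |w i - ρ (w i)| + |((i : ℕ) : ℝ) * (ρ q.1 - q.1)| := abs_add_le _ _
          _ = |ρ (w i) - w i| + (i : ℕ) * |ρ q.1 - q.1| := by
            rw [abs_sub_comm, abs_mul, Nat.abs_cast]
          _ < ε / (n + 1) + n * (ε / (n + 1)) := by
            refine add_lt_add_of_lt_of_le e1 ?_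
            gcongr
          _ = ε := by field_simp; ring

theorem doubleRoots_eq (p : ℕ) [Fact p.Prime] [CharP K p] (hp : 2 < p)
    (hv : ∃ x : K, x ≠ 0 ∧ v x ≠ 0) (f : Fin (n + 1) → ℝ) :
    doubleRoots v f = {b | shiftRoot b f ∈ singularSpace p n} := by
  ext b
  rw [doubleRoots, closure_singularPairs v p hp hv]
  rfl

theorem tropDisc_eq (p : ℕ) [Fact p.Prime] [CharP K p] (hp : 2 < p)
    (hv : ∃ x : K, x ≠ 0 ∧ v x ≠ 0) :
    tropDisc v n = {f | ∃ b, shiftRoot b f ∈ singularSpace p n} := by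
  apply Set.Subset.antisymm
  · refine closure_minimal ?_ isClosed_setOf_exists_root
    rintro f ⟨b, hb⟩
    exact ⟨b, shiftRoot_mem_of_mem_singularPairs v p hp hb⟩
  · rintro f ⟨b, hb⟩
    have h : (b, f) ∈ closure (singularPairs v n) := by
      rw [closure_singularPairs v p hp hv]; exact hb
    exact map_mem_closure continuous_snd h fun q hq => ⟨q.1, hq⟩

end closure

/-! ### Generic points -/

section generic
variable {V : Type*} [AddCommGroup V] [Module ℝ V]

lemma eventually_affine_ne_zero (x y s : ℝ) (h : y ≠ 0 ∨ x ≠ 0) :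
    ∀ᶠ t in 𝓝[>] s, x + t * y ≠ 0 := by
  by_cases hy : y = 0
  · simp [hy, h.resolve_left (not_not.2 hy)]
  · have : ∀ᶠ t in 𝓝[>] s, t ≠ -x / y := by
      by_cases hs : s = -x / y
      · filter_upwards [self_mem_nhdsWithin] with t ht
        exact (hs ▸ ht : -x / y < t).ne'
      · exact (eventually_ne_nhds hs).filter_mono nhdsWithin_le_nhds
    filter_upwards [this] with t ht h0
    exact ht (by field_simp; linarith)

lemma eventually_forall_affine_ne_zero (Q : Finset (Module.Dual ℝ V)) {z h : V} {s : ℝ}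
    (hQ : ∀ q ∈ Q, q h ≠ 0 ∨ q z ≠ 0) : ∀ᶠ t in 𝓝[>] s, ∀ q ∈ Q, q (z + t • h) ≠ 0 := by
  refine (Filter.eventually_all_finset Q).2 fun q hq => ?_
  filter_upwards [eventually_affine_ne_zero (q z) (q h) s (hQ q hq)] with t ht
  simpa using ht

lemma exists_mem_forall_ne_zero (H : Submodule ℝ V) (Q : Finset (Module.Dual ℝ V))
    (hQ : ∀ q ∈ Q, ∃ h ∈ H, q h ≠ 0) : ∃ h ∈ H, ∀ q ∈ Q, q h ≠ 0 := by
  classical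
  induction Q using Finset.induction_on with
  | empty => exact ⟨0, H.zero_mem, by simp⟩
  | insert q Q _ ih =>
    obtain ⟨h, hh, hne⟩ := ih fun q' hq' => hQ q' (Finset.mem_insert_of_mem hq')
    obtain ⟨h', hh', hne'⟩ := hQ q (Finset.mem_insert_self q Q)
    obtain ⟨t, ht⟩ := (eventually_forall_affine_ne_zero (insert q Q) (z := h) (h := h') (s := 0)
      fun q' hq' => by
        rcases Finset.mem_insert.1 hq' with rfl | hq'
        · exact Or.inl hne'
        · exact Or.inr (hne q' hq')).exists
    exact ⟨h + t • h', H.add_mem hh (H.smul_mem t hh'), ht⟩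

end generic

/-! ### The discriminant polynomial -/

section resultant

/-- The univariate polynomial with indeterminate coefficients. -/
noncomputable def genericPoly (p n : ℕ) :
    Polynomial (MvPolynomial (Fin (n + 1)) (ZMod p)) :=
  ∑ i : Fin (n + 1), Polynomial.C (MvPolynomial.X i) * Polynomial.X ^ (i : ℕ)

/-- The resultant of the generic polynomial and its derivative. -/
noncomputable def genericResultant (p n : ℕ) : MvPolynomial (Fin (n + 1)) (ZMod p) :=
  (genericPoly p n).resultant (genericPoly p n).derivative n (n - 1)

variable {K : Type*} [Field K] (p : ℕ) [CharP K p] {n : ℕ}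

lemma natDegree_polyOf_le (A : Fin (n + 1) → K) : (polyOf A).natDegree ≤ n := by
  refine Polynomial.natDegree_sum_le_of_forall_le _ _ fun i _ => ?_
  exact (Polynomial.natDegree_C_mul_X_pow_le _ _).trans (Nat.lt_succ_iff.1 i.2)

lemma coeff_polyOf (A : Fin (n + 1) → K) (i : Fin (n + 1)) : (polyOf A).coeff i = A i := by
  simp only [polyOf, Polynomial.finsetSum_coeff, Polynomial.coeff_C_mul_X_pow]
  rw [Finset.sum_eq_single i]
  · simp
  · intro j _ hj
    exact if_neg fun h => hj (Fin.ext h.symm)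
  · simp

lemma map_genericPoly (A : Fin (n + 1) → K) :
    (genericPoly p n).map (MvPolynomial.eval₂Hom (ZMod.castHom dvd_rfl K) A) = polyOf A := by
  simp [genericPoly, polyOf, Polynomial.map_sum]

lemma eval_genericResultant_eq_zero_iff [IsAlgClosed K] {A : Fin (n + 1) → K}
    (hA : A (Fin.last n) ≠ 0) :
    MvPolynomial.eval₂Hom (ZMod.castHom dvd_rfl K) A (genericResultant p n) = 0 ↔
      ∃ B, (polyOf A).eval B = 0 ∧ (polyOf A).derivative.eval B = 0 := by
  have hc : (polyOf A).coeff n ≠ 0 := by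
    have := coeff_polyOf A (Fin.last n)
    rw [Fin.val_last] at this
    rwa [this]
  have hdeg : (polyOf A).natDegree = n :=
    le_antisymm (natDegree_polyOf_le A) (Polynomial.le_natDegree_of_ne_zero hc)
  have h0 : polyOf A ≠ 0 := by
    intro h; rw [h] at hc; simp at hc
  have hlc : (polyOf A).leadingCoeff ≠ 0 := Polynomial.leadingCoeff_ne_zero.2 h0
  rw [genericResultant, ← Polynomial.resultant_map_map, ← Polynomial.derivative_map,
    map_genericPoly]
  have := Polynomial.resultant_eq_prod_eval (polyOf A) (polyOf A).derivative (n - 1)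
    ((Polynomial.natDegree_derivative_le _).trans (by rw [hdeg])) (IsAlgClosed.splits _)
  rw [hdeg] at this
  rw [this, mul_eq_zero, or_iff_right (pow_ne_zero _ hlc), Multiset.prod_eq_zero_iff]
  simp only [Multiset.mem_map, Polynomial.mem_roots h0, Polynomial.IsRoot.def]

lemma exists_separable_polyOf [IsAlgClosed K] [Fact p.Prime] (n : ℕ) :
    ∃ A : Fin (n + 1) → K, A (Fin.last n) ≠ 0 ∧
      ¬ ∃ B, (polyOf A).eval B = 0 ∧ (polyOf A).derivative.eval B = 0 := by
  have key : ∀ f : Polynomial K, f.natDegree = n → f ≠ 0 → f.Separable →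
      ∃ A : Fin (n + 1) → K, A (Fin.last n) ≠ 0 ∧
        ¬ ∃ B, (polyOf A).eval B = 0 ∧ (polyOf A).derivative.eval B = 0 := by
    intro f hf hf0 hsep
    have hpoly : polyOf (fun i : Fin (n + 1) => f.coeff i) = f := by
      rw [polyOf, Fin.sum_univ_eq_sum_range fun i => Polynomial.C (f.coeff i) * Polynomial.X ^ i,
        ← hf]
      exact f.as_sum_range_C_mul_X_pow.symm
    refine ⟨fun i => f.coeff i, ?_, ?_⟩
    · have : f.coeff n = f.leadingCoeff := by rw [← hf]; rfl
      simp only [Fin.val_last, this]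
      exact Polynomial.leadingCoeff_ne_zero.2 hf0
    · rw [hpoly]
      rintro ⟨B, h1, h2⟩
      exact hsep.eval₂_derivative_ne_zero (RingHom.id K) h1 h2
  by_cases hpn : p ∣ n
  · rcases Nat.eq_zero_or_pos n with rfl | hn
    · exact key 1 (by simp) one_ne_zero Polynomial.separable_one
    · have h1 : 1 < n := (Fact.out : p.Prime).one_lt.trans_le (Nat.le_of_dvd hn hpn)
      have := FiniteField.X_pow_card_sub_X_natDegree_eq K h1
      exact key (Polynomial.X ^ n - Polynomial.X) this
        (by intro h; rw [h] at this; simp at this; omega) (galois_poly_separable p n hpn)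
  · have hn : n ≠ 0 := by rintro rfl; exact hpn (dvd_zero p)
    refine key (Polynomial.X ^ n - 1) (Polynomial.natDegree_X_pow_sub_C (r := (1 : K)))
      (Polynomial.X_pow_sub_C_ne_zero (Nat.pos_of_ne_zero hn) (1 : K))
      (Polynomial.X_pow_sub_one_separable_iff.2 ?_)
    rwa [Ne, CharP.cast_eq_zero_iff K p]

lemma genericResultant_ne_zero (K : Type*) [Field K] [IsAlgClosed K] (p : ℕ) [CharP K p]
    [Fact p.Prime] (n : ℕ) : genericResultant p n ≠ 0 := by
  intro h
  obtain ⟨A, hA, hB⟩ := exists_separable_polyOf (K := K) p n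
  exact hB ((eval_genericResultant_eq_zero_iff p hA).1 (by rw [h, map_zero]))

end resultant

/-! ### The discriminant as a tropical hypersurface -/

/-- The linear functional given by an exponent vector. -/
noncomputable def exponentFunctional {n : ℕ} (u : Fin (n + 1) →₀ ℕ) :
    Module.Dual ℝ (Fin (n + 1) → ℝ) := ∑ i, (u i : ℝ) • LinearMap.proj i

/-- The tropical hypersurface with the given exponents: the minimum is attained twice. -/
def tropHypersurface {V : Type*} [AddCommGroup V] [Module ℝ V] (S : Finset (Module.Dual ℝ V)) :
    Set V := {a | (argminOn (S : Set (Module.Dual ℝ V)) fun u => u a).Nontrivial}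

section kapranov
variable {n : ℕ}

lemma exponentFunctional_apply (u : Fin (n + 1) →₀ ℕ) (a : Fin (n + 1) → ℝ) :
    exponentFunctional u a = ∑ i, (u i : ℝ) * a i := by
  simp [exponentFunctional, LinearMap.sum_apply]

lemma exponentFunctional_single (u : Fin (n + 1) →₀ ℕ) (k : Fin (n + 1)) :
    exponentFunctional u (Pi.single k 1) = u k := by
  rw [exponentFunctional_apply, Finset.sum_eq_single k]
  · simp
  · intro j _ hj; simp [hj]
  · simp

lemma exponentFunctional_injective :
    Function.Injective (exponentFunctional (n := n)) := by
  intro u u' h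
  ext k
  have := congrArg (fun q => q (Pi.single k 1)) h
  simp only [exponentFunctional_single] at this
  exact_mod_cast this

lemma tendsto_dual_apply (u : Module.Dual ℝ (Fin (n + 1) → ℝ)) (a : Fin (n + 1) → ℝ) :
    Filter.Tendsto (fun b => u b) (𝓝 a) (𝓝 (u a)) :=
  (LinearMap.continuous_of_finiteDimensional u).tendsto a

lemma isClosed_tropHypersurface (S : Finset (Module.Dual ℝ (Fin (n + 1) → ℝ))) :
    IsClosed (tropHypersurface S) := by
  rw [← isOpen_compl_iff, isOpen_iff_mem_nhds]
  intro a ha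
  filter_upwards [argminOn_eventually_subset S.finite_toSet (l := 𝓝 a) (w := fun u => u a)
    (φ := fun b u => u b) fun u _ => tendsto_dual_apply u a] with b hb hb'
  exact ha (hb'.mono hb)

variable {K : Type*} [Field K] (v : AddValuation K (WithTop ℝ)) (p : ℕ) [Fact p.Prime] [CharP K p]

lemma val_prod_pow {A : Fin (n + 1) → K} {a : Fin (n + 1) → ℝ} (hA : ∀ i, v (A i) = a i)
    (u : Fin (n + 1) →₀ ℕ) :
    v (∏ i, A i ^ u i) = (exponentFunctional u a : ℝ) := by
  rw [exponentFunctional_apply]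
  have : ∀ s : Finset (Fin (n + 1)),
      v (∏ i ∈ s, A i ^ u i) = ((∑ i ∈ s, (u i : ℝ) * a i : ℝ) : WithTop ℝ) := by
    classical
    intro s
    induction s using Finset.induction_on with
    | empty => simp
    | insert i s hi ih =>
      rw [Finset.prod_insert hi, Finset.sum_insert hi]
      exact val_mul v (val_pow v (hA i) _) ih
  exact this _

lemma val_term {A : Fin (n + 1) → K} {a : Fin (n + 1) → ℝ} (hA : ∀ i, v (A i) = a i)
    {G : MvPolynomial (Fin (n + 1)) (ZMod p)} {u : Fin (n + 1) →₀ ℕ} (hu : u ∈ G.support) :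
    v (ZMod.castHom dvd_rfl K (G.coeff u) * ∏ i, A i ^ u i) = (exponentFunctional u a : ℝ) := by
  have : v (ZMod.castHom (dvd_refl p) K (G.coeff u)) = ((0 : ℝ) : WithTop ℝ) := by
    refine val_eq_zero_of_pow_eq_self v (q := p) (Fact.out : p.Prime).one_lt ?_ ?_
    · rw [Ne, map_eq_zero]
      exact MvPolynomial.mem_support_iff.1 hu
    · rw [← map_pow, ZMod.pow_card]
  rw [val_mul v this (val_prod_pow v hA u), zero_add]

lemma val_eval_of_separated {A : Fin (n + 1) → K} {a : Fin (n + 1) → ℝ} (hA : ∀ i, v (A i) = a i)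
    {G : MvPolynomial (Fin (n + 1)) (ZMod p)} (hG : G.support.Nonempty)
    (hsep : ∀ u ∈ G.support, ∀ u' ∈ G.support, u ≠ u' →
      exponentFunctional u a ≠ exponentFunctional u' a) :
    v (MvPolynomial.eval₂Hom (ZMod.castHom dvd_rfl K) A G) =
      ((G.support.inf' hG fun u => exponentFunctional u a : ℝ) : WithTop ℝ) := by
  obtain ⟨u₀, hu₀, he⟩ := G.support.exists_mem_eq_inf' hG fun u => exponentFunctional u a
  rw [MvPolynomial.coe_eval₂Hom, MvPolynomial.eval₂_eq', he]
  refine val_sum_eq_of_unique v (fun u hu => val_term v p hA hu) hu₀ fun u hu hne => ?_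
  exact lt_of_le_of_ne (he ▸ Finset.inf'_le _ hu) (hsep u₀ hu₀ u hu hne.symm)

lemma mem_tropHypersurface_of_eval_eq_zero {A : Fin (n + 1) → K} {a : Fin (n + 1) → ℝ}
    (hA : ∀ i, v (A i) = a i) {G : MvPolynomial (Fin (n + 1)) (ZMod p)}
    (hG : G.support.Nonempty)
    (h : MvPolynomial.eval₂Hom (ZMod.castHom dvd_rfl K) A G = 0) :
    a ∈ tropHypersurface (G.support.map ⟨_, exponentFunctional_injective⟩) := by
  rw [MvPolynomial.coe_eval₂Hom, MvPolynomial.eval₂_eq'] at h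
  have := argminOn_nontrivial_of_sum_eq_zero v hG (fun u hu => val_term v p hA hu) h
  obtain ⟨u, hu, u', hu', hne⟩ := this
  have hmem : ∀ u ∈ argminOn (G.support : Set (Fin (n + 1) →₀ ℕ)) fun u => exponentFunctional u a,
      exponentFunctional u ∈ argminOn ((G.support.map ⟨_, exponentFunctional_injective⟩ :
        Finset (Module.Dual ℝ (Fin (n + 1) → ℝ))) : Set (Module.Dual ℝ (Fin (n + 1) → ℝ)))
          fun u => u a := by
    intro u hu
    refine ⟨by simpa using ⟨u, MvPolynomial.mem_support_iff.1 hu.1, rfl⟩, fun m hm => ?_⟩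
    obtain ⟨m', hm', rfl⟩ := Finset.mem_map.1 (Finset.mem_coe.1 hm)
    exact hu.2 m' hm'
  exact ⟨_, hmem u hu, _, hmem u' hu', exponentFunctional_injective.ne hne⟩

end kapranov

section kapranov
variable {K : Type*} [Field K] (v : AddValuation K (WithTop ℝ)) {n : ℕ}

/-- If no root has valuation close to `t₀`, the valuation of a product of linear factors is an
affine function of the valuation of the variable near `t₀`. -/
lemma val_prod_sub_affine {t₀ ε : ℝ} (R : Multiset K)
    (hR : ∀ x ∈ R, ∀ r : ℝ, v x = r → ε ≤ |r - t₀|) :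
    ∃ (C : ℝ) (N : ℕ), ∀ (B : K) (t : ℝ), v B = t → |t - t₀| < ε →
      v (R.map fun x => B - x).prod = ((C + N * t : ℝ) : WithTop ℝ) := by
  induction R using Multiset.induction_on with
  | empty => exact ⟨0, 0, fun B t _ _ => by simp⟩
  | cons x R ih =>
    obtain ⟨C, N, h⟩ := ih fun y hy => hR y (Multiset.mem_cons_of_mem hy)
    have hx := hR x (Multiset.mem_cons_self x R)
    have key : (∃ r : ℝ, v x = r ∧ r ≤ t₀ - ε) ∨
        ∀ t : ℝ, |t - t₀| < ε → (t : WithTop ℝ) < v x := by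
      by_cases hx0 : x = 0
      · right; intro t _; rw [hx0, v.map_zero]; exact WithTop.coe_lt_top t
      · obtain ⟨r, hr⟩ := exists_val_eq v hx0
        rcases le_abs.1 (hx r hr) with h1 | h1
        · right; intro t ht; rw [hr, WithTop.coe_lt_coe]; linarith [(abs_lt.1 ht).2]
        · exact Or.inl ⟨r, hr, by linarith⟩
    rcases key with ⟨r, hr, hle⟩ | hlt
    · refine ⟨r + C, N, fun B t hB ht => ?_⟩
      have h1 : v (B - x) = (r : WithTop ℝ) := by
        rw [← hr]
        refine v.map_sub_eq_of_lt_right ?_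
        rw [hr, hB, WithTop.coe_lt_coe]
        linarith [(abs_lt.1 ht).1]
      rw [Multiset.map_cons, Multiset.prod_cons, val_mul v h1 (h B t hB ht), WithTop.coe_inj]
      ring
    · refine ⟨C, N + 1, fun B t hB ht => ?_⟩
      have h1 : v (B - x) = (t : WithTop ℝ) := by
        rw [← hB]
        refine v.map_sub_eq_of_lt_left ?_
        rw [hB]; exact hlt t ht
      rw [Multiset.map_cons, Multiset.prod_cons, val_mul v h1 (h B t hB ht), WithTop.coe_inj]
      push_cast
      ring

end kapranov

section kapranov
variable {K : Type*} [Field K] [IsAlgClosed K] (v : AddValuation K (WithTop ℝ)) {n : ℕ}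

/-- Points with coordinates in the value group that avoid finitely many hyperplanes are dense. -/
lemma exists_generic_val (hv : ∃ x : K, x ≠ 0 ∧ v x ≠ 0)
    (Q : Finset (Module.Dual ℝ (Fin (n + 1) → ℝ))) (hQ : ∀ q ∈ Q, q ≠ 0)
    {U : Set (Fin (n + 1) → ℝ)} {a : Fin (n + 1) → ℝ} (hU : U ∈ 𝓝 a) :
    ∃ b ∈ U, (∀ q ∈ Q, q b ≠ 0) ∧ ∀ i, ∃ x : K, v x = b i := by
  obtain ⟨h, -, hh⟩ := exists_mem_forall_ne_zero (⊤ : Submodule ℝ (Fin (n + 1) → ℝ)) Q fun q hq => by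
    by_contra hcon
    push Not at hcon
    exact hQ q hq (LinearMap.ext fun x => hcon x trivial)
  have h1 := eventually_forall_affine_ne_zero Q (z := a) (h := h) (s := 0)
    fun q hq => Or.inl (hh q hq)
  have h2 : ∀ᶠ t in 𝓝[>] (0 : ℝ), U ∈ 𝓝 (a + t • h) := by
    have : Filter.Tendsto (fun t : ℝ => a + t • h) (𝓝[>] 0) (𝓝 a) := by
      have : Continuous fun t : ℝ => a + t • h := by fun_prop
      simpa using (this.tendsto 0).mono_left nhdsWithin_le_nhds
    exact this.eventually (eventually_mem_nhds_iff.2 hU)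
  obtain ⟨t, ht1, ht2⟩ := (h1.and h2).exists
  have h3 : ∀ᶠ b in 𝓝 (a + t • h), b ∈ U ∧ ∀ q ∈ Q, q b ≠ 0 :=
    Filter.Eventually.and ht2 ((Filter.eventually_all_finset Q).2 fun q hq =>
      (tendsto_dual_apply q _).eventually_ne (ht1 q hq))
  obtain ⟨ε, hε, hball⟩ := Metric.eventually_nhds_iff.1 h3
  obtain ⟨ρ, -, hρ1, hρ2⟩ := exists_rounding v hv hε
  obtain ⟨h4, h5⟩ := hball (y := fun i => ρ ((a + t • h) i)) (by
    rw [dist_pi_lt_iff hε]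
    exact fun i => by rw [Real.dist_eq]; exact hρ1 _)
  exact ⟨_, h4, h5, fun i => hρ2 _⟩

lemma exists_val_update (hv : ∃ x : K, x ≠ 0 ∧ v x ≠ 0)
    (Q : Finset (Module.Dual ℝ (Fin (n + 1) → ℝ))) {b : Fin (n + 1) → ℝ}
    (hQ : ∀ q ∈ Q, q b ≠ 0) (k : Fin (n + 1)) (s : ℝ) {η : ℝ} (hη : 0 < η) :
    ∃ (x : K) (t : ℝ), v x = t ∧ s < t ∧ t < s + η ∧ ∀ q ∈ Q, q (Function.update b k t) ≠ 0 := by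
  have h1 : ∀ᶠ t in 𝓝[>] s, ∀ q ∈ Q, q (Function.update b k t) ≠ 0 := by
    have := eventually_forall_affine_ne_zero Q (z := b - b k • Pi.single k 1)
      (h := Pi.single k 1) (s := s) fun q hq => by
        by_contra hcon
        push Not at hcon
        refine hQ q hq ?_
        have := hcon.2
        rwa [map_sub, map_smul, hcon.1, smul_zero, sub_zero] at this
    filter_upwards [this] with t ht q hq
    convert ht q hq using 2
    ext i
    by_cases hi : i = k
    · subst hi; simp
    · simp [hi]
  obtain ⟨c, hc, hsub⟩ := (mem_nhdsGT_iff_exists_Ioo_subset).1 h1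
  obtain ⟨x, t, hx, ht1, ht2⟩ := exists_val_mem_Ioo v hv (c := s) (d := min c (s + η))
    (lt_min hc (by linarith))
  exact ⟨x, t, hx, ht1, ht2.trans_le (min_le_right _ _),
    hsub ⟨ht1, ht2.trans_le (min_le_left _ _)⟩⟩

lemma singularPairs_of_eval_eq_zero (p : ℕ) [Fact p.Prime] [CharP K p] {A : Fin (n + 1) → K} {a : Fin (n + 1) → ℝ}
    (hA : ∀ i, v (A i) = a i)
    (h : MvPolynomial.eval₂Hom (ZMod.castHom dvd_rfl K) A (genericResultant p n) = 0) :
    ∃ b, (b, a) ∈ singularPairs v n := by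
  obtain ⟨B, h1, h2⟩ := (eval_genericResultant_eq_zero_iff p
    (ne_zero_of_val_eq v (hA (Fin.last n)))).1 h
  have hB : B ≠ 0 := by
    rintro rfl
    rw [eval_polyOf, Finset.sum_eq_single 0] at h1
    · simp only [Fin.val_zero, pow_zero, mul_one] at h1
      exact ne_zero_of_val_eq v (hA 0) h1
    · intro i _ hi
      rw [zero_pow fun h => hi (Fin.ext h), mul_zero]
    · simp
  obtain ⟨b, hb⟩ := exists_val_eq v hB
  exact ⟨b, A, B, hA, hb, h1, h2⟩

/-- The restriction of the resultant to a line parallel to a coordinate axis has an affine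
valuation if the line does not meet the discriminant. -/
lemma val_eval_update_affine (p : ℕ) [Fact p.Prime] [CharP K p] {A : Fin (n + 1) → K} {b : Fin (n + 1) → ℝ} (hA : ∀ i, v (A i) = b i)
    (k : Fin (n + 1)) {t₀ ε : ℝ}
    (hne : MvPolynomial.eval₂Hom (ZMod.castHom dvd_rfl K) A (genericResultant p n) ≠ 0)
    (hsing : ∀ t, |t - t₀| < ε → ¬ ∃ β, (β, Function.update b k t) ∈ singularPairs v n) :
    ∃ (C : ℝ) (N : ℕ), ∀ (B : K) (t : ℝ), v B = t → |t - t₀| < ε →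
      v (MvPolynomial.eval₂Hom (ZMod.castHom dvd_rfl K) (Function.update A k B)
        (genericResultant p n)) = ((C + N * t : ℝ) : WithTop ℝ) := by
  classical
  set h : Polynomial K := MvPolynomial.eval₂Hom (Polynomial.C.comp (ZMod.castHom dvd_rfl K))
    (fun i => if i = k then Polynomial.X else Polynomial.C (A i)) (genericResultant p n) with hh
  have heval : ∀ B, h.eval B = MvPolynomial.eval₂Hom (ZMod.castHom dvd_rfl K)
      (Function.update A k B) (genericResultant p n) := by
    intro B
    rw [hh, ← Polynomial.coe_evalRingHom, MvPolynomial.map_eval₂Hom]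
    congr 2
    · exact RingHom.ext fun x => by simp
    · ext i
      by_cases hi : i = k
      · subst hi; simp
      · simp [hi]
  have hh0 : h ≠ 0 := by
    intro h0
    refine hne ?_
    have := heval (A k)
    rw [Function.update_eq_self, h0, Polynomial.eval_zero] at this
    exact this.symm
  obtain ⟨l, hl⟩ := exists_val_eq v (Polynomial.leadingCoeff_ne_zero.2 hh0)
  obtain ⟨C, N, hCN⟩ := val_prod_sub_affine v (t₀ := t₀) (ε := ε) h.roots fun x hx r hr => by
    by_contra hlt
    push Not at hlt
    refine hsing r hlt (singularPairs_of_eval_eq_zero v p (A := Function.update A k x)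
      (fun i => ?_) ?_)
    · by_cases hi : i = k
      · subst hi; simpa using hr
      · simpa [hi] using hA i
    · rw [← heval]
      exact (Polynomial.mem_roots hh0).1 hx
  refine ⟨l + C, N, fun B t hB ht => ?_⟩
  rw [← heval]
  have : h.eval B = h.leadingCoeff * (h.roots.map fun x => B - x).prod := by
    conv_lhs => rw [(IsAlgClosed.splits h).eq_prod_roots]
    simp [Polynomial.eval_mul, Polynomial.eval_multiset_prod, Multiset.map_map]
  rw [this, val_mul v hl (hCN B t hB ht), WithTop.coe_inj]
  ring

lemma mem_tropDisc_of_mem_tropHypersurface (p : ℕ) [Fact p.Prime] [CharP K p]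
    (hv : ∃ x : K, x ≠ 0 ∧ v x ≠ 0)
    {a : Fin (n + 1) → ℝ}
    (ha : a ∈ tropHypersurface
      ((genericResultant p n).support.map ⟨_, exponentFunctional_injective⟩)) :
    a ∈ tropDisc v n := by
  classical
  by_contra hcon
  set G := genericResultant p n with hG
  have hGne : G.support.Nonempty := by
    rw [Finset.nonempty_iff_ne_empty, Ne, MvPolynomial.support_eq_empty]
    exact genericResultant_ne_zero K p n
  obtain ⟨ε, hε, hball⟩ := Metric.mem_nhds_iff.1 (isClosed_closure.isOpen_compl.mem_nhds hcon)
  have hsing : ∀ c, dist c a < ε → ¬ ∃ β, (β, c) ∈ singularPairs v n := fun c hc hβ =>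
    hball (Metric.mem_ball.2 hc) (subset_closure hβ)
  obtain ⟨u₁, u₂, hu₁, hu₂, k, hk⟩ : ∃ u₁ u₂ : Fin (n + 1) →₀ ℕ,
      (u₁ ∈ G.support ∧ ∀ u ∈ G.support, exponentFunctional u₁ a ≤ exponentFunctional u a) ∧
      (u₂ ∈ G.support ∧ ∀ u ∈ G.support, exponentFunctional u₂ a ≤ exponentFunctional u a) ∧
      ∃ k, u₂ k < u₁ k := by
    have hex : ∀ q, q ∈ argminOn ((G.support.map ⟨_, exponentFunctional_injective⟩ :
        Finset (Module.Dual ℝ (Fin (n + 1) → ℝ))) : Set (Module.Dual ℝ (Fin (n + 1) → ℝ)))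
          (fun u => u a) → ∃ u, exponentFunctional u = q ∧ u ∈ G.support ∧ ∀ u' ∈ G.support,
          exponentFunctional u a ≤ exponentFunctional u' a := by
      intro q hq
      obtain ⟨u, hu, rfl⟩ := Finset.mem_map.1 (Finset.mem_coe.1 hq.1)
      exact ⟨u, rfl, hu, fun u' hu' => hq.2 _ (by simpa using
        ⟨u', MvPolynomial.mem_support_iff.1 hu', rfl⟩)⟩
    obtain ⟨q₁, hq₁, q₂, hq₂, hne⟩ := ha
    obtain ⟨u₁, rfl, h₁⟩ := hex q₁ hq₁
    obtain ⟨u₂, rfl, h₂⟩ := hex q₂ hq₂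
    obtain ⟨k, hk⟩ : ∃ k, u₁ k ≠ u₂ k := by
      by_contra hall
      push Not at hall
      exact hne (congrArg _ (Finsupp.ext hall))
    rcases lt_or_gt_of_ne hk with hk | hk
    · exact ⟨u₂, u₁, h₂, h₁, k, hk⟩
    · exact ⟨u₁, u₂, h₁, h₂, k, hk⟩
  -- the tropical polynomial
  set g : (Fin (n + 1) → ℝ) → ℝ := fun b => G.support.inf' hGne fun u => exponentFunctional u b
    with hg
  have hgcont : Continuous g := Continuous.finset_inf'_apply hGne fun u _ =>
    LinearMap.continuous_of_finiteDimensional (exponentFunctional u)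
  have hga : g a = exponentFunctional u₁ a :=
    le_antisymm (Finset.inf'_le _ hu₁.1) (Finset.le_inf' _ _ hu₁.2)
  have hga' : g a = exponentFunctional u₂ a :=
    le_antisymm (Finset.inf'_le _ hu₂.1) (Finset.le_inf' _ _ hu₂.2)
  set e : Fin (n + 1) → ℝ := Pi.single k 1 with he
  set δ : ℝ := ε / 2 with hδ
  have hδ0 : 0 < δ := by positivity
  have hplus : g (a + δ • e) ≤ g a + δ * u₂ k := by
    refine (Finset.inf'_le _ hu₂.1).trans ?_
    rw [map_add, map_smul, he, exponentFunctional_single, hga', smul_eq_mul]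
  have hminus : g (a - δ • e) ≤ g a - δ * u₁ k := by
    refine (Finset.inf'_le _ hu₁.1).trans ?_
    rw [map_sub, map_smul, he, exponentFunctional_single, hga, smul_eq_mul]
  -- continuity
  have hcts : ∀ c, ∃ η > 0, ∀ b, dist b c < η → |g b - g c| < δ / 8 := fun c => by
    obtain ⟨η, hη, h⟩ := Metric.continuous_iff.1 hgcont c (δ / 8) (by positivity)
    exact ⟨η, hη, fun b hb => by simpa [Real.dist_eq] using h b hb⟩
  obtain ⟨η₁, hη₁, hc₁⟩ := hcts a
  obtain ⟨η₂, hη₂, hc₂⟩ := hcts (a + δ • e)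
  obtain ⟨η₃, hη₃, hc₃⟩ := hcts (a - δ • e)
  set η : ℝ := min (min η₁ (min η₂ η₃)) (δ / (8 * (u₁ k + 1))) with hη
  have hu0 : (0 : ℝ) < 8 * (u₁ k + 1) := by positivity
  have hηpos : 0 < η := lt_min (lt_min hη₁ (lt_min hη₂ hη₃)) (by positivity)
  have hηle₁ : η ≤ η₁ := (min_le_left _ _).trans (min_le_left _ _)
  have hηle₂ : η ≤ η₂ := (min_le_left _ _).trans ((min_le_right _ _).trans (min_le_left _ _))
  have hηle₃ : η ≤ η₃ := (min_le_left _ _).trans ((min_le_right _ _).trans (min_le_right _ _))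
  have hηδ : 8 * (u₁ k + 1) * η ≤ δ := by
    have := (le_div_iff₀ hu0).1 (min_le_right (min η₁ (min η₂ η₃)) (δ / (8 * (u₁ k + 1))))
    linarith
  have hηδ' : 8 * η ≤ δ := by nlinarith [(Nat.cast_nonneg (u₁ k) : (0 : ℝ) ≤ u₁ k)]
  -- generic points
  set Q : Finset (Module.Dual ℝ (Fin (n + 1) → ℝ)) :=
    ((G.support ×ˢ G.support).filter fun q => q.1 ≠ q.2).image
      fun q => exponentFunctional q.1 - exponentFunctional q.2 with hQ
  have hQ0 : ∀ q ∈ Q, q ≠ 0 := by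
    intro q hq
    obtain ⟨q', hq', rfl⟩ := Finset.mem_image.1 hq
    exact sub_ne_zero.2 (exponentFunctional_injective.ne (Finset.mem_filter.1 hq').2)
  have hsep : ∀ b, (∀ q ∈ Q, q b ≠ 0) → ∀ u ∈ G.support, ∀ u' ∈ G.support, u ≠ u' →
      exponentFunctional u b ≠ exponentFunctional u' b := by
    intro b hb u hu u' hu' hne h
    refine hb _ (Finset.mem_image.2 ⟨(u, u'), Finset.mem_filter.2
      ⟨Finset.mem_product.2 ⟨hu, hu'⟩, hne⟩, rfl⟩) ?_
    rw [LinearMap.sub_apply, h, sub_self]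
  obtain ⟨b, hb, hbQ, hbv⟩ := exists_generic_val v hv Q hQ0 (Metric.ball_mem_nhds a (half_pos hηpos))
  rw [Metric.mem_ball] at hb
  have hbi : ∀ i, |b i - a i| < η / 2 := fun i => (dist_le_pi_dist b a i).trans_lt hb
  obtain ⟨xp, tp, hxp, htp1, htp2, htpQ⟩ := exists_val_update v hv Q hbQ k (a k + δ) hηpos
  obtain ⟨xm, tm, hxm, htm1, htm2, htmQ⟩ := exists_val_update v hv Q hbQ k (a k - δ) hηpos
  choose A hA using hbv
  have hval : ∀ (B : K) (t : ℝ), v B = t → (∀ q ∈ Q, q (Function.update b k t) ≠ 0) →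
      v (MvPolynomial.eval₂Hom (ZMod.castHom dvd_rfl K) (Function.update A k B) G) =
        ((g (Function.update b k t) : ℝ) : WithTop ℝ) := by
    intro B t hB ht
    refine val_eval_of_separated v p (fun i => ?_) hGne (hsep _ ht)
    by_cases hi : i = k
    · subst hi; simpa using hB
    · simpa [hi] using hA i
  have hAne : MvPolynomial.eval₂Hom (ZMod.castHom dvd_rfl K) A G ≠ 0 :=
    ne_zero_of_val_eq v (val_eval_of_separated v p hA hGne (hsep _ hbQ))
  have hupd : ∀ t s : ℝ, |t - (a k + s)| < η → dist (Function.update b k t) (a + s • e) < η := by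
    intro t s ht
    rw [dist_pi_lt_iff hηpos]
    intro i
    by_cases hi : i = k
    · subst hi; simpa [he, Real.dist_eq] using ht
    · have := hbi i
      simp only [Function.update_of_ne hi, Pi.add_apply, Pi.smul_apply, he, Pi.single_eq_of_ne hi,
        smul_zero, add_zero, Real.dist_eq]
      linarith
  obtain ⟨C, N, hCN⟩ := val_eval_update_affine v p hA k (t₀ := a k) (ε := ε) hAne fun t ht => by
    refine hsing _ ?_
    rw [dist_pi_lt_iff hε]
    intro i
    by_cases hi : i = k
    · subst hi; simpa [Real.dist_eq] using ht
    · have := hbi i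
      simp only [Function.update_of_ne hi, Real.dist_eq]
      linarith
  have hlin : ∀ (B : K) (t : ℝ), v B = t → (∀ q ∈ Q, q (Function.update b k t) ≠ 0) →
      |t - a k| < ε → g (Function.update b k t) = C + N * t := by
    intro B t hB hQt ht
    have := hval B t hB hQt
    rw [hCN B t hB ht, WithTop.coe_inj] at this
    exact this.symm
  have e1 := hlin xp tp hxp htpQ (by rw [abs_lt]; constructor <;> linarith)
  have e2 := hlin xm tm hxm htmQ (by rw [abs_lt]; constructor <;> linarith)
  have hbk := abs_lt.1 (hbi k)
  have e3 := hlin (A k) (b k) (hA k) (by rwa [Function.update_eq_self])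
    (by rw [abs_lt]; constructor <;> linarith)
  rw [Function.update_eq_self] at e3
  have c1 := abs_lt.1 (hc₁ b (by linarith))
  have c2 := abs_lt.1 (hc₂ (Function.update b k tp)
    ((hupd tp δ (by rw [abs_lt]; constructor <;> linarith)).trans_le hηle₂))
  have hm := hupd tm (-δ) (by rw [abs_lt]; constructor <;> linarith)
  rw [neg_smul, ← sub_eq_add_neg] at hm
  have c3 := abs_lt.1 (hc₃ (Function.update b k tm) (hm.trans_le hηle₃))
  rw [e1] at c2
  rw [e2] at c3
  rw [e3] at c1
  -- slopes
  have s1 : N * (tp - b k) ≤ δ * u₂ k + δ / 4 := by linarith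
  have s2 : δ * u₁ k - δ / 4 ≤ N * (b k - tm) := by linarith
  have hN0 : (0 : ℝ) ≤ N := N.cast_nonneg
  have hk' : (u₂ k : ℝ) + 1 ≤ u₁ k := by exact_mod_cast hk
  rcases Nat.lt_or_ge (u₂ k) N with hN | hN
  · have hN' : (u₂ k : ℝ) + 1 ≤ N := by exact_mod_cast hN
    have : ((u₂ k : ℝ) + 1) * (δ - η) ≤ N * (tp - b k) := by
      apply mul_le_mul hN' (by linarith) (by linarith) hN0
    nlinarith
  · have hN' : (N : ℝ) ≤ u₂ k := by exact_mod_cast hN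
    have : N * (b k - tm) ≤ ((u₁ k : ℝ) - 1) * (δ + η) := by
      apply mul_le_mul (by linarith) (by linarith) (by linarith) (by linarith)
    nlinarith

/-- The tropical discriminant is a tropical hypersurface. -/
theorem exists_tropDisc_eq_tropHypersurface (p : ℕ) [Fact p.Prime] [CharP K p]
    (hv : ∃ x : K, x ≠ 0 ∧ v x ≠ 0) (n : ℕ) :
    ∃ S : Finset (Module.Dual ℝ (Fin (n + 1) → ℝ)), S.Nonempty ∧
      tropDisc v n = tropHypersurface S := by
  have hGne : (genericResultant p n).support.Nonempty := by
    rw [Finset.nonempty_iff_ne_empty, Ne, MvPolynomial.support_eq_empty]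
    exact genericResultant_ne_zero K p n
  refine ⟨(genericResultant p n).support.map ⟨_, exponentFunctional_injective⟩, hGne.map,
    Set.Subset.antisymm ?_ fun a ha => mem_tropDisc_of_mem_tropHypersurface v p hv ha⟩
  refine closure_minimal ?_ (isClosed_tropHypersurface _)
  rintro a ⟨b, A, B, hA, hB, h1, h2⟩
  exact mem_tropHypersurface_of_eval_eq_zero v p hA hGne ((eval_genericResultant_eq_zero_iff p
    (ne_zero_of_val_eq v (hA (Fin.last n)))).2 ⟨B, h1, h2⟩)

end kapranov

/-! ### Cones of a tropical hypersurface -/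

lemma IsPreconnected.eq_of_eventually_eq {X β : Type*} [TopologicalSpace X] {A : Set X}
    (hA : IsPreconnected A) {φ : X → β} (h : ∀ x ∈ A, ∀ᶠ y in 𝓝 x, y ∈ A → φ y = φ x)
    {x y : X} (hx : x ∈ A) (hy : y ∈ A) : φ x = φ y := by
  have : PreconnectedSpace A := isPreconnected_iff_preconnectedSpace.1 hA
  have hlc : IsLocallyConstant fun z : A => φ z := by
    rw [IsLocallyConstant.iff_eventually_eq]
    intro z
    filter_upwards [continuous_subtype_val.continuousAt.eventually (h z z.2)] with y hy
    exact hy y.2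
  exact hlc.apply_eq_of_preconnectedSpace ⟨x, hx⟩ ⟨y, hy⟩

section argmin
variable {α : Type*} {A : Set α} {w w' : α → ℝ}

lemma argminOn_smul {c : ℝ} (hc : 0 < c) :
    argminOn A (fun i => c * w i) = argminOn A w := by
  ext i
  simp only [argminOn, Set.mem_ofPred_eq, mul_le_mul_iff_right₀ hc]

lemma argminOn_congr_sub {κ : ℝ} (h : ∀ i ∈ A, w i = w' i + κ) : argminOn A w = argminOn A w' := by
  ext i
  constructor
  · rintro ⟨hi, h'⟩
    refine ⟨hi, fun m hm => ?_⟩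
    have := h' m hm
    rw [h i hi, h m hm] at this
    linarith
  · rintro ⟨hi, h'⟩
    refine ⟨hi, fun m hm => ?_⟩
    rw [h i hi, h m hm]
    linarith [h' m hm]

lemma argminOn_eq_self (h : ∀ i ∈ A, ∀ j ∈ A, w i = w j) : argminOn A w = A :=
  Set.Subset.antisymm argminOn_subset fun i hi => ⟨hi, fun m hm => (h i hi m hm).le⟩

end argmin

section fan
variable {n : ℕ}

/-- The exponents of `S` at which the minimum is attained. -/
def minSet (S : Finset (Module.Dual ℝ (Fin (n + 1) → ℝ))) (a : Fin (n + 1) → ℝ) :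
    Set (Module.Dual ℝ (Fin (n + 1) → ℝ)) :=
  argminOn (S : Set (Module.Dual ℝ (Fin (n + 1) → ℝ))) fun u => u a

/-- The span of the differences of the minimizing exponents. -/
def dirSpace (S : Finset (Module.Dual ℝ (Fin (n + 1) → ℝ))) (a : Fin (n + 1) → ℝ) :
    Submodule ℝ (Module.Dual ℝ (Fin (n + 1) → ℝ)) :=
  Submodule.span ℝ {d | ∃ u ∈ minSet S a, ∃ u' ∈ minSet S a, d = u - u'}

/-- The directions in which all minimizing exponents stay equal. -/
def linSpace (S : Finset (Module.Dual ℝ (Fin (n + 1) → ℝ))) (a : Fin (n + 1) → ℝ) :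
    Submodule ℝ (Fin (n + 1) → ℝ) := (dirSpace S a).dualCoannihilator

/-- The closed cone of points at which all exponents minimizing at `a` are minimizing. -/
def minCone (S : Finset (Module.Dual ℝ (Fin (n + 1) → ℝ))) (a : Fin (n + 1) → ℝ) :
    Set (Fin (n + 1) → ℝ) := {b | minSet S a ⊆ minSet S b}

variable {S : Finset (Module.Dual ℝ (Fin (n + 1) → ℝ))} {a b f x : Fin (n + 1) → ℝ}

lemma minSet_nonempty (hS : S.Nonempty) (a : Fin (n + 1) → ℝ) : (minSet S a).Nonempty :=
  argminOn_nonempty S.finite_toSet (by simpa using hS)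

lemma minSet_finite : (minSet S a).Finite := S.finite_toSet.subset argminOn_subset

lemma minSet_zero : minSet S 0 = S := argminOn_eq_self fun u _ u' _ => by simp

lemma sub_mem_dirSpace {u u' : Module.Dual ℝ (Fin (n + 1) → ℝ)} (hu : u ∈ minSet S a)
    (hu' : u' ∈ minSet S a) : u - u' ∈ dirSpace S a :=
  Submodule.subset_span ⟨u, hu, u', hu', rfl⟩

lemma mem_linSpace_iff_dirSpace : x ∈ linSpace S a ↔ ∀ d ∈ dirSpace S a, d x = 0 :=
  Submodule.mem_dualCoannihilator _

lemma mem_linSpace : x ∈ linSpace S a ↔ ∀ u ∈ minSet S a, ∀ u' ∈ minSet S a, u x = u' x := by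
  rw [mem_linSpace_iff_dirSpace]
  constructor
  · intro h u hu u' hu'
    have := h _ (sub_mem_dirSpace hu hu')
    rwa [LinearMap.sub_apply, sub_eq_zero] at this
  · intro h d hd
    induction hd using Submodule.span_induction with
    | mem d hd =>
      obtain ⟨u, hu, u', hu', rfl⟩ := hd
      rw [LinearMap.sub_apply, h u hu u' hu', sub_self]
    | zero => simp
    | add d e _ _ hd he => rw [LinearMap.add_apply, hd, he, add_zero]
    | smul c d _ hd => rw [LinearMap.smul_apply, hd, smul_zero]

lemma finrank_dirSpace_add (S : Finset (Module.Dual ℝ (Fin (n + 1) → ℝ))) (a) :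
    Module.finrank ℝ (dirSpace S a) + Module.finrank ℝ (linSpace S a) = n + 1 := by
  have := Subspace.finrank_add_finrank_dualCoannihilator_eq (dirSpace S a)
  rwa [Module.finrank_fin_fun] at this

lemma dirSpace_congr (h : minSet S a = minSet S b) : dirSpace S a = dirSpace S b := by
  rw [dirSpace, h, dirSpace]

lemma linSpace_congr (h : minSet S a = minSet S b) : linSpace S a = linSpace S b := by
  rw [linSpace, dirSpace_congr h, linSpace]

lemma dirSpace_mono (h : minSet S a ⊆ minSet S b) : dirSpace S a ≤ dirSpace S b := by
  refine Submodule.span_mono ?_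
  rintro _ ⟨u, hu, u', hu', rfl⟩
  exact ⟨u, h hu, u', h hu', rfl⟩

lemma eventually_minSet_eq (S : Finset (Module.Dual ℝ (Fin (n + 1) → ℝ))) (a) :
    ∀ᶠ b in 𝓝 a, minSet S b = argminOn (minSet S a) fun u => u b :=
  argminOn_eventually_eq S.finite_toSet fun u _ => tendsto_dual_apply u a

lemma argminOn_minSet_add (h : Fin (n + 1) → ℝ) :
    argminOn (minSet S a) (fun u => u (a + h)) = argminOn (minSet S a) fun u => u h := by
  simp only [map_add]
  exact argminOn_add_argminOn

lemma eventually_minSet_ray (S : Finset (Module.Dual ℝ (Fin (n + 1) → ℝ))) (a h) :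
    ∀ᶠ t in 𝓝[>] (0 : ℝ), minSet S (a + t • h) = argminOn (minSet S a) fun u => u h := by
  have h1 : Filter.Tendsto (fun t : ℝ => a + t • h) (𝓝[>] 0) (𝓝 a) := by
    have : Continuous fun t : ℝ => a + t • h := by fun_prop
    simpa using (this.tendsto 0).mono_left nhdsWithin_le_nhds
  filter_upwards [h1.eventually (eventually_minSet_eq S a), self_mem_nhdsWithin] with t ht ht0
  rw [ht, argminOn_minSet_add]
  simp only [map_smul, smul_eq_mul]
  exact argminOn_smul ht0

lemma eventually_minSet_lin (S : Finset (Module.Dual ℝ (Fin (n + 1) → ℝ))) (a) :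
    ∀ᶠ b in 𝓝 a, b - a ∈ linSpace S a → minSet S b = minSet S a := by
  filter_upwards [eventually_minSet_eq S a] with b hb hlin
  rw [hb, show b = a + (b - a) by abel, argminOn_minSet_add]
  exact argminOn_eq_self (mem_linSpace.1 hlin)

lemma minSet_segment {t : ℝ} (ht0 : 0 < t) (ht1 : t < 1)
    (h : (minSet S f ∩ minSet S a).Nonempty) :
    minSet S (f + t • (a - f)) = minSet S f ∩ minSet S a := by
  obtain ⟨u₀, hu₀f, hu₀a⟩ := h
  have hval : ∀ u : Module.Dual ℝ (Fin (n + 1) → ℝ),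
      u (f + t • (a - f)) = (1 - t) * u f + t * u a := by
    intro u; simp only [map_add, map_smul, map_sub, smul_eq_mul]; ring
  ext u
  simp only [minSet, argminOn, Set.mem_inter_iff, Set.mem_ofPred_eq, hval]
  constructor
  · rintro ⟨hu, h⟩
    have h0 := h u₀ hu₀f.1
    have hf := hu₀f.2 u hu
    have ha := hu₀a.2 u hu
    have ef : u f = u₀ f := by nlinarith
    have ea : u a = u₀ a := by nlinarith
    exact ⟨⟨hu, fun m hm => ef ▸ hu₀f.2 m hm⟩, ⟨hu, fun m hm => ea ▸ hu₀a.2 m hm⟩⟩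
  · rintro ⟨⟨hu, hf⟩, -, ha⟩
    refine ⟨hu, fun m hm => ?_⟩
    have := hf m hm
    have := ha m hm
    have : 0 < 1 - t := by linarith
    gcongr

lemma mem_tropHypersurface : a ∈ tropHypersurface S ↔ (minSet S a).Nontrivial := Iff.rfl

lemma dirSpace_ne_bot (ha : a ∈ tropHypersurface S) : dirSpace S a ≠ ⊥ := by
  obtain ⟨u, hu, u', hu', hne⟩ := ha
  intro h
  have := sub_mem_dirSpace hu hu'
  rw [h, Submodule.mem_bot, sub_eq_zero] at this
  exact hne this

lemma mem_tropHypersurface_of_finrank (h : 0 < Module.finrank ℝ (dirSpace S a)) :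
    a ∈ tropHypersurface S := by
  rw [mem_tropHypersurface]
  by_contra hcon
  rw [Set.not_nontrivial_iff] at hcon
  have : dirSpace S a = ⊥ := by
    rw [dirSpace, Submodule.span_eq_bot]
    rintro _ ⟨u, hu, u', hu', rfl⟩
    rw [hcon hu hu', sub_self]
  rw [this] at h
  simp at h

/-- Near a point whose minimizing exponents are collinear, the minimizing exponents are constant
along the hypersurface. -/
lemma eventually_minSet_of_finrank_eq_one (h : Module.finrank ℝ (dirSpace S a) = 1) :
    ∀ᶠ b in 𝓝 a, b ∈ tropHypersurface S → b - a ∈ linSpace S a ∧ minSet S b = minSet S a := by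
  filter_upwards [eventually_minSet_eq S a, eventually_minSet_lin S a] with b hb hlin hX
  have hlin' : b - a ∈ linSpace S a := by
    obtain ⟨u, hu, u', hu', hne⟩ := hX
    have e : u b = u' b := eq_of_mem_argminOn hu hu'
    change u ∈ minSet S b at hu
    change u' ∈ minSet S b at hu'
    rw [hb] at hu hu'
    have e' : u a = u' a := eq_of_mem_argminOn hu.1 hu'.1
    rw [mem_linSpace_iff_dirSpace]
    intro d hd
    obtain ⟨c, hc⟩ := (finrank_eq_one_iff_of_nonzero' (⟨u - u', sub_mem_dirSpace hu.1 hu'.1⟩ :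
      dirSpace S a) (by simpa [sub_eq_zero] using hne)).1 h ⟨d, hd⟩
    have hc' : c • (u - u') = d := congrArg Subtype.val hc
    rw [← hc', LinearMap.smul_apply, LinearMap.sub_apply, map_sub, map_sub, e, e', sub_self,
      smul_zero]
  exact ⟨hlin', hlin hlin'⟩

lemma mem_regularPoints_of_finrank_eq_one (h : Module.finrank ℝ (dirSpace S a) = 1) :
    a ∈ regularPoints (tropHypersurface S) := by
  have ha : a ∈ tropHypersurface S := mem_tropHypersurface_of_finrank (by omega)
  refine ⟨ha, linSpace S a, by have := finrank_dirSpace_add S a; omega, ?_⟩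
  filter_upwards [eventually_minSet_of_finrank_eq_one h, eventually_minSet_lin S a] with b h1 h2
  exact ⟨fun hb => (h1 hb).1, fun hb => by rw [mem_tropHypersurface, h2 hb]; exact ha⟩

lemma finrank_eq_one_of_mem_regularPoints (hS : S.Nonempty)
    (h : a ∈ regularPoints (tropHypersurface S)) : Module.finrank ℝ (dirSpace S a) = 1 := by
  obtain ⟨ha, L, hL, hnear⟩ := h
  have hz : ∃ z, z ∉ L := by
    by_contra hcon
    push Not at hcon
    rw [(Submodule.eq_top_iff').2 hcon, finrank_top, Module.finrank_fin_fun] at hL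
    omega
  obtain ⟨z, hz⟩ := hz
  have huniq : ∀ z, z ∉ L → (argminOn (minSet S a) fun u => u z).Subsingleton := by
    intro z hz
    have h1 : Filter.Tendsto (fun t : ℝ => a + t • z) (𝓝[>] 0) (𝓝 a) := by
      have : Continuous fun t : ℝ => a + t • z := by fun_prop
      simpa using (this.tendsto 0).mono_left nhdsWithin_le_nhds
    obtain ⟨t, ⟨ht, ht'⟩, ht0⟩ := (((h1.eventually hnear).and (eventually_minSet_ray S a z)).and
      self_mem_nhdsWithin).exists
    rw [← ht', ← Set.not_nontrivial_iff, ← mem_tropHypersurface, ht, add_sub_cancel_left]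
    intro hmem
    exact hz ((Submodule.smul_mem_iff _ (ne_of_gt ht0)).1 hmem)
  have hle : L ≤ linSpace S a := by
    intro x hx
    set T : ℝ → Set (Module.Dual ℝ (Fin (n + 1) → ℝ)) :=
      fun s => argminOn (minSet S a) fun u => u (z + s • x) with hT
    have hTne : ∀ s, (T s).Nonempty := fun s =>
      argminOn_nonempty minSet_finite (minSet_nonempty hS a)
    have hTsub : ∀ s, (T s).Subsingleton := fun s => huniq _ fun hmem =>
      hz (by simpa using L.sub_mem hmem (L.smul_mem s hx))
    have hconst : ∀ s, T s = T 0 := by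
      intro s
      refine isPreconnected_univ.eq_of_eventually_eq (φ := T) (fun s _ => ?_) trivial trivial
      have : ∀ᶠ s' in 𝓝 s, T s' ⊆ T s := by
        refine argminOn_eventually_subset minSet_finite fun u _ => ?_
        have : Continuous fun s : ℝ => u (z + s • x) := by
          simp only [map_add, map_smul]; fun_prop
        exact this.tendsto s
      filter_upwards [this] with s' hs' _
      obtain ⟨u, hu⟩ := hTne s'
      exact Set.Subset.antisymm hs' fun u' hu' => hTsub s (hs' hu) hu' ▸ hu
    obtain ⟨u₀, hu₀⟩ := hTne 0
    have hzero : ∀ u ∈ minSet S a, u x = u₀ x := by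
      intro u hu
      have key : ∀ s : ℝ, 0 ≤ (u z - u₀ z) + s * (u x - u₀ x) := by
        intro s
        have : u₀ ∈ T s := hconst s ▸ hu₀
        have := this.2 u hu
        simp only [map_add, map_smul, smul_eq_mul] at this
        linarith
      by_contra hne
      have hne' : u x - u₀ x ≠ 0 := sub_ne_zero.2 hne
      have := key (-(u z - u₀ z + 1) / (u x - u₀ x))
      rw [div_mul_cancel₀ _ hne'] at this
      linarith
    exact mem_linSpace.2 fun u hu u' hu' => (hzero u hu).trans (hzero u' hu').symm
  have h1 := Submodule.finrank_mono hle
  have h2 := finrank_dirSpace_add S a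
  have h3 : Module.finrank ℝ (dirSpace S a) ≠ 0 := by
    rw [Ne, Submodule.finrank_eq_zero]
    exact dirSpace_ne_bot ha
  omega

lemma isClosed_minCone : IsClosed (minCone S a) := by
  have : minCone S a = ⋂ u : minSet S a, ⋂ m : (S : Set (Module.Dual ℝ (Fin (n + 1) → ℝ))),
      {b | u.1 b ≤ m.1 b} := by
    ext b
    simp only [minCone, Set.mem_ofPred_eq, Set.mem_iInter]
    exact ⟨fun h u m => (h u.2).2 m m.2, fun h u hu => ⟨hu.1, fun m hm => h ⟨u, hu⟩ ⟨m, hm⟩⟩⟩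
  rw [this]
  exact isClosed_iInter fun u => isClosed_iInter fun m =>
    isClosed_le (LinearMap.continuous_of_finiteDimensional u.1)
      (LinearMap.continuous_of_finiteDimensional m.1)

lemma mem_minCone_self : a ∈ minCone S a := Set.Subset.rfl

lemma minCone_congr (h : minSet S a = minSet S b) : minCone S a = minCone S b := by
  rw [minCone, h, minCone]

lemma minSet_eq_of_minCone_eq (h : minCone S a = minCone S b) : minSet S a = minSet S b := by
  have h1 : b ∈ minCone S a := h ▸ mem_minCone_self
  have h2 : a ∈ minCone S b := h ▸ mem_minCone_self
  exact Set.Subset.antisymm h1 h2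

lemma convex_setOf_minSet_eq (hS : S.Nonempty) : Convex ℝ {b | minSet S b = minSet S a} := by
  rw [convex_iff_forall_pos]
  intro x hx y hy s t hs ht hst
  have hne : (minSet S x ∩ minSet S y).Nonempty := by
    rw [hx.out, hy.out, Set.inter_self]; exact minSet_nonempty hS a
  have := minSet_segment ht (by linarith) hne
  rw [hx.out, hy.out, Set.inter_self] at this
  have e : s • x + t • y = x + t • (y - x) := by
    rw [show s = 1 - t by linarith]; module
  rw [e]; exact this

lemma closure_setOf_minSet_eq (hS : S.Nonempty) :
    closure {b | minSet S b = minSet S a} = minCone S a := by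
  apply Set.Subset.antisymm
  · refine closure_minimal (fun b hb => ?_) isClosed_minCone
    exact (hb.out ▸ Set.Subset.rfl : minSet S a ⊆ minSet S b)
  · intro b hb
    have hcont : Continuous fun t : ℝ => b + t • (a - b) := by fun_prop
    have h1 : Filter.Tendsto (fun t : ℝ => b + t • (a - b)) (𝓝[>] 0) (𝓝 b) := by
      simpa using (hcont.tendsto 0).mono_left nhdsWithin_le_nhds
    refine mem_closure_of_tendsto h1 ?_
    filter_upwards [Ioo_mem_nhdsGT (show (0 : ℝ) < 1 by norm_num)] with t ht
    have hb' : minSet S b ∩ minSet S a = minSet S a := Set.inter_eq_right.2 hb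
    exact (minSet_segment ht.1 ht.2 (by rw [hb']; exact minSet_nonempty hS a)).trans hb'

lemma connectedComponentIn_regularPoints (hS : S.Nonempty)
    (h : Module.finrank ℝ (dirSpace S a) = 1) :
    connectedComponentIn (regularPoints (tropHypersurface S)) a =
      {b | minSet S b = minSet S a} := by
  have ha := mem_regularPoints_of_finrank_eq_one h
  apply Set.Subset.antisymm
  · intro b hb
    refine isPreconnected_connectedComponentIn.eq_of_eventually_eq (φ := minSet S)
      (fun c hc => ?_) hb (mem_connectedComponentIn ha)
    have hc' := connectedComponentIn_subset _ _ hc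
    filter_upwards [eventually_minSet_of_finrank_eq_one
      (finrank_eq_one_of_mem_regularPoints hS hc')] with d hd hd'
    exact (hd (connectedComponentIn_subset _ _ hd').1).2
  · refine (convex_setOf_minSet_eq hS).isPreconnected.subset_connectedComponentIn rfl ?_
    intro b hb
    exact mem_regularPoints_of_finrank_eq_one (dirSpace_congr hb.out ▸ h)

lemma isMaximalCone_iff (hS : S.Nonempty) {C : Set (Fin (n + 1) → ℝ)} :
    IsMaximalCone (tropHypersurface S) C ↔
      ∃ a, Module.finrank ℝ (dirSpace S a) = 1 ∧ C = minCone S a := by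
  constructor
  · rintro ⟨a, ha, rfl⟩
    have h := finrank_eq_one_of_mem_regularPoints hS ha
    exact ⟨a, h, by rw [connectedComponentIn_regularPoints hS h, closure_setOf_minSet_eq hS]⟩
  · rintro ⟨a, h, rfl⟩
    exact ⟨a, mem_regularPoints_of_finrank_eq_one h, by
      rw [connectedComponentIn_regularPoints hS h, closure_setOf_minSet_eq hS]⟩

end fan

section fan
variable {n : ℕ} {S : Finset (Module.Dual ℝ (Fin (n + 1) → ℝ))} {a b f x : Fin (n + 1) → ℝ}

lemma zero_mem_minCone : (0 : Fin (n + 1) → ℝ) ∈ minCone S a := by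
  change minSet S a ⊆ minSet S 0
  rw [minSet_zero]
  exact argminOn_subset

/-- The intersection of two cones is the cone of some point. -/
lemma exists_inter_eq_minCone (hS : S.Nonempty) (a b : Fin (n + 1) → ℝ) :
    ∃ f, minCone S a ∩ minCone S b = minCone S f := by
  obtain ⟨f, hf, hmin⟩ := (measure fun c => (minSet S c).ncard).wf.has_min
    (minCone S a ∩ minCone S b) ⟨0, zero_mem_minCone, zero_mem_minCone⟩
  refine ⟨f, Set.Subset.antisymm (fun c hc => ?_) fun c hc =>
    ⟨Set.Subset.trans hf.1 hc, Set.Subset.trans hf.2 hc⟩⟩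
  obtain ⟨u, hu⟩ := minSet_nonempty hS a
  have hseg := minSet_segment (S := S) (f := f) (a := c) (t := 1 / 2) (by norm_num) (by norm_num)
    ⟨u, hf.1 hu, hc.1 hu⟩
  have hmem : f + (1 / 2 : ℝ) • (c - f) ∈ minCone S a ∩ minCone S b := by
    constructor
    · change minSet S a ⊆ minSet S _
      rw [hseg]; exact Set.subset_inter hf.1 hc.1
    · change minSet S b ⊆ minSet S _
      rw [hseg]; exact Set.subset_inter hf.2 hc.2
  have hcard := hmin _ hmem
  simp only [WellFoundedRelation.rel, InvImage, hseg] at hcard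
  have := Set.eq_of_subset_of_ncard_le (Set.inter_subset_left (s := minSet S f) (t := minSet S c))
    (not_lt.1 hcard) minSet_finite
  exact Set.inter_eq_left.1 this

lemma minCone_subset_linSpace : minCone S f ⊆ linSpace S f := fun _ hb =>
  mem_linSpace.2 fun _ hu _ hu' => eq_of_mem_argminOn (hb hu) (hb hu')

lemma span_minCone : Submodule.span ℝ (minCone S f) = linSpace S f := by
  apply le_antisymm
  · exact Submodule.span_le.2 minCone_subset_linSpace
  · intro x hx
    have hcont : Continuous fun t : ℝ => f + t • x := by fun_prop
    have h1 : Filter.Tendsto (fun t : ℝ => f + t • x) (𝓝[>] 0) (𝓝 f) := by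
      simpa using (hcont.tendsto 0).mono_left nhdsWithin_le_nhds
    obtain ⟨t, ht, ht0⟩ := ((h1.eventually (eventually_minSet_lin S f)).and
      self_mem_nhdsWithin).exists
    have hmem : f + t • x ∈ minCone S f := by
      change minSet S f ⊆ minSet S _
      rw [ht (by simpa using (linSpace S f).smul_mem t hx)]
    have h2 := (Submodule.span ℝ (minCone S f)).sub_mem (Submodule.subset_span hmem)
      (Submodule.subset_span mem_minCone_self)
    rw [add_sub_cancel_left] at h2
    exact (Submodule.smul_mem_iff _ (ne_of_gt ht0)).1 h2

lemma intrinsicInterior_minCone (hS : S.Nonempty) :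
    intrinsicInterior ℝ (minCone S f) = {b | minSet S b = minSet S f} := by
  have hsub : ∀ y ∈ affineSpan ℝ (minCone S f), y ∈ linSpace S f := by
    intro y hy
    have : affineSpan ℝ (minCone S f) ≤ (linSpace S f).toAffineSubspace :=
      affineSpan_le.2 minCone_subset_linSpace
    exact this hy
  ext b
  rw [mem_intrinsicInterior]
  constructor
  · rintro ⟨⟨y, hy⟩, hint, rfl⟩
    have hf : f ∈ affineSpan ℝ (minCone S f) := subset_affineSpan ℝ _ mem_minCone_self
    let γ : ℝ → affineSpan ℝ (minCone S f) := fun t =>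
      ⟨AffineMap.lineMap y f (-t), AffineMap.lineMap_mem (-t) hy hf⟩
    have hγ : Continuous γ := by
      refine Continuous.subtype_mk ?_ _
      simp only [AffineMap.lineMap_apply_module]
      fun_prop
    have hγ0 : γ 0 = ⟨y, hy⟩ := by
      apply Subtype.ext; simp [γ]
    have h1 : ∀ᶠ t in 𝓝 (0 : ℝ), (γ t).1 ∈ minCone S f := by
      have : interior (Subtype.val ⁻¹' minCone S f : Set (affineSpan ℝ (minCone S f))) ∈ 𝓝 (γ 0) :=
        isOpen_interior.mem_nhds (hγ0 ▸ hint)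
      filter_upwards [hγ.continuousAt.eventually this] with t ht
      exact interior_subset (s := (Subtype.val ⁻¹' minCone S f : Set (affineSpan ℝ (minCone S f)))) ht
    obtain ⟨t, ht, ht0⟩ := ((h1.filter_mono nhdsWithin_le_nhds).and
      (self_mem_nhdsWithin (s := Set.Ioi (0 : ℝ)))).exists
    have ht0' : (0 : ℝ) < t := ht0
    set c : Fin (n + 1) → ℝ := (γ t).1 with hc
    have hct : c = (1 + t) • y - t • f := by
      simp only [hc, γ, AffineMap.lineMap_apply_module]; module
    have hinter : minSet S f ∩ minSet S c = minSet S f := Set.inter_eq_left.2 ht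
    have hseg := minSet_segment (S := S) (f := f) (a := c) (t := 1 / (1 + t)) (by positivity)
      (by rw [div_lt_one (by positivity)]; linarith) (by rw [hinter]; exact minSet_nonempty hS f)
    rw [hinter] at hseg
    have hy' : f + (1 / (1 + t)) • (c - f) = y := by
      have h0 : (1 + t) ≠ 0 := by positivity
      rw [hct, show (1 + t) • y - t • f - f = (1 + t) • (y - f) by module, smul_smul,
        one_div_mul_cancel h0, one_smul]
      abel
    rw [hy'] at hseg
    exact hseg
  · intro hb
    have hbm : b ∈ minCone S f := (hb.out ▸ Set.Subset.rfl : minSet S f ⊆ minSet S b)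
    refine ⟨⟨b, subset_affineSpan ℝ _ hbm⟩, ?_, rfl⟩
    rw [mem_interior_iff_mem_nhds]
    have h1 : ∀ᶠ y in 𝓝 (⟨b, subset_affineSpan ℝ _ hbm⟩ : affineSpan ℝ (minCone S f)),
        y.1 - b ∈ linSpace S b → minSet S y.1 = minSet S b :=
      (continuous_subtype_val.tendsto (⟨b, subset_affineSpan ℝ _ hbm⟩ :
        affineSpan ℝ (minCone S f))).eventually (eventually_minSet_lin S b)
    filter_upwards [h1] with y hy
    change minSet S f ⊆ minSet S y.1
    rw [hy ?_, hb.out]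
    rw [linSpace_congr hb.out]
    exact Submodule.sub_mem _ (hsub y y.2) (minCone_subset_linSpace hbm)

lemma isExposed_minCone (hS : S.Nonempty) (h : f ∈ minCone S a) :
    IsExposed ℝ (minCone S a) (minCone S f) := by
  intro _
  obtain ⟨u₀, hu₀⟩ := minSet_nonempty hS a
  set s : Finset (Module.Dual ℝ (Fin (n + 1) → ℝ)) := minSet_finite.toFinset (s := minSet S f)
    with hs
  have hsf : ∀ u, u ∈ s ↔ u ∈ minSet S f := fun u => by rw [hs, Set.Finite.mem_toFinset]
  set l : Module.Dual ℝ (Fin (n + 1) → ℝ) := ∑ u ∈ s, (u₀ - u) with hl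
  have hlx : ∀ x, l x = ∑ u ∈ s, (u₀ x - u x) := fun x => by
    rw [hl, LinearMap.sum_apply]; rfl
  have hle : ∀ x ∈ minCone S a, ∀ u ∈ s, u₀ x - u x ≤ 0 := fun x hx u hu =>
    sub_nonpos.2 ((hx hu₀).2 u ((hsf u).1 hu).1)
  refine ⟨LinearMap.toContinuousLinearMap l, ?_⟩
  ext x
  simp only [LinearMap.coe_toContinuousLinearMap', Set.mem_ofPred_eq]
  constructor
  · intro hx
    refine ⟨Set.Subset.trans h hx, fun y hy => ?_⟩
    have h0 : l x = 0 := by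
      rw [hlx]
      refine Finset.sum_eq_zero fun u hu => sub_eq_zero.2 ?_
      exact eq_of_mem_argminOn (hx (h hu₀)) (hx ((hsf u).1 hu))
    rw [h0, hlx]
    exact Finset.sum_nonpos (hle y hy)
  · rintro ⟨hx, hmax⟩
    have h0 : 0 ≤ l x := by simpa using hmax 0 zero_mem_minCone
    have h1 : ∑ u ∈ s, (u₀ x - u x) = 0 :=
      le_antisymm (Finset.sum_nonpos (hle x hx)) (hlx x ▸ h0)
    intro u hu
    have := (Finset.sum_eq_zero_iff_of_nonpos (hle x hx)).1 h1 u ((hsf u).2 hu)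
    refine ⟨hu.1, fun m hm => ?_⟩
    change u x ≤ m x
    rw [← sub_eq_zero.1 this]
    exact (hx hu₀).2 m hm

lemma isExposed_minCone_iff (hS : S.Nonempty) :
    IsExposed ℝ (minCone S a) (minCone S f) ↔ f ∈ minCone S a := by
  refine ⟨fun h => ?_, isExposed_minCone hS⟩
  obtain ⟨l, hl⟩ := h ⟨f, mem_minCone_self⟩
  have : f ∈ minCone S f := mem_minCone_self
  rw [hl] at this
  exact this.1

lemma eventually_mem_linSpace_ray (f x : Fin (n + 1) → ℝ) {U : Set (Fin (n + 1) → ℝ)}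
    (hU : U ∈ 𝓝 f) : ∀ᶠ t in 𝓝[>] (0 : ℝ), f + t • x ∈ U := by
  have hcont : Continuous fun t : ℝ => f + t • x := by fun_prop
  have h1 : Filter.Tendsto (fun t : ℝ => f + t • x) (𝓝[>] 0) (𝓝 f) := by
    simpa using (hcont.tendsto 0).mono_left nhdsWithin_le_nhds
  exact h1 hU

/-- If the direction space at `f` is a plane, a functional that vanishes on a line of this plane
and on a further vector of it vanishes on all of it. -/
lemma mem_linSpace_of_plane (hf : Module.finrank ℝ (dirSpace S f) = 2)
    {E : Submodule ℝ (Module.Dual ℝ (Fin (n + 1) → ℝ))} (hE : E ≤ dirSpace S f) (hE0 : E ≠ ⊥)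
    {d : Module.Dual ℝ (Fin (n + 1) → ℝ)} (hd : d ∈ dirSpace S f) (hdE : d ∉ E)
    (hx : ∀ e ∈ E, e x = 0) (hdx : d x = 0) : x ∈ linSpace S f := by
  set P : Submodule ℝ (Module.Dual ℝ (Fin (n + 1) → ℝ)) := E ⊔ Submodule.span ℝ {d} with hP
  have hPle : P ≤ dirSpace S f := sup_le hE (by simpa using hd)
  have hlt : E < P := by
    refine lt_of_le_of_ne le_sup_left fun h => hdE ?_
    rw [h]
    exact Submodule.mem_sup_right (Submodule.mem_span_singleton_self d)
  have h1 : Module.finrank ℝ E ≠ 0 := by rwa [Ne, Submodule.finrank_eq_zero]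
  have h2 := Submodule.finrank_lt_finrank_of_lt hlt
  have hPeq : P = dirSpace S f := Submodule.eq_of_le_of_finrank_le hPle (by omega)
  rw [mem_linSpace_iff_dirSpace, ← hPeq]
  intro e he
  obtain ⟨e₁, h₁, e₂, h₂, rfl⟩ := Submodule.mem_sup.1 he
  obtain ⟨c, rfl⟩ := Submodule.mem_span_singleton.1 h₂
  rw [LinearMap.add_apply, hx e₁ h₁, LinearMap.smul_apply, hdx, smul_zero, add_zero]

/-- Leaving a point with planar direction space along the hypersurface, one gets into the relative
interior of a maximal cone. -/
lemma finrank_eq_one_of_argmin (hf : Module.finrank ℝ (dirSpace S f) = 2)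
    {w : Fin (n + 1) → ℝ} (hw : w ∉ linSpace S f)
    (ha : minSet S a = argminOn (minSet S f) fun u => u w) (haX : a ∈ tropHypersurface S) :
    Module.finrank ℝ (dirSpace S a) = 1 := by
  have hsub : minSet S a ⊆ minSet S f := ha ▸ argminOn_subset
  have hE0 := dirSpace_ne_bot haX
  have hne : Module.finrank ℝ (dirSpace S a) ≠ 0 := by rwa [Ne, Submodule.finrank_eq_zero]
  have hlt : dirSpace S a < dirSpace S f := by
    refine lt_of_le_of_ne (dirSpace_mono hsub) fun h => hw ?_
    rw [mem_linSpace_iff_dirSpace, ← h, ← mem_linSpace_iff_dirSpace, mem_linSpace]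
    intro u hu u' hu'
    rw [ha] at hu hu'
    exact eq_of_mem_argminOn hu hu'
  have := Submodule.finrank_lt_finrank_of_lt hlt
  omega

/-- The maximal cones through a point at which the hypersurface is locally a union of finitely
many half-hyperplanes with a common boundary. -/
theorem exists_cones_through (hS : S.Nonempty) (hf : Module.finrank ℝ (dirSpace S f) = 2)
    {m : ℕ} (w : Fin m → Fin (n + 1) → ℝ)
    (hX : ∀ᶠ g in 𝓝 f, g ∈ tropHypersurface S ↔
      ∃ r, ∃ c : ℝ, 0 ≤ c ∧ g - f - c • w r ∈ linSpace S f)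
    (hw : ∀ r, w r ∉ linSpace S f)
    (hdist : ∀ r r', r ≠ r' → ∀ c : ℝ, 0 ≤ c → w r - c • w r' ∉ linSpace S f) :
    ∃ C : Fin m → Set (Fin (n + 1) → ℝ), Function.Injective C ∧
      (∀ D, IsMaximalCone (tropHypersurface S) D ∧ f ∈ D ↔ ∃ r, D = C r) ∧
      ∀ r, ∀ᶠ t in 𝓝[>] (0 : ℝ),
        Module.finrank ℝ (dirSpace S (f + t • w r)) = 1 ∧ C r = minCone S (f + t • w r) := by
  set T : Fin m → Set (Module.Dual ℝ (Fin (n + 1) → ℝ)) :=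
    fun r => argminOn (minSet S f) fun u => u (w r) with hT
  have hray : ∀ r, ∀ᶠ t in 𝓝[>] (0 : ℝ), minSet S (f + t • w r) = T r ∧
      f + t • w r ∈ tropHypersurface S := by
    intro r
    filter_upwards [eventually_minSet_ray S f (w r), eventually_mem_linSpace_ray f (w r) hX,
      self_mem_nhdsWithin] with t ht htX ht0
    refine ⟨ht, htX.2 ⟨r, t, le_of_lt ht0, ?_⟩⟩
    rw [add_sub_cancel_left, sub_self]; exact Submodule.zero_mem _
  have hpt : ∀ r, ∃ a, minSet S a = T r ∧ a ∈ tropHypersurface S := fun r => by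
    obtain ⟨t, ht⟩ := (hray r).exists
    exact ⟨_, ht⟩
  choose A hA hAX using hpt
  have hAone : ∀ r, Module.finrank ℝ (dirSpace S (A r)) = 1 := fun r =>
    finrank_eq_one_of_argmin hf (hw r) (hA r) (hAX r)
  have hAf : ∀ r, minSet S (A r) ⊆ minSet S f := fun r => by
    rw [hA r]; exact argminOn_subset
  refine ⟨fun r => minCone S (A r), ?_, ?_, ?_⟩
  · intro r r' h
    by_contra hne
    have hTT : minSet S (A r) = minSet S (A r') := minSet_eq_of_minCone_eq h
    obtain ⟨u₀, hu₀⟩ := minSet_nonempty hS (A r)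
    have hmin : ∀ u ∈ minSet S f, u ∉ minSet S (A r) →
        0 < (u - u₀) (w r) ∧ 0 < (u - u₀) (w r') := by
      intro u hu hu'
      have key : ∀ q, minSet S (A r) = minSet S (A q) → 0 < (u - u₀) (w q) := by
        intro q hq
        have h0 : u₀ ∈ T q := by rw [← hA q, ← hq]; exact hu₀
        rw [LinearMap.sub_apply, sub_pos]
        refine lt_of_le_of_ne (h0.2 u hu) fun e => hu' ?_
        rw [hq, hA q]
        exact ⟨hu, fun m hm => e.symm.trans_le (h0.2 m hm)⟩
      exact ⟨key r rfl, key r' hTT⟩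
    have hzero : ∀ q, minSet S (A r) = minSet S (A q) → ∀ e ∈ dirSpace S (A r), e (w q) = 0 := by
      intro q hq
      rw [← mem_linSpace_iff_dirSpace, mem_linSpace]
      intro u hu u' hu'
      rw [hq, hA q] at hu hu'
      exact eq_of_mem_argminOn hu hu'
    obtain ⟨u₁, hu₁, hu₁'⟩ : ∃ u₁ ∈ minSet S f, u₁ ∉ minSet S (A r) := by
      by_contra hcon
      push Not at hcon
      have := dirSpace_mono (S := S) (a := f) (b := A r) hcon
      have := Submodule.finrank_mono this
      rw [hf, hAone] at this
      omega
    obtain ⟨p1, p2⟩ := hmin u₁ hu₁ hu₁'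
    refine hdist r r' hne ((u₁ - u₀) (w r) / (u₁ - u₀) (w r')) (by positivity) ?_
    refine mem_linSpace_of_plane hf (dirSpace_mono (hAf r)) (dirSpace_ne_bot (hAX r))
      (sub_mem_dirSpace hu₁ (hAf r hu₀)) ?_ ?_ ?_
    · intro hmem
      exact p1.ne' (hzero r rfl _ hmem)
    · intro e he
      rw [map_sub, map_smul, hzero r rfl e he, hzero r' hTT e he, smul_zero, sub_zero]
    · rw [map_sub, map_smul, smul_eq_mul, div_mul_cancel₀ _ p2.ne', sub_self]
  · intro D
    constructor
    · rintro ⟨hD, hfD⟩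
      obtain ⟨a, ha, rfl⟩ := (isMaximalCone_iff hS).1 hD
      have haf : minSet S a ⊆ minSet S f := hfD
      have hne : minSet S a ≠ minSet S f := by
        intro h
        rw [dirSpace_congr h] at ha
        omega
      have haX : a ∈ tropHypersurface S := mem_tropHypersurface_of_finrank (by omega)
      have hinter : minSet S f ∩ minSet S a = minSet S a := Set.inter_eq_right.2 haf
      have hIoo : ∀ᶠ t in 𝓝[>] (0 : ℝ), t ∈ Set.Ioo (0 : ℝ) 1 := Ioo_mem_nhdsGT one_pos
      obtain ⟨t, ⟨ht1, htX⟩, ht0, htone⟩ := (((eventually_minSet_ray S f (a - f)).and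
        (eventually_mem_linSpace_ray f (a - f) hX)).and hIoo).exists
      have hseg := minSet_segment ht0 htone (by rw [hinter]; exact minSet_nonempty hS a)
      rw [hinter] at hseg
      have hmem : f + t • (a - f) ∈ tropHypersurface S := by
        rw [mem_tropHypersurface, hseg]; exact haX
      obtain ⟨r, c, hc, hlin⟩ := htX.1 hmem
      rw [add_sub_cancel_left] at hlin
      refine ⟨r, minCone_congr ?_⟩
      rw [hA r, ← hseg, ht1, ← argminOn_smul ht0]
      obtain ⟨u₀, hu₀⟩ := minSet_nonempty hS f
      have hval : ∀ u ∈ minSet S f, t * u (a - f) = c * u (w r) + u₀ (t • (a - f) - c • w r) := by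
        intro u hu
        rw [← mem_linSpace.1 hlin u hu u₀ hu₀]
        simp only [map_sub, map_smul, smul_eq_mul]
        ring
      rcases hc.eq_or_lt with hc0 | hc0
      · exfalso
        refine hne ?_
        rw [← hseg, ht1, ← argminOn_smul ht0]
        refine argminOn_eq_self fun u hu u' hu' => ?_
        rw [hval u hu, hval u' hu', ← hc0]
        simp
      · rw [argminOn_congr_sub hval, argminOn_smul hc0]
    · rintro ⟨r, rfl⟩
      exact ⟨(isMaximalCone_iff hS).2 ⟨_, hAone r, rfl⟩, hAf r⟩
  · intro r
    filter_upwards [hray r] with t ht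
    have := ht.1.trans (hA r).symm
    exact ⟨dirSpace_congr this ▸ hAone r, (minCone_congr this).symm⟩

/-- Two maximal cones through a point with planar direction space intersect in its cone. -/
lemma inter_eq_minCone (hf : Module.finrank ℝ (dirSpace S f) = 2)
    {C₁ C₂ : Set (Fin (n + 1) → ℝ)} (hS : S.Nonempty)
    (h₁ : IsMaximalCone (tropHypersurface S) C₁) (h₂ : IsMaximalCone (tropHypersurface S) C₂)
    (hf₁ : f ∈ C₁) (hf₂ : f ∈ C₂) (hne : C₁ ≠ C₂) : C₁ ∩ C₂ = minCone S f := by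
  obtain ⟨a₁, ha₁, rfl⟩ := (isMaximalCone_iff hS).1 h₁
  obtain ⟨a₂, ha₂, rfl⟩ := (isMaximalCone_iff hS).1 h₂
  have main : ∀ a₁ a₂, Module.finrank ℝ (dirSpace S a₁) = 1 → f ∈ minCone S a₁ →
      f ∈ minCone S a₂ → ¬ minSet S a₂ ⊆ minSet S a₁ →
      minCone S a₁ ∩ minCone S a₂ ⊆ minCone S f := by
    intro a₁ a₂ ha₁ hf₁ hf₂ hsub b hb
    obtain ⟨u₂, hu₂, hu₂'⟩ := Set.not_subset.1 hsub
    obtain ⟨u₁, hu₁⟩ := minSet_nonempty hS a₁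
    have hne0 : dirSpace S a₁ ≠ ⊥ := dirSpace_ne_bot (mem_tropHypersurface_of_finrank (by omega))
    have hlin : b ∈ linSpace S f := by
      by_cases hmem : u₂ - u₁ ∈ dirSpace S a₁
      · exfalso
        refine hu₂' ⟨hu₂.1, fun m hm => ?_⟩
        have hz := mem_linSpace_iff_dirSpace.1 (minCone_subset_linSpace
          (mem_minCone_self (S := S) (a := a₁))) _ hmem
        rw [LinearMap.sub_apply, sub_eq_zero] at hz
        exact hz.trans_le (hu₁.2 m hm)
      · refine mem_linSpace_of_plane hf (dirSpace_mono hf₁) hne0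
          (sub_mem_dirSpace (hf₂ hu₂) (hf₁ hu₁)) hmem
          (mem_linSpace_iff_dirSpace.1 (minCone_subset_linSpace hb.1)) ?_
        rw [LinearMap.sub_apply, sub_eq_zero]
        exact eq_of_mem_argminOn (hb.2 hu₂) (hb.1 hu₁)
    intro u hu
    refine ⟨hu.1, fun m hm => ?_⟩
    change u b ≤ m b
    rw [mem_linSpace.1 hlin u hu u₁ (hf₁ hu₁)]
    exact (hb.1 hu₁).2 m hm
  apply Set.Subset.antisymm
  · by_cases h12 : minSet S a₂ ⊆ minSet S a₁
    · by_cases h21 : minSet S a₁ ⊆ minSet S a₂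
      · exact absurd (minCone_congr (Set.Subset.antisymm h21 h12)) hne
      · rw [Set.inter_comm]
        exact main a₂ a₁ ha₂ hf₂ hf₁ h21
    · exact main a₁ a₂ ha₁ hf₁ hf₂ h12
  · exact fun b hb => ⟨Set.Subset.trans hf₁ hb, Set.Subset.trans hf₂ hb⟩

end fan

/-! ### The local structure of the discriminant -/

section local_structure
variable {p n : ℕ} {w y : Fin (n + 1) → ℝ}

/-- The polynomials with a tropical double root. -/
def singularSet (p n : ℕ) : Set (Fin (n + 1) → ℝ) :=
  {f | ∃ b, shiftRoot b f ∈ singularSpace p n}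

/-- The star of the tropical linear space at `w`. -/
def starAt (p : ℕ) {n : ℕ} (w : Fin (n + 1) → ℝ) : Set (Fin (n + 1) → ℝ) :=
  {y | ∀ t : Fin (n + 1), (argminOn (argminOn {m | ¬ SameClass p m t} w) y).Nontrivial}

lemma eventually_add_mem_singularSpace (p : ℕ) (w : Fin (n + 1) → ℝ) :
    ∀ᶠ y in 𝓝 (0 : Fin (n + 1) → ℝ), w + y ∈ singularSpace p n ↔ y ∈ starAt p w := by
  have key : ∀ t : Fin (n + 1), ∀ᶠ y in 𝓝 (0 : Fin (n + 1) → ℝ),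
      argminOn {m | ¬ SameClass p m t} (w + y) =
        argminOn (argminOn {m | ¬ SameClass p m t} w) y := by
    intro t
    have := argminOn_eventually_eq (A := {m | ¬ SameClass p m t}) (Set.toFinite _)
      (l := 𝓝 (0 : Fin (n + 1) → ℝ)) (φ := fun y => w + y) (w := w) fun i _ => by
        have : Continuous fun y : Fin (n + 1) → ℝ => (w + y) i := by fun_prop
        simpa using this.tendsto 0
    filter_upwards [this] with y hy
    rw [hy]
    exact argminOn_add_argminOn
  filter_upwards [Filter.eventually_all.2 key] with y hy
  exact forall_congr' fun t => by rw [hy t]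

lemma shiftRoot_add_add (b s : ℝ) (f x : Fin (n + 1) → ℝ) :
    shiftRoot (b + s) (f + x) = shiftRoot b f + shiftRoot s x := by
  ext i; simp only [shiftRoot, Pi.add_apply]; ring

lemma finite_roots (p : ℕ) (f : Fin (n + 1) → ℝ) :
    {b | shiftRoot b f ∈ singularSpace p n}.Finite := by
  refine (Set.finite_range fun q : Fin (n + 1) × Fin (n + 1) => slopeRoot f q.1 q.2).subset ?_
  intro b hb
  obtain ⟨i, j, -, h⟩ := exists_eq_slopeRoot hb
  exact ⟨(i, j), h.symm⟩

/-- Near `f` the discriminant is the union of the stars at its double roots. -/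
lemma eventually_mem_singularSet_iff (p : ℕ) (f : Fin (n + 1) → ℝ) :
    ∀ᶠ g in 𝓝 f, g ∈ singularSet p n ↔ ∃ b, shiftRoot b f ∈ singularSpace p n ∧
      ∃ s, shiftRoot s (g - f) ∈ starAt p (shiftRoot b f) := by
  have h1 : ∀ᶠ q in 𝓝 ((0 : ℝ), (0 : Fin (n + 1) → ℝ)),
      ∀ b ∈ {b | shiftRoot b f ∈ singularSpace p n},
        (shiftRoot b f + shiftRoot q.1 q.2 ∈ singularSpace p n ↔
          shiftRoot q.1 q.2 ∈ starAt p (shiftRoot b f)) := by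
    rw [Filter.eventually_all_finite (finite_roots p f)]
    intro b _
    have ht : Filter.Tendsto (fun q : ℝ × (Fin (n + 1) → ℝ) => shiftRoot q.1 q.2) (𝓝 (0, 0))
        (𝓝 0) := by
      have := continuous_shiftRoot.tendsto ((0 : ℝ), (0 : Fin (n + 1) → ℝ))
      have h0 : shiftRoot (0 : ℝ) (0 : Fin (n + 1) → ℝ) = 0 := by ext i; simp [shiftRoot]
      simpa only [h0] using this
    exact ht.eventually (eventually_add_mem_singularSpace p (shiftRoot b f))
  obtain ⟨ε, hε, hball⟩ := Metric.eventually_nhds_iff.1 h1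
  have h2 : ∀ᶠ g in 𝓝 f, ∀ i j, |slopeRoot (g - f) i j| < ε := by
    rw [Filter.eventually_all]; intro i
    rw [Filter.eventually_all]; intro j
    have hc : Continuous fun g : Fin (n + 1) → ℝ => |slopeRoot (g - f) i j| :=
      ((continuous_slopeRoot i j).comp (by fun_prop)).abs
    have h0 : |slopeRoot (f - f) i j| < ε := by simpa [slopeRoot] using hε
    exact hc.continuousAt.eventually_lt continuousAt_const h0
  filter_upwards [h2, eventually_root_near (p := p) f hε, Metric.ball_mem_nhds f hε]
    with g hg1 hg2 hg3
  have hsmall : ∀ s : ℝ, |s| < ε → dist (s, g - f) ((0 : ℝ), (0 : Fin (n + 1) → ℝ)) < ε := by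
    intro s hs
    rw [Prod.dist_eq, max_lt_iff]
    refine ⟨by simpa [Real.dist_eq] using hs, ?_⟩
    rw [dist_zero_right, ← dist_eq_norm]
    exact hg3
  have hsum : ∀ b s, shiftRoot b f + shiftRoot s (g - f) = shiftRoot (b + s) g := by
    intro b s; rw [← shiftRoot_add_add, add_sub_cancel]
  constructor
  · rintro ⟨b', hb'⟩
    obtain ⟨b, hb, hbb⟩ := hg2 b' hb'
    refine ⟨b, hb, b' - b, (hball (hsmall _ hbb) b hb).1 ?_⟩
    rw [hsum, add_sub_cancel]
    exact hb'
  · rintro ⟨b, hb, s, hs⟩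
    obtain ⟨i, hi, j, hj, hij⟩ := hs 0
    have hs' : s = slopeRoot (g - f) i j := (shiftRoot_eq_iff hij).1 (eq_of_mem_argminOn hi hj)
    refine ⟨b + s, ?_⟩
    rw [← hsum]
    exact (hball (hsmall s (hs' ▸ hg1 i j)) b hb).2 hs

lemma argminOn_union_nontrivial {α : Type*} {A B : Set α} {w : α → ℝ}
    (hA : (argminOn A w).Nontrivial) (hB : (argminOn B w).Nontrivial) :
    (argminOn (A ∪ B) w).Nontrivial := by
  obtain ⟨i, hi⟩ := hA.nonempty
  obtain ⟨j, hj⟩ := hB.nonempty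
  rcases le_total (w i) (w j) with h | h
  · refine hA.mono fun k hk => ⟨Or.inl hk.1, ?_⟩
    rintro m (hm | hm)
    · exact hk.2 m hm
    · exact ((hk.2 i hi.1).trans h).trans (hj.2 m hm)
  · refine hB.mono fun k hk => ⟨Or.inr hk.1, ?_⟩
    rintro m (hm | hm)
    · exact ((hk.2 j hj.1).trans h).trans (hi.2 m hm)
    · exact hk.2 m hm

lemma IsTri.argminOn_eq {M : Set (Fin (n + 1))} (h : IsTri p w M) (t : Fin (n + 1)) :
    argminOn {m | ¬ SameClass p m t} w = M ∩ {m | ¬ SameClass p m t} := by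
  obtain ⟨i, hi, j, hj, k, hk, hij, -, -⟩ := h.three
  rw [h.eq] at hi hj ⊢
  by_cases hit : SameClass p i t
  · exact argminOn_not_class_of_mem hj fun hjt => hij (hit.trans' hjt.symm')
  · exact argminOn_not_class_of_mem hi hit

lemma IsTri.mem_starAt {M : Set (Fin (n + 1))} (h : IsTri p w M) :
    y ∈ starAt p w ↔ ∀ t : Fin (n + 1), (argminOn (M ∩ {m | ¬ SameClass p m t}) y).Nontrivial :=
  forall_congr' fun t => by rw [h.argminOn_eq]

section pair
variable {r : Fin (n + 1)} {M N : Set (Fin (n + 1))}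

lemma IsPair.class_of_mem (h : IsPair p w r M N) {i : Fin (n + 1)} (hi : i ∈ M) :
    SameClass p i r := by
  rw [h.eqM] at hi; exact hi.1

lemma IsPair.not_class_of_mem (h : IsPair p w r M N) {i : Fin (n + 1)} (hi : i ∈ N) :
    ¬ SameClass p i r := by
  rw [h.eqN] at hi; exact hi.1

lemma IsPair.disjoint (h : IsPair p w r M N) {i : Fin (n + 1)} (hi : i ∈ M) : i ∉ N :=
  fun hi' => h.not_class_of_mem hi' (h.class_of_mem hi)

lemma IsPair.mem_argminOn_univ (h : IsPair p w r M N) {i : Fin (n + 1)} (hi : i ∈ M) :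
    i ∈ argminOn Set.univ w := by
  refine ⟨trivial, fun m _ => ?_⟩
  obtain ⟨j, hj⟩ := h.nontrivN.nonempty
  have hij := h.le i hi j hj
  rw [h.eqM] at hi
  rw [h.eqN] at hj
  by_cases hm : SameClass p m r
  · exact hi.2 m hm
  · exact hij.trans (hj.2 m hm)

lemma IsPair.argminOn_eq_right (h : IsPair p w r M N) {t : Fin (n + 1)} (ht : SameClass p t r) :
    argminOn {m | ¬ SameClass p m t} w = N := by
  rw [h.eqN]
  congr 1
  ext m
  exact not_congr ⟨fun h' => h'.trans' ht, fun h' => h'.trans' ht.symm'⟩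

/-- The minimum over the complement of another class. -/
lemma IsPair.argminOn_cases (h : IsPair p w r M N) {t : Fin (n + 1)} (ht : ¬ SameClass p t r) :
    (argminOn {m | ¬ SameClass p m t} w = M) ∨
      (t ∉ N ∧ argminOn {m | ¬ SameClass p m t} w = M ∪ N) := by
  obtain ⟨i, hi⟩ := h.nontrivM.nonempty
  have hMt : ∀ m ∈ M, ¬ SameClass p m t := fun m hm h' =>
    ht (h'.symm'.trans' (h.class_of_mem hm))
  have hiu := h.mem_argminOn_univ hi
  rw [argminOn_not_class_of_mem hiu (hMt i hi)]
  have hsub : ∀ m ∈ argminOn Set.univ w, m ∉ M → m ∈ N ∧ w i = w m := by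
    intro m hm hmM
    have hmr : ¬ SameClass p m r := by
      intro hmr
      apply hmM
      rw [h.eqM]
      exact ⟨hmr, fun m' _ => hm.2 m' trivial⟩
    refine ⟨?_, eq_of_mem_argminOn hiu hm⟩
    rw [h.eqN]
    exact ⟨hmr, fun m' _ => hm.2 m' trivial⟩
  by_cases hall : ∀ m ∈ argminOn Set.univ w, ¬ SameClass p m t → m ∈ M
  · left
    ext m
    exact ⟨fun hm => hall m hm.1 hm.2, fun hm => ⟨h.mem_argminOn_univ hm, hMt m hm⟩⟩
  · right
    push Not at hall
    obtain ⟨j, hj, hjt, hjM⟩ := hall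
    obtain ⟨hjN, hij⟩ := hsub j hj hjM
    have hsame := h.single i hi j hjN hij
    refine ⟨fun htN => hjt (hsame t htN), ?_⟩
    ext m
    constructor
    · intro hm
      by_cases hmM : m ∈ M
      · exact Or.inl hmM
      · exact Or.inr (hsub m hm.1 hmM).1
    · rintro (hm | hm)
      · exact ⟨h.mem_argminOn_univ hm, hMt m hm⟩
      · refine ⟨⟨trivial, fun m' _ => ?_⟩, fun hmt => hjt ((hsame m hm).trans' hmt)⟩
        rw [h.eqN] at hm hjN
        rw [eq_of_mem_argminOn hm hjN, ← hij]
        exact hiu.2 m' trivial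

lemma IsPair.argminOn_eq_left (h : IsPair p w r M N) {t : Fin (n + 1)} (ht : t ∈ N) :
    argminOn {m | ¬ SameClass p m t} w = M :=
  (h.argminOn_cases (h.not_class_of_mem ht)).resolve_right fun h' => h'.1 ht

lemma IsPair.mem_starAt (h : IsPair p w r M N) :
    y ∈ starAt p w ↔ (argminOn M y).Nontrivial ∧ (argminOn N y).Nontrivial := by
  constructor
  · intro hy
    obtain ⟨j, hj⟩ := h.nontrivN.nonempty
    have h1 := hy j
    have h2 := hy r
    rw [h.argminOn_eq_left hj] at h1
    rw [h.argminOn_eq_right (SameClass.refl' r)] at h2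
    exact ⟨h1, h2⟩
  · rintro ⟨h1, h2⟩ t
    by_cases ht : SameClass p t r
    · rwa [h.argminOn_eq_right ht]
    · rcases h.argminOn_cases ht with e | ⟨-, e⟩
      · rwa [e]
      · rw [e]; exact argminOn_union_nontrivial h1 h2

end pair

end local_structure

/-! ### Normal vectors of the cells -/

section normals
variable {p n : ℕ} {S : Finset (Module.Dual ℝ (Fin (n + 1) → ℝ))} {f : Fin (n + 1) → ℝ}

/-- The vectors whose associated functionals are in the direction space. -/
noncomputable def dirVec (S : Finset (Module.Dual ℝ (Fin (n + 1) → ℝ))) (f : Fin (n + 1) → ℝ) :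
    Submodule ℝ (Fin (n + 1) → ℝ) :=
  (dirSpace S f).comap (dotProductEquiv ℝ (Fin (n + 1))).toLinearMap

lemma finrank_dirVec : Module.finrank ℝ (dirVec S f) = Module.finrank ℝ (dirSpace S f) :=
  LinearEquiv.finrank_eq ((dotProductEquiv ℝ (Fin (n + 1))).ofSubmodule' (dirSpace S f))

lemma dotProduct_eq_zero_of_mem {y x : Fin (n + 1) → ℝ} (hy : y ∈ dirVec S f)
    (hx : x ∈ linSpace S f) : y ⬝ᵥ x = 0 :=
  mem_linSpace_iff_dirSpace.1 hx _ hy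

lemma mem_dirVec_of_forall {y : Fin (n + 1) → ℝ} (h : ∀ x ∈ linSpace S f, y ⬝ᵥ x = 0) :
    y ∈ dirVec S f := by
  change dotProductEquiv ℝ (Fin (n + 1)) y ∈ dirSpace S f
  rw [← Subspace.dualCoannihilator_dualAnnihilator_eq (W := dirSpace S f),
    Submodule.mem_dualAnnihilator]
  exact h

/-- If a half-open cone spanning the hyperplane `y⊥` is contained in the star of the
hypersurface at `f`, then `y` is in the direction space. -/
lemma mem_dirVec_of_cell (hΔ : tropHypersurface S = singularSet p n) {y z : Fin (n + 1) → ℝ}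
    {b : ℝ} (hb : shiftRoot b f ∈ singularSpace p n)
    (hcell : ∀ h, y ⬝ᵥ h = 0 → ∀ᶠ ε in 𝓝[>] (0 : ℝ), ∃ s,
      shiftRoot s (z + ε • h) ∈ starAt p (shiftRoot b f)) : y ∈ dirVec S f := by
  classical
  set ν := dotProductEquiv ℝ (Fin (n + 1)) y with hν
  set T : Finset (Module.Dual ℝ (Fin (n + 1) → ℝ)) := minSet_finite.toFinset (s := minSet S f)
  set Q : Finset (Module.Dual ℝ (Fin (n + 1) → ℝ)) :=
    ((T ×ˢ T).filter fun q => q.1 ≠ q.2).image fun q => q.1 - q.2 with hQ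
  have hQmem : ∀ q, q ∈ Q ↔ ∃ u ∈ minSet S f, ∃ u' ∈ minSet S f, u ≠ u' ∧ q = u - u' := by
    intro q
    simp only [hQ, T, Finset.mem_image, Finset.mem_filter, Finset.mem_product,
      Set.Finite.mem_toFinset, Prod.exists]
    constructor
    · rintro ⟨u, u', ⟨⟨h1, h2⟩, h3⟩, rfl⟩; exact ⟨u, h1, u', h2, h3, rfl⟩
    · rintro ⟨u, h1, u', h2, h3, rfl⟩; exact ⟨u, u', ⟨⟨h1, h2⟩, h3⟩, rfl⟩
  have hker : ∃ q ∈ Q, LinearMap.ker ν ≤ LinearMap.ker q := by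
    by_contra hcon
    push Not at hcon
    obtain ⟨h, hh, hne⟩ := exists_mem_forall_ne_zero (LinearMap.ker ν) Q fun q hq => by
      obtain ⟨h, hh, hne⟩ := SetLike.not_le_iff_exists.1 (hcon q hq)
      exact ⟨h, hh, hne⟩
    obtain ⟨ε, ⟨s, hs⟩, hε⟩ := ((hcell h hh).and
      (eventually_forall_affine_ne_zero Q (z := z) (h := h) (s := 0)
        fun q hq => Or.inl (hne q hq))).exists
    set x := z + ε • h
    obtain ⟨τ, ⟨hτ1, hτ2⟩, hτ0⟩ := (((eventually_minSet_ray S f x).and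
      (eventually_mem_linSpace_ray f x (eventually_mem_singularSet_iff p f))).and
        self_mem_nhdsWithin).exists
    have hτ0' : (0 : ℝ) < τ := hτ0
    have hmem : f + τ • x ∈ tropHypersurface S := by
      rw [hΔ]
      refine hτ2.2 ⟨b, hb, τ * s, fun t => ?_⟩
      have e : shiftRoot (τ * s) (f + τ • x - f) = fun i => τ * shiftRoot s x i := by
        ext i
        simp only [shiftRoot, add_sub_cancel_left, Pi.smul_apply, smul_eq_mul]
        ring
      rw [e, argminOn_smul hτ0']
      exact hs t
    rw [mem_tropHypersurface, hτ1] at hmem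
    obtain ⟨u, hu, u', hu', hne'⟩ := hmem
    refine hε (u - u') ((hQmem _).2 ⟨u, hu.1, u', hu'.1, hne', rfl⟩) ?_
    rw [LinearMap.sub_apply, sub_eq_zero]
    exact eq_of_mem_argminOn hu hu'
  obtain ⟨q, hq, hle⟩ := hker
  obtain ⟨u, hu, u', hu', hne, rfl⟩ := (hQmem q).1 hq
  have hspan : u - u' ∈ Submodule.span ℝ (Set.range fun _ : Unit => ν) := by
    refine mem_span_of_iInf_ker_le_ker ?_
    simpa using hle
  rw [Set.range_const, Submodule.mem_span_singleton] at hspan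
  obtain ⟨c, hc⟩ := hspan
  have hc0 : c ≠ 0 := by
    rintro rfl
    rw [zero_smul] at hc
    exact hne (sub_eq_zero.1 hc.symm)
  change ν ∈ dirSpace S f
  have := (dirSpace S f).smul_mem c⁻¹ (sub_mem_dirSpace hu hu')
  rwa [← hc, smul_smul, inv_mul_cancel₀ hc0, one_smul] at this

/-- The normal vector of a cell of type I. -/
noncomputable def triVec (i j k : Fin (n + 1)) : Fin (n + 1) → ℝ :=
  ((j : ℕ) - (k : ℕ) : ℝ) • Pi.single i 1 + ((k : ℕ) - (i : ℕ) : ℝ) • Pi.single j 1 +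
    ((i : ℕ) - (j : ℕ) : ℝ) • Pi.single k 1

/-- The normal vector of a cell of type II or III. -/
noncomputable def pairVec (i j k l : Fin (n + 1)) : Fin (n + 1) → ℝ :=
  ((k : ℕ) - (l : ℕ) : ℝ) • (Pi.single i 1 - Pi.single j 1) -
    ((i : ℕ) - (j : ℕ) : ℝ) • (Pi.single k 1 - Pi.single l 1)

lemma triVec_dotProduct (i j k : Fin (n + 1)) (x : Fin (n + 1) → ℝ) :
    triVec i j k ⬝ᵥ x = ((j : ℕ) - (k : ℕ) : ℝ) * x i + ((k : ℕ) - (i : ℕ) : ℝ) * x j +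
      ((i : ℕ) - (j : ℕ) : ℝ) * x k := by
  simp [triVec, add_dotProduct, smul_dotProduct]

lemma pairVec_dotProduct (i j k l : Fin (n + 1)) (x : Fin (n + 1) → ℝ) :
    pairVec i j k l ⬝ᵥ x = ((k : ℕ) - (l : ℕ) : ℝ) * (x i - x j) -
      ((i : ℕ) - (j : ℕ) : ℝ) * (x k - x l) := by
  simp [pairVec, sub_dotProduct, smul_dotProduct]

/-- Three points of the graph of `x` are collinear. -/
lemma triVec_dotProduct_eq_zero_iff {i j k : Fin (n + 1)} (hij : i ≠ j) {x : Fin (n + 1) → ℝ} :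
    triVec i j k ⬝ᵥ x = 0 ↔
      shiftRoot (slopeRoot x i j) x i = shiftRoot (slopeRoot x i j) x k := by
  have h0 := natCast_sub_ne_zero hij
  rw [triVec_dotProduct]
  simp only [shiftRoot, slopeRoot]
  field_simp
  constructor <;> intro h <;> linarith

/-- Two segments of the graph of `x` are parallel. -/
lemma pairVec_dotProduct_eq_zero_iff {i j k l : Fin (n + 1)} (hij : i ≠ j)
    {x : Fin (n + 1) → ℝ} :
    pairVec i j k l ⬝ᵥ x = 0 ↔
      shiftRoot (slopeRoot x i j) x k = shiftRoot (slopeRoot x i j) x l := by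
  have h0 := natCast_sub_ne_zero hij
  rw [pairVec_dotProduct]
  simp only [shiftRoot, slopeRoot]
  field_simp
  constructor <;> intro h <;> linarith

lemma shiftRoot_slopeRoot {i j : Fin (n + 1)} (hij : i ≠ j) (x : Fin (n + 1) → ℝ) :
    shiftRoot (slopeRoot x i j) x i = shiftRoot (slopeRoot x i j) x j :=
  (shiftRoot_eq_iff hij).2 rfl

lemma triVec_mem_dirVec (hΔ : tropHypersurface S = singularSet p n) {b : ℝ}
    (hb : shiftRoot b f ∈ singularSpace p n) {M : Set (Fin (n + 1))}
    (hM : IsTri p (shiftRoot b f) M) {i j k : Fin (n + 1)} (hi : i ∈ M) (hj : j ∈ M) (hk : k ∈ M)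
    (hij : ¬ SameClass p i j) (hik : ¬ SameClass p i k) (hjk : ¬ SameClass p j k) :
    triVec i j k ∈ dirVec S f := by
  classical
  have nij : i ≠ j := fun h => hij (h ▸ SameClass.refl' i)
  have nik : i ≠ k := fun h => hik (h ▸ SameClass.refl' i)
  have njk : j ≠ k := fun h => hjk (h ▸ SameClass.refl' j)
  set z : Fin (n + 1) → ℝ := fun m => if m = i ∨ m = j ∨ m = k then 0 else 1 with hz
  refine mem_dirVec_of_cell (z := z) hΔ hb fun h hh => ?_
  set s := slopeRoot h i j with hs
  have e1 : shiftRoot s h i = shiftRoot s h j := shiftRoot_slopeRoot nij h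
  have e2 : shiftRoot s h i = shiftRoot s h k := (triVec_dotProduct_eq_zero_iff nij).1 hh
  have hev : ∀ᶠ ε in 𝓝[>] (0 : ℝ), ∀ m, ε * shiftRoot s h i < 1 + ε * shiftRoot s h m := by
    refine Filter.Eventually.filter_mono nhdsWithin_le_nhds (Filter.eventually_all.2 fun m => ?_)
    have c1 : Continuous fun ε : ℝ => ε * shiftRoot s h i := by fun_prop
    have c2 : Continuous fun ε : ℝ => 1 + ε * shiftRoot s h m := by fun_prop
    exact c1.continuousAt.eventually_lt c2.continuousAt (by simp)
  filter_upwards [hev] with ε hε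
  refine ⟨ε * s, hM.mem_starAt.2 fun t => ?_⟩
  have hval : ∀ m, shiftRoot (ε * s) (z + ε • h) m = z m + ε * shiftRoot s h m := by
    intro m; simp only [shiftRoot, Pi.add_apply, Pi.smul_apply, smul_eq_mul]; ring
  have hmin : ∀ q, (q = i ∨ q = j ∨ q = k) → ∀ m,
      shiftRoot (ε * s) (z + ε • h) q ≤ shiftRoot (ε * s) (z + ε • h) m := by
    intro q hq m
    have hq' : shiftRoot s h q = shiftRoot s h i := by
      rcases hq with rfl | rfl | rfl
      · rfl
      · exact e1.symm
      · exact e2.symm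
    rw [hval, hval, hq']
    simp only [hz, if_pos hq]
    split_ifs with hm
    · have hm' : shiftRoot s h m = shiftRoot s h i := by
        rcases hm with rfl | rfl | rfl
        · rfl
        · exact e1.symm
        · exact e2.symm
      rw [hm']
    · linarith [hε m]
  by_cases hit : SameClass p i t
  · exact ⟨j, ⟨⟨hj, fun h => hij (hit.trans' h.symm')⟩, fun m _ => hmin j (by simp) m⟩, k,
      ⟨⟨hk, fun h => hik (hit.trans' h.symm')⟩, fun m _ => hmin k (by simp) m⟩, njk⟩
  · by_cases hjt : SameClass p j t
    · exact ⟨i, ⟨⟨hi, hit⟩, fun m _ => hmin i (by simp) m⟩, k,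
        ⟨⟨hk, fun h => hjk (hjt.trans' h.symm')⟩, fun m _ => hmin k (by simp) m⟩, nik⟩
    · exact ⟨i, ⟨⟨hi, hit⟩, fun m _ => hmin i (by simp) m⟩, j,
        ⟨⟨hj, hjt⟩, fun m _ => hmin j (by simp) m⟩, nij⟩

lemma pairVec_mem_dirVec (hΔ : tropHypersurface S = singularSet p n) {b : ℝ}
    (hb : shiftRoot b f ∈ singularSpace p n) {r : Fin (n + 1)} {M N : Set (Fin (n + 1))}
    (hM : IsPair p (shiftRoot b f) r M N) {i j k l : Fin (n + 1)} (hi : i ∈ M) (hj : j ∈ M)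
    (hk : k ∈ N) (hl : l ∈ N) (hij : i ≠ j) (hkl : k ≠ l) : pairVec i j k l ∈ dirVec S f := by
  classical
  have hik : i ≠ k := fun h => hM.disjoint hi (h ▸ hk)
  have hil : i ≠ l := fun h => hM.disjoint hi (h ▸ hl)
  have hjk : j ≠ k := fun h => hM.disjoint hj (h ▸ hk)
  have hjl : j ≠ l := fun h => hM.disjoint hj (h ▸ hl)
  set z : Fin (n + 1) → ℝ := fun m => if m = i ∨ m = j ∨ m = k ∨ m = l then 0 else 1 with hz
  refine mem_dirVec_of_cell (z := z) hΔ hb fun h hh => ?_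
  set s := slopeRoot h i j with hs
  have e1 : shiftRoot s h i = shiftRoot s h j := shiftRoot_slopeRoot hij h
  have e2 : shiftRoot s h k = shiftRoot s h l := (pairVec_dotProduct_eq_zero_iff hij).1 hh
  have hev : ∀ q, ∀ᶠ ε in 𝓝[>] (0 : ℝ), ∀ m,
      ε * shiftRoot s h q < 1 + ε * shiftRoot s h m := by
    intro q
    refine Filter.Eventually.filter_mono nhdsWithin_le_nhds (Filter.eventually_all.2 fun m => ?_)
    have c1 : Continuous fun ε : ℝ => ε * shiftRoot s h q := by fun_prop
    have c2 : Continuous fun ε : ℝ => 1 + ε * shiftRoot s h m := by fun_prop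
    exact c1.continuousAt.eventually_lt c2.continuousAt (by simp)
  filter_upwards [hev i, hev k] with ε hεi hεk
  refine ⟨ε * s, hM.mem_starAt.2 ?_⟩
  have hval : ∀ m, shiftRoot (ε * s) (z + ε • h) m = z m + ε * shiftRoot s h m := by
    intro m; simp only [shiftRoot, Pi.add_apply, Pi.smul_apply, smul_eq_mul]; ring
  have vi : z i = 0 := by simp [hz]
  have vj : z j = 0 := by simp [hz]
  have vk : z k = 0 := by simp [hz]
  have vl : z l = 0 := by simp [hz]
  have vM : ∀ m ∈ M, m ≠ i → m ≠ j → z m = 1 := fun m hm h1 h2 => by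
    have h3 : m ≠ k := fun h => hM.disjoint hm (h ▸ hk)
    have h4 : m ≠ l := fun h => hM.disjoint hm (h ▸ hl)
    simp [hz, h1, h2, h3, h4]
  have vN : ∀ m ∈ N, m ≠ k → m ≠ l → z m = 1 := fun m hm h1 h2 => by
    have h3 : m ≠ i := fun h => hM.disjoint hi (h ▸ hm)
    have h4 : m ≠ j := fun h => hM.disjoint hj (h ▸ hm)
    simp [hz, h1, h2, h3, h4]
  have hminM : ∀ m ∈ M, shiftRoot (ε * s) (z + ε • h) i ≤ shiftRoot (ε * s) (z + ε • h) m := by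
    intro m hm
    rw [hval, hval, vi]
    by_cases h1 : m = i
    · rw [h1, vi]
    by_cases h2 : m = j
    · rw [h2, vj, e1]
    · rw [vM m hm h1 h2, zero_add]; exact (hεi m).le
  have hminN : ∀ m ∈ N, shiftRoot (ε * s) (z + ε • h) k ≤ shiftRoot (ε * s) (z + ε • h) m := by
    intro m hm
    rw [hval, hval, vk]
    by_cases h1 : m = k
    · rw [h1, vk]
    by_cases h2 : m = l
    · rw [h2, vl, e2]
    · rw [vN m hm h1 h2, zero_add]; exact (hεk m).le
  have eij : shiftRoot (ε * s) (z + ε • h) i = shiftRoot (ε * s) (z + ε • h) j := by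
    rw [hval, hval, vi, vj, e1]
  have ekl : shiftRoot (ε * s) (z + ε • h) k = shiftRoot (ε * s) (z + ε • h) l := by
    rw [hval, hval, vk, vl, e2]
  exact ⟨⟨i, ⟨hi, hminM⟩, j, ⟨hj, fun m hm => eij ▸ hminM m hm⟩, hij⟩,
    ⟨k, ⟨hk, hminN⟩, l, ⟨hl, fun m hm => ekl ▸ hminN m hm⟩, hkl⟩⟩

end normals

/-! ### Independence of the cells at different double roots -/

section independence
variable {p n : ℕ} {w y : Fin (n + 1) → ℝ} {M N : Set (Fin (n + 1))}

/-- The initial sets `M` and `N` of a point of the tropical linear space; `N` is empty if three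
classes are minimal. -/
def IsRootType (p : ℕ) {n : ℕ} (w : Fin (n + 1) → ℝ) (M N : Set (Fin (n + 1))) : Prop :=
  (IsTri p w M ∧ N = ∅) ∨ ∃ r, IsPair p w r M N

lemma exists_isRootType (hw : w ∈ singularSpace p n) : ∃ M N, IsRootType p w M N := by
  rcases isTri_or_isPair hw with ⟨M, hM⟩ | ⟨r, M, N, h⟩
  · exact ⟨M, ∅, Or.inl ⟨hM, rfl⟩⟩
  · exact ⟨M, N, Or.inr ⟨r, h⟩⟩

/-- The vectors supported on `M ∪ N` that annihilate the polynomials which are affine with the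
same slope on `M` and on `N`. -/
def rootSpace (M N : Set (Fin (n + 1))) : Submodule ℝ (Fin (n + 1) → ℝ) where
  carrier := {y | (∀ m, m ∉ M → m ∉ N → y m = 0) ∧ ∑ m, M.indicator y m = 0 ∧
    ∑ m, N.indicator y m = 0 ∧ ∑ m : Fin (n + 1), ((m : ℕ) : ℝ) * y m = 0}
  zero_mem' := by simp
  add_mem' := by
    rintro x y ⟨h1, h2, h3, h4⟩ ⟨h1', h2', h3', h4'⟩
    refine ⟨fun m hm hn => ?_, ?_, ?_, ?_⟩
    · rw [Pi.add_apply, h1 m hm hn, h1' m hm hn, add_zero]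
    · simp only [Set.indicator_add', Pi.add_apply, Finset.sum_add_distrib, h2, h2', add_zero]
    · simp only [Set.indicator_add', Pi.add_apply, Finset.sum_add_distrib, h3, h3', add_zero]
    · simp only [Pi.add_apply, mul_add, Finset.sum_add_distrib, h4, h4', add_zero]
  smul_mem' := by
    rintro c x ⟨h1, h2, h3, h4⟩
    have hs : ∀ (A : Set (Fin (n + 1))) m, A.indicator (c • x) m = c * A.indicator x m := by
      intro A m
      by_cases hm : m ∈ A <;> simp [hm]
    refine ⟨fun m hm hn => ?_, ?_, ?_, ?_⟩
    · rw [Pi.smul_apply, h1 m hm hn, smul_zero]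
    · simp only [hs, ← Finset.mul_sum, h2, mul_zero]
    · simp only [hs, ← Finset.mul_sum, h3, mul_zero]
    · simp only [Pi.smul_apply, smul_eq_mul, mul_left_comm _ c, ← Finset.mul_sum, h4, mul_zero]

lemma IsRootType.disjoint (h : IsRootType p w M N) {i : Fin (n + 1)} (hi : i ∈ M) : i ∉ N := by
  rcases h with ⟨-, rfl⟩ | ⟨r, h⟩
  · exact id
  · exact h.disjoint hi

lemma dotProduct_eq_zero_of_mem_rootSpace (hMN : ∀ i ∈ M, i ∉ N) (hy : y ∈ rootSpace M N)
    {x : Fin (n + 1) → ℝ} {s c d : ℝ} (hM : ∀ i ∈ M, shiftRoot s x i = c)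
    (hN : ∀ i ∈ N, shiftRoot s x i = d) : y ⬝ᵥ x = 0 := by
  obtain ⟨h1, h2, h3, h4⟩ := hy
  have : ∀ i, y i * x i = c * M.indicator y i + d * N.indicator y i - s * (((i : ℕ) : ℝ) * y i) := by
    intro i
    by_cases hi : i ∈ M
    · have := hM i hi
      rw [Set.indicator_of_mem hi, Set.indicator_of_notMem (hMN i hi), ← this, shiftRoot]
      ring
    · by_cases hi' : i ∈ N
      · have := hN i hi'
        rw [Set.indicator_of_mem hi', Set.indicator_of_notMem hi, ← this, shiftRoot]
        ring
      · rw [Set.indicator_of_notMem hi, Set.indicator_of_notMem hi', h1 i hi hi']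
        ring
  simp only [dotProduct, this, Finset.sum_sub_distrib, Finset.sum_add_distrib, ← Finset.mul_sum,
    h2, h3, h4, mul_zero, add_zero, sub_zero]

section lin
variable {S : Finset (Module.Dual ℝ (Fin (n + 1) → ℝ))} {f x : Fin (n + 1) → ℝ} {b : ℝ}

lemma exists_shiftRoot_eq_of_mem_linSpace (hΔ : tropHypersurface S = singularSet p n)
    (hb : shiftRoot b f ∈ singularSpace p n) (h : IsRootType p (shiftRoot b f) M N)
    (hx : x ∈ linSpace S f) :
    ∃ s c d, (∀ i ∈ M, shiftRoot s x i = c) ∧ ∀ i ∈ N, shiftRoot s x i = d := by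
  rcases h with ⟨h, rfl⟩ | ⟨r, h⟩
  · obtain ⟨i, hi, j, hj, k, hk, hij, hik, hjk⟩ := h.three
    have nij : i ≠ j := fun h => hij (h ▸ SameClass.refl' i)
    have nik : i ≠ k := fun h => hik (h ▸ SameClass.refl' i)
    have njk : j ≠ k := fun h => hjk (h ▸ SameClass.refl' j)
    have key : ∀ {i j k}, i ∈ M → j ∈ M → k ∈ M → ¬ SameClass p i j → ¬ SameClass p i k →
        ¬ SameClass p j k →
        shiftRoot (slopeRoot x i j) x i = shiftRoot (slopeRoot x i j) x k := by
      intro i j k hi hj hk hij hik hjk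
      have nij : i ≠ j := fun h => hij (h ▸ SameClass.refl' i)
      exact (triVec_dotProduct_eq_zero_iff nij).1
        (dotProduct_eq_zero_of_mem (triVec_mem_dirVec hΔ hb h hi hj hk hij hik hjk) hx)
    set s := slopeRoot x i j with hs
    have eij : shiftRoot s x i = shiftRoot s x j := shiftRoot_slopeRoot nij x
    have eik : shiftRoot s x i = shiftRoot s x k := key hi hj hk hij hik hjk
    have sik : s = slopeRoot x i k := (shiftRoot_eq_iff nik).1 eik
    have sjk : s = slopeRoot x j k := (shiftRoot_eq_iff njk).1 (eij.symm.trans eik)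
    refine ⟨s, shiftRoot s x i, 0, fun m hm => ?_, fun m hm => hm.elim⟩
    by_cases hmi : SameClass p i m
    · have hjm : ¬ SameClass p j m := fun h' => hij (hmi.trans' h'.symm')
      have hkm : ¬ SameClass p k m := fun h' => hik (hmi.trans' h'.symm')
      have := key hj hk hm hjk hjm hkm
      rw [← sjk] at this
      rw [← this, eij]
    · by_cases hmj : SameClass p j m
      · have hkm : ¬ SameClass p k m := fun h' => hjk (hmj.trans' h'.symm')
        have := key hi hk hm hik hmi hkm
        rw [← sik] at this
        rw [← this]
      · exact (key hi hj hm hij hmi hmj).symm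
  · obtain ⟨i, hi, j, hj, nij⟩ := h.nontrivM
    obtain ⟨k, hk, l, hl, nkl⟩ := h.nontrivN
    have key : ∀ {i j k l}, i ∈ M → j ∈ M → k ∈ N → l ∈ N → i ≠ j → k ≠ l →
        slopeRoot x i j = slopeRoot x k l := by
      intro i j k l hi hj hk hl hij hkl
      exact (shiftRoot_eq_iff hkl).1 <| (pairVec_dotProduct_eq_zero_iff hij).1
        (dotProduct_eq_zero_of_mem (pairVec_mem_dirVec hΔ hb h hi hj hk hl hij hkl) hx)
    set s := slopeRoot x i j with hs
    refine ⟨s, shiftRoot s x i, shiftRoot s x k, fun m hm => ?_, fun m hm => ?_⟩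
    · by_cases hmi : i = m
      · rw [hmi]
      · exact ((shiftRoot_eq_iff hmi).2
          ((key hi hj hk hl nij nkl).trans (key hi hm hk hl hmi nkl).symm)).symm
    · by_cases hmk : k = m
      · rw [hmk]
      · exact ((shiftRoot_eq_iff hmk).2 (key hi hj hk hm nij hmk)).symm

lemma rootSpace_le_dirVec (hΔ : tropHypersurface S = singularSet p n)
    (hb : shiftRoot b f ∈ singularSpace p n) (h : IsRootType p (shiftRoot b f) M N) :
    rootSpace M N ≤ dirVec S f := fun _ hy => mem_dirVec_of_forall fun _ hx => by
  obtain ⟨s, c, d, hM, hN⟩ := exists_shiftRoot_eq_of_mem_linSpace hΔ hb h hx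
  exact dotProduct_eq_zero_of_mem_rootSpace (fun i hi => h.disjoint hi) hy hM hN

end lin

/-! ### Dimension of the root spaces -/

lemma finrank_ker_add_ge {V : Type*} [AddCommGroup V] [Module ℝ V] [FiniteDimensional ℝ V] {k : ℕ}
    (L : V →ₗ[ℝ] (Fin k → ℝ)) : Module.finrank ℝ V ≤ Module.finrank ℝ (LinearMap.ker L) + k := by
  have h1 := L.finrank_range_add_finrank_ker
  have h2 := Submodule.finrank_le (LinearMap.range L)
  rw [Module.finrank_fin_fun] at h2
  omega

lemma ncard_le_finrank_rootSpace (hMN : ∀ i ∈ M, i ∉ N) :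
    M.ncard + N.ncard ≤ Module.finrank ℝ (rootSpace M N) + 3 ∧
      (N = ∅ → M.ncard ≤ Module.finrank ℝ (rootSpace M N) + 2) := by
  classical
  have hcard : M.ncard + N.ncard = Fintype.card ↥(M ∪ N) := by
    rw [← Set.ncard_union_eq (Set.disjoint_left.2 hMN), Set.ncard_eq_toFinset_card',
      Set.toFinset_card]
  have hrank : Module.finrank ℝ (↥(M ∪ N) → ℝ) = M.ncard + N.ncard := by
    rw [Module.finrank_fintype_fun_eq_card, hcard]
  set e : (↥(M ∪ N) → ℝ) →ₗ[ℝ] (Fin (n + 1) → ℝ) :=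
    Function.ExtendByZero.linearMap ℝ (Subtype.val : ↥(M ∪ N) → Fin (n + 1)) with he
  have hinj : Function.Injective e := by
    intro x y hxy
    ext i
    have := congrFun hxy i
    simpa [he, Subtype.val_injective.extend_apply] using this
  have hsupp : ∀ x m, m ∉ M → m ∉ N → e x m = 0 := by
    intro x m hm hn
    simp only [he, Function.ExtendByZero.linearMap_apply]
    rw [Function.extend_apply']
    · rfl
    · rintro ⟨⟨a, ha⟩, rfl⟩
      exact ha.elim hm hn
  set σ : Set (Fin (n + 1)) → (Fin (n + 1) → ℝ) →ₗ[ℝ] ℝ := fun A =>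
    dotProductBilin ℝ ℝ (A.indicator 1) with hσ
  have hσ' : ∀ A y, σ A y = ∑ m, A.indicator y m := by
    intro A y
    simp only [hσ, dotProductBilin_apply_apply, dotProduct]
    refine Finset.sum_congr rfl fun m _ => ?_
    by_cases hm : m ∈ A <;> simp [hm]
  set τ : (Fin (n + 1) → ℝ) →ₗ[ℝ] ℝ :=
    dotProductBilin ℝ ℝ (fun m : Fin (n + 1) => ((m : ℕ) : ℝ)) with hτ
  have hτ' : ∀ y, τ y = ∑ m : Fin (n + 1), ((m : ℕ) : ℝ) * y m := fun y => rfl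
  have main : ∀ {k : ℕ} (L : (↥(M ∪ N) → ℝ) →ₗ[ℝ] (Fin k → ℝ)),
      (∀ x, L x = 0 → σ M (e x) = 0 ∧ σ N (e x) = 0 ∧ τ (e x) = 0) →
      M.ncard + N.ncard ≤ Module.finrank ℝ (rootSpace M N) + k := by
    intro k L hL
    have h1 := finrank_ker_add_ge L
    rw [hrank] at h1
    have h2 : (LinearMap.ker L).map e ≤ rootSpace M N := by
      rintro _ ⟨x, hx, rfl⟩
      obtain ⟨h1, h2, h3⟩ := hL x hx
      rw [hσ'] at h1 h2
      exact ⟨hsupp x, h1, h2, (hτ' _).symm.trans h3⟩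
    have h3 := Submodule.finrank_mono h2
    rw [← (Submodule.equivMapOfInjective e hinj _).finrank_eq] at h3
    omega
  refine ⟨main (LinearMap.pi ![σ M ∘ₗ e, σ N ∘ₗ e, τ ∘ₗ e]) fun x hx => ?_, fun hN => ?_⟩
  · exact ⟨congrFun hx 0, congrFun hx 1, congrFun hx 2⟩
  · have := main (LinearMap.pi ![σ M ∘ₗ e, τ ∘ₗ e]) fun x hx =>
      ⟨congrFun hx 0, by
        rw [hσ']
        exact Finset.sum_eq_zero fun m _ => Set.indicator_of_notMem (fun hm => by simp [hN] at hm) _, congrFun hx 1⟩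
    simpa [hN] using this

/-! ### Peeling off the smallest double root -/

/-- The monomial `m` is minimal among those outside some class. -/
def Touched (p : ℕ) {n : ℕ} (w : Fin (n + 1) → ℝ) (m : Fin (n + 1)) : Prop :=
  ∃ t, m ∈ argminOn {m | ¬ SameClass p m t} w

lemma IsRootType.touched (h : IsRootType p w M N) {m : Fin (n + 1)} (hm : m ∈ M ∨ m ∈ N) :
    Touched p w m := by
  rcases h with ⟨h, rfl⟩ | ⟨r, h⟩
  · rw [or_iff_left (Set.notMem_empty m)] at hm
    obtain ⟨i, hi, j, hj, -, -, hij, -, -⟩ := h.three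
    by_cases hmi : SameClass p m i
    · exact ⟨j, by rw [h.argminOn_eq]; exact ⟨hm, fun hmj => hij (hmi.symm'.trans' hmj)⟩⟩
    · exact ⟨i, by rw [h.argminOn_eq]; exact ⟨hm, hmi⟩⟩
  · rcases hm with hm | hm
    · obtain ⟨t, ht⟩ := h.nontrivN.nonempty
      exact ⟨t, by rwa [h.argminOn_eq_left ht]⟩
    · exact ⟨r, by rwa [h.argminOn_eq_right (SameClass.refl' r)]⟩

lemma touched_of_mem_rootSpace (h : IsRootType p w M N) (hy : y ∈ rootSpace M N)
    {m : Fin (n + 1)} (hm : y m ≠ 0) : Touched p w m := by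
  refine h.touched ?_
  by_contra hcon
  push Not at hcon
  exact hm (hy.1 m hcon.1 hcon.2)

section peel
variable {f : Fin (n + 1) → ℝ} {β b : ℝ}

lemma le_of_mem_argminOn_of_lt (hb : β < b) {i j t : Fin (n + 1)}
    (hij : shiftRoot β f i = shiftRoot β f j)
    (hj : j ∈ argminOn {m | ¬ SameClass p m t} (shiftRoot b f)) (hi : ¬ SameClass p i t) :
    j ≤ i := by
  have h := hj.2 i hi
  by_contra hcon
  push Not at hcon
  have hlt : ((i : ℕ) : ℝ) < ((j : ℕ) : ℝ) := by exact_mod_cast hcon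
  simp only [shiftRoot] at h hij
  nlinarith

lemma sameClass_of_touched_of_lt (hb : β < b) {i j : Fin (n + 1)}
    (hij : shiftRoot β f i = shiftRoot β f j) (hlt : i < j) {t : Fin (n + 1)}
    (hj : j ∈ argminOn {m | ¬ SameClass p m t} (shiftRoot b f)) : SameClass p i t := by
  by_contra h
  exact absurd (le_of_mem_argminOn_of_lt hb hij hj h) (not_le.2 hlt)

/-- At most two monomials at the same height matter for larger double roots. -/
lemma not_three_touched {i j k : Fin (n + 1)} (hij : shiftRoot β f i = shiftRoot β f j)
    (hik : shiftRoot β f i = shiftRoot β f k) (h1 : i < j) (h2 : j < k)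
    (hj : ∃ b > β, Touched p (shiftRoot b f) j) (hk : ∃ b > β, Touched p (shiftRoot b f) k) :
    False := by
  obtain ⟨b, hb, t, ht⟩ := hj
  obtain ⟨b', hb', t', ht'⟩ := hk
  have s1 := sameClass_of_touched_of_lt hb hij h1 ht
  have s2 := sameClass_of_touched_of_lt hb' hik (h1.trans h2) ht'
  have s3 := sameClass_of_touched_of_lt hb' (hij.symm.trans hik) h2 ht'
  exact ht.1 (s3.trans' (s2.symm'.trans' s1))

lemma eq_zero_of_two_support {z : Fin (n + 1) → ℝ}
    (h : ∀ i j k, i < j → j < k → z i ≠ 0 → z j ≠ 0 → z k ≠ 0 → False)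
    (h1 : ∑ m, z m = 0) (h2 : ∑ m : Fin (n + 1), ((m : ℕ) : ℝ) * z m = 0) : z = 0 := by
  have h' : ∀ i j k, i ≠ j → i ≠ k → j ≠ k → z i ≠ 0 → z j ≠ 0 → z k = 0 := by
    intro i j k hij hik hjk hi hj
    by_contra hk
    rcases lt_or_gt_of_ne hij with a | a <;> rcases lt_or_gt_of_ne hik with b | b <;>
      rcases lt_or_gt_of_ne hjk with c | c
    · exact h i j k a c hi hj hk
    · exact h i k j b c hi hk hj
    · omega
    · exact h k i j b a hk hi hj
    · exact h j i k a b hj hi hk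
    · omega
    · exact h j k i c b hj hk hi
    · exact h k j i c a hk hj hi
  by_contra hz
  obtain ⟨i, hi⟩ := Function.ne_iff.1 hz
  rw [Pi.zero_apply] at hi
  have : ∃ j, j ≠ i ∧ z j ≠ 0 := by
    by_contra hcon
    push Not at hcon
    rw [Fintype.sum_eq_single i hcon] at h1
    exact hi h1
  obtain ⟨j, hji, hj⟩ := this
  have hrest : ∀ m, m ≠ i ∧ m ≠ j → z m = 0 := fun m hm => h' i j m hji.symm hm.1.symm hm.2.symm hi hj
  rw [Fintype.sum_eq_add i j hji.symm hrest] at h1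
  rw [Fintype.sum_eq_add i j hji.symm fun m hm => by rw [hrest m hm, mul_zero]] at h2
  have e : z j = - z i := by linarith
  rw [e] at h2
  have h3 : (((i : ℕ) : ℝ) - ((j : ℕ) : ℝ)) * z i = 0 := by linarith
  exact hi ((mul_eq_zero.1 h3).resolve_left (natCast_sub_ne_zero hji.symm))

lemma IsPair.shiftRoot_eq_left {r : Fin (n + 1)} (h : IsPair p w r M N) {i j : Fin (n + 1)}
    (hi : i ∈ M) (hj : j ∈ M) : w i = w j := by
  rw [h.eqM] at hi hj; exact eq_of_mem_argminOn hi hj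

lemma IsPair.shiftRoot_eq_right {r : Fin (n + 1)} (h : IsPair p w r M N) {i j : Fin (n + 1)}
    (hi : i ∈ N) (hj : j ∈ N) : w i = w j := by
  rw [h.eqN] at hi hj; exact eq_of_mem_argminOn hi hj

lemma eq_zero_of_touched (hβ : IsRootType p (shiftRoot β f) M N) (hy : y ∈ rootSpace M N)
    (h : ∀ m, y m ≠ 0 → ∃ b > β, Touched p (shiftRoot b f) m) : y = 0 := by
  obtain ⟨h1, h2, h3, h4⟩ := hy
  rcases hβ with ⟨hβ, rfl⟩ | ⟨r, hβ⟩
  · have hM : ∀ m, y m ≠ 0 → m ∈ M := fun m hm => by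
      by_contra hmM
      exact hm (h1 m hmM (Set.notMem_empty m))
    have heq : ∀ i ∈ M, ∀ j ∈ M, shiftRoot β f i = shiftRoot β f j := by
      rw [hβ.eq]; exact fun i hi j hj => eq_of_mem_argminOn hi hj
    refine eq_zero_of_two_support (fun i j k a b hi hj hk => ?_) ?_ h4
    · exact not_three_touched (heq i (hM i hi) j (hM j hj)) (heq i (hM i hi) k (hM k hk)) a b
        (h j hj) (h k hk)
    · rw [← h2]
      refine Finset.sum_congr rfl fun m _ => ?_
      by_cases hm : m ∈ M
      · rw [Set.indicator_of_mem hm]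
      · rw [Set.indicator_of_notMem hm, h1 m hm (Set.notMem_empty m)]
  · have htwo : ∀ i ∈ M, ∀ j ∈ M, i < j → y i ≠ 0 → y j ≠ 0 → False := by
      intro i hi j hj hij _ hj0
      obtain ⟨b, hb, t, ht⟩ := h j hj0
      have := sameClass_of_touched_of_lt hb (hβ.shiftRoot_eq_left hi hj) hij ht
      exact ht.1 ((hβ.class_of_mem hj).trans' ((hβ.class_of_mem hi).symm'.trans' this))
    have hM0 : ∀ i ∈ M, y i = 0 := by
      intro i hi
      by_contra hi0
      rw [Fintype.sum_eq_single i, Set.indicator_of_mem hi] at h2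
      · exact hi0 h2
      · intro j hji
        by_cases hj : j ∈ M
        · rw [Set.indicator_of_mem hj]
          by_contra hj0
          rcases lt_or_gt_of_ne hji with a | a
          · exact htwo j hj i hi a hj0 hi0
          · exact htwo i hi j hj a hi0 hj0
        · exact Set.indicator_of_notMem hj _
    have hN : ∀ m, y m ≠ 0 → m ∈ N := fun m hm => by
      by_contra hmN
      exact hm (h1 m (fun hmM => hm (hM0 m hmM)) hmN)
    refine eq_zero_of_two_support (fun i j k a b hi hj hk => ?_) ?_ h4
    · exact not_three_touched (hβ.shiftRoot_eq_right (hN i hi) (hN j hj))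
        (hβ.shiftRoot_eq_right (hN i hi) (hN k hk)) a b (h j hj) (h k hk)
    · rw [← h3]
      refine Finset.sum_congr rfl fun m _ => ?_
      by_cases hm : m ∈ N
      · rw [Set.indicator_of_mem hm]
      · rw [Set.indicator_of_notMem hm]
        by_contra h0
        exact hm (hN m h0)

end peel

end independence

/-! ### The star of the discriminant at a point -/

section star
variable {p n : ℕ} {S : Finset (Module.Dual ℝ (Fin (n + 1) → ℝ))} {f g x y : Fin (n + 1) → ℝ}

/-- The star of the discriminant at `f`. -/
def starSet (p : ℕ) {n : ℕ} (f : Fin (n + 1) → ℝ) : Set (Fin (n + 1) → ℝ) :=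
  {x | ∃ b, shiftRoot b f ∈ singularSpace p n ∧ ∃ s, shiftRoot s x ∈ starAt p (shiftRoot b f)}

lemma eventually_mem_tropHypersurface_iff (hΔ : tropHypersurface S = singularSet p n) (f) :
    ∀ᶠ g in 𝓝 f, g ∈ tropHypersurface S ↔ g - f ∈ starSet p f := by
  rw [hΔ]
  exact eventually_mem_singularSet_iff p f

lemma smul_mem_starSet {t : ℝ} (ht : 0 < t) (hx : x ∈ starSet p f) : t • x ∈ starSet p f := by
  obtain ⟨b, hb, s, hs⟩ := hx
  refine ⟨b, hb, t * s, fun r => ?_⟩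
  have e : shiftRoot (t * s) (t • x) = fun i => t * shiftRoot s x i := by
    ext i; simp only [shiftRoot, Pi.smul_apply, smul_eq_mul]; ring
  rw [e, argminOn_smul ht]
  exact hs r

lemma smul_mem_starSet_iff {t : ℝ} (ht : 0 < t) : t • x ∈ starSet p f ↔ x ∈ starSet p f := by
  refine ⟨fun h => ?_, smul_mem_starSet ht⟩
  have := smul_mem_starSet (inv_pos.2 ht) h
  rwa [smul_smul, inv_mul_cancel₀ ht.ne', one_smul] at this

lemma mem_starSet_iff (hΔ : tropHypersurface S = singularSet p n) :
    x ∈ starSet p f ↔ (argminOn (minSet S f) fun u => u x).Nontrivial := by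
  obtain ⟨t, ⟨h1, h2⟩, ht⟩ := (((eventually_minSet_ray S f x).and
    (eventually_mem_linSpace_ray f x (eventually_mem_tropHypersurface_iff hΔ f))).and
      self_mem_nhdsWithin).exists
  have ht' : (0 : ℝ) < t := ht
  have h2' : f + t • x ∈ tropHypersurface S ↔ f + t • x - f ∈ starSet p f := h2
  rw [add_sub_cancel_left, smul_mem_starSet_iff ht', mem_tropHypersurface, h1] at h2'
  exact h2'.symm

lemma starSet_congr (hΔ : tropHypersurface S = singularSet p n) (h : minSet S f = minSet S g) :
    starSet p f = starSet p g := by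
  ext x; rw [mem_starSet_iff hΔ, mem_starSet_iff hΔ, h]

/-- A direction along which the complement of the star is invariant is in the linear space. -/
lemma mem_linSpace_of_forall_notMem_starSet (hΔ : tropHypersurface S = singularSet p n)
    (hS : S.Nonempty) (h : ∀ t : ℝ, y + t • x ∉ starSet p f) : x ∈ linSpace S f := by
  set T := minSet S f with hT
  set φ : ℝ → Set (Module.Dual ℝ (Fin (n + 1) → ℝ)) := fun t =>
    argminOn T fun u => u (y + t • x) with hφ
  have hsub : ∀ t, (φ t).Subsingleton := fun t => by
    rw [← Set.not_nontrivial_iff]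
    exact fun h' => h t ((mem_starSet_iff hΔ).2 h')
  have hne : ∀ t, (φ t).Nonempty := fun t => argminOn_nonempty minSet_finite (minSet_nonempty hS f)
  have hconst : ∀ s t, φ s = φ t := by
    intro s t
    refine isPreconnected_univ.eq_of_eventually_eq (φ := φ) (fun s _ => ?_) trivial trivial
    have := argminOn_eventually_subset (A := T) (l := 𝓝 s) minSet_finite
      (φ := fun t u => u (y + t • x)) (w := fun u => u (y + s • x)) fun u _ => by
        have hc : Continuous fun t : ℝ => u y + t * u x := by fun_prop
        simpa using hc.tendsto s
    filter_upwards [this] with t ht _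
    obtain ⟨u, hu⟩ := hne t
    exact Set.Subset.antisymm ht fun u' hu' => by rwa [hsub s hu' (ht hu)]
  obtain ⟨u₀, hu₀⟩ := hne 0
  have key : ∀ u ∈ T, u x = u₀ x := by
    intro u hu
    have hle : ∀ t : ℝ, u₀ y + t * u₀ x ≤ u y + t * u x := by
      intro t
      have h0 : u₀ ∈ φ t := hconst 0 t ▸ hu₀
      simpa using h0.2 u hu
    by_contra hne'
    have h1 := hle ((u y - u₀ y + 1) / (u₀ x - u x))
    have h3 : u₀ x - u x ≠ 0 := sub_ne_zero.2 (Ne.symm hne')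
    have h2 : (u y - u₀ y + 1) / (u₀ x - u x) * (u₀ x - u x) = u y - u₀ y + 1 :=
      div_mul_cancel₀ _ h3
    nlinarith
  exact mem_linSpace.2 fun u hu u' hu' => (key u hu).trans (key u' hu').symm

lemma finrank_dirSpace_eq_two {ν₁ ν₂ u₁ u₂ : Fin (n + 1) → ℝ}
    (hlin : ∀ x, x ∈ linSpace S f ↔ ν₁ ⬝ᵥ x = 0 ∧ ν₂ ⬝ᵥ x = 0) (h11 : ν₁ ⬝ᵥ u₁ = 1)
    (h21 : ν₂ ⬝ᵥ u₁ = 0) (h12 : ν₁ ⬝ᵥ u₂ = 0) (h22 : ν₂ ⬝ᵥ u₂ = 1) :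
    Module.finrank ℝ (dirSpace S f) = 2 := by
  set L : (Fin (n + 1) → ℝ) →ₗ[ℝ] ℝ × ℝ :=
    (dotProductBilin ℝ ℝ ν₁).prod (dotProductBilin ℝ ℝ ν₂) with hL
  have hLx : ∀ x, L x = (ν₁ ⬝ᵥ x, ν₂ ⬝ᵥ x) := fun x => rfl
  have hker : LinearMap.ker L = linSpace S f := by
    ext x
    rw [LinearMap.mem_ker, hLx, hlin, Prod.mk_eq_zero]
  have hsurj : LinearMap.range L = ⊤ := by
    rw [LinearMap.range_eq_top]
    rintro ⟨a, b⟩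
    refine ⟨a • u₁ + b • u₂, ?_⟩
    rw [hLx]
    simp [dotProduct_add, dotProduct_smul, h11, h12, h21, h22]
  have h1 := L.finrank_range_add_finrank_ker
  rw [hker, hsurj, finrank_top, Module.finrank_prod, Module.finrank_self,
    Module.finrank_fin_fun] at h1
  have h2 := finrank_dirSpace_add S f
  omega

/-- The maximal cones through `f` if the star at `f` is the union of `m` half-hyperplanes with a
common boundary of codimension two. -/
theorem exists_cones_of_starSet (hΔ : tropHypersurface S = singularSet p n) (hS : S.Nonempty)
    {ν₁ ν₂ u₁ u₂ : Fin (n + 1) → ℝ} (hν₁ : ν₁ ∈ dirVec S f) (hν₂ : ν₂ ∈ dirVec S f)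
    (h11 : ν₁ ⬝ᵥ u₁ = 1) (h21 : ν₂ ⬝ᵥ u₁ = 0) (h12 : ν₁ ⬝ᵥ u₂ = 0) (h22 : ν₂ ⬝ᵥ u₂ = 1)
    {m : ℕ} (w : Fin m → Fin (n + 1) → ℝ)
    (hstar : ∀ x, x ∈ starSet p f ↔
      ∃ r, ∃ c : ℝ, 0 ≤ c ∧ ν₁ ⬝ᵥ x = c * ν₁ ⬝ᵥ w r ∧ ν₂ ⬝ᵥ x = c * ν₂ ⬝ᵥ w r)
    (hw : ∀ r, ν₁ ⬝ᵥ w r = 0 → ν₂ ⬝ᵥ w r ≠ 0)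
    (hdist : ∀ r r', r ≠ r' → ∀ c : ℝ, 0 ≤ c → ν₁ ⬝ᵥ w r = c * ν₁ ⬝ᵥ w r' →
      ν₂ ⬝ᵥ w r ≠ c * ν₂ ⬝ᵥ w r') (hy : y ∉ starSet p f) :
    Module.finrank ℝ (dirSpace S f) = 2 ∧
    ∃ C : Fin m → Set (Fin (n + 1) → ℝ), Function.Injective C ∧
      (∀ D, IsMaximalCone (tropHypersurface S) D ∧ f ∈ D ↔ ∃ r, D = C r) ∧
      ∀ r, ∀ᶠ t in 𝓝[>] (0 : ℝ),
        Module.finrank ℝ (dirSpace S (f + t • w r)) = 1 ∧ C r = minCone S (f + t • w r) := by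
  have hlin : ∀ x, x ∈ linSpace S f ↔ ν₁ ⬝ᵥ x = 0 ∧ ν₂ ⬝ᵥ x = 0 := by
    refine fun x => ⟨fun hx => ⟨dotProduct_eq_zero_of_mem hν₁ hx, dotProduct_eq_zero_of_mem hν₂ hx⟩,
      fun hx => mem_linSpace_of_forall_notMem_starSet hΔ hS (y := y) fun t ht => hy ?_⟩
    rw [hstar] at ht ⊢
    simpa [dotProduct_add, dotProduct_smul, hx.1, hx.2] using ht
  have hf := finrank_dirSpace_eq_two hlin h11 h21 h12 h22
  refine ⟨hf, exists_cones_through hS hf w ?_ (fun r hr => ?_) fun r r' hrr c hc h => ?_⟩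
  · filter_upwards [eventually_mem_tropHypersurface_iff hΔ f] with g hg
    rw [hg, hstar]
    simp only [hlin, dotProduct_sub, dotProduct_smul, smul_eq_mul, sub_eq_zero]
  · exact hw r ((hlin _).1 hr).1 ((hlin _).1 hr).2
  · have := (hlin _).1 h
    simp only [dotProduct_sub, dotProduct_smul, smul_eq_mul, sub_eq_zero] at this
    exact hdist r r' hrr c hc this.1 this.2

/-- If the star is a hyperplane then the point is regular. -/
lemma finrank_dirSpace_eq_one (hΔ : tropHypersurface S = singularSet p n) (hS : S.Nonempty)
    {ν : Fin (n + 1) → ℝ} (hν : ν ≠ 0) (hstar : ∀ x, x ∈ starSet p f ↔ ν ⬝ᵥ x = 0) :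
    Module.finrank ℝ (dirSpace S f) = 1 := by
  refine finrank_eq_one_of_mem_regularPoints hS ?_
  have hev := eventually_mem_tropHypersurface_iff hΔ f
  refine ⟨hev.self_of_nhds.2 ((hstar _).2 (by simp)), LinearMap.ker (dotProductBilin ℝ ℝ ν), ?_, ?_⟩
  · set L : (Fin (n + 1) → ℝ) →ₗ[ℝ] ℝ := dotProductBilin ℝ ℝ ν
    have h1 := L.finrank_range_add_finrank_ker
    have h2 : L ≠ 0 := fun h => hν (dotProduct_eq_zero ν fun w => LinearMap.congr_fun h w)
    rw [LinearMap.range_eq_top.2 (LinearMap.surjective h2), finrank_top, Module.finrank_self,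
      Module.finrank_fin_fun] at h1
    omega
  · filter_upwards [hev] with g hg
    rw [hg, hstar]
    rfl

end star

/-! ### Simple double roots -/

section simple_roots
variable {p n : ℕ} {w x y : Fin (n + 1) → ℝ} {M N : Set (Fin (n + 1))}

/-- The restrictions of `x` to `M` and to `N` are affine with the same slope. -/
def AffineOn (M N : Set (Fin (n + 1))) (x : Fin (n + 1) → ℝ) : Prop :=
  ∃ s c d, (∀ i ∈ M, shiftRoot s x i = c) ∧ ∀ i ∈ N, shiftRoot s x i = d

lemma mem_rootSpace_of_forall (hMN : ∀ i ∈ M, i ∉ N) (h : ∀ x, AffineOn M N x → y ⬝ᵥ x = 0) :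
    y ∈ rootSpace M N := by
  classical
  have hind : ∀ A : Set (Fin (n + 1)), ∑ m, A.indicator y m = y ⬝ᵥ A.indicator 1 := by
    intro A
    refine Finset.sum_congr rfl fun m _ => ?_
    by_cases hm : m ∈ A <;> simp [hm]
  refine ⟨fun m hm hn => ?_, ?_, ?_, ?_⟩
  · have := h (Pi.single m 1) ⟨0, 0, 0, fun i hi => ?_, fun i hi => ?_⟩
    · simpa using this
    · have : i ≠ m := fun e => hm (e ▸ hi)
      simp [shiftRoot, this]
    · have : i ≠ m := fun e => hn (e ▸ hi)
      simp [shiftRoot, this]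
  · rw [hind]
    refine h _ ⟨0, 1, 0, fun i hi => by simp [shiftRoot, hi], fun i hi => ?_⟩
    have : i ∉ M := fun h => hMN i h hi
    simp [shiftRoot, this]
  · rw [hind]
    refine h _ ⟨0, 0, 1, fun i hi => ?_, fun i hi => by simp [shiftRoot, hi]⟩
    simp [shiftRoot, hMN i hi]
  · have := h (fun m : Fin (n + 1) => ((m : ℕ) : ℝ))
      ⟨-1, 0, 0, fun i _ => by simp [shiftRoot], fun i _ => by simp [shiftRoot]⟩
    rw [← this]
    exact Finset.sum_congr rfl fun m _ => mul_comm _ _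

lemma IsRootType.mem_starAt_of_eq (h : IsRootType p w M N) (hw : w ∈ singularSpace p n)
    (hM : ∀ i ∈ M, ∀ j ∈ M, y i = y j) (hN : ∀ i ∈ N, ∀ j ∈ N, y i = y j) : y ∈ starAt p w := by
  rcases h with ⟨h, -⟩ | ⟨r, h⟩
  · refine h.mem_starAt.2 fun t => ?_
    rw [argminOn_eq_self fun i hi j hj => hM i hi.1 j hj.1, ← h.argminOn_eq]
    exact hw t
  · rw [h.mem_starAt, argminOn_eq_self hM, argminOn_eq_self hN]
    exact ⟨h.nontrivM, h.nontrivN⟩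

lemma IsRootType.mem_starAt_of_affineOn (h : IsRootType p w M N) (hw : w ∈ singularSpace p n)
    (hx : AffineOn M N x) : ∃ s, shiftRoot s x ∈ starAt p w := by
  obtain ⟨s, c, d, hM, hN⟩ := hx
  exact ⟨s, h.mem_starAt_of_eq hw (fun i hi j hj => (hM i hi).trans (hM j hj).symm)
    fun i hi j hj => (hN i hi).trans (hN j hj).symm⟩

lemma argminOn_pair_nontrivial_iff {α : Type*} {i j : α} (hij : i ≠ j) {y : α → ℝ} :
    (argminOn {i, j} y).Nontrivial ↔ y i = y j := by
  constructor
  · rintro ⟨a, ha, b, hb, hab⟩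
    have e := eq_of_mem_argminOn ha hb
    rcases ha.1 with rfl | rfl <;> rcases hb.1 with rfl | rfl
    · exact absurd rfl hab
    · exact e
    · exact e.symm
    · exact absurd rfl hab
  · intro h
    refine ⟨i, ⟨by simp, ?_⟩, j, ⟨by simp, ?_⟩, hij⟩ <;> rintro m (rfl | rfl) <;> simp [h]

lemma argminOn_triple_nontrivial_iff {α : Type*} {i j k : α} (hij : i ≠ j) (hik : i ≠ k)
    (hjk : j ≠ k) {y : α → ℝ} : (argminOn {i, j, k} y).Nontrivial ↔
      (y i = y j ∧ y i ≤ y k) ∨ (y i = y k ∧ y i ≤ y j) ∨ (y j = y k ∧ y j ≤ y i) := by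
  constructor
  · rintro ⟨a, ha, b, hb, hab⟩
    have e := eq_of_mem_argminOn ha hb
    have h1 := ha.2 i (by simp)
    have h2 := ha.2 j (by simp)
    have h3 := ha.2 k (by simp)
    rcases ha.1 with rfl | rfl | rfl <;> rcases hb.1 with rfl | rfl | rfl
    · exact absurd rfl hab
    · exact Or.inl ⟨e, h3⟩
    · exact Or.inr (Or.inl ⟨e, h2⟩)
    · exact Or.inl ⟨e.symm, e ▸ h3⟩
    · exact absurd rfl hab
    · exact Or.inr (Or.inr ⟨e, h1⟩)
    · exact Or.inr (Or.inl ⟨e.symm, e ▸ h2⟩)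
    · exact Or.inr (Or.inr ⟨e.symm, e ▸ h1⟩)
    · exact absurd rfl hab
  · rintro (⟨e, h⟩ | ⟨e, h⟩ | ⟨e, h⟩)
    · refine ⟨i, ⟨by simp, ?_⟩, j, ⟨by simp, ?_⟩, hij⟩ <;> rintro m (rfl | rfl | rfl) <;> linarith
    · refine ⟨i, ⟨by simp, ?_⟩, k, ⟨by simp, ?_⟩, hik⟩ <;> rintro m (rfl | rfl | rfl) <;> linarith
    · refine ⟨j, ⟨by simp, ?_⟩, k, ⟨by simp, ?_⟩, hjk⟩ <;> rintro m (rfl | rfl | rfl) <;> linarith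

lemma SameClass.ne_of_not {i j : Fin (n + 1)} (h : ¬ SameClass p i j) : i ≠ j :=
  fun e => h (e ▸ SameClass.refl' i)

lemma IsTri.two_lt_ncard (h : IsTri p w M) : 2 < M.ncard := by
  obtain ⟨i, hi, j, hj, k, hk, hij, hik, hjk⟩ := h.three
  exact (Set.two_lt_ncard (Set.toFinite M)).2 ⟨i, hi, j, hj, k, hk, SameClass.ne_of_not hij,
    SameClass.ne_of_not hik, SameClass.ne_of_not hjk⟩

lemma one_lt_ncard_of_nontrivial (h : M.Nontrivial) : 1 < M.ncard :=
  Set.one_lt_ncard_iff_nontrivial.2 h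

lemma IsRootType.finrank_pos (h : IsRootType p w M N) :
    0 < Module.finrank ℝ (rootSpace M N) := by
  have h1 := ncard_le_finrank_rootSpace (fun i hi => h.disjoint hi)
  rcases h with ⟨h, hN⟩ | ⟨r, h⟩
  · have := h.two_lt_ncard
    have := h1.2 hN
    omega
  · have := one_lt_ncard_of_nontrivial h.nontrivM
    have := one_lt_ncard_of_nontrivial h.nontrivN
    omega

lemma eq_pair_of_ncard_le (h : M.ncard ≤ 2) {i j : Fin (n + 1)} (hi : i ∈ M) (hj : j ∈ M)
    (hij : i ≠ j) : M = {i, j} := by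
  refine (Set.eq_of_subset_of_ncard_le ?_ ?_ (Set.toFinite M)).symm
  · rintro m (rfl | rfl) <;> assumption
  · rwa [Set.ncard_pair hij]

lemma eq_triple_of_ncard_le (h : M.ncard ≤ 3) {i j k : Fin (n + 1)} (hi : i ∈ M) (hj : j ∈ M)
    (hk : k ∈ M) (hij : i ≠ j) (hik : i ≠ k) (hjk : j ≠ k) : M = {i, j, k} := by
  refine (Set.eq_of_subset_of_ncard_le ?_ ?_ (Set.toFinite M)).symm
  · rintro m (rfl | rfl | rfl) <;> assumption
  · rwa [Set.ncard_eq_three.2 ⟨i, j, k, hij, hik, hjk, rfl⟩]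

lemma exists_mem_notMem_of_ncard_lt {A : Set (Fin (n + 1))} (h : A.ncard < M.ncard) :
    ∃ m ∈ M, m ∉ A := by
  by_contra hcon
  push Not at hcon
  exact absurd (Set.ncard_le_ncard hcon (Set.toFinite A)) (not_le.2 h)

lemma affineOn_triple_iff {i j k : Fin (n + 1)} (hij : i ≠ j) :
    AffineOn {i, j, k} ∅ x ↔ triVec i j k ⬝ᵥ x = 0 := by
  rw [triVec_dotProduct_eq_zero_iff hij]
  constructor
  · rintro ⟨s, c, d, hM, -⟩
    have h1 := (hM i (by simp)).trans (hM j (by simp)).symm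
    rw [← (shiftRoot_eq_iff hij).1 h1]
    exact (hM i (by simp)).trans (hM k (by simp)).symm
  · intro h
    refine ⟨slopeRoot x i j, shiftRoot (slopeRoot x i j) x i, 0, ?_, fun m hm => hm.elim⟩
    rintro m (rfl | rfl | rfl)
    · rfl
    · exact (shiftRoot_slopeRoot hij x).symm
    · exact h.symm

lemma affineOn_pairs_iff {i j k l : Fin (n + 1)} (hij : i ≠ j) :
    AffineOn {i, j} {k, l} x ↔ pairVec i j k l ⬝ᵥ x = 0 := by
  rw [pairVec_dotProduct_eq_zero_iff hij]
  constructor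
  · rintro ⟨s, c, d, hM, hN⟩
    have h1 := (hM i (by simp)).trans (hM j (by simp)).symm
    rw [← (shiftRoot_eq_iff hij).1 h1]
    exact (hN k (by simp)).trans (hN l (by simp)).symm
  · intro h
    refine ⟨slopeRoot x i j, shiftRoot (slopeRoot x i j) x i, shiftRoot (slopeRoot x i j) x k,
      ?_, ?_⟩
    · rintro m (rfl | rfl)
      · rfl
      · exact (shiftRoot_slopeRoot hij x).symm
    · rintro m (rfl | rfl)
      · rfl
      · exact h.symm

/-- The initial sets of a simple double root. -/
def IsSimple (M N : Set (Fin (n + 1))) : Prop :=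
  (M.ncard ≤ 3 ∧ N = ∅) ∨ (M.ncard ≤ 2 ∧ N.ncard ≤ 2)

/-- Near a simple double root the discriminant is a hyperplane. -/
lemma IsRootType.exists_normal (h : IsRootType p w M N) (hw : w ∈ singularSpace p n)
    (h1 : IsSimple M N) : ∃ ν ∈ rootSpace M N, ν ≠ 0 ∧
      (∀ x, ν ⬝ᵥ x = 0 ↔ AffineOn M N x) ∧
      ∀ x, (∃ s, shiftRoot s x ∈ starAt p w) ↔ ν ⬝ᵥ x = 0 := by
  suffices hs : ∃ ν, ν ≠ 0 ∧ (∀ x, ν ⬝ᵥ x = 0 ↔ AffineOn M N x) ∧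
      ∀ y, y ∈ starAt p w → (∀ i ∈ M, ∀ j ∈ M, y i = y j) ∧ ∀ i ∈ N, ∀ j ∈ N, y i = y j by
    obtain ⟨ν, h0, h2, h3⟩ := hs
    refine ⟨ν, mem_rootSpace_of_forall (fun i hi => h.disjoint hi) fun x hx => (h2 x).2 hx, h0, h2,
      fun x => ⟨?_, fun hx => h.mem_starAt_of_affineOn hw ((h2 x).1 hx)⟩⟩
    rintro ⟨s, hs⟩
    obtain ⟨hM, hN⟩ := h3 _ hs
    have : ∀ A : Set (Fin (n + 1)), (∀ i ∈ A, ∀ j ∈ A, shiftRoot s x i = shiftRoot s x j) →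
        ∃ c, ∀ i ∈ A, shiftRoot s x i = c := by
      intro A hA
      rcases A.eq_empty_or_nonempty with rfl | ⟨j, hj⟩
      · exact ⟨0, fun i hi => hi.elim⟩
      · exact ⟨_, fun i hi => hA i hi j hj⟩
    obtain ⟨c, hc⟩ := this M hM
    obtain ⟨d, hd⟩ := this N hN
    exact (h2 x).2 ⟨s, c, d, hc, hd⟩
  rcases h with ⟨h, rfl⟩ | ⟨r, h⟩
  · have hc : M.ncard ≤ 3 := by
      rcases h1 with h1 | h1
      · exact h1.1
      · omega
    obtain ⟨i, hi, j, hj, k, hk, hij, hik, hjk⟩ := h.three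
    have nij := SameClass.ne_of_not hij
    have nik := SameClass.ne_of_not hik
    have njk := SameClass.ne_of_not hjk
    obtain rfl := eq_triple_of_ncard_le hc hi hj hk nij nik njk
    refine ⟨triVec i j k, fun h0 => ?_, fun x => (affineOn_triple_iff nij).symm, fun y hy =>
      ⟨?_, by simp⟩⟩
    · have := congrArg (fun v => v ⬝ᵥ Pi.single i (1 : ℝ)) h0
      simp only [triVec_dotProduct, zero_dotProduct, Pi.single_eq_same,
        Pi.single_eq_of_ne nij.symm, Pi.single_eq_of_ne nik.symm] at this
      exact natCast_sub_ne_zero njk (by linarith)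
    · rw [h.mem_starAt] at hy
      have e1 : ({i, j, k} ∩ {m | ¬ SameClass p m k} : Set (Fin (n + 1))) = {i, j} := by
        ext m
        constructor
        · rintro ⟨rfl | rfl | rfl, hm⟩
          · simp
          · simp
          · exact absurd (SameClass.refl' _) hm
        · rintro (rfl | rfl)
          · exact ⟨by simp, hik⟩
          · exact ⟨by simp, hjk⟩
      have e2 : ({i, j, k} ∩ {m | ¬ SameClass p m i} : Set (Fin (n + 1))) = {j, k} := by
        ext m
        constructor
        · rintro ⟨rfl | rfl | rfl, hm⟩
          · exact absurd (SameClass.refl' _) hm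
          · simp
          · simp
        · rintro (rfl | rfl)
          · exact ⟨by simp, fun h => hij h.symm'⟩
          · exact ⟨by simp, fun h => hik h.symm'⟩
      have h1 := hy k
      have h2 := hy i
      rw [e1, argminOn_pair_nontrivial_iff nij] at h1
      rw [e2, argminOn_pair_nontrivial_iff njk] at h2
      rintro a (rfl | rfl | rfl) b (rfl | rfl | rfl) <;> linarith
  · obtain ⟨i, hi, j, hj, nij⟩ := h.nontrivM
    obtain ⟨k, hk, l, hl, nkl⟩ := h.nontrivN
    have hc : M.ncard ≤ 2 ∧ N.ncard ≤ 2 := by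
      rcases h1 with h1 | h1
      · exact absurd hk (h1.2 ▸ Set.notMem_empty k)
      · exact h1
    have hki : i ≠ k := fun e => h.disjoint hi (e ▸ hk)
    have hli : i ≠ l := fun e => h.disjoint hi (e ▸ hl)
    obtain rfl := eq_pair_of_ncard_le hc.1 hi hj nij
    obtain rfl := eq_pair_of_ncard_le hc.2 hk hl nkl
    refine ⟨pairVec i j k l, fun h0 => ?_, fun x => (affineOn_pairs_iff nij).symm, fun y hy => ?_⟩
    · have := congrArg (fun v => v ⬝ᵥ Pi.single i (1 : ℝ)) h0
      simp only [pairVec_dotProduct, zero_dotProduct, Pi.single_eq_same,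
        Pi.single_eq_of_ne nij.symm, Pi.single_eq_of_ne hki.symm, Pi.single_eq_of_ne hli.symm] at this
      exact natCast_sub_ne_zero nkl (by linarith)
    · rw [h.mem_starAt, argminOn_pair_nontrivial_iff nij, argminOn_pair_nontrivial_iff nkl] at hy
      constructor
      · rintro a (rfl | rfl) b (rfl | rfl) <;> linarith
      · rintro a (rfl | rfl) b (rfl | rfl) <;> linarith

lemma IsRootType.isSimple (h : IsRootType p w M N)
    (h1 : Module.finrank ℝ (rootSpace M N) ≤ 1) : IsSimple M N := by
  have h2 := ncard_le_finrank_rootSpace (fun i hi => h.disjoint hi)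
  rcases h with ⟨h, hN⟩ | ⟨r, h⟩
  · exact Or.inl ⟨by have := h2.2 hN; omega, hN⟩
  · have := one_lt_ncard_of_nontrivial h.nontrivM
    have := one_lt_ncard_of_nontrivial h.nontrivN
    exact Or.inr ⟨by omega, by omega⟩

end simple_roots

/-! ### Points with two double roots -/

section two_roots
variable {p n : ℕ} {S : Finset (Module.Dual ℝ (Fin (n + 1) → ℝ))} {f : Fin (n + 1) → ℝ}
  {b₁ b₂ : ℝ} {M₁ N₁ M₂ N₂ : Set (Fin (n + 1))}

lemma rootSpace_inf_eq_bot (hlt : b₁ < b₂) (h₁ : IsRootType p (shiftRoot b₁ f) M₁ N₁)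
    (h₂ : IsRootType p (shiftRoot b₂ f) M₂ N₂) : rootSpace M₁ N₁ ⊓ rootSpace M₂ N₂ = ⊥ := by
  rw [Submodule.eq_bot_iff]
  rintro y ⟨hy₁, hy₂⟩
  exact eq_zero_of_touched h₁ hy₁ fun m hm => ⟨b₂, hlt, touched_of_mem_rootSpace h₂ hy₂ hm⟩

lemma exists_dual_pair {ν₁ ν₂ : Fin (n + 1) → ℝ} (h₁ : ∀ c : ℝ, ν₁ ≠ c • ν₂) (h₂ : ν₂ ≠ 0) :
    ∃ u, ν₁ ⬝ᵥ u = 1 ∧ ν₂ ⬝ᵥ u = 0 := by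
  have h0 : ν₂ ⬝ᵥ ν₂ ≠ 0 := fun h => h₂ (dotProduct_self_eq_zero.1 h)
  set u := ν₁ - (ν₂ ⬝ᵥ ν₁ / ν₂ ⬝ᵥ ν₂) • ν₂ with hu
  have hu0 : u ≠ 0 := fun h => h₁ _ (sub_eq_zero.1 h)
  have h2u : ν₂ ⬝ᵥ u = 0 := by
    rw [hu, dotProduct_sub, dotProduct_smul, smul_eq_mul, div_mul_cancel₀ _ h0, sub_self]
  have h1u : ν₁ ⬝ᵥ u = u ⬝ᵥ u := by
    conv_rhs => rw [hu, sub_dotProduct, smul_dotProduct, ← hu, h2u, smul_zero, sub_zero]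
  have huu : u ⬝ᵥ u ≠ 0 := fun h => hu0 (dotProduct_self_eq_zero.1 h)
  exact ⟨(u ⬝ᵥ u)⁻¹ • u, by rw [dotProduct_smul, h1u, smul_eq_mul, inv_mul_cancel₀ huu],
    by rw [dotProduct_smul, h2u, smul_zero]⟩

/-- The maximal cones through a point with two simple double roots. -/
theorem exists_cones_of_two_roots (hΔ : tropHypersurface S = singularSet p n) (hS : S.Nonempty)
    (hlt : b₁ < b₂) (hroots : {b | shiftRoot b f ∈ singularSpace p n} = {b₁, b₂})
    (h₁ : IsRootType p (shiftRoot b₁ f) M₁ N₁) (h₂ : IsRootType p (shiftRoot b₂ f) M₂ N₂)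
    (s₁ : IsSimple M₁ N₁) (s₂ : IsSimple M₂ N₂) :
    (∀ x ∈ starSet p f, -x ∈ starSet p f) ∧ Module.finrank ℝ (dirSpace S f) = 2 ∧
    ∃ w : Fin 4 → Fin (n + 1) → ℝ, AffineOn M₁ N₁ (w 0) ∧ AffineOn M₂ N₂ (w 1) ∧
    ∃ C : Fin 4 → Set (Fin (n + 1) → ℝ), Function.Injective C ∧
      (∀ D, IsMaximalCone (tropHypersurface S) D ∧ f ∈ D ↔ ∃ r, D = C r) ∧
      ∀ r, ∀ᶠ t in 𝓝[>] (0 : ℝ),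
        Module.finrank ℝ (dirSpace S (f + t • w r)) = 1 ∧ C r = minCone S (f + t • w r) := by
  have hb₁ : shiftRoot b₁ f ∈ singularSpace p n := by
    have : b₁ ∈ {b | shiftRoot b f ∈ singularSpace p n} := hroots ▸ (by simp)
    exact this
  have hb₂ : shiftRoot b₂ f ∈ singularSpace p n := by
    have : b₂ ∈ {b | shiftRoot b f ∈ singularSpace p n} := hroots ▸ (by simp)
    exact this
  obtain ⟨ν₁, hν₁, n₁, a₁, k₁⟩ := h₁.exists_normal hb₁ s₁
  obtain ⟨ν₂, hν₂, n₂, a₂, k₂⟩ := h₂.exists_normal hb₂ s₂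
  have hinf := rootSpace_inf_eq_bot hlt h₁ h₂
  rw [Submodule.eq_bot_iff] at hinf
  obtain ⟨u₁, h11, h21⟩ := exists_dual_pair (ν₁ := ν₁) (ν₂ := ν₂)
    (fun c hc => n₁ (hinf _ ⟨hν₁, hc ▸ Submodule.smul_mem _ c hν₂⟩)) n₂
  obtain ⟨u₂, h22, h12⟩ := exists_dual_pair (ν₁ := ν₂) (ν₂ := ν₁)
    (fun c hc => n₂ (hinf _ ⟨hc ▸ Submodule.smul_mem _ c hν₁, hν₂⟩)) n₁
  have hstar : ∀ x, x ∈ starSet p f ↔ ν₁ ⬝ᵥ x = 0 ∨ ν₂ ⬝ᵥ x = 0 := by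
    intro x
    constructor
    · rintro ⟨b, hb, hs⟩
      have hb' : b ∈ ({b₁, b₂} : Set ℝ) := hroots ▸ hb
      rcases hb' with rfl | rfl
      · exact Or.inl ((k₁ x).1 hs)
      · exact Or.inr ((k₂ x).1 hs)
    · rintro (h | h)
      · exact ⟨b₁, hb₁, (k₁ x).2 h⟩
      · exact ⟨b₂, hb₂, (k₂ x).2 h⟩
  set w : Fin 4 → Fin (n + 1) → ℝ := ![u₂, u₁, -u₂, -u₁] with hw
  have e₁ : ∀ r, ν₁ ⬝ᵥ w r = ![0, 1, 0, -1] r := by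
    intro r; fin_cases r <;> simp [hw, h11, h12]
  have e₂ : ∀ r, ν₂ ⬝ᵥ w r = ![1, 0, -1, 0] r := by
    intro r; fin_cases r <;> simp [hw, h22, h21]
  have main := exists_cones_of_starSet hΔ hS (y := u₁ + u₂) (rootSpace_le_dirVec hΔ hb₁ h₁ hν₁)
    (rootSpace_le_dirVec hΔ hb₂ h₂ hν₂) h11 h21 h12 h22 w ?_ ?_ ?_ ?_
  · refine ⟨fun x hx => ?_, main.1, w, (a₁ _).1 (e₁ 0), (a₂ _).1 (e₂ 1), main.2⟩
    rw [hstar] at hx ⊢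
    simpa using hx
  · intro x
    rw [hstar]
    simp only [e₁, e₂]
    constructor
    · rintro (h | h)
      · rcases le_total 0 (ν₂ ⬝ᵥ x) with h' | h'
        · exact ⟨0, _, h', by simp [h], by simp⟩
        · exact ⟨2, -(ν₂ ⬝ᵥ x), by linarith, by simp [h], by simp⟩
      · rcases le_total 0 (ν₁ ⬝ᵥ x) with h' | h'
        · exact ⟨1, _, h', by simp, by simp [h]⟩
        · exact ⟨3, -(ν₁ ⬝ᵥ x), by linarith, by simp, by simp [h]⟩
    · rintro ⟨r, c, -, h, h'⟩
      fin_cases r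
      · left; simpa using h
      · right; simpa using h'
      · left; simpa using h
      · right; simpa using h'
  · intro r
    rw [e₁, e₂]
    fin_cases r <;> simp
  · intro r r' hrr c hc
    rw [e₁, e₂, e₁, e₂]
    fin_cases r <;> fin_cases r' <;> first | exact absurd rfl hrr | (simp <;> linarith)
  · rw [hstar]
    simp [dotProduct_add, h11, h12, h21, h22]

end two_roots

/-! ### Points with one double root -/

section one_root
variable {p n : ℕ} {S : Finset (Module.Dual ℝ (Fin (n + 1) → ℝ))} {f : Fin (n + 1) → ℝ}
  {b : ℝ} {M N : Set (Fin (n + 1))}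

lemma mem_starSet_iff_of_root (hroots : {b | shiftRoot b f ∈ singularSpace p n} = {b})
    (x : Fin (n + 1) → ℝ) : x ∈ starSet p f ↔ ∃ s, shiftRoot s x ∈ starAt p (shiftRoot b f) := by
  have hroot : ∀ b', shiftRoot b' f ∈ singularSpace p n ↔ b' = b := fun b' => by
    change b' ∈ {b | shiftRoot b f ∈ singularSpace p n} ↔ _
    rw [hroots, Set.mem_singleton_iff]
  constructor
  · rintro ⟨b', hb', hs⟩
    rwa [(hroot b').1 hb'] at hs
  · intro h
    exact ⟨b, (hroot b).2 rfl, h⟩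

lemma pairVec_dotProduct' {i j : Fin (n + 1)} (hij : i ≠ j) (k l : Fin (n + 1))
    (x : Fin (n + 1) → ℝ) : (-(((i : ℕ) : ℝ) - ((j : ℕ) : ℝ))⁻¹ • pairVec i j k l) ⬝ᵥ x =
      shiftRoot (slopeRoot x i j) x k - shiftRoot (slopeRoot x i j) x l := by
  have h0 := natCast_sub_ne_zero hij
  rw [smul_dotProduct, pairVec_dotProduct, smul_eq_mul]
  simp only [shiftRoot, slopeRoot]
  field_simp
  ring

/-- The maximal cones through a point whose star consists of the polynomials with a minimum
attained twice on three given monomials, once two other monomials are at the same height. -/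
theorem exists_cones_of_three_rays (hΔ : tropHypersurface S = singularSet p n) (hS : S.Nonempty)
    (hroots : {b | shiftRoot b f ∈ singularSpace p n} = {b})
    (h : IsRootType p (shiftRoot b f) M N) {i j k l t : Fin (n + 1)} (hij : i ≠ j) (hkl : k ≠ l)
    (hkt : k ≠ t) (hlt : l ≠ t) (hijMN : (i ∈ M ∧ j ∈ M) ∨ (i ∈ N ∧ j ∈ N))
    (hkltMN : (k ∈ M ∧ l ∈ M ∧ t ∈ M) ∨ (k ∈ N ∧ l ∈ N ∧ t ∈ N))
    (hstar : ∀ x, (∃ s, shiftRoot s x ∈ starAt p (shiftRoot b f)) ↔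
      (argminOn {k, l, t} (shiftRoot (slopeRoot x i j) x)).Nontrivial)
    {w₁ w₂ w₃ : Fin (n + 1) → ℝ} (hw₁ : w₁ i = w₁ j ∧ w₁ k = 1 ∧ w₁ l = 0 ∧ w₁ t = 0)
    (hw₂ : w₂ i = w₂ j ∧ w₂ k = 0 ∧ w₂ l = 1 ∧ w₂ t = 0)
    (hw₃ : w₃ i = w₃ j ∧ w₃ k = 0 ∧ w₃ l = 0 ∧ w₃ t = 1) :
    Module.finrank ℝ (dirSpace S f) = 2 ∧
    ∃ C : Fin 3 → Set (Fin (n + 1) → ℝ), Function.Injective C ∧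
      (∀ D, IsMaximalCone (tropHypersurface S) D ∧ f ∈ D ↔ ∃ r, D = C r) ∧
      ∀ r, ∀ᶠ τ in 𝓝[>] (0 : ℝ), Module.finrank ℝ (dirSpace S (f + τ • ![w₁, w₂, w₃] r)) = 1 ∧
        C r = minCone S (f + τ • ![w₁, w₂, w₃] r) := by
  have hb : shiftRoot b f ∈ singularSpace p n := by
    have : b ∈ {b | shiftRoot b f ∈ singularSpace p n} := hroots ▸ rfl
    exact this
  set ν₁ := -(((i : ℕ) : ℝ) - ((j : ℕ) : ℝ))⁻¹ • pairVec i j k t with hν₁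
  set ν₂ := -(((i : ℕ) : ℝ) - ((j : ℕ) : ℝ))⁻¹ • pairVec i j l t with hν₂
  have hslope : ∀ {x : Fin (n + 1) → ℝ}, x i = x j → slopeRoot x i j = 0 := fun hx => by
    simp [slopeRoot, hx]
  have hshift : ∀ {x : Fin (n + 1) → ℝ}, x i = x j → shiftRoot (slopeRoot x i j) x = x :=
    fun hx => by ext m; simp [hslope hx, shiftRoot]
  have ev₁ : ∀ x, x i = x j → ν₁ ⬝ᵥ x = x k - x t := fun x hx => by
    rw [hν₁, pairVec_dotProduct' hij, hshift hx]
  have ev₂ : ∀ x, x i = x j → ν₂ ⬝ᵥ x = x l - x t := fun x hx => by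
    rw [hν₂, pairVec_dotProduct' hij, hshift hx]
  have hdir : ∀ q ∈ ({k, l, t} : Set (Fin (n + 1))), ∀ q' ∈ ({k, l, t} : Set (Fin (n + 1))),
      -(((i : ℕ) : ℝ) - ((j : ℕ) : ℝ))⁻¹ • pairVec i j q q' ∈ dirVec S f := by
    intro q hq q' hq'
    refine mem_dirVec_of_forall fun x hx => ?_
    obtain ⟨s, c, d, hM, hN⟩ := exists_shiftRoot_eq_of_mem_linSpace hΔ hb h hx
    have hs : s = slopeRoot x i j := by
      rw [← shiftRoot_eq_iff hij]
      rcases hijMN with h' | h'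
      · rw [hM i h'.1, hM j h'.2]
      · rw [hN i h'.1, hN j h'.2]
    rw [pairVec_dotProduct' hij, ← hs, sub_eq_zero]
    rcases hkltMN with ⟨hk, hl, ht⟩ | ⟨hk, hl, ht⟩
    · have : ∀ q ∈ ({k, l, t} : Set (Fin (n + 1))), shiftRoot s x q = c := by
        rintro q (rfl | rfl | rfl) <;> exact hM _ (by assumption)
      rw [this q hq, this q' hq']
    · have : ∀ q ∈ ({k, l, t} : Set (Fin (n + 1))), shiftRoot s x q = d := by
        rintro q (rfl | rfl | rfl) <;> exact hN _ (by assumption)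
      rw [this q hq, this q' hq']
  have hstar' : ∀ x, x ∈ starSet p f ↔
      (ν₁ ⬝ᵥ x = ν₂ ⬝ᵥ x ∧ ν₁ ⬝ᵥ x ≤ 0) ∨ (ν₁ ⬝ᵥ x = 0 ∧ 0 ≤ ν₂ ⬝ᵥ x) ∨
        (ν₂ ⬝ᵥ x = 0 ∧ 0 ≤ ν₁ ⬝ᵥ x) := by
    intro x
    rw [mem_starSet_iff_of_root hroots, hstar, argminOn_triple_nontrivial_iff hkl hkt hlt, hν₁, hν₂,
      pairVec_dotProduct' hij, pairVec_dotProduct' hij]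
    refine or_congr ?_ (or_congr ?_ ?_)
    · constructor <;> rintro ⟨h1, h2⟩ <;> constructor <;> linarith
    · constructor <;> rintro ⟨h1, h2⟩ <;> constructor <;> linarith
    · constructor <;> rintro ⟨h1, h2⟩ <;> constructor <;> linarith
  have e₁ : ∀ r, ν₁ ⬝ᵥ ![w₁, w₂, w₃] r = ![1, 0, -1] r := by
    intro r
    fin_cases r
    · exact (ev₁ _ hw₁.1).trans (by simp [hw₁])
    · exact (ev₁ _ hw₂.1).trans (by simp [hw₂])
    · exact (ev₁ _ hw₃.1).trans (by simp [hw₃])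
  have e₂ : ∀ r, ν₂ ⬝ᵥ ![w₁, w₂, w₃] r = ![0, 1, -1] r := by
    intro r
    fin_cases r
    · exact (ev₂ _ hw₁.1).trans (by simp [hw₁])
    · exact (ev₂ _ hw₂.1).trans (by simp [hw₂])
    · exact (ev₂ _ hw₃.1).trans (by simp [hw₃])
  refine exists_cones_of_starSet hΔ hS (ν₁ := ν₁) (ν₂ := ν₂) (y := -w₁) (hdir k (by simp) t (by simp))
    (hdir l (by simp) t (by simp)) (e₁ 0) (e₂ 0) (e₁ 1) (e₂ 1) ![w₁, w₂, w₃] ?_ ?_ ?_ ?_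
  · intro x
    rw [hstar']
    simp only [e₁, e₂]
    constructor
    · rintro (⟨h1, h2⟩ | ⟨h1, h2⟩ | ⟨h1, h2⟩)
      · exact ⟨2, -(ν₁ ⬝ᵥ x), by linarith, by simp, by simp [h1]⟩
      · exact ⟨1, _, h2, by simp [h1], by simp⟩
      · exact ⟨0, _, h2, by simp, by simp [h1]⟩
    · rintro ⟨r, c, hc, h1, h2⟩
      fin_cases r
      · right; right; simp at h1 h2; exact ⟨h2, h1 ▸ hc⟩
      · right; left; simp at h1 h2; exact ⟨h1, h2 ▸ hc⟩
      · left; simp at h1 h2; exact ⟨h1.trans h2.symm, by linarith⟩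
  · intro r
    rw [e₁, e₂]
    fin_cases r <;> simp
  · intro r r' hrr c hc
    rw [e₁, e₂, e₁, e₂]
    fin_cases r <;> fin_cases r' <;> first | exact absurd rfl hrr | (simp <;> intros <;> linarith)
  · rw [hstar', dotProduct_neg, dotProduct_neg]
    have h1 : ν₁ ⬝ᵥ w₁ = 1 := e₁ 0
    have h2 : ν₂ ⬝ᵥ w₁ = 0 := e₂ 0
    rw [h1, h2]
    norm_num

/-- The star at four minimal monomials of different classes. -/
lemma IsTri.mem_starAt_four {w y : Fin (n + 1) → ℝ} (h : IsTri p w M) {e : Fin 4 → Fin (n + 1)}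
    (he : M = Set.range e) (hcl : ∀ r r', r ≠ r' → ¬ SameClass p (e r) (e r')) :
    y ∈ starAt p w ↔ ∃ r c κ, 0 ≤ c ∧ y (e r) = κ + c ∧ ∀ r', r' ≠ r → y (e r') = κ := by
  subst he
  have hex : ∀ r q q' : Fin 4, ∃ s, s ≠ r ∧ s ≠ q ∧ s ≠ q' := by decide
  rw [h.mem_starAt]
  constructor
  · intro hy
    obtain ⟨r, hr⟩ : ∃ r, ∀ r', y (e r') ≤ y (e r) := Finite.exists_max fun r => y (e r)
    have key : ∀ q q' q'', q ≠ r → q' ≠ r → q'' ≠ r → q ≠ q' → q ≠ q'' → y (e q') = y (e q'') := by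
      intro q q' q'' hqr hqr' hqr'' hqq hqq'
      obtain ⟨_, ⟨⟨⟨s, rfl⟩, hs⟩, hs'⟩, _, ⟨⟨⟨s', rfl⟩, hss⟩, hss'⟩, hne⟩ := hy (e q)
      have h1 : s ≠ q := fun h => hs (h ▸ SameClass.refl' _)
      have h2 : s' ≠ q := fun h => hss (h ▸ SameClass.refl' _)
      have h3 : s ≠ s' := fun h => hne (h ▸ rfl)
      have m1 := hs' _ ⟨⟨q', rfl⟩, hcl _ _ hqq.symm⟩
      have m2 := hs' _ ⟨⟨q'', rfl⟩, hcl _ _ hqq'.symm⟩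
      have m3 := hss' _ ⟨⟨q', rfl⟩, hcl _ _ hqq.symm⟩
      have m4 := hss' _ ⟨⟨q'', rfl⟩, hcl _ _ hqq'.symm⟩
      have M1 := hr q'
      have M2 := hr q''
      by_cases h4 : s = r
      · subst h4; linarith
      by_cases h5 : s' = r
      · subst h5; linarith
      have h6 : (s = q' ∨ s' = q') ∧ (s = q'' ∨ s' = q'') := by omega
      rcases h6 with ⟨rfl | rfl, rfl | rfl⟩ <;> linarith
    obtain ⟨q, hqr, -, -⟩ := hex r r r
    refine ⟨r, y (e r) - y (e q), y (e q), sub_nonneg.2 (hr q), by ring, fun r' hr' => ?_⟩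
    obtain ⟨q', h1, h2, h3⟩ := hex r q r'
    exact key q' r' q h1 hr' hqr h3 h2
  · rintro ⟨r, c, κ, hc, hr, hr'⟩ t
    have hmin : ∀ s, s ≠ r → ∀ m ∈ Set.range e ∩ {m | ¬ SameClass p m t}, y (e s) ≤ y m := by
      rintro s hs _ ⟨⟨s', rfl⟩, -⟩
      rw [hr' s hs]
      by_cases hs' : s' = r
      · rw [hs', hr]; linarith
      · rw [hr' s' hs']
    obtain ⟨q, hq⟩ : ∃ q, ∀ s, s ≠ q → ¬ SameClass p (e s) t := by
      by_cases hq : ∃ q, SameClass p (e q) t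
      · obtain ⟨q, hq⟩ := hq
        exact ⟨q, fun s hs h => hcl s q hs (h.trans' hq.symm')⟩
      · exact ⟨r, fun s _ hs => hq ⟨s, hs⟩⟩
    obtain ⟨s, h1, h2, -⟩ := hex r q r
    obtain ⟨s', h1', h2', h3⟩ := hex r q s
    exact ⟨e s, ⟨⟨⟨s, rfl⟩, hq s h2⟩, hmin s h1⟩, e s', ⟨⟨⟨s', rfl⟩, hq s' h2'⟩, hmin s' h1'⟩,
      fun hh => hcl s s' h3.symm (hh ▸ SameClass.refl' _)⟩

/-- The maximal cones through a point with four minimal monomials of different classes. -/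
theorem exists_cones_of_four_classes (hΔ : tropHypersurface S = singularSet p n) (hS : S.Nonempty)
    (hroots : {b | shiftRoot b f ∈ singularSpace p n} = {b})
    (h : IsTri p (shiftRoot b f) M) {e : Fin 4 → Fin (n + 1)} (he : M = Set.range e)
    (hcl : ∀ r r', r ≠ r' → ¬ SameClass p (e r) (e r')) :
    (∃ x ∈ starSet p f, -x ∉ starSet p f) ∧ Module.finrank ℝ (dirSpace S f) = 2 ∧
    ∃ C : Fin 4 → Set (Fin (n + 1) → ℝ), Function.Injective C ∧
      (∀ D, IsMaximalCone (tropHypersurface S) D ∧ f ∈ D ↔ ∃ r, D = C r) ∧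
      ∀ r, ∀ᶠ t in 𝓝[>] (0 : ℝ),
        Module.finrank ℝ (dirSpace S (f + t • (Pi.single (e r) 1 : Fin (n + 1) → ℝ))) = 1 ∧
          C r = minCone S (f + t • (Pi.single (e r) 1 : Fin (n + 1) → ℝ)) := by
  have hb : shiftRoot b f ∈ singularSpace p n := by
    have : b ∈ {b | shiftRoot b f ∈ singularSpace p n} := hroots ▸ rfl
    exact this
  have hne : ∀ r r', r ≠ r' → e r ≠ e r' := fun r r' hr => SameClass.ne_of_not (hcl r r' hr)
  have hex : ∀ r r' : Fin 4, ∃ s s', s ≠ s' ∧ s ≠ r ∧ s ≠ r' ∧ s' ≠ r ∧ s' ≠ r' := by decide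
  have h01 := hne 0 1 (by decide)
  have hx01 := natCast_sub_ne_zero h01
  set ν₁ := (((e 0 : ℕ) : ℝ) - ((e 1 : ℕ) : ℝ))⁻¹ • triVec (e 0) (e 1) (e 2) with hν₁
  set ν₂ := (((e 0 : ℕ) : ℝ) - ((e 1 : ℕ) : ℝ))⁻¹ • triVec (e 0) (e 1) (e 3) with hν₂
  have hmem : ∀ r, e r ∈ M := fun r => he ▸ ⟨r, rfl⟩
  have hv₁ : ν₁ ∈ dirVec S f := Submodule.smul_mem _ _ (triVec_mem_dirVec hΔ hb h (hmem 0) (hmem 1)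
    (hmem 2) (hcl 0 1 (by decide)) (hcl 0 2 (by decide)) (hcl 1 2 (by decide)))
  have hv₂ : ν₂ ∈ dirVec S f := Submodule.smul_mem _ _ (triVec_mem_dirVec hΔ hb h (hmem 0) (hmem 1)
    (hmem 3) (hcl 0 1 (by decide)) (hcl 0 3 (by decide)) (hcl 1 3 (by decide)))
  have haff : ∀ z, (ν₁ ⬝ᵥ z = 0 ∧ ν₂ ⬝ᵥ z = 0) ↔ ∃ s κ, ∀ r, shiftRoot s z (e r) = κ := by
    intro z
    rw [hν₁, hν₂, smul_dotProduct, smul_dotProduct, smul_eq_zero_iff_right (inv_ne_zero hx01),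
      smul_eq_zero_iff_right (inv_ne_zero hx01), triVec_dotProduct_eq_zero_iff h01,
      triVec_dotProduct_eq_zero_iff h01]
    constructor
    · rintro ⟨h1, h2⟩
      refine ⟨slopeRoot z (e 0) (e 1), shiftRoot (slopeRoot z (e 0) (e 1)) z (e 0), fun r => ?_⟩
      fin_cases r
      · rfl
      · exact (shiftRoot_slopeRoot h01 z).symm
      · exact h1.symm
      · exact h2.symm
    · rintro ⟨s, κ, hs⟩
      rw [← (shiftRoot_eq_iff h01).1 ((hs 0).trans (hs 1).symm), hs, hs, hs]
      exact ⟨rfl, rfl⟩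
  have haff' : ∀ z r c, (ν₁ ⬝ᵥ z = c * ν₁ ⬝ᵥ Pi.single (e r) 1 ∧
      ν₂ ⬝ᵥ z = c * ν₂ ⬝ᵥ Pi.single (e r) 1) ↔
      ∃ s κ, shiftRoot s z (e r) = κ + c ∧ ∀ r', r' ≠ r → shiftRoot s z (e r') = κ := by
    intro z r c
    have h1 := haff (z - c • Pi.single (e r) 1)
    simp only [dotProduct_sub, dotProduct_smul, smul_eq_mul, sub_eq_zero] at h1
    rw [h1]
    have hval : ∀ s r', shiftRoot s (z - c • Pi.single (e r) 1) (e r') =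
        shiftRoot s z (e r') - if r' = r then c else 0 := by
      intro s r'
      split_ifs with hr
      · subst hr; simp [shiftRoot]; ring
      · simp [shiftRoot, hne r' r hr]
    refine exists_congr fun s => exists_congr fun κ => ?_
    simp only [hval]
    constructor
    · intro hs
      refine ⟨by have := hs r; rw [if_pos rfl] at this; linarith, fun r' hr' => ?_⟩
      have := hs r'
      rwa [if_neg hr', sub_zero] at this
    · rintro ⟨h2, h3⟩ r'
      split_ifs with hr
      · rw [hr, h2]; ring
      · rw [h3 r' hr, sub_zero]
  have hstar : ∀ x, x ∈ starSet p f ↔ ∃ r, ∃ c : ℝ, 0 ≤ c ∧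
      ν₁ ⬝ᵥ x = c * ν₁ ⬝ᵥ Pi.single (e r) 1 ∧ ν₂ ⬝ᵥ x = c * ν₂ ⬝ᵥ Pi.single (e r) 1 := by
    intro x
    simp only [haff', mem_starSet_iff_of_root hroots, h.mem_starAt_four he hcl]
    constructor
    · rintro ⟨s, r, c, κ, hc, h1, h2⟩
      exact ⟨r, c, hc, s, κ, h1, h2⟩
    · rintro ⟨r, c, hc, s, κ, h1, h2⟩
      exact ⟨s, r, c, κ, hc, h1, h2⟩
  have hkey : ∀ r r' (a c : ℝ), a ≠ 0 → r ≠ r' ∨ a ≠ c →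
      ν₁ ⬝ᵥ (a • Pi.single (e r) 1) = c * ν₁ ⬝ᵥ Pi.single (e r') 1 →
      ν₂ ⬝ᵥ (a • Pi.single (e r) 1) = c * ν₂ ⬝ᵥ Pi.single (e r') 1 → False := by
    intro r r' a c ha hac h1 h2
    obtain ⟨s, κ, h3, h4⟩ := (haff' _ _ _).1 ⟨h1, h2⟩
    obtain ⟨q, q', hqq, h5, h6, h7, h8⟩ := hex r r'
    have e1 := h4 q h6
    have e2 := h4 q' h8
    simp only [shiftRoot, Pi.smul_apply, smul_eq_mul, Pi.single_eq_of_ne (hne q r h5),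
      Pi.single_eq_of_ne (hne q' r h7), mul_zero, zero_add] at e1 e2
    have hs : s = 0 := by
      have : (((e q : ℕ) : ℝ) - ((e q' : ℕ) : ℝ)) * s = 0 := by linarith
      exact (mul_eq_zero.1 this).resolve_left (natCast_sub_ne_zero (hne q q' hqq))
    have hκ : κ = 0 := by rw [← e1, hs, mul_zero]
    by_cases hr : r = r'
    · subst hr
      simp [shiftRoot, hs, hκ] at h3
      exact hac.elim (fun h => h rfl) fun h => h h3
    · have := h4 r hr
      simp [shiftRoot, hs, hκ] at this
      exact ha this
  have hy : -(Pi.single (e 0) 1) ∉ starSet p f := by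
    rw [hstar]
    rintro ⟨r, c, hc, h1, h2⟩
    rw [← neg_one_smul ℝ] at h1 h2
    exact hkey 0 r (-1) c (by norm_num) (Or.inr (by linarith)) h1 h2
  refine ⟨⟨_, (hstar _).2 ⟨0, 1, zero_le_one, (one_mul _).symm, (one_mul _).symm⟩, hy⟩,
    exists_cones_of_starSet hΔ hS (u₁ := Pi.single (e 2) 1) (u₂ := Pi.single (e 3) 1) hv₁ hv₂
      ?_ ?_ ?_ ?_ (fun r => Pi.single (e r) 1) hstar (fun r h1 h2 => ?_)
      (fun r r' hrr c _ h1 h2 => ?_) hy⟩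
  · rw [hν₁, smul_dotProduct, triVec_dotProduct]
    simp [hne 0 2 (by decide), hne 1 2 (by decide), hx01]
  · rw [hν₂, smul_dotProduct, triVec_dotProduct]
    simp [hne 0 2 (by decide), hne 1 2 (by decide), hne 3 2 (by decide)]
  · rw [hν₁, smul_dotProduct, triVec_dotProduct]
    simp [hne 0 3 (by decide), hne 1 3 (by decide), hne 2 3 (by decide)]
  · rw [hν₂, smul_dotProduct, triVec_dotProduct]
    simp [hne 0 3 (by decide), hne 1 3 (by decide), hx01]
  · exact hkey r r 1 0 one_ne_zero (Or.inr one_ne_zero) (by rw [one_smul, h1, zero_mul])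
      (by rw [one_smul, h2, zero_mul])
  · exact hkey r r' 1 c one_ne_zero (Or.inl hrr) (by rw [one_smul, h1]) (by rw [one_smul, h2])

end one_root

/-! ### Classification of the points with planar direction space -/

section configurations
variable {p n : ℕ} {S : Finset (Module.Dual ℝ (Fin (n + 1) → ℝ))} {f w : Fin (n + 1) → ℝ}
  {b : ℝ} {M N : Set (Fin (n + 1))}

lemma exists_shiftRoot_iff {i j : Fin (n + 1)} (hij : i ≠ j) {P : (Fin (n + 1) → ℝ) → Prop}
    {A : Set (Fin (n + 1) → ℝ)} (h : ∀ y, y ∈ A ↔ y i = y j ∧ P y) (x : Fin (n + 1) → ℝ) :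
    (∃ s, shiftRoot s x ∈ A) ↔ P (shiftRoot (slopeRoot x i j) x) := by
  simp only [h]
  constructor
  · rintro ⟨s, h1, h2⟩
    rwa [(shiftRoot_eq_iff hij).1 h1] at h2
  · exact fun h => ⟨_, shiftRoot_slopeRoot hij x, h⟩

lemma IsTri.mem_starAt_pair {y : Fin (n + 1) → ℝ} {i j k l : Fin (n + 1)}
    (h : IsTri p w {i, j, k, l}) (nij : i ≠ j) (hij : SameClass p i j) (hik : ¬ SameClass p i k)
    (hil : ¬ SameClass p i l) (hkl : ¬ SameClass p k l) :
    y ∈ starAt p w ↔ y k = y l ∧ (argminOn {i, j, k} y).Nontrivial := by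
  have hjk : ¬ SameClass p j k := fun h => hik (hij.trans' h)
  have hjl : ¬ SameClass p j l := fun h => hil (hij.trans' h)
  have nik := SameClass.ne_of_not hik
  have njk := SameClass.ne_of_not hjk
  have nil := SameClass.ne_of_not hil
  have njl := SameClass.ne_of_not hjl
  have nkl := SameClass.ne_of_not hkl
  have ei : ∀ t, SameClass p i t →
      ({i, j, k, l} ∩ {m | ¬ SameClass p m t} : Set (Fin (n + 1))) = {k, l} := by
    intro t ht
    ext m
    constructor
    · rintro ⟨rfl | rfl | rfl | rfl, hm⟩
      · exact absurd ht hm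
      · exact absurd (hij.symm'.trans' ht) hm
      · simp
      · simp
    · rintro (rfl | rfl)
      · exact ⟨by simp, fun h => hik (ht.trans' h.symm')⟩
      · exact ⟨by simp, fun h => hil (ht.trans' h.symm')⟩
  have el : ∀ t, SameClass p l t →
      ({i, j, k, l} ∩ {m | ¬ SameClass p m t} : Set (Fin (n + 1))) = {i, j, k} := by
    intro t ht
    ext m
    constructor
    · rintro ⟨rfl | rfl | rfl | rfl, hm⟩
      · simp
      · simp
      · simp
      · exact absurd ht hm
    · rintro (rfl | rfl | rfl)
      · exact ⟨by simp, fun h => hil (h.trans' ht.symm')⟩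
      · exact ⟨by simp, fun h => hjl (h.trans' ht.symm')⟩
      · exact ⟨by simp, fun h => hkl (h.trans' ht.symm')⟩
  have ek : ∀ t, SameClass p k t →
      ({i, j, k, l} ∩ {m | ¬ SameClass p m t} : Set (Fin (n + 1))) = {i, j, l} := by
    intro t ht
    ext m
    constructor
    · rintro ⟨rfl | rfl | rfl | rfl, hm⟩
      · simp
      · simp
      · exact absurd ht hm
      · simp
    · rintro (rfl | rfl | rfl)
      · exact ⟨by simp, fun h => hik (h.trans' ht.symm')⟩
      · exact ⟨by simp, fun h => hjk (h.trans' ht.symm')⟩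
      · exact ⟨by simp, fun h => hkl (ht.trans' h.symm')⟩
  rw [h.mem_starAt]
  constructor
  · intro hy
    have h1 := hy i
    have h2 := hy l
    rw [ei i (SameClass.refl' i), argminOn_pair_nontrivial_iff nkl] at h1
    rw [el l (SameClass.refl' l)] at h2
    exact ⟨h1, h2⟩
  · rintro ⟨h1, h2⟩ t
    by_cases hi : SameClass p i t
    · rwa [ei t hi, argminOn_pair_nontrivial_iff nkl]
    by_cases hl : SameClass p l t
    · rwa [el t hl]
    by_cases hk : SameClass p k t
    · rw [ek t hk]
      rw [argminOn_triple_nontrivial_iff nij nik njk] at h2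
      rwa [argminOn_triple_nontrivial_iff nij nil njl, ← h1]
    · have : ({i, j, k, l} ∩ {m | ¬ SameClass p m t} : Set (Fin (n + 1))) = {i, j, k} ∪ {k, l} := by
        ext m
        constructor
        · rintro ⟨rfl | rfl | rfl | rfl, hm⟩ <;> simp
        · rintro ((rfl | rfl | rfl) | (rfl | rfl))
          · exact ⟨by simp, hi⟩
          · exact ⟨by simp, fun h => hi (hij.trans' h)⟩
          · exact ⟨by simp, hk⟩
          · exact ⟨by simp, hk⟩
          · exact ⟨by simp, hl⟩
      rw [this]
      exact argminOn_union_nontrivial h2 ((argminOn_pair_nontrivial_iff nkl).2 h1)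

/-- The maximal cones through `f`, one for each of the directions `w`. -/
def HasCones {m : ℕ} (S : Finset (Module.Dual ℝ (Fin (n + 1) → ℝ))) (f : Fin (n + 1) → ℝ)
    (w : Fin m → Fin (n + 1) → ℝ) : Prop :=
  ∃ C : Fin m → Set (Fin (n + 1) → ℝ), Function.Injective C ∧
    (∀ D, IsMaximalCone (tropHypersurface S) D ∧ f ∈ D ↔ ∃ r, D = C r) ∧
    ∀ r, ∀ᶠ t in 𝓝[>] (0 : ℝ),
      Module.finrank ℝ (dirSpace S (f + t • w r)) = 1 ∧ C r = minCone S (f + t • w r)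

theorem hasCones_of_tri (hΔ : tropHypersurface S = singularSet p n) (hS : S.Nonempty)
    (hroots : {b | shiftRoot b f ∈ singularSpace p n} = {b}) {i j k l : Fin (n + 1)}
    (h : IsTri p (shiftRoot b f) {i, j, k, l}) (nij : i ≠ j) (hij : SameClass p i j)
    (hik : ¬ SameClass p i k) (hil : ¬ SameClass p i l) (hkl : ¬ SameClass p k l) :
    Module.finrank ℝ (dirSpace S f) = 2 ∧
      HasCones S f ![Pi.single i 1, Pi.single j 1, Pi.single k 1 + Pi.single l 1] := by
  have nik := SameClass.ne_of_not hik
  have nil := SameClass.ne_of_not hil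
  have nkl := SameClass.ne_of_not hkl
  have njk : j ≠ k := SameClass.ne_of_not fun h => hik (hij.trans' h)
  have njl : j ≠ l := SameClass.ne_of_not fun h => hil (hij.trans' h)
  refine exists_cones_of_three_rays hΔ hS hroots (Or.inl ⟨h, rfl⟩) nkl nij nik njk
    (Or.inl (by simp)) (Or.inl (by simp)) (exists_shiftRoot_iff nkl fun y =>
      h.mem_starAt_pair nij hij hik hil hkl) ?_ ?_ ?_
  · simp [nik.symm, nil.symm, nij.symm]
  · simp [njk.symm, njl.symm, nij]
  · simp [nik, njk, nil, njl, nkl, nkl.symm]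

theorem hasCones_of_pair_left (hΔ : tropHypersurface S = singularSet p n) (hS : S.Nonempty)
    (hroots : {b | shiftRoot b f ∈ singularSpace p n} = {b}) {r i j k l t : Fin (n + 1)}
    (h : IsPair p (shiftRoot b f) r {i, j} {k, l, t}) (nij : i ≠ j) (nkl : k ≠ l) (nkt : k ≠ t)
    (nlt : l ≠ t) : Module.finrank ℝ (dirSpace S f) = 2 ∧
      HasCones S f ![Pi.single k 1, Pi.single l 1, Pi.single t 1] := by
  have hne : ∀ a ∈ ({i, j} : Set (Fin (n + 1))), ∀ a' ∈ ({k, l, t} : Set (Fin (n + 1))), a ≠ a' :=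
    fun a ha a' ha' e => h.disjoint ha (e ▸ ha')
  have hik := hne i (by simp) k (by simp)
  have hil := hne i (by simp) l (by simp)
  have hit := hne i (by simp) t (by simp)
  have hjk := hne j (by simp) k (by simp)
  have hjl := hne j (by simp) l (by simp)
  have hjt := hne j (by simp) t (by simp)
  refine exists_cones_of_three_rays hΔ hS hroots (Or.inr ⟨r, h⟩) nij nkl nkt nlt
    (Or.inl (by simp)) (Or.inr (by simp)) (exists_shiftRoot_iff
      (P := fun y => (argminOn {k, l, t} y).Nontrivial) nij fun y => ?_) ?_ ?_ ?_
  · rw [h.mem_starAt, argminOn_pair_nontrivial_iff nij]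
  · simp [hik, hjk, nkl.symm, nkt.symm]
  · simp [hil, hjl, nkl, nlt.symm]
  · simp [hit, hjt, nkt, nlt]

theorem hasCones_of_pair_right (hΔ : tropHypersurface S = singularSet p n) (hS : S.Nonempty)
    (hroots : {b | shiftRoot b f ∈ singularSpace p n} = {b}) {r i j k l t : Fin (n + 1)}
    (h : IsPair p (shiftRoot b f) r {k, l, t} {i, j}) (nij : i ≠ j) (nkl : k ≠ l) (nkt : k ≠ t)
    (nlt : l ≠ t) : Module.finrank ℝ (dirSpace S f) = 2 ∧
      HasCones S f ![Pi.single k 1, Pi.single l 1, Pi.single t 1] := by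
  have hne : ∀ a ∈ ({i, j} : Set (Fin (n + 1))), ∀ a' ∈ ({k, l, t} : Set (Fin (n + 1))), a ≠ a' :=
    fun a ha a' ha' e => h.disjoint ha' (e ▸ ha)
  have hik := hne i (by simp) k (by simp)
  have hil := hne i (by simp) l (by simp)
  have hit := hne i (by simp) t (by simp)
  have hjk := hne j (by simp) k (by simp)
  have hjl := hne j (by simp) l (by simp)
  have hjt := hne j (by simp) t (by simp)
  refine exists_cones_of_three_rays hΔ hS hroots (Or.inr ⟨r, h⟩) nij nkl nkt nlt
    (Or.inr (by simp)) (Or.inl (by simp)) (exists_shiftRoot_iff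
      (P := fun y => (argminOn {k, l, t} y).Nontrivial) nij fun y => ?_) ?_ ?_ ?_
  · rw [h.mem_starAt, argminOn_pair_nontrivial_iff nij, and_comm]
  · simp [hik, hjk, nkl.symm, nkt.symm]
  · simp [hil, hjl, nkl, nlt.symm]
  · simp [hit, hjt, nkt, nlt]

/-- The minimum is attained at four monomials of different classes. -/
def HasFourClasses (p : ℕ) {n : ℕ} (w : Fin (n + 1) → ℝ) : Prop :=
  ∃ e : Fin 4 → Fin (n + 1), (∀ r, e r ∈ argminOn Set.univ w) ∧
    ∀ r r', r ≠ r' → ¬ SameClass p (e r) (e r')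

lemma range_eq_of_ncard_le {e : Fin 4 → Fin (n + 1)} (he : ∀ r, e r ∈ M) (hM : M.ncard ≤ 4)
    (hcl : ∀ r r', r ≠ r' → ¬ SameClass p (e r) (e r')) : M = Set.range e := by
  have hinj : Function.Injective e := fun r r' h => by
    by_contra hne
    exact hcl r r' hne (h ▸ SameClass.refl' _)
  refine (Set.eq_of_subset_of_ncard_le ?_ ?_ (Set.toFinite M)).symm
  · rintro _ ⟨r, rfl⟩; exact he r
  · rw [Set.ncard_range_of_injective hinj]
    simpa using hM

end configurations

section classification
variable {p n : ℕ} {S : Finset (Module.Dual ℝ (Fin (n + 1) → ℝ))} {f : Fin (n + 1) → ℝ} {b : ℝ}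

lemma not_three_roots (hΔ : tropHypersurface S = singularSet p n)
    (hf : Module.finrank ℝ (dirSpace S f) = 2) {b₁ b₂ b₃ : ℝ} (h12 : b₁ < b₂) (h23 : b₂ < b₃)
    (hb₁ : shiftRoot b₁ f ∈ singularSpace p n) (hb₂ : shiftRoot b₂ f ∈ singularSpace p n)
    (hb₃ : shiftRoot b₃ f ∈ singularSpace p n) : False := by
  obtain ⟨M₁, N₁, h₁⟩ := exists_isRootType hb₁
  obtain ⟨M₂, N₂, h₂⟩ := exists_isRootType hb₂
  obtain ⟨M₃, N₃, h₃⟩ := exists_isRootType hb₃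
  have i1 : rootSpace M₁ N₁ ⊓ (rootSpace M₂ N₂ ⊔ rootSpace M₃ N₃) = ⊥ := by
    rw [Submodule.eq_bot_iff]
    rintro y ⟨hy₁, hy⟩
    obtain ⟨y₂, hy₂, y₃, hy₃, rfl⟩ := Submodule.mem_sup.1 hy
    refine eq_zero_of_touched h₁ hy₁ fun m hm => ?_
    by_cases h0 : y₂ m = 0
    · exact ⟨b₃, h12.trans h23, touched_of_mem_rootSpace h₃ hy₃ fun h => hm (by simp [h0, h])⟩
    · exact ⟨b₂, h12, touched_of_mem_rootSpace h₂ hy₂ h0⟩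
  have i2 := rootSpace_inf_eq_bot h23 h₂ h₃
  have f1 := Submodule.finrank_sup_add_finrank_inf_eq (rootSpace M₁ N₁)
    (rootSpace M₂ N₂ ⊔ rootSpace M₃ N₃)
  have f2 := Submodule.finrank_sup_add_finrank_inf_eq (rootSpace M₂ N₂) (rootSpace M₃ N₃)
  rw [i1, finrank_bot] at f1
  rw [i2, finrank_bot] at f2
  have hle : rootSpace M₁ N₁ ⊔ (rootSpace M₂ N₂ ⊔ rootSpace M₃ N₃) ≤ dirVec S f :=
    sup_le (rootSpace_le_dirVec hΔ hb₁ h₁)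
      (sup_le (rootSpace_le_dirVec hΔ hb₂ h₂) (rootSpace_le_dirVec hΔ hb₃ h₃))
  have f3 := Submodule.finrank_mono hle
  rw [finrank_dirVec, hf] at f3
  have := h₁.finrank_pos
  have := h₂.finrank_pos
  have := h₃.finrank_pos
  omega

lemma roots_eq_singleton_or_pair (hΔ : tropHypersurface S = singularSet p n)
    (hf : Module.finrank ℝ (dirSpace S f) = 2) :
    (∃ b, {b | shiftRoot b f ∈ singularSpace p n} = {b}) ∨
      ∃ b₁ b₂, b₁ < b₂ ∧ {b | shiftRoot b f ∈ singularSpace p n} = {b₁, b₂} := by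
  have hmem : f ∈ tropHypersurface S := mem_tropHypersurface_of_finrank (by omega)
  rw [hΔ] at hmem
  obtain ⟨b, hb, hmin⟩ := Set.exists_min_image {b | shiftRoot b f ∈ singularSpace p n} id
    (finite_roots p f) hmem
  by_cases h1 : ∀ b', shiftRoot b' f ∈ singularSpace p n → b' = b
  · exact Or.inl ⟨b, Set.Subset.antisymm h1 fun b' hb' => by rw [hb']; exact hb⟩
  right
  push Not at h1
  obtain ⟨c, hc, hcb⟩ := h1
  have hbc : b < c := lt_of_le_of_ne (hmin c hc) hcb.symm
  refine ⟨b, c, hbc, Set.Subset.antisymm (fun d hd => ?_) ?_⟩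
  · by_contra hcon
    rw [Set.mem_insert_iff, Set.mem_singleton_iff, not_or] at hcon
    have hbd : b < d := lt_of_le_of_ne (hmin d hd) (Ne.symm hcon.1)
    rcases lt_or_gt_of_ne hcon.2 with h | h
    · exact not_three_roots hΔ hf hbd h hb hd hc
    · exact not_three_roots hΔ hf hbc h hb hc hd
  · rintro d (rfl | rfl)
    · exact hb
    · exact hc

lemma isSimple_of_two_roots (hΔ : tropHypersurface S = singularSet p n)
    (hf : Module.finrank ℝ (dirSpace S f) = 2) {b₁ b₂ : ℝ} {M₁ N₁ M₂ N₂ : Set (Fin (n + 1))}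
    (hlt : b₁ < b₂) (hb₁ : shiftRoot b₁ f ∈ singularSpace p n)
    (hb₂ : shiftRoot b₂ f ∈ singularSpace p n) (h₁ : IsRootType p (shiftRoot b₁ f) M₁ N₁)
    (h₂ : IsRootType p (shiftRoot b₂ f) M₂ N₂) : IsSimple M₁ N₁ ∧ IsSimple M₂ N₂ := by
  have f2 := Submodule.finrank_sup_add_finrank_inf_eq (rootSpace M₁ N₁) (rootSpace M₂ N₂)
  rw [rootSpace_inf_eq_bot hlt h₁ h₂, finrank_bot] at f2
  have f3 := Submodule.finrank_mono
    (sup_le (rootSpace_le_dirVec hΔ hb₁ h₁) (rootSpace_le_dirVec hΔ hb₂ h₂))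
  rw [finrank_dirVec, hf] at f3
  have := h₁.finrank_pos
  have := h₂.finrank_pos
  exact ⟨h₁.isSimple (by omega), h₂.isSimple (by omega)⟩

lemma not_isSimple_of_one_root (hΔ : tropHypersurface S = singularSet p n) (hS : S.Nonempty)
    (hf : Module.finrank ℝ (dirSpace S f) = 2)
    (hroots : {b | shiftRoot b f ∈ singularSpace p n} = {b}) {M N : Set (Fin (n + 1))}
    (h : IsRootType p (shiftRoot b f) M N) : ¬ IsSimple M N := by
  intro hs
  have hb : shiftRoot b f ∈ singularSpace p n := by
    have : b ∈ {b | shiftRoot b f ∈ singularSpace p n} := hroots ▸ rfl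
    exact this
  obtain ⟨ν, -, h0, -, hν⟩ := h.exists_normal hb hs
  have := finrank_dirSpace_eq_one hΔ hS (f := f) h0 fun x => by
    rw [mem_starSet_iff_of_root hroots, hν]
  omega

lemma ncard_add_le_of_root (hΔ : tropHypersurface S = singularSet p n)
    (hf : Module.finrank ℝ (dirSpace S f) = 2) (hb : shiftRoot b f ∈ singularSpace p n)
    {M N : Set (Fin (n + 1))} (h : IsRootType p (shiftRoot b f) M N) :
    M.ncard + N.ncard ≤ 5 ∧ (N = ∅ → M.ncard ≤ 4) := by
  have h1 := ncard_le_finrank_rootSpace (fun i hi => h.disjoint hi)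
  have h2 := Submodule.finrank_mono (rootSpace_le_dirVec hΔ hb h)
  rw [finrank_dirVec, hf] at h2
  exact ⟨by omega, fun hN => by have := h1.2 hN; omega⟩

/-- A point with planar direction space and one double root has three maximal cones unless the
minimum is attained at four monomials of different classes. -/
theorem hasCones_of_not_hasFourClasses (hΔ : tropHypersurface S = singularSet p n)
    (hS : S.Nonempty) (hf : Module.finrank ℝ (dirSpace S f) = 2)
    (hroots : {b | shiftRoot b f ∈ singularSpace p n} = {b})
    (h4 : ¬ HasFourClasses p (shiftRoot b f)) :
    ∃ w : Fin 3 → Fin (n + 1) → ℝ, HasCones S f w := by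
  have hb : shiftRoot b f ∈ singularSpace p n := by
    have : b ∈ {b | shiftRoot b f ∈ singularSpace p n} := hroots ▸ rfl
    exact this
  obtain ⟨M, N, h⟩ := exists_isRootType hb
  have hns := not_isSimple_of_one_root hΔ hS hf hroots h
  have hc := ncard_add_le_of_root hΔ hf hb h
  rcases h with ⟨h, rfl⟩ | ⟨r, h⟩
  · obtain ⟨i, hi, j, hj, k, hk, hij, hik, hjk⟩ := h.three
    have nij := SameClass.ne_of_not hij
    have nik := SameClass.ne_of_not hik
    have njk := SameClass.ne_of_not hjk
    have h3 : ({i, j, k} : Set (Fin (n + 1))).ncard = 3 :=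
      Set.ncard_eq_three.2 ⟨i, j, k, nij, nik, njk, rfl⟩
    have h3' : 3 < M.ncard := by
      by_contra hcon
      exact hns (Or.inl ⟨not_lt.1 hcon, rfl⟩)
    obtain ⟨l, hl, hlA⟩ := exists_mem_notMem_of_ncard_lt (h3 ▸ h3')
    simp only [Set.mem_insert_iff, Set.mem_singleton_iff, not_or] at hlA
    have hM : M = {l, i, j, k} := by
      refine (Set.eq_of_subset_of_ncard_le ?_ ?_ (Set.toFinite M)).symm
      · rintro m (rfl | rfl | rfl | rfl) <;> assumption
      · rw [Set.ncard_insert_of_notMem (by simp [hlA]), h3]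
        exact hc.2 rfl
    by_cases hli : SameClass p l i
    · rw [hM] at h
      exact ⟨_, (hasCones_of_tri hΔ hS hroots h hlA.1 hli (fun h => hij (hli.symm'.trans' h))
        (fun h => hik (hli.symm'.trans' h)) hjk).2⟩
    by_cases hlj : SameClass p l j
    · have e : M = {l, j, i, k} := by rw [hM, Set.insert_comm i j]
      rw [e] at h
      exact ⟨_, (hasCones_of_tri hΔ hS hroots h hlA.2.1 hlj
        (fun h => hij (hlj.symm'.trans' h).symm') (fun h => hjk (hlj.symm'.trans' h)) hik).2⟩
    by_cases hlk : SameClass p l k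
    · have e : M = {l, k, i, j} := by rw [hM, Set.pair_comm j k, Set.insert_comm i k]
      rw [e] at h
      exact ⟨_, (hasCones_of_tri hΔ hS hroots h hlA.2.2 hlk
        (fun h => hik (hlk.symm'.trans' h).symm') (fun h => hjk (hlk.symm'.trans' h).symm') hij).2⟩
    · refine absurd ⟨![l, i, j, k], fun r => ?_, fun r r' hr => ?_⟩ h4
      · rw [← h.eq]
        fin_cases r <;> assumption
      · fin_cases r <;> fin_cases r' <;>
          first
          | exact absurd rfl hr
          | assumption
          | exact fun h => hli h.symm'
          | exact fun h => hlj h.symm'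
          | exact fun h => hlk h.symm'
          | exact fun h => hij h.symm'
          | exact fun h => hik h.symm'
          | exact fun h => hjk h.symm'
  · have m2 := one_lt_ncard_of_nontrivial h.nontrivM
    have n2 := one_lt_ncard_of_nontrivial h.nontrivN
    rcases Nat.lt_or_ge 2 M.ncard with hM | hM
    · obtain ⟨k, l, t, hkl, hkt, hlt, rfl⟩ := Set.ncard_eq_three.1 (show M.ncard = 3 by omega)
      obtain ⟨i, j, hij, rfl⟩ := Set.ncard_eq_two.1 (show N.ncard = 2 by omega)
      exact ⟨_, (hasCones_of_pair_right hΔ hS hroots h hij hkl hkt hlt).2⟩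
    · have hN : 2 < N.ncard := by
        by_contra hcon
        exact hns (Or.inr ⟨hM, not_lt.1 hcon⟩)
      obtain ⟨k, l, t, hkl, hkt, hlt, rfl⟩ := Set.ncard_eq_three.1 (show N.ncard = 3 by omega)
      obtain ⟨i, j, hij, rfl⟩ := Set.ncard_eq_two.1 (show M.ncard = 2 by omega)
      exact ⟨_, (hasCones_of_pair_left hΔ hS hroots h hij hkl hkt hlt).2⟩

end classification

/-! ### Types of maximal cones -/

section types
variable {p n : ℕ} {S : Finset (Module.Dual ℝ (Fin (n + 1) → ℝ))} {a w : Fin (n + 1) → ℝ} {b : ℝ}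
  {i j k l : Fin (n + 1)}

lemma isClosed_setOf_exists_shiftRoot (hij : i ≠ j) {A : Set (Fin (n + 1) → ℝ)} (hA : IsClosed A)
    (hAij : ∀ a ∈ A, a i = a j) : IsClosed {f | ∃ b : ℝ, shiftRoot b f ∈ A} := by
  have hc : Continuous fun f : Fin (n + 1) → ℝ => shiftRoot (slopeRoot f i j) f :=
    continuous_shiftRoot.comp ((continuous_slopeRoot i j).prodMk continuous_id)
  convert hA.preimage hc using 1
  ext f
  constructor
  · rintro ⟨b, hb⟩
    have := (shiftRoot_eq_iff hij).1 (hAij _ hb)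
    change shiftRoot (slopeRoot f i j) f ∈ A
    rwa [← this]
  · exact fun h => ⟨_, h⟩

lemma isClosed_minAtThree (i j k : Fin (n + 1)) : IsClosed (minAtThree i j k) := by
  have h : ∀ i j : Fin (n + 1), IsClosed {a : Fin (n + 1) → ℝ | a i = a j} := fun i j =>
    isClosed_eq (continuous_apply i) (continuous_apply j)
  have h' : IsClosed {a : Fin (n + 1) → ℝ | ∀ m, a i ≤ a m} := by
    simp only [Set.ofPred_forall]
    exact isClosed_iInter fun m => isClosed_le (continuous_apply i) (continuous_apply m)
  exact (h i j).inter ((h j k).inter h')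

lemma isClosed_minAtPairs (p : ℕ) (i j k l : Fin (n + 1)) : IsClosed (minAtPairs p i j k l) := by
  have h : ∀ i j : Fin (n + 1), IsClosed {a : Fin (n + 1) → ℝ | a i = a j} := fun i j =>
    isClosed_eq (continuous_apply i) (continuous_apply j)
  have h' : ∀ (k : Fin (n + 1)) (Q : Fin (n + 1) → Prop),
      IsClosed {a : Fin (n + 1) → ℝ | ∀ m, Q m → a k ≤ a m} := by
    intro k Q
    simp only [Set.ofPred_forall]
    exact isClosed_iInter fun m => isClosed_iInter fun _ =>
      isClosed_le (continuous_apply k) (continuous_apply m)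
  have h'' : IsClosed {a : Fin (n + 1) → ℝ | ∀ m, a i ≤ a m} := by
    simpa using h' i fun _ => True
  exact (h i j).inter (h''.inter ((h k l).inter (h' k _)))

lemma minCone_subset_of_isClosed (hS : S.Nonempty) {U : Set (Fin (n + 1) → ℝ)} (hU : IsClosed U)
    (h : ∀ g, minSet S g = minSet S a → g ∈ U) : minCone S a ⊆ U := by
  rw [← closure_setOf_minSet_eq hS]
  exact closure_minimal h hU

lemma triVec_ne_zero_iff (hij : i ≠ j) (hik : i ≠ k) (hjk : j ≠ k) {m : Fin (n + 1)} :
    triVec i j k m ≠ 0 ↔ m ∈ ({i, j, k} : Set (Fin (n + 1))) := by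
  have h1 := natCast_sub_ne_zero hij
  have h2 := natCast_sub_ne_zero hik.symm
  have h3 := natCast_sub_ne_zero hjk
  by_cases hi : m = i
  · subst hi; simp [triVec, hij, hik, h3]
  by_cases hj : m = j
  · subst hj; simp [triVec, hij.symm, hjk, h2]
  by_cases hk : m = k
  · subst hk; simp [triVec, hik.symm, hjk.symm, h1]
  · simp [triVec, hi, hj, hk]

lemma pairVec_ne_zero_iff (hij : i ≠ j) (hik : i ≠ k) (hil : i ≠ l) (hjk : j ≠ k) (hjl : j ≠ l)
    (hkl : k ≠ l) {m : Fin (n + 1)} :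
    pairVec i j k l m ≠ 0 ↔ m ∈ ({i, j, k, l} : Set (Fin (n + 1))) := by
  have h1 := natCast_sub_ne_zero hij
  have h2 := natCast_sub_ne_zero hkl
  have h1' := natCast_sub_ne_zero hij.symm
  have h2' := natCast_sub_ne_zero hkl.symm
  by_cases hi : m = i
  · subst hi; simp [pairVec, hij, hik, hil, h2]
  by_cases hj : m = j
  · subst hj; simp [pairVec, hij.symm, hjk, hjl, h2']
  by_cases hk : m = k
  · subst hk; simp [pairVec, hik.symm, hjk.symm, hkl, h1']
  by_cases hl : m = l
  · subst hl; simp [pairVec, hil.symm, hjl.symm, hkl.symm, h1]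
  · simp [pairVec, hi, hj, hk, hl]

lemma ne_zero_iff_of_finrank_eq_one (h1 : Module.finrank ℝ (dirSpace S a) = 1)
    {ν ν' : Fin (n + 1) → ℝ} (hν : ν ∈ dirVec S a) (hν' : ν' ∈ dirVec S a) (h0 : ν ≠ 0)
    (h0' : ν' ≠ 0) (m : Fin (n + 1)) : ν m ≠ 0 ↔ ν' m ≠ 0 := by
  rw [← finrank_dirVec] at h1
  obtain ⟨c, hc⟩ := (finrank_eq_one_iff_of_nonzero' (⟨ν, hν⟩ : dirVec S a)
    (fun h => h0 (congrArg Subtype.val h))).1 h1 ⟨ν', hν'⟩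
  have hc' : c • ν = ν' := congrArg Subtype.val hc
  have hc0 : c ≠ 0 := by
    rintro rfl
    exact h0' (by rw [← hc', zero_smul])
  rw [← hc', Pi.smul_apply, smul_eq_mul, Ne, Ne, mul_eq_zero]
  simp [hc0]

lemma ne_zero_of_forall_iff {ν : Fin (n + 1) → ℝ} {A : Set (Fin (n + 1))}
    (h : ∀ m, ν m ≠ 0 ↔ m ∈ A) (hA : A.Nonempty) : ν ≠ 0 := by
  obtain ⟨m, hm⟩ := hA
  rintro rfl
  exact (h m).2 hm rfl

/-- The supports of the normal vectors of the cells over a point. -/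
lemma exists_normal_support (hΔ : tropHypersurface S = singularSet p n)
    (hb : shiftRoot b a ∈ singularSpace p n) :
    (∃ i j k, ¬ SameClass p i j ∧ ¬ SameClass p i k ∧ ¬ SameClass p j k ∧
      shiftRoot b a ∈ minAtThree i j k ∧ triVec i j k ∈ dirVec S a) ∨
    ∃ i j k l, i ≠ j ∧ k ≠ l ∧ SameClass p i j ∧ ¬ SameClass p k i ∧ ¬ SameClass p l i ∧
      shiftRoot b a ∈ minAtPairs p i j k l ∧ pairVec i j k l ∈ dirVec S a := by
  rcases isTri_or_isPair hb with ⟨M, h⟩ | ⟨r, M, N, h⟩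
  · left
    obtain ⟨i, hi, j, hj, k, hk, hij, hik, hjk⟩ := h.three
    refine ⟨i, j, k, hij, hik, hjk, ?_, triVec_mem_dirVec hΔ hb h hi hj hk hij hik hjk⟩
    rw [h.eq] at hi hj hk
    exact ⟨eq_of_mem_argminOn hi hj, eq_of_mem_argminOn hj hk, fun m => hi.2 m trivial⟩
  · right
    obtain ⟨i, hi, j, hj, hij⟩ := h.nontrivM
    obtain ⟨k, hk, l, hl, hkl⟩ := h.nontrivN
    refine ⟨i, j, k, l, hij, hkl, (h.class_of_mem hi).trans' (h.class_of_mem hj).symm',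
      fun h' => h.not_class_of_mem hk (h'.trans' (h.class_of_mem hi)),
      fun h' => h.not_class_of_mem hl (h'.trans' (h.class_of_mem hi)),
      ⟨h.shiftRoot_eq_left hi hj, fun m => (h.mem_argminOn_univ hi).2 m trivial,
        h.shiftRoot_eq_right hk hl, fun m hm => ?_⟩, pairVec_mem_dirVec hΔ hb h hi hj hk hl hij hkl⟩
    have hmr : ¬ SameClass p m r := fun h' => hm (h'.trans' (h.class_of_mem hi).symm')
    rw [h.eqN] at hk
    exact hk.2 m hmr

lemma ncard_triple_ne_quadruple {i j k : Fin (n + 1)} {i' j' k' l' : Fin (n + 1)}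
    (hij : i' ≠ j') (hik : i' ≠ k') (hil : i' ≠ l') (hjk : j' ≠ k') (hjl : j' ≠ l') (hkl : k' ≠ l')
    (h : ∀ m, m ∈ ({i, j, k} : Set (Fin (n + 1))) ↔ m ∈ ({i', j', k', l'} : Set (Fin (n + 1)))) :
    False := by
  have e := Set.ext h
  have h4 : ({i', j', k', l'} : Set (Fin (n + 1))).ncard = 4 := by
    rw [Set.ncard_insert_of_notMem (by simp [hij, hik, hil]),
      Set.ncard_eq_three.2 ⟨j', k', l', hjk, hjl, hkl, rfl⟩]
  have h3 : ({i, j, k} : Set (Fin (n + 1))).ncard ≤ 3 :=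
    (Set.ncard_insert_le _ _).trans (Nat.succ_le_succ ((Set.ncard_insert_le j {k}).trans
      (by rw [Set.ncard_singleton])))
  rw [e, h4] at h3
  omega

theorem isCellI_minCone (hΔ : tropHypersurface S = singularSet p n) (hS : S.Nonempty)
    (h1 : Module.finrank ℝ (dirSpace S a) = 1) (hij : ¬ SameClass p i j)
    (hik : ¬ SameClass p i k) (hjk : ¬ SameClass p j k) (ha : shiftRoot b a ∈ minAtThree i j k) :
    IsCellI p (minCone S a) i j k := by
  have nij := SameClass.ne_of_not hij
  have nik := SameClass.ne_of_not hik
  have njk := SameClass.ne_of_not hjk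
  refine ⟨hij, hik, hjk, minCone_subset_of_isClosed hS
    (isClosed_setOf_exists_shiftRoot nij (isClosed_minAtThree i j k) fun a ha => ha.1)
    fun g hg => ?_⟩
  have hb := mem_singularSpace_of_three hij hik hjk ha
  have hmem : ∀ m ∈ ({i, j, k} : Set (Fin (n + 1))), m ∈ argminOn Set.univ (shiftRoot b a) := by
    obtain ⟨e1, e2, e3⟩ := ha
    rintro m (rfl | rfl | rfl)
    · exact ⟨trivial, fun m _ => e3 m⟩
    · exact ⟨trivial, fun m _ => e1 ▸ e3 m⟩
    · exact ⟨trivial, fun m _ => e2 ▸ e1 ▸ e3 m⟩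
  have hi := hmem i (by simp)
  have hj := hmem j (by simp)
  have hk := hmem k (by simp)
  have hν : triVec i j k ∈ dirVec S a := triVec_mem_dirVec hΔ hb
    ⟨rfl, i, hi, j, hj, k, hk, hij, hik, hjk⟩ hi hj hk hij hik hjk
  have hs := fun m => triVec_ne_zero_iff nij nik njk (m := m)
  have hdir : dirVec S g = dirVec S a := by rw [dirVec, dirVec, dirSpace_congr hg]
  have hgX : g ∈ tropHypersurface S :=
    mem_tropHypersurface_of_finrank (by rw [dirSpace_congr hg, h1]; exact one_pos)
  rw [hΔ] at hgX
  obtain ⟨b', hb'⟩ := hgX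
  refine ⟨b', ?_⟩
  have h0 := ne_zero_of_forall_iff hs ⟨i, by simp⟩
  rcases exists_normal_support hΔ hb' with ⟨i', j', k', hij', hik', hjk', hm, hv⟩ |
    ⟨i', j', k', l', nij', nkl', hij', hki', hli', hm, hv⟩
  · have hs' := fun m => triVec_ne_zero_iff (SameClass.ne_of_not hij') (SameClass.ne_of_not hik')
      (SameClass.ne_of_not hjk') (m := m)
    have h0' := ne_zero_of_forall_iff hs' ⟨i', by simp⟩
    have hsupp : ∀ m ∈ ({i, j, k} : Set (Fin (n + 1))), m ∈ ({i', j', k'} : Set (Fin (n + 1))) :=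
      fun m hm => (hs' m).1 ((ne_zero_iff_of_finrank_eq_one h1 hν (hdir ▸ hv) h0 h0' m).1
        ((hs m).2 hm))
    obtain ⟨e1, e2, e3⟩ := hm
    have hval : ∀ m ∈ ({i, j, k} : Set (Fin (n + 1))), shiftRoot b' g m = shiftRoot b' g i' := by
      intro m hm
      rcases hsupp m hm with rfl | rfl | rfl
      · rfl
      · exact e1.symm
      · exact (e1.trans e2).symm
    have vi := hval i (by simp)
    have vj := hval j (by simp)
    have vk := hval k (by simp)
    exact ⟨vi.trans vj.symm, vj.trans vk.symm, fun m => vi ▸ e3 m⟩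
  · have a1 := SameClass.ne_of_not hki'
    have a2 := SameClass.ne_of_not hli'
    have a3 : k' ≠ j' := SameClass.ne_of_not fun h => hki' (h.trans' hij'.symm')
    have a4 : l' ≠ j' := SameClass.ne_of_not fun h => hli' (h.trans' hij'.symm')
    have hs' := fun m => pairVec_ne_zero_iff nij' a1.symm a2.symm a3.symm a4.symm nkl' (m := m)
    have h0' := ne_zero_of_forall_iff hs' ⟨i', by simp⟩
    exact (ncard_triple_ne_quadruple nij' a1.symm a2.symm a3.symm a4.symm nkl' fun m => by
      rw [← hs, ← hs', ne_zero_iff_of_finrank_eq_one h1 hν (hdir ▸ hv) h0 h0']).elim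

lemma isPair_of_lt (hw : w ∈ minAtPairs p i j k l) (nij : i ≠ j) (nkl : k ≠ l)
    (hij : SameClass p i j) (hki : ¬ SameClass p k i) (hli : ¬ SameClass p l i)
    (hlt : w i < w k) : IsPair p w i (argminOn {m | SameClass p m i} w)
      (argminOn {m | ¬ SameClass p m i} w) := by
  obtain ⟨e1, e2, e3, e4⟩ := hw
  have hi : i ∈ argminOn {m | SameClass p m i} w := ⟨SameClass.refl' i, fun m _ => e2 m⟩
  have hk : k ∈ argminOn {m | ¬ SameClass p m i} w := ⟨hki, e4⟩
  have hval : ∀ m ∈ argminOn {m | SameClass p m i} w,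
      ∀ m' ∈ argminOn {m | ¬ SameClass p m i} w, w m < w m' := by
    intro m hm m' hm'
    rwa [eq_of_mem_argminOn hm hi, eq_of_mem_argminOn hm' hk]
  exact ⟨rfl, rfl, ⟨i, hi, j, ⟨hij.symm', fun m _ => e1 ▸ e2 m⟩, nij⟩,
    ⟨k, hk, l, ⟨hli, fun m hm => e3 ▸ e4 m hm⟩, nkl⟩, fun m hm m' hm' => (hval m hm m' hm').le,
    fun m hm m' hm' h => absurd h (hval m hm m' hm').ne⟩

/-- The polynomials with the same minimal exponents as a regular point over a cell of type II or
III lie over a cell with the same four monomials. -/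
lemma exists_minAtPairs_of_minSet_eq (hΔ : tropHypersurface S = singularSet p n)
    (h1 : Module.finrank ℝ (dirSpace S a) = 1) (nij : i ≠ j) (nkl : k ≠ l)
    (hij : SameClass p i j) (hki : ¬ SameClass p k i) (hli : ¬ SameClass p l i)
    (ha : shiftRoot b a ∈ minAtPairs p i j k l) (hlt : shiftRoot b a i < shiftRoot b a k)
    {g : Fin (n + 1) → ℝ} (hg : minSet S g = minSet S a) :
    ∃ b', shiftRoot b' g ∈ minAtPairs p i j k l ∪ minAtPairs p k l i j ∧
      (¬ SameClass p k l → shiftRoot b' g ∈ minAtPairs p i j k l) := by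
  have nki := SameClass.ne_of_not hki
  have nli := SameClass.ne_of_not hli
  have hkj : ¬ SameClass p k j := fun h => hki (h.trans' hij.symm')
  have hlj : ¬ SameClass p l j := fun h => hli (h.trans' hij.symm')
  have nkj := SameClass.ne_of_not hkj
  have nlj := SameClass.ne_of_not hlj
  have hb := mem_singularSpace_of_pairs nij hij nkl hki hli ha
  have hpair := isPair_of_lt ha nij nkl hij hki hli hlt
  have hν : pairVec i j k l ∈ dirVec S a := by
    obtain ⟨e1, e2, e3, e4⟩ := ha
    exact pairVec_mem_dirVec hΔ hb hpair ⟨SameClass.refl' i, fun m _ => e2 m⟩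
      ⟨hij.symm', fun m _ => e1 ▸ e2 m⟩ ⟨hki, e4⟩ ⟨hli, fun m hm => e3 ▸ e4 m hm⟩ nij nkl
  have hs := fun m => pairVec_ne_zero_iff nij nki.symm nli.symm nkj.symm nlj.symm nkl (m := m)
  have hdir : dirVec S g = dirVec S a := by rw [dirVec, dirVec, dirSpace_congr hg]
  have hgX : g ∈ tropHypersurface S :=
    mem_tropHypersurface_of_finrank (by rw [dirSpace_congr hg, h1]; exact one_pos)
  rw [hΔ] at hgX
  obtain ⟨b', hb'⟩ := hgX
  refine ⟨b', ?_⟩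
  have h0 := ne_zero_of_forall_iff hs ⟨i, by simp⟩
  rcases exists_normal_support hΔ hb' with ⟨i', j', k', hij', hik', hjk', hm, hv⟩ |
    ⟨i', j', k', l', nij', nkl', hij', hki', hli', hm, hv⟩
  · have hs' := fun m => triVec_ne_zero_iff (SameClass.ne_of_not hij') (SameClass.ne_of_not hik')
      (SameClass.ne_of_not hjk') (m := m)
    have h0' := ne_zero_of_forall_iff hs' ⟨i', by simp⟩
    exact (ncard_triple_ne_quadruple nij nki.symm nli.symm nkj.symm nlj.symm nkl fun m => by
      rw [← hs, ← hs', ne_zero_iff_of_finrank_eq_one h1 hν (hdir ▸ hv) h0 h0']).elim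
  · have a1 := SameClass.ne_of_not hki'
    have a2 := SameClass.ne_of_not hli'
    have hkj' : ¬ SameClass p k' j' := fun h => hki' (h.trans' hij'.symm')
    have hlj' : ¬ SameClass p l' j' := fun h => hli' (h.trans' hij'.symm')
    have a3 := SameClass.ne_of_not hkj'
    have a4 := SameClass.ne_of_not hlj'
    have hs' := fun m => pairVec_ne_zero_iff nij' a1.symm a2.symm a3.symm a4.symm nkl' (m := m)
    have h0' := ne_zero_of_forall_iff hs' ⟨i', by simp⟩
    have hsupp : ∀ m ∈ ({i', j', k', l'} : Set (Fin (n + 1))),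
        m ∈ ({i, j, k, l} : Set (Fin (n + 1))) := fun m hm =>
      (hs m).1 ((ne_zero_iff_of_finrank_eq_one h1 hν (hdir ▸ hv) h0 h0' m).2 ((hs' m).2 hm))
    have hi' := hsupp i' (by simp)
    have hj' := hsupp j' (by simp)
    have hk' := hsupp k' (by simp)
    have hl' := hsupp l' (by simp)
    obtain ⟨e1, e2, e3, e4⟩ := hm
    have hpair_cases : (i' = i ∧ j' = j ∨ i' = j ∧ j' = i) ∨
        ((i' = k ∧ j' = l ∨ i' = l ∧ j' = k) ∧ SameClass p k l) := by
      rcases hi' with rfl | rfl | rfl | rfl <;> rcases hj' with rfl | rfl | rfl | rfl <;>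
        first
        | exact absurd rfl nij'
        | exact Or.inl (Or.inl ⟨rfl, rfl⟩)
        | exact Or.inl (Or.inr ⟨rfl, rfl⟩)
        | exact Or.inr ⟨Or.inl ⟨rfl, rfl⟩, hij'⟩
        | exact Or.inr ⟨Or.inr ⟨rfl, rfl⟩, hij'.symm'⟩
        | exact absurd hij' hki
        | exact absurd hij' hli
        | exact absurd hij' hkj
        | exact absurd hij' hlj
        | exact absurd hij'.symm' hki
        | exact absurd hij'.symm' hli
        | exact absurd hij'.symm' hkj
        | exact absurd hij'.symm' hlj
    have hrest : ∀ {x y z t : Fin (n + 1)}, ({i, j, k, l} : Set (Fin (n + 1))) ⊆ {x, y, z, t} →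
        (i' = x ∧ j' = y ∨ i' = y ∧ j' = x) → (k' = z ∧ l' = t ∨ k' = t ∧ l' = z) := by
      intro x y z t hsub hxy
      have hk2 := hsub hk'
      have hl2 := hsub hl'
      simp only [Set.mem_insert_iff, Set.mem_singleton_iff] at hk2 hl2
      rcases hxy with ⟨rfl, rfl⟩ | ⟨rfl, rfl⟩
      · rcases hk2 with h | h | h | h
        · exact absurd h a1
        · exact absurd h a3
        · rcases hl2 with h' | h' | h' | h'
          · exact absurd h' a2
          · exact absurd h' a4
          · exact absurd (h.trans h'.symm) nkl'
          · exact Or.inl ⟨h, h'⟩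
        · rcases hl2 with h' | h' | h' | h'
          · exact absurd h' a2
          · exact absurd h' a4
          · exact Or.inr ⟨h, h'⟩
          · exact absurd (h.trans h'.symm) nkl'
      · rcases hk2 with h | h | h | h
        · exact absurd h a3
        · exact absurd h a1
        · rcases hl2 with h' | h' | h' | h'
          · exact absurd h' a4
          · exact absurd h' a2
          · exact absurd (h.trans h'.symm) nkl'
          · exact Or.inl ⟨h, h'⟩
        · rcases hl2 with h' | h' | h' | h'
          · exact absurd h' a4
          · exact absurd h' a2
          · exact Or.inr ⟨h, h'⟩
          · exact absurd (h.trans h'.symm) nkl'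
    have hmk : ∀ {x y z t : Fin (n + 1)}, (i' = x ∧ j' = y ∨ i' = y ∧ j' = x) →
        (k' = z ∧ l' = t ∨ k' = t ∧ l' = z) → shiftRoot b' g ∈ minAtPairs p x y z t := by
      intro x y z t hxy hzt
      have hx : shiftRoot b' g x = shiftRoot b' g i' ∧ shiftRoot b' g y = shiftRoot b' g i' ∧
          SameClass p i' x := by
        rcases hxy with ⟨rfl, rfl⟩ | ⟨rfl, rfl⟩
        · exact ⟨rfl, e1.symm, SameClass.refl' _⟩
        · exact ⟨e1.symm, rfl, hij'⟩
      have hz : shiftRoot b' g z = shiftRoot b' g k' ∧ shiftRoot b' g t = shiftRoot b' g k' := by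
        rcases hzt with ⟨rfl, rfl⟩ | ⟨rfl, rfl⟩
        · exact ⟨rfl, e3.symm⟩
        · exact ⟨e3.symm, rfl⟩
      exact ⟨hx.1.trans hx.2.1.symm, fun m => hx.1 ▸ e2 m, hz.1.trans hz.2.symm,
        fun m hm => hz.1 ▸ e4 m fun h => hm (h.trans' hx.2.2)⟩
    rcases hpair_cases with h | ⟨h, hkl⟩
    · have := hmk h (hrest (fun _ h => h) h)
      exact ⟨Or.inl this, fun _ => this⟩
    · refine ⟨Or.inr (hmk h (hrest ?_ h)), fun hkl' => absurd hkl hkl'⟩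
      rintro m (rfl | rfl | rfl | rfl) <;> simp

theorem isCellII_minCone (hΔ : tropHypersurface S = singularSet p n) (hS : S.Nonempty)
    (h1 : Module.finrank ℝ (dirSpace S a) = 1) (nij : i ≠ j)
    (hij : SameClass p i j) (hki : ¬ SameClass p k i) (hli : ¬ SameClass p l i)
    (hkl : ¬ SameClass p k l) (ha : shiftRoot b a ∈ minAtPairs p i j k l)
    (hlt : shiftRoot b a i < shiftRoot b a k) : IsCellII p (minCone S a) i j k l := by
  refine ⟨nij, hij, hki, hli, hkl, minCone_subset_of_isClosed hS
    (isClosed_setOf_exists_shiftRoot nij (isClosed_minAtPairs p i j k l) fun a ha => ha.1)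
    fun g hg => ?_⟩
  obtain ⟨b', -, hb'⟩ := exists_minAtPairs_of_minSet_eq hΔ h1 nij (SameClass.ne_of_not hkl) hij hki
    hli ha hlt hg
  exact ⟨b', hb' hkl⟩

theorem isCellIII_minCone (hΔ : tropHypersurface S = singularSet p n) (hS : S.Nonempty)
    (h1 : Module.finrank ℝ (dirSpace S a) = 1) (nij : i ≠ j) (nkl : k ≠ l)
    (hij : SameClass p i j) (hki : ¬ SameClass p k i) (hkl : SameClass p k l)
    (ha : shiftRoot b a ∈ minAtPairs p i j k l)
    (hlt : shiftRoot b a i < shiftRoot b a k) : IsCellIII p (minCone S a) i j k l := by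
  have hli : ¬ SameClass p l i := fun h => hki (hkl.trans' h)
  refine ⟨nij, hij, nkl, hkl, hki, fun g hg => ?_⟩
  have hcl := (isClosed_setOf_exists_shiftRoot nij (isClosed_minAtPairs p i j k l)
    fun a ha => ha.1).union (isClosed_setOf_exists_shiftRoot nkl (isClosed_minAtPairs p k l i j)
    fun a ha => ha.1)
  rcases minCone_subset_of_isClosed hS hcl (fun g hg => by
    obtain ⟨b', hb' | hb', -⟩ := exists_minAtPairs_of_minSet_eq hΔ h1 nij nkl hij hki hli ha hlt hg
    · exact Or.inl ⟨b', hb'⟩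
    · exact Or.inr ⟨b', hb'⟩) hg with ⟨b', hb'⟩ | ⟨b', hb'⟩
  · exact ⟨b', Or.inl hb'⟩
  · exact ⟨b', Or.inr hb'⟩

end types

/-! ### Adjacent maximal cones -/

section adjacent
variable {p n : ℕ} {S : Finset (Module.Dual ℝ (Fin (n + 1) → ℝ))} {f : Fin (n + 1) → ℝ} {b : ℝ}

lemma mem_argminOn_of_minAtThree {w : Fin (n + 1) → ℝ} {i j k : Fin (n + 1)}
    (h : w ∈ minAtThree i j k) : i ∈ argminOn Set.univ w ∧ j ∈ argminOn Set.univ w ∧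
      k ∈ argminOn Set.univ w := by
  obtain ⟨e1, e2, e3⟩ := h
  exact ⟨⟨trivial, fun m _ => e3 m⟩, ⟨trivial, fun m _ => e1 ▸ e3 m⟩,
    ⟨trivial, fun m _ => e2 ▸ e1 ▸ e3 m⟩⟩

lemma isTri_of_three_classes {w : Fin (n + 1) → ℝ} {i j k : Fin (n + 1)}
    (hi : i ∈ argminOn Set.univ w) (hj : j ∈ argminOn Set.univ w) (hk : k ∈ argminOn Set.univ w)
    (hij : ¬ SameClass p i j) (hik : ¬ SameClass p i k) (hjk : ¬ SameClass p j k) :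
    IsTri p w (argminOn Set.univ w) := ⟨rfl, i, hi, j, hj, k, hk, hij, hik, hjk⟩

/-- Three classes and two pairs in different classes need at least five monomials. -/
lemma four_lt_ncard_of_pairs {w : Fin (n + 1) → ℝ} {i j k i' j' k' l' : Fin (n + 1)}
    (hi : i ∈ argminOn Set.univ w) (hj : j ∈ argminOn Set.univ w) (hk : k ∈ argminOn Set.univ w)
    (hij : ¬ SameClass p i j) (hik : ¬ SameClass p i k) (hjk : ¬ SameClass p j k)
    (nij : i' ≠ j') (hij' : SameClass p i' j') (nkl : k' ≠ l') (hkl' : SameClass p k' l')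
    (hki' : ¬ SameClass p k' i') (hw : w ∈ minAtPairs p i' j' k' l') :
    4 < (argminOn Set.univ w).ncard := by
  obtain ⟨e1, e2, e3, e4⟩ := hw
  have mi' : i' ∈ argminOn Set.univ w := ⟨trivial, fun m _ => e2 m⟩
  have mj' : j' ∈ argminOn Set.univ w := ⟨trivial, fun m _ => e1 ▸ e2 m⟩
  obtain ⟨m, hm, hmi⟩ : ∃ m ∈ argminOn Set.univ w, ¬ SameClass p m i' := by
    by_cases h : SameClass p i i'
    · exact ⟨j, hj, fun h' => hij (h.trans' h'.symm')⟩
    · exact ⟨i, hi, h⟩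
  have mk' : k' ∈ argminOn Set.univ w :=
    ⟨trivial, fun m' hm' => (e4 m hmi).trans (hm.2 m' hm')⟩
  have ml' : l' ∈ argminOn Set.univ w :=
    ⟨trivial, fun m' hm' => e3 ▸ (e4 m hmi).trans (hm.2 m' hm')⟩
  have hkj' : ¬ SameClass p k' j' := fun h => hki' (h.trans' hij'.symm')
  have n1 := (SameClass.ne_of_not hki').symm
  have n2 := (SameClass.ne_of_not hkj').symm
  have n3 : i' ≠ l' := (SameClass.ne_of_not fun h => hki' (hkl'.trans' h)).symm
  have n4 : j' ≠ l' := (SameClass.ne_of_not fun h => hkj' (hkl'.trans' h)).symm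
  have h4 : ({i', j', k', l'} : Set (Fin (n + 1))).ncard = 4 := by
    rw [Set.ncard_insert_of_notMem (by simp [nij, n1, n3]),
      Set.ncard_eq_three.2 ⟨j', k', l', n2, n4, nkl, rfl⟩]
  obtain ⟨m, hm, hmi, hmk⟩ : ∃ m ∈ argminOn Set.univ w, ¬ SameClass p m i' ∧ ¬ SameClass p m k' := by
    by_contra hcon
    push Not at hcon
    have key : ∀ m ∈ argminOn Set.univ w, SameClass p m i' ∨ SameClass p m k' := fun m hm => by
      by_cases h : SameClass p m i'
      · exact Or.inl h
      · exact Or.inr (hcon m hm h)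
    rcases key i hi with h1 | h1 <;> rcases key j hj with h2 | h2 <;> rcases key k hk with h3 | h3 <;>
      first
      | exact hij (h1.trans' h2.symm')
      | exact hik (h1.trans' h3.symm')
      | exact hjk (h2.trans' h3.symm')
  have h5 : ({m, i', j', k', l'} : Set (Fin (n + 1))).ncard = 5 := by
    rw [Set.ncard_insert_of_notMem, h4]
    rintro (rfl | rfl | rfl | rfl)
    · exact hmi (SameClass.refl' _)
    · exact hmi hij'.symm'
    · exact hmk (SameClass.refl' _)
    · exact hmk hkl'.symm'
  have hsub : ({m, i', j', k', l'} : Set (Fin (n + 1))) ⊆ argminOn Set.univ w := by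
    rintro _ (rfl | rfl | rfl | rfl | rfl) <;> assumption
  have := Set.ncard_le_ncard hsub (Set.toFinite _)
  omega

lemma not_cellI_cellIII (hΔ : tropHypersurface S = singularSet p n)
    (hf : Module.finrank ℝ (dirSpace S f) = 2)
    (hroots : {b | shiftRoot b f ∈ singularSpace p n} = {b}) {C C' : Set (Fin (n + 1) → ℝ)}
    (hC : f ∈ C) (hC' : f ∈ C') (h : HasType p C ConeType.I) (h' : HasType p C' ConeType.III) :
    False := by
  obtain ⟨i, j, k, hij, hik, hjk, hI⟩ := h
  obtain ⟨i', j', k', l', nij, hij', nkl, hkl', hki', hIII⟩ := h'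
  obtain ⟨b₁, hb₁⟩ := hI f hC
  obtain ⟨b₂, hb₂⟩ := hIII f hC'
  have hs₁ : b₁ ∈ {b | shiftRoot b f ∈ singularSpace p n} :=
    mem_singularSpace_of_three hij hik hjk hb₁
  have hli' : ¬ SameClass p l' i' := fun h => hki' (hkl'.trans' h)
  have hs₂ : b₂ ∈ {b | shiftRoot b f ∈ singularSpace p n} := by
    rcases hb₂ with hb₂ | hb₂
    · exact mem_singularSpace_of_pairs nij hij' nkl hki' hli' hb₂
    · exact mem_singularSpace_of_pairs nkl hkl' nij (fun h => hki' h.symm')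
        (fun h => hki' (hij'.trans' h).symm') hb₂
  have hs := hs₁
  rw [hroots] at hs₁ hs₂
  obtain rfl : b₁ = b := hs₁
  obtain rfl : b₂ = b₁ := hs₂
  obtain ⟨hi, hj, hk⟩ := mem_argminOn_of_minAtThree hb₁
  have hc := (ncard_add_le_of_root hΔ hf hs
    (Or.inl ⟨isTri_of_three_classes hi hj hk hij hik hjk, rfl⟩)).2 rfl
  rcases hb₂ with hb₂ | hb₂
  · have := four_lt_ncard_of_pairs hi hj hk hij hik hjk nij hij' nkl hkl' hki' hb₂
    omega
  · have := four_lt_ncard_of_pairs hi hj hk hij hik hjk nkl hkl' nij hij' (fun h => hki' h.symm') hb₂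
    omega

lemma hasFourClasses_of_fourClassesI (hroots : {b | shiftRoot b f ∈ singularSpace p n} = {b})
    {C C' : Set (Fin (n + 1) → ℝ)} (hC : f ∈ C) (hC' : f ∈ C') (h : FourClassesI p C C') :
    HasFourClasses p (shiftRoot b f) := by
  obtain ⟨i, j, k, l, ⟨hij, hik, hjk, hI⟩, ⟨-, hil, hjl, hI'⟩, hkl⟩ := h
  obtain ⟨b₁, hb₁⟩ := hI f hC
  obtain ⟨b₂, hb₂⟩ := hI' f hC'
  have hs₁ : b₁ ∈ {b | shiftRoot b f ∈ singularSpace p n} :=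
    mem_singularSpace_of_three hij hik hjk hb₁
  have hs₂ : b₂ ∈ {b | shiftRoot b f ∈ singularSpace p n} :=
    mem_singularSpace_of_three hij hil hjl hb₂
  rw [hroots] at hs₁ hs₂
  obtain rfl : b₁ = b := hs₁
  obtain rfl : b₂ = b₁ := hs₂
  obtain ⟨hi, hj, hk⟩ := mem_argminOn_of_minAtThree hb₁
  obtain ⟨-, -, hl⟩ := mem_argminOn_of_minAtThree hb₂
  refine ⟨![i, j, k, l], fun r => by fin_cases r <;> assumption, fun r r' hr => ?_⟩
  fin_cases r <;> fin_cases r' <;>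
    first
    | exact absurd rfl hr
    | assumption
    | exact fun h => hij h.symm'
    | exact fun h => hik h.symm'
    | exact fun h => hjk h.symm'
    | exact fun h => hil h.symm'
    | exact fun h => hjl h.symm'
    | exact fun h => hkl h.symm'

lemma HasFourClasses.exists_tri (hΔ : tropHypersurface S = singularSet p n)
    (hf : Module.finrank ℝ (dirSpace S f) = 2) (hb : shiftRoot b f ∈ singularSpace p n)
    (h : HasFourClasses p (shiftRoot b f)) :
    ∃ e : Fin 4 → Fin (n + 1), IsTri p (shiftRoot b f) (argminOn Set.univ (shiftRoot b f)) ∧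
      argminOn Set.univ (shiftRoot b f) = Set.range e ∧
      ∀ r r', r ≠ r' → ¬ SameClass p (e r) (e r') := by
  obtain ⟨e, he, hcl⟩ := h
  have htri := isTri_of_three_classes (he 0) (he 1) (he 2) (hcl 0 1 (by decide))
    (hcl 0 2 (by decide)) (hcl 1 2 (by decide))
  exact ⟨e, htri, range_eq_of_ncard_le he
    ((ncard_add_le_of_root hΔ hf hb (Or.inl ⟨htri, rfl⟩)).2 rfl) hcl, hcl⟩

lemma fourClassesI_of_hasFourClasses (hΔ : tropHypersurface S = singularSet p n) (hS : S.Nonempty)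
    (hf : Module.finrank ℝ (dirSpace S f) = 2)
    (hroots : {b | shiftRoot b f ∈ singularSpace p n} = {b})
    (h : HasFourClasses p (shiftRoot b f)) {C C' : Set (Fin (n + 1) → ℝ)}
    (hC : IsMaximalCone (tropHypersurface S) C ∧ f ∈ C)
    (hC' : IsMaximalCone (tropHypersurface S) C' ∧ f ∈ C') (hne : C ≠ C') :
    FourClassesI p C C' := by
  have hb : shiftRoot b f ∈ singularSpace p n := by
    have : b ∈ {b | shiftRoot b f ∈ singularSpace p n} := hroots ▸ rfl
    exact this
  obtain ⟨e, htri, he, hcl⟩ := h.exists_tri hΔ hf hb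
  obtain ⟨-, -, K, hinj, hK, hray⟩ := exists_cones_of_four_classes hΔ hS hroots htri he hcl
  obtain ⟨r, rfl⟩ := (hK C).1 hC
  obtain ⟨r', rfl⟩ := (hK C').1 hC'
  have hrr : r ≠ r' := fun h => hne (h ▸ rfl)
  have hmem : ∀ r, e r ∈ argminOn Set.univ (shiftRoot b f) := fun r => he ▸ ⟨r, rfl⟩
  have hcell : ∀ r u v z : Fin 4, u ≠ r → v ≠ r → z ≠ r → u ≠ v → u ≠ z → v ≠ z →
      IsCellI p (K r) (e u) (e v) (e z) := by
    intro r u v z hu hv hz huv huz hvz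
    obtain ⟨t, ⟨h1, h2⟩, ht⟩ := ((hray r).and self_mem_nhdsWithin).exists
    have ht0 : (0 : ℝ) < t := ht
    rw [h2]
    have hval : ∀ m, shiftRoot b (f + t • Pi.single (e r) 1) m =
        shiftRoot b f m + t * (Pi.single (e r) 1 : Fin (n + 1) → ℝ) m := by
      intro m; simp only [shiftRoot, Pi.add_apply, Pi.smul_apply, smul_eq_mul]; ring
    have hval' : ∀ u, u ≠ r → shiftRoot b (f + t • Pi.single (e r) 1) (e u) =
        shiftRoot b f (e u) := by
      intro u hu
      rw [hval, Pi.single_eq_of_ne (SameClass.ne_of_not (hcl u r hu)), mul_zero, add_zero]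
    refine isCellI_minCone hΔ hS h1 (b := b) (hcl u v huv) (hcl u z huz) (hcl v z hvz) ⟨?_, ?_, ?_⟩
    · rw [hval' u hu, hval' v hv]; exact eq_of_mem_argminOn (hmem u) (hmem v)
    · rw [hval' v hv, hval' z hz]; exact eq_of_mem_argminOn (hmem v) (hmem z)
    · intro m
      rw [hval' u hu, hval]
      have h3 := (hmem u).2 m trivial
      have h4 : 0 ≤ (Pi.single (e r) 1 : Fin (n + 1) → ℝ) m := by
        by_cases hm : m = e r
        · rw [hm, Pi.single_eq_same]; exact zero_le_one
        · rw [Pi.single_eq_of_ne hm]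
      have := mul_nonneg ht0.le h4
      linarith
  have hex : ∀ r r' : Fin 4, r ≠ r' → ∃ u v, u ≠ v ∧ u ≠ r ∧ u ≠ r' ∧ v ≠ r ∧ v ≠ r' := by decide
  obtain ⟨u, v, huv, hur, hur', hvr, hvr'⟩ := hex r r' hrr
  exact ⟨e u, e v, e r', e r, hcell r u v r' hur hvr hrr.symm huv hur' hvr',
    hcell r' u v r hur' hvr' hrr huv hur hvr, hcl _ _ hrr.symm⟩

end adjacent

section adjacent
variable {p : ℕ} {K : Type*} [Field K] {v : AddValuation K (WithTop ℝ)} {n : ℕ}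
  {S : Finset (Module.Dual ℝ (Fin (n + 1) → ℝ))} {f : Fin (n + 1) → ℝ} {b : ℝ}

lemma conesWithFace_minCone (hX : tropDisc v n = tropHypersurface S) (hS : S.Nonempty) :
    conesWithFace v (minCone S f) = {D | IsMaximalCone (tropHypersurface S) D ∧ f ∈ D} := by
  ext D
  simp only [conesWithFace, hX, Set.mem_ofPred_eq]
  refine and_congr_right fun hD => ?_
  obtain ⟨a, -, rfl⟩ := (isMaximalCone_iff hS).1 hD
  exact isExposed_minCone_iff hS

lemma ncard_conesWithFace (hX : tropDisc v n = tropHypersurface S) (hS : S.Nonempty) {m : ℕ}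
    {w : Fin m → Fin (n + 1) → ℝ} (h : HasCones S f w) :
    (conesWithFace v (minCone S f)).ncard = m := by
  obtain ⟨C, hinj, hC, -⟩ := h
  rw [conesWithFace_minCone hX hS]
  have : {D | IsMaximalCone (tropHypersurface S) D ∧ f ∈ D} = Set.range C := by
    ext D
    exact (hC D).trans ⟨fun ⟨r, hr⟩ => ⟨r, hr.symm⟩, fun ⟨r, hr⟩ => ⟨r, hr.symm⟩⟩
  rw [this, Set.ncard_range_of_injective hinj, Nat.card_eq_fintype_card, Fintype.card_fin]

lemma hasCones_of_pair_roots (hΔ : tropHypersurface S = singularSet p n) (hS : S.Nonempty)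
    (hf : Module.finrank ℝ (dirSpace S f) = 2) {b₁ b₂ : ℝ} (hlt : b₁ < b₂)
    (hroots : {b | shiftRoot b f ∈ singularSpace p n} = {b₁, b₂}) :
    (∀ x ∈ starSet p f, -x ∈ starSet p f) ∧ ∃ w : Fin 4 → Fin (n + 1) → ℝ, HasCones S f w := by
  have hb₁ : shiftRoot b₁ f ∈ singularSpace p n := by
    have : b₁ ∈ {b | shiftRoot b f ∈ singularSpace p n} := hroots ▸ (by simp)
    exact this
  have hb₂ : shiftRoot b₂ f ∈ singularSpace p n := by
    have : b₂ ∈ {b | shiftRoot b f ∈ singularSpace p n} := hroots ▸ (by simp)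
    exact this
  obtain ⟨M₁, N₁, h₁⟩ := exists_isRootType hb₁
  obtain ⟨M₂, N₂, h₂⟩ := exists_isRootType hb₂
  obtain ⟨s₁, s₂⟩ := isSimple_of_two_roots hΔ hf hlt hb₁ hb₂ h₁ h₂
  obtain ⟨hsym, -, w, -, -, h⟩ := exists_cones_of_two_roots hΔ hS hlt hroots h₁ h₂ s₁ s₂
  exact ⟨hsym, w, h⟩

lemma pair_roots_of_minSet_eq (hX : tropDisc v n = tropHypersurface S)
    (hΔ : tropHypersurface S = singularSet p n) (hS : S.Nonempty)
    (hf : Module.finrank ℝ (dirSpace S f) = 2) {b₁ b₂ : ℝ} (hlt : b₁ < b₂)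
    (hroots : {b | shiftRoot b f ∈ singularSpace p n} = {b₁, b₂}) {g : Fin (n + 1) → ℝ}
    (hg : minSet S g = minSet S f) (hroots' : {b | shiftRoot b g ∈ singularSpace p n} = {b}) :
    False := by
  have hb : shiftRoot b g ∈ singularSpace p n := by
    have : b ∈ {b | shiftRoot b g ∈ singularSpace p n} := hroots' ▸ rfl
    exact this
  obtain ⟨hsym, w, hw⟩ := hasCones_of_pair_roots hΔ hS hf hlt hroots
  have hg2 : Module.finrank ℝ (dirSpace S g) = 2 := dirSpace_congr hg ▸ hf
  by_cases h4 : HasFourClasses p (shiftRoot b g)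
  · obtain ⟨e, htri, he, hcl⟩ := h4.exists_tri hΔ hg2 hb
    obtain ⟨⟨x, hx, hx'⟩, -⟩ := exists_cones_of_four_classes hΔ hS hroots' htri he hcl
    rw [starSet_congr hΔ hg] at hx hx'
    exact hx' (hsym x hx)
  · obtain ⟨w', hw'⟩ := hasCones_of_not_hasFourClasses hΔ hS hg2 hroots' h4
    have h1 := ncard_conesWithFace hX hS hw
    have h2 := ncard_conesWithFace hX hS hw'
    rw [minCone_congr hg, h1] at h2
    omega

variable (p) in
/-- The structure of the discriminant along the intersection of adjacent maximal cones. -/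
theorem areAdjacent_structure (hX : tropDisc v n = tropHypersurface S)
    (hΔ : tropHypersurface S = singularSet p n) (hS : S.Nonempty)
    (hroots : ∀ f : Fin (n + 1) → ℝ, doubleRoots v f = {b | shiftRoot b f ∈ singularSpace p n})
    {C₁ C₂ : Set (Fin (n + 1) → ℝ)} (h : AreAdjacent v C₁ C₂) :
    (intrinsicInterior ℝ (C₁ ∩ C₂)).Nonempty ∧
      (TwoRoots v (C₁ ∩ C₂) ∨ OneRoot v (C₁ ∩ C₂)) ∧
      (TwoRoots v (C₁ ∩ C₂) → (conesWithFace v (C₁ ∩ C₂)).ncard = 4) ∧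
      (OneRoot v (C₁ ∩ C₂) →
        ¬ (HasType p C₁ ConeType.I ∧ HasType p C₂ ConeType.III) ∧
        ¬ (HasType p C₁ ConeType.III ∧ HasType p C₂ ConeType.I) ∧
        (FourClassesI p C₁ C₂ → (conesWithFace v (C₁ ∩ C₂)).ncard = 4) ∧
        (¬ FourClassesI p C₁ C₂ → (conesWithFace v (C₁ ∩ C₂)).ncard = 3)) := by
  obtain ⟨m₁, m₂, hne, hdim⟩ := h
  rw [hX] at m₁ m₂
  obtain ⟨a₁, ha₁, hC₁⟩ := (isMaximalCone_iff hS).1 m₁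
  obtain ⟨a₂, ha₂, hC₂⟩ := (isMaximalCone_iff hS).1 m₂
  obtain ⟨f, hf⟩ := exists_inter_eq_minCone hS a₁ a₂
  rw [← hC₁, ← hC₂] at hf
  have hfD : f ∈ C₁ ∩ C₂ := hf ▸ mem_minCone_self
  rw [hf, span_minCone] at hdim
  have hf2 : Module.finrank ℝ (dirSpace S f) = 2 := by
    have := finrank_dirSpace_add S f
    omega
  rw [hf]
  have hint : intrinsicInterior ℝ (minCone S f) = {b | minSet S b = minSet S f} :=
    intrinsicInterior_minCone hS
  have hfint : f ∈ intrinsicInterior ℝ (minCone S f) := by rw [hint]; rfl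
  refine ⟨⟨f, hfint⟩, ?_, fun h2 => ?_, fun h1 => ?_⟩
  · rcases roots_eq_singleton_or_pair hΔ hf2 with ⟨b, hb⟩ | ⟨b₁, b₂, hlt, hb⟩
    · right
      intro g hg
      rw [hint] at hg
      rw [hroots]
      rcases roots_eq_singleton_or_pair hΔ (dirSpace_congr hg.out ▸ hf2) with h | ⟨c₁, c₂, hc, h⟩
      · exact h
      · exact (pair_roots_of_minSet_eq hX hΔ hS (dirSpace_congr hg.out ▸ hf2) hc h
          hg.out.symm hb).elim
    · left
      intro g hg
      rw [hint] at hg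
      rw [hroots]
      rcases roots_eq_singleton_or_pair hΔ (dirSpace_congr hg.out ▸ hf2) with ⟨c, h⟩ | ⟨c₁, c₂, hc, h⟩
      · exact (pair_roots_of_minSet_eq hX hΔ hS hf2 hlt hb hg.out h).elim
      · exact ⟨c₁, c₂, hc.ne, h⟩
  · obtain ⟨b₁, b₂, hb12, hb⟩ := h2 f hfint
    rw [hroots] at hb
    rcases roots_eq_singleton_or_pair hΔ hf2 with ⟨c, hc⟩ | ⟨c₁, c₂, hlt, hc⟩
    · rw [hc] at hb
      have e1 : b₁ ∈ ({c} : Set ℝ) := hb ▸ (by simp)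
      have e2 : b₂ ∈ ({c} : Set ℝ) := hb ▸ (by simp)
      exact absurd (e1.trans e2.symm) hb12
    · obtain ⟨-, w, hw⟩ := hasCones_of_pair_roots hΔ hS hf2 hlt hc
      exact ncard_conesWithFace hX hS hw
  · obtain ⟨b, hb⟩ := h1 f hfint
    rw [hroots] at hb
    have hbf : shiftRoot b f ∈ singularSpace p n := by
      have : b ∈ {b | shiftRoot b f ∈ singularSpace p n} := hb ▸ rfl
      exact this
    refine ⟨fun h => not_cellI_cellIII hΔ hf2 hb hfD.1 hfD.2 h.1 h.2,
      fun h => not_cellI_cellIII hΔ hf2 hb hfD.2 hfD.1 h.2 h.1, fun h => ?_, fun h => ?_⟩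
    · obtain ⟨e, htri, he, hcl⟩ :=
        (hasFourClasses_of_fourClassesI hb hfD.1 hfD.2 h).exists_tri hΔ hf2 hbf
      obtain ⟨-, -, hw⟩ := exists_cones_of_four_classes hΔ hS hb htri he hcl
      exact ncard_conesWithFace hX hS (w := fun r => Pi.single (e r) 1) hw
    · obtain ⟨w, hw⟩ := hasCones_of_not_hasFourClasses hΔ hS hf2 hb fun h4 =>
        h (fourClassesI_of_hasFourClasses hΔ hS hf2 hb h4 ⟨m₁, hfD.1⟩ ⟨m₂, hfD.2⟩ hne)
      exact ncard_conesWithFace hX hS hw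

end adjacent

/-! ### Construction of adjacent cones -/

section construction
variable {p : ℕ} {K : Type*} [Field K] {v : AddValuation K (WithTop ℝ)} {n : ℕ}
  {S : Finset (Module.Dual ℝ (Fin (n + 1) → ℝ))} {f : Fin (n + 1) → ℝ}

lemma areAdjacent_of_finrank_eq_two (hX : tropDisc v n = tropHypersurface S) (hS : S.Nonempty)
    (hf : Module.finrank ℝ (dirSpace S f) = 2) {C C' : Set (Fin (n + 1) → ℝ)}
    (hC : IsMaximalCone (tropHypersurface S) C ∧ f ∈ C)
    (hC' : IsMaximalCone (tropHypersurface S) C' ∧ f ∈ C') (hne : C ≠ C') :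
    AreAdjacent v C C' ∧ f ∈ intrinsicInterior ℝ (C ∩ C') := by
  have hD := inter_eq_minCone hf hS hC.1 hC'.1 hC.2 hC'.2 hne
  refine ⟨⟨hX ▸ hC.1, hX ▸ hC'.1, hne, ?_⟩, ?_⟩
  · rw [hD, span_minCone]
    have := finrank_dirSpace_add S f
    omega
  · rw [hD, intrinsicInterior_minCone hS]
    rfl

lemma eventually_argminOn_ray {α : Type*} {A : Set α} (hA : A.Finite) (w y : α → ℝ) :
    ∀ᶠ t in 𝓝[>] (0 : ℝ), argminOn A (fun i => w i + t * y i) = argminOn (argminOn A w) y := by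
  have := argminOn_eventually_eq hA (l := 𝓝[>] (0 : ℝ)) (φ := fun t i => w i + t * y i) (w := w)
    fun i _ => by
      have hc : Continuous fun t : ℝ => w i + t * y i := by fun_prop
      simpa using (hc.tendsto 0).mono_left nhdsWithin_le_nhds
  filter_upwards [this, self_mem_nhdsWithin] with t ht ht0
  rw [ht, argminOn_add_argminOn, argminOn_smul ht0]

lemma shiftRoot_add_smul (b s t : ℝ) (f x : Fin (n + 1) → ℝ) :
    shiftRoot (b + t * s) (f + t • x) = fun i => shiftRoot b f i + t * shiftRoot s x i := by
  ext i; simp only [shiftRoot, Pi.add_apply, Pi.smul_apply, smul_eq_mul]; ring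

section ray
variable {C : Set (Fin (n + 1) → ℝ)} {x : Fin (n + 1) → ℝ} {b s : ℝ} {i j k l : Fin (n + 1)}

lemma hasType_I_of_ray (hΔ : tropHypersurface S = singularSet p n) (hS : S.Nonempty)
    (hray : ∀ᶠ t in 𝓝[>] (0 : ℝ),
      Module.finrank ℝ (dirSpace S (f + t • x)) = 1 ∧ C = minCone S (f + t • x))
    (hij : ¬ SameClass p i j) (hik : ¬ SameClass p i k) (hjk : ¬ SameClass p j k)
    (hi : i ∈ argminOn (argminOn Set.univ (shiftRoot b f)) (shiftRoot s x))
    (hj : j ∈ argminOn (argminOn Set.univ (shiftRoot b f)) (shiftRoot s x))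
    (hk : k ∈ argminOn (argminOn Set.univ (shiftRoot b f)) (shiftRoot s x)) :
    HasType p C ConeType.I := by
  obtain ⟨t, ⟨h1, rfl⟩, h2⟩ := (hray.and
    (eventually_argminOn_ray Set.finite_univ (shiftRoot b f) (shiftRoot s x))).exists
  rw [← h2, ← shiftRoot_add_smul] at hi hj hk
  exact ⟨i, j, k, isCellI_minCone hΔ hS h1 hij hik hjk
    ⟨eq_of_mem_argminOn hi hj, eq_of_mem_argminOn hj hk, fun m => hi.2 m trivial⟩⟩

lemma exists_minAtPairs_of_ray (hray : ∀ᶠ t in 𝓝[>] (0 : ℝ),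
      Module.finrank ℝ (dirSpace S (f + t • x)) = 1 ∧ C = minCone S (f + t • x))
    (hi : i ∈ argminOn (argminOn Set.univ (shiftRoot b f)) (shiftRoot s x))
    (hj : j ∈ argminOn (argminOn Set.univ (shiftRoot b f)) (shiftRoot s x))
    (hk : k ∈ argminOn (argminOn {m | ¬ SameClass p m i} (shiftRoot b f)) (shiftRoot s x))
    (hl : l ∈ argminOn (argminOn {m | ¬ SameClass p m i} (shiftRoot b f)) (shiftRoot s x))
    (hlt : shiftRoot b f i < shiftRoot b f k ∨
      (shiftRoot b f i = shiftRoot b f k ∧ shiftRoot s x i < shiftRoot s x k)) :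
    ∃ a b', Module.finrank ℝ (dirSpace S a) = 1 ∧ C = minCone S a ∧
      shiftRoot b' a ∈ minAtPairs p i j k l ∧ shiftRoot b' a i < shiftRoot b' a k := by
  have hlt' : ∀ᶠ t in 𝓝[>] (0 : ℝ), shiftRoot b f i + t * shiftRoot s x i <
      shiftRoot b f k + t * shiftRoot s x k := by
    rcases hlt with h | ⟨h, h'⟩
    · refine Filter.Eventually.filter_mono nhdsWithin_le_nhds ?_
      have c1 : Continuous fun t : ℝ => shiftRoot b f i + t * shiftRoot s x i := by fun_prop
      have c2 : Continuous fun t : ℝ => shiftRoot b f k + t * shiftRoot s x k := by fun_prop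
      exact c1.continuousAt.eventually_lt c2.continuousAt (by simpa using h)
    · filter_upwards [self_mem_nhdsWithin] with t ht
      have ht' : (0 : ℝ) < t := ht
      rw [h]
      have := mul_lt_mul_of_pos_left h' ht'
      linarith
  obtain ⟨t, ⟨⟨⟨h1, h1'⟩, h2⟩, h3⟩, h4⟩ := (((hray.and
    (eventually_argminOn_ray Set.finite_univ (shiftRoot b f) (shiftRoot s x))).and
    (eventually_argminOn_ray (Set.toFinite {m | ¬ SameClass p m i}) (shiftRoot b f)
      (shiftRoot s x))).and hlt').exists
  rw [← h2] at hi hj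
  rw [← h3] at hk hl
  rw [← shiftRoot_add_smul] at hi hj hk hl
  refine ⟨_, b + t * s, h1, h1', ⟨eq_of_mem_argminOn hi hj, fun m => hi.2 m trivial,
    eq_of_mem_argminOn hk hl, fun m hm => hk.2 m hm⟩, ?_⟩
  rw [shiftRoot_add_smul]
  exact h4

end ray

end construction

/-! ### Blocks -/

section blocks
variable {p n q : ℕ} {w : Fin (n + 1) → ℝ} {M N : Finset ℕ}

/-- The monomials `X ^ (q + a)` with `a ∈ A`. -/
def blockSet (n q : ℕ) (A : Finset ℕ) : Set (Fin (n + 1)) := {m | ∃ a ∈ A, (m : ℕ) = q + a}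

/-- The values of `w` are lowest at the exponents in `q + M`, second lowest at those in `q + N`. -/
structure IsBlock (w : Fin (n + 1) → ℝ) (q : ℕ) (M N : Finset ℕ) (κ : ℝ) : Prop where
  left : ∀ m ∈ blockSet n q M, w m = κ
  right : ∀ m ∈ blockSet n q N, w m = κ + 1
  rest : ∀ m, m ∉ blockSet n q M → m ∉ blockSet n q N → κ + 2 ≤ w m

variable {κ : ℝ}

lemma IsBlock.le (h : IsBlock w q M N κ) (m : Fin (n + 1)) : κ ≤ w m := by
  by_cases hM : m ∈ blockSet n q M
  · exact (h.left m hM).ge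
  by_cases hN : m ∈ blockSet n q N
  · rw [h.right m hN]; linarith
  · linarith [h.rest m hM hN]

lemma IsBlock.argminOn_univ (h : IsBlock w q M N κ) (hM : (blockSet n q M).Nonempty) :
    argminOn Set.univ w = blockSet n q M := by
  obtain ⟨i, hi⟩ := hM
  ext m
  constructor
  · intro hm
    by_contra hmM
    have h1 := hm.2 i trivial
    rw [h.left i hi] at h1
    by_cases hN : m ∈ blockSet n q N
    · rw [h.right m hN] at h1; linarith
    · linarith [h.rest m hmM hN]
  · exact fun hm => ⟨trivial, fun m' _ => (h.left m hm).trans_le (h.le m')⟩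

lemma IsBlock.argminOn_compl (h : IsBlock w q M N κ) {r : Fin (n + 1)}
    (hM : ∀ m ∈ blockSet n q M, SameClass p m r) (hN : ∀ m ∈ blockSet n q N, ¬ SameClass p m r)
    (hne : (blockSet n q N).Nonempty) :
    argminOn {m | ¬ SameClass p m r} w = blockSet n q N := by
  obtain ⟨k, hk⟩ := hne
  ext m
  constructor
  · intro hm
    by_contra hmN
    have h1 := hm.2 k (hN k hk)
    rw [h.right k hk] at h1
    linarith [h.rest m (fun hmM => hm.1 (hM m hmM)) hmN]
  · refine fun hm => ⟨hN m hm, fun m' hm' => ?_⟩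
    rw [h.right m hm]
    have hmM : m' ∉ blockSet n q M := fun h' => hm' (hM m' h')
    by_cases hmN : m' ∈ blockSet n q N
    · exact (h.right m' hmN).ge
    · linarith [h.rest m' hmM hmN]

lemma IsBlock.isPair (h : IsBlock w q M N κ) {r : Fin (n + 1)} (hr : r ∈ blockSet n q M)
    (hM : ∀ m ∈ blockSet n q M, SameClass p m r) (hN : ∀ m ∈ blockSet n q N, ¬ SameClass p m r)
    (h1 : (blockSet n q M).Nontrivial) (h2 : (blockSet n q N).Nontrivial) :
    IsPair p w r (blockSet n q M) (blockSet n q N) := by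
  refine ⟨?_, (h.argminOn_compl hM hN h2.nonempty).symm, h1, h2, fun i hi j hj => ?_,
    fun i hi j hj hij => ?_⟩
  · rw [argminOn_inter_of_nonempty (S := Set.univ), h.argminOn_univ h1.nonempty]
    · exact (Set.inter_eq_left.2 hM).symm
    · rw [h.argminOn_univ h1.nonempty]
      exact ⟨r, hr, SameClass.refl' r⟩
    · exact Set.subset_univ _
  · rw [h.left i hi]; exact h.le j
  · rw [h.left i hi, h.right j hj] at hij
    linarith

lemma sameClass_iff {i j : Fin (n + 1)} {a c : ℕ} (hi : (i : ℕ) = q + a) (hj : (j : ℕ) = q + c) :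
    SameClass p i j ↔ a ≡ c [MOD p] := by
  rw [SameClass, hi, hj]
  exact ⟨fun h => Nat.ModEq.add_left_cancel' q h, fun h => h.add_left q⟩

end blocks

/-! ### Polynomials with prescribed double roots -/

section poly
variable {M N M' N' : Finset ℕ} {L L' : ℕ}

/-- The values `0`, `1`, `2` on `M`, on `N` and elsewhere. -/
noncomputable def level (M N : Finset ℕ) (m : ℕ) : ℝ := if m ∈ M then 0 else if m ∈ N then 1 else 2

/-- The levels of `M` and `N` up to `L`, continued by a strictly convex function. -/
noncomputable def blockFun (M N : Finset ℕ) (L m : ℕ) : ℝ :=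
  if m ≤ L then level M N m else ((m : ℝ) - L) * ((m : ℝ) - L + 2)

/-- Two blocks, the second one sheared. -/
noncomputable def twoBlockFun (M N M' N' : Finset ℕ) (L L' m : ℕ) : ℝ :=
  if m ≤ L then level M N m else
    3 + 6 * ((m : ℝ) - (L + 1 : ℕ)) + blockFun M' N' L' (m - (L + 1))

lemma level_nonneg (m : ℕ) : 0 ≤ level M N m := by
  unfold level; split_ifs <;> norm_num

lemma level_of_mem {m : ℕ} (h : m ∈ M) : level M N m = 0 := if_pos h

lemma blockFun_of_ge (hL : L ∈ M) {m : ℕ} (h : L ≤ m) :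
    blockFun M N L m = ((m : ℝ) - L) * ((m : ℝ) - L + 2) := by
  unfold blockFun
  split_ifs with h'
  · obtain rfl : m = L := le_antisymm h' h
    rw [level_of_mem hL, sub_self, zero_mul]
  · rfl

lemma three_le_blockFun {m : ℕ} (h : L < m) : 3 ≤ blockFun M N L m := by
  rw [blockFun, if_neg (not_le.2 h)]
  have : (L : ℝ) + 1 ≤ m := by exact_mod_cast h
  nlinarith

lemma blockFun_nonneg (m : ℕ) : 0 ≤ blockFun M N L m := by
  rcases le_or_gt m L with h | h
  · rw [blockFun, if_pos h]; exact level_nonneg m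
  · exact le_trans (by norm_num) (three_le_blockFun h)

lemma eq_zero_of_argmin_blockFun (h0 : 0 ∈ M) (hL : L ∈ M) {n i j : ℕ} {b : ℝ} (hn : L ≤ n)
    (hj : j ≤ n) (hij : i + 2 ≤ j)
    (hmin : ∀ m ≤ n, blockFun M N L i + i * b ≤ blockFun M N L m + m * b)
    (heq : blockFun M N L i + i * b = blockFun M N L j + j * b) : b = 0 := by
  have hF0 : blockFun M N L 0 = 0 := by rw [blockFun, if_pos (Nat.zero_le _), level_of_mem h0]
  have hFL : blockFun M N L L = 0 := by rw [blockFun, if_pos le_rfl, level_of_mem hL]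
  have hijr : (i : ℝ) + 2 ≤ j := by exact_mod_cast hij
  have hi0 : (0 : ℝ) ≤ i := Nat.cast_nonneg i
  have hb : b ≤ 0 := by
    have h1 := hmin 0 (Nat.zero_le _)
    rw [heq, hF0] at h1
    have h2 := blockFun_nonneg (M := M) (N := N) (L := L) j
    simp only [Nat.cast_zero, zero_mul, add_zero] at h1
    by_contra hcon
    push Not at hcon
    have : 0 < (j : ℝ) * b := mul_pos (by linarith) hcon
    linarith
  by_contra hb0
  have hb' : b < 0 := lt_of_le_of_ne hb hb0
  have hLi : L ≤ i := by
    by_contra hcon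
    push Not at hcon
    have h1 := hmin L hn
    rw [hFL] at h1
    have h2 := blockFun_nonneg (M := M) (N := N) (L := L) i
    have h3 : (i : ℝ) < L := by exact_mod_cast hcon
    nlinarith
  have hLir : (L : ℝ) ≤ i := by exact_mod_cast hLi
  have h1 := hmin (i + 1) (by omega)
  rw [blockFun_of_ge hL hLi, blockFun_of_ge hL (hLi.trans (Nat.le_succ i))] at h1
  rw [blockFun_of_ge hL hLi, blockFun_of_ge hL (by omega)] at heq
  push_cast at h1
  have h2 : ((j : ℝ) - i) * ((i : ℝ) - L + ((j : ℝ) - L) + 2 + b) = 0 := by linarith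
  have h3 := (mul_eq_zero.1 h2).resolve_left (by linarith)
  linarith

lemma eq_of_argmin_twoBlockFun (h0 : 0 ∈ M) (hL : L ∈ M) (h0' : 0 ∈ M') (hL' : L' ∈ M')
    {n i j : ℕ} {b : ℝ} (hn : L + 1 + L' ≤ n) (hj : j ≤ n) (hij : i + 2 ≤ j)
    (hmin : ∀ m ≤ n, twoBlockFun M N M' N' L L' i + i * b ≤ twoBlockFun M N M' N' L L' m + m * b)
    (heq : twoBlockFun M N M' N' L L' i + i * b = twoBlockFun M N M' N' L L' j + j * b) :
    b = 0 ∨ b = -6 := by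
  set F := twoBlockFun M N M' N' L L' with hF
  have hlow : ∀ m, m ≤ L → F m = level M N m := fun m hm => by rw [hF, twoBlockFun, if_pos hm]
  have hhigh : ∀ m, F (L + 1 + m) = 3 + 6 * (m : ℝ) + blockFun M' N' L' m := fun m => by
    rw [hF, twoBlockFun, if_neg (by omega), Nat.add_sub_cancel_left, Nat.cast_add,
      add_sub_cancel_left]
  have hF0 : F 0 = 0 := by rw [hlow 0 (Nat.zero_le _), level_of_mem h0]
  have hFL : F L = 0 := by rw [hlow L le_rfl, level_of_mem hL]
  have hnn : ∀ m, 0 ≤ F m := by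
    intro m
    rcases le_or_gt m L with h | h
    · rw [hlow m h]; exact level_nonneg m
    · obtain ⟨a, rfl⟩ := Nat.exists_eq_add_of_le (show L + 1 ≤ m from h)
      rw [hhigh]
      have := blockFun_nonneg (M := M') (N := N') (L := L') a
      positivity
  have hijr : (i : ℝ) + 2 ≤ j := by exact_mod_cast hij
  have hi0 : (0 : ℝ) ≤ i := Nat.cast_nonneg i
  have hb : b ≤ 0 := by
    have h1 := hmin 0 (Nat.zero_le _)
    rw [heq, hF0] at h1
    have h2 := hnn j
    simp only [Nat.cast_zero, zero_mul, add_zero] at h1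
    by_contra hcon
    push Not at hcon
    have : 0 < (j : ℝ) * b := mul_pos (by linarith) hcon
    linarith
  by_contra hcon
  push Not at hcon
  have hb' : b < 0 := lt_of_le_of_ne hb hcon.1
  have hLi : L ≤ i := by
    by_contra hcon
    push Not at hcon
    have h1 := hmin L (by omega)
    rw [hFL] at h1
    have h2 := hnn i
    have h3 : (i : ℝ) < L := by exact_mod_cast hcon
    nlinarith
  obtain ⟨j', rfl⟩ := Nat.exists_eq_add_of_le (show L + 1 ≤ j by omega)
  have hq := hmin (L + 1 + 0) (by omega)
  have hB0 : blockFun M' N' L' 0 = 0 := by rw [blockFun, if_pos (Nat.zero_le _), level_of_mem h0']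
  rw [hhigh, hB0] at hq
  push_cast at hq hijr
  have hj1 : (1 : ℝ) ≤ j' := by exact_mod_cast (show 1 ≤ j' by omega)
  have hjn := blockFun_nonneg (M := M') (N := N') (L := L') j'
  have heq' := heq
  rw [hhigh] at heq'
  push_cast at heq'
  rcases lt_or_gt_of_ne hcon.2 with h6 | h6
  · rcases hLi.eq_or_lt with rfl | hLi
    · rw [hFL] at hq
      linarith
    · obtain ⟨i', rfl⟩ := Nat.exists_eq_add_of_le (show L + 1 ≤ i from hLi)
      rw [hhigh] at heq'
      push_cast at heq'
      have := eq_zero_of_argmin_blockFun (M := M') (N := N') (L := L') (n := n - (L + 1)) (i := i')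
        (j := j') (b := b + 6) h0' hL' (by omega) (by omega) (by omega) (fun m hm => by
          have h1 := hmin (L + 1 + m) (by omega)
          rw [hhigh, hhigh] at h1
          push_cast at h1
          linarith) (by linarith)
      linarith
  · nlinarith

end poly

/-! ### Existence of adjacent cones of given types -/

section configurations
variable {p n q : ℕ} {S : Finset (Module.Dual ℝ (Fin (n + 1) → ℝ))} {f w : Fin (n + 1) → ℝ}
  {b κ : ℝ}

lemma IsRootType.mem_singularSpace {M N : Set (Fin (n + 1))} (h : IsRootType p w M N) :
    w ∈ singularSpace p n := by
  rcases h with ⟨h, -⟩ | ⟨r, h⟩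
  · obtain ⟨i, hi, j, hj, k, hk, hij, hik, hjk⟩ := h.three
    rw [h.eq] at hi hj hk
    exact mem_singularSpace_of_three hij hik hjk
      ⟨eq_of_mem_argminOn hi hj, eq_of_mem_argminOn hj hk, fun m => hi.2 m trivial⟩
  · intro t
    by_cases ht : SameClass p t r
    · rw [h.argminOn_eq_right ht]; exact h.nontrivN
    · rcases h.argminOn_cases ht with e | ⟨-, e⟩
      · rw [e]; exact h.nontrivM
      · rw [e]; exact h.nontrivM.mono Set.subset_union_left

/-- At a double root the minimum is attained at two monomials that are not consecutive. -/
lemma exists_far_argmin (hp : 2 < p) (hw : w ∈ singularSpace p n) :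
    ∃ i ∈ argminOn Set.univ w, ∃ j ∈ argminOn Set.univ w, (i : ℕ) + 2 ≤ (j : ℕ) := by
  have key : ∀ i ∈ argminOn Set.univ w, ∀ j ∈ argminOn Set.univ w,
      ((i : ℕ) + 2 ≤ j ∨ (j : ℕ) + 2 ≤ i) →
      ∃ i ∈ argminOn Set.univ w, ∃ j ∈ argminOn Set.univ w, (i : ℕ) + 2 ≤ (j : ℕ) := by
    rintro i hi j hj (h | h)
    · exact ⟨i, hi, j, hj, h⟩
    · exact ⟨j, hj, i, hi, h⟩
  rcases isTri_or_isPair hw with ⟨M, h⟩ | ⟨r, M, N, h⟩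
  · obtain ⟨i, hi, j, hj, k, hk, hij, hik, hjk⟩ := h.three
    rw [h.eq] at hi hj hk
    have nij := Fin.val_ne_of_ne (SameClass.ne_of_not hij)
    have nik := Fin.val_ne_of_ne (SameClass.ne_of_not hik)
    have njk := Fin.val_ne_of_ne (SameClass.ne_of_not hjk)
    by_contra hcon
    have h1 : ¬ ((i : ℕ) + 2 ≤ j ∨ (j : ℕ) + 2 ≤ i) := fun h => hcon (key i hi j hj h)
    have h2 : ¬ ((i : ℕ) + 2 ≤ k ∨ (k : ℕ) + 2 ≤ i) := fun h => hcon (key i hi k hk h)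
    have h3 : ¬ ((j : ℕ) + 2 ≤ k ∨ (k : ℕ) + 2 ≤ j) := fun h => hcon (key j hj k hk h)
    omega
  · obtain ⟨i, hi, j, hj, hij⟩ := h.nontrivM
    have nij := Fin.val_ne_of_ne hij
    have hc := (h.class_of_mem hi).trans' (h.class_of_mem hj).symm'
    refine key i (h.mem_argminOn_univ hi) j (h.mem_argminOn_univ hj) ?_
    rcases lt_or_gt_of_ne nij with hlt | hlt
    · have := Nat.le_of_dvd (by omega) ((Nat.modEq_iff_dvd' hlt.le).1 hc)
      omega
    · have := Nat.le_of_dvd (by omega) ((Nat.modEq_iff_dvd' hlt.le).1 hc.symm')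
      omega

/-- The monomial `X ^ (q + a)`. -/
def expo (q a : ℕ) (h : q + a ≤ n) : Fin (n + 1) := ⟨q + a, Nat.lt_succ_of_le h⟩

lemma expo_sameClass {a c : ℕ} (ha : q + a ≤ n) (hc : q + c ≤ n) :
    SameClass p (expo q a ha) (expo q c hc) ↔ a % p = c % p := sameClass_iff rfl rfl

lemma expo_injective {a c : ℕ} (ha : q + a ≤ n) (hc : q + c ≤ n) :
    expo q a ha = expo q c hc ↔ a = c := by
  rw [expo, expo, Fin.mk.injEq]; omega

lemma eq_expo_iff {a : ℕ} (ha : q + a ≤ n) {m : Fin (n + 1)} :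
    m = expo q a ha ↔ (m : ℕ) = q + a := Fin.ext_iff

lemma blockSet_pair {a c : ℕ} (ha : q + a ≤ n) (hc : q + c ≤ n) :
    blockSet n q {a, c} = {expo q a ha, expo q c hc} := by
  ext m; simp [blockSet, eq_expo_iff]

lemma blockSet_triple {a c d : ℕ} (ha : q + a ≤ n) (hc : q + c ≤ n) (hd : q + d ≤ n) :
    blockSet n q {a, c, d} = {expo q a ha, expo q c hc, expo q d hd} := by
  ext m; simp [blockSet, eq_expo_iff]

lemma blockSet_quadruple {a c d e : ℕ} (ha : q + a ≤ n) (hc : q + c ≤ n) (hd : q + d ≤ n)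
    (he : q + e ≤ n) :
    blockSet n q {a, c, d, e} = {expo q a ha, expo q c hc, expo q d hd, expo q e he} := by
  ext m; simp [blockSet, eq_expo_iff]

lemma shiftRoot_zero (f : Fin (n + 1) → ℝ) : shiftRoot 0 f = f := by
  ext i; simp [shiftRoot]

lemma mem_argminOn_of_eq_zero {α : Type*} {A : Set α} {y : α → ℝ} {i : α} (hi : i ∈ A)
    (h0 : y i = 0) (hy : ∀ m, 0 ≤ y m) : i ∈ argminOn A y :=
  ⟨hi, fun m _ => h0 ▸ hy m⟩

lemma single_one_nonneg (i m : Fin (n + 1)) : 0 ≤ (Pi.single i 1 : Fin (n + 1) → ℝ) m := by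
  by_cases h : m = i
  · rw [h, Pi.single_eq_same]; exact zero_le_one
  · rw [Pi.single_eq_of_ne h]

section ray
variable {C : Set (Fin (n + 1) → ℝ)} {x : Fin (n + 1) → ℝ} {s : ℝ} {i j k l : Fin (n + 1)}

lemma hasType_II_of_ray (hΔ : tropHypersurface S = singularSet p n) (hS : S.Nonempty)
    (hray : ∀ᶠ t in 𝓝[>] (0 : ℝ),
      Module.finrank ℝ (dirSpace S (f + t • x)) = 1 ∧ C = minCone S (f + t • x))
    (nij : i ≠ j) (hij : SameClass p i j) (hki : ¬ SameClass p k i) (hli : ¬ SameClass p l i)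
    (hkl : ¬ SameClass p k l)
    (hi : i ∈ argminOn (argminOn Set.univ (shiftRoot b f)) (shiftRoot s x))
    (hj : j ∈ argminOn (argminOn Set.univ (shiftRoot b f)) (shiftRoot s x))
    (hk : k ∈ argminOn (argminOn {m | ¬ SameClass p m i} (shiftRoot b f)) (shiftRoot s x))
    (hl : l ∈ argminOn (argminOn {m | ¬ SameClass p m i} (shiftRoot b f)) (shiftRoot s x))
    (hlt : shiftRoot b f i < shiftRoot b f k ∨
      (shiftRoot b f i = shiftRoot b f k ∧ shiftRoot s x i < shiftRoot s x k)) :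
    HasType p C ConeType.II := by
  obtain ⟨a, b', h1, rfl, h2, h3⟩ := exists_minAtPairs_of_ray hray hi hj hk hl hlt
  exact ⟨i, j, k, l, isCellII_minCone hΔ hS h1 nij hij hki hli hkl h2 h3⟩

lemma hasType_III_of_ray (hΔ : tropHypersurface S = singularSet p n) (hS : S.Nonempty)
    (hray : ∀ᶠ t in 𝓝[>] (0 : ℝ),
      Module.finrank ℝ (dirSpace S (f + t • x)) = 1 ∧ C = minCone S (f + t • x))
    (nij : i ≠ j) (nkl : k ≠ l) (hij : SameClass p i j) (hki : ¬ SameClass p k i)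
    (hkl : SameClass p k l)
    (hi : i ∈ argminOn (argminOn Set.univ (shiftRoot b f)) (shiftRoot s x))
    (hj : j ∈ argminOn (argminOn Set.univ (shiftRoot b f)) (shiftRoot s x))
    (hk : k ∈ argminOn (argminOn {m | ¬ SameClass p m i} (shiftRoot b f)) (shiftRoot s x))
    (hl : l ∈ argminOn (argminOn {m | ¬ SameClass p m i} (shiftRoot b f)) (shiftRoot s x))
    (hlt : shiftRoot b f i < shiftRoot b f k ∨
      (shiftRoot b f i = shiftRoot b f k ∧ shiftRoot s x i < shiftRoot s x k)) :
    HasType p C ConeType.III := by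
  obtain ⟨a, b', h1, rfl, h2, h3⟩ := exists_minAtPairs_of_ray hray hi hj hk hl hlt
  exact ⟨i, j, k, l, isCellIII_minCone hΔ hS h1 nij nkl hij hki hkl h2 h3⟩

end ray

/-- The lowest exponents of a block of given type. -/
def blockLow (p : ℕ) : ConeType → Finset ℕ
  | ConeType.I => {0, 1, 2}
  | ConeType.II => {0, 2 * p}
  | ConeType.III => {0, 2 * p}

/-- The second lowest exponents of a block of given type. -/
def blockHigh (p : ℕ) : ConeType → Finset ℕ
  | ConeType.I => ∅
  | ConeType.II => {1, 2}
  | ConeType.III => {1, 1 + p}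

/-- The largest exponent of a block of given type. -/
def blockLen (p : ℕ) : ConeType → ℕ
  | ConeType.I => 2
  | ConeType.II => 2 * p
  | ConeType.III => 2 * p

/-- A block of type `s` is a simple root; the cones over the corresponding cell have type `s`. -/
lemma IsBlock.exists_isRootType (hΔ : tropHypersurface S = singularSet p n) (hS : S.Nonempty)
    (hp : 2 < p) {s : ConeType}
    (h : IsBlock (shiftRoot b f) q (blockLow p s) (blockHigh p s) κ) (hn : q + 2 * p ≤ n) :
    ∃ M N, IsRootType p (shiftRoot b f) M N ∧ IsSimple M N ∧
      ∀ (x : Fin (n + 1) → ℝ) (C : Set (Fin (n + 1) → ℝ)), AffineOn M N x →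
        (∀ᶠ t in 𝓝[>] (0 : ℝ),
          Module.finrank ℝ (dirSpace S (f + t • x)) = 1 ∧ C = minCone S (f + t • x)) →
        HasType p C s := by
  have m0 : 0 % p = 0 := Nat.zero_mod p
  have m1 : 1 % p = 1 := Nat.mod_eq_of_lt (by omega)
  have m2 : 2 % p = 2 := Nat.mod_eq_of_lt hp
  have mpp : 2 * p % p = 0 := Nat.mul_mod_left 2 p
  have mp1 : (1 + p) % p = 1 := by rw [Nat.add_mod_right, m1]
  have g0 : q + 0 ≤ n := by omega
  have g1 : q + 1 ≤ n := by omega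
  have g2 : q + 2 ≤ n := by omega
  have gp1 : q + (1 + p) ≤ n := by omega
  have c01 : ¬ SameClass p (expo q 0 g0) (expo q 1 g1) := by rw [expo_sameClass, m0, m1]; decide
  have c02 : ¬ SameClass p (expo q 0 g0) (expo q 2 g2) := by rw [expo_sameClass, m0, m2]; decide
  have c12 : ¬ SameClass p (expo q 1 g1) (expo q 2 g2) := by rw [expo_sameClass, m1, m2]; decide
  have c0pp : SameClass p (expo q 0 g0) (expo q (2 * p) hn) := by rw [expo_sameClass, m0, mpp]
  have c1p1 : SameClass p (expo q 1 g1) (expo q (1 + p) gp1) := by rw [expo_sameClass, m1, mp1]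
  have n0pp : expo q 0 g0 ≠ expo q (2 * p) hn := by rw [Ne, expo_injective]; omega
  have n1p1 : expo q 1 g1 ≠ expo q (1 + p) gp1 := by rw [Ne, expo_injective]; omega
  have hmem : ∀ {A : Set (Fin (n + 1))} {x : Fin (n + 1) → ℝ} {σ c : ℝ},
      (∀ i ∈ A, shiftRoot σ x i = c) → ∀ i ∈ A, i ∈ argminOn A (shiftRoot σ x) :=
    fun hA i hi => ⟨hi, fun m hm => (hA i hi).trans_le (hA m hm).ge⟩
  cases s with
  | I =>
    have hM := blockSet_triple g0 g1 g2
    have hu := h.argminOn_univ ⟨expo q 0 g0, 0, by simp [blockLow], rfl⟩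
    simp only [blockLow] at hu
    rw [hM] at hu
    have htri : IsTri p (shiftRoot b f) {expo q 0 g0, expo q 1 g1, expo q 2 g2} :=
      ⟨hu.symm, _, by simp, _, by simp, _, by simp, c01, c02, c12⟩
    refine ⟨_, ∅, Or.inl ⟨htri, rfl⟩, Or.inl ⟨(Set.ncard_insert_le _ _).trans
      (Nat.succ_le_succ ((Set.ncard_insert_le _ _).trans (by rw [Set.ncard_singleton]))), rfl⟩,
      fun x C hx hray => ?_⟩
    obtain ⟨σ, c, d, hσ, -⟩ := hx
    exact hasType_I_of_ray hΔ hS (s := σ) (b := b) hray c01 c02 c12 (by rw [hu]; exact hmem hσ _ (by simp))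
      (by rw [hu]; exact hmem hσ _ (by simp)) (by rw [hu]; exact hmem hσ _ (by simp))
  | II =>
    simp only [blockLow, blockHigh] at h
    have hM := blockSet_pair g0 hn
    have hN := blockSet_pair g1 g2
    have hMr : ∀ m ∈ blockSet n q {0, 2 * p}, SameClass p m (expo q 0 g0) := by
      rw [hM]; rintro m (rfl | rfl)
      · exact SameClass.refl' _
      · exact c0pp.symm'
    have hNr : ∀ m ∈ blockSet n q {1, 2}, ¬ SameClass p m (expo q 0 g0) := by
      rw [hN]; rintro m (rfl | rfl)
      · exact fun h => c01 h.symm'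
      · exact fun h => c02 h.symm'
    have n12 := SameClass.ne_of_not c12
    have hpair := h.isPair (r := expo q 0 g0) (by rw [hM]; simp) hMr hNr
      (by rw [hM]; exact Set.nontrivial_pair n0pp) (by rw [hN]; exact Set.nontrivial_pair n12)
    have hu := h.argminOn_univ hpair.nontrivM.nonempty
    have hc := h.argminOn_compl hMr hNr hpair.nontrivN.nonempty
    have v0 := h.left (expo q 0 g0) (by rw [hM]; simp)
    have v1 := h.right (expo q 1 g1) (by rw [hN]; simp)
    rw [hM] at hu
    rw [hN] at hc
    rw [hM, hN] at hpair
    refine ⟨_, _, Or.inr ⟨_, hpair⟩, Or.inr ⟨(Set.ncard_pair n0pp).le, (Set.ncard_pair n12).le⟩,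
      fun x C hx hray => ?_⟩
    obtain ⟨σ, c, d, hσ, hσ'⟩ := hx
    exact hasType_II_of_ray hΔ hS (s := σ) (b := b) hray n0pp c0pp (fun h => c01 h.symm')
      (fun h => c02 h.symm') c12 (by rw [hu]; exact hmem hσ _ (by simp))
      (by rw [hu]; exact hmem hσ _ (by simp)) (by rw [hc]; exact hmem hσ' _ (by simp))
      (by rw [hc]; exact hmem hσ' _ (by simp)) (Or.inl (by rw [v0, v1]; linarith))
  | III =>
    simp only [blockLow, blockHigh] at h
    have hM := blockSet_pair g0 hn
    have hN := blockSet_pair g1 gp1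
    have hMr : ∀ m ∈ blockSet n q {0, 2 * p}, SameClass p m (expo q 0 g0) := by
      rw [hM]; rintro m (rfl | rfl)
      · exact SameClass.refl' _
      · exact c0pp.symm'
    have hNr : ∀ m ∈ blockSet n q {1, 1 + p}, ¬ SameClass p m (expo q 0 g0) := by
      rw [hN]; rintro m (rfl | rfl)
      · exact fun h => c01 h.symm'
      · exact fun h => c01 (c1p1.trans' h).symm'
    have hpair := h.isPair (r := expo q 0 g0) (by rw [hM]; simp) hMr hNr
      (by rw [hM]; exact Set.nontrivial_pair n0pp) (by rw [hN]; exact Set.nontrivial_pair n1p1)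
    have hu := h.argminOn_univ hpair.nontrivM.nonempty
    have hc := h.argminOn_compl hMr hNr hpair.nontrivN.nonempty
    have v0 := h.left (expo q 0 g0) (by rw [hM]; simp)
    have v1 := h.right (expo q 1 g1) (by rw [hN]; simp)
    rw [hM] at hu
    rw [hN] at hc
    rw [hM, hN] at hpair
    refine ⟨_, _, Or.inr ⟨_, hpair⟩, Or.inr ⟨(Set.ncard_pair n0pp).le, (Set.ncard_pair n1p1).le⟩,
      fun x C hx hray => ?_⟩
    obtain ⟨σ, c, d, hσ, hσ'⟩ := hx
    exact hasType_III_of_ray hΔ hS (s := σ) (b := b) hray n0pp n1p1 c0pp (fun h => c01 h.symm')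
      c1p1 (by rw [hu]; exact hmem hσ _ (by simp))
      (by rw [hu]; exact hmem hσ _ (by simp)) (by rw [hc]; exact hmem hσ' _ (by simp))
      (by rw [hc]; exact hmem hσ' _ (by simp)) (Or.inl (by rw [v0, v1]; linarith))

/-! ### Points with one double root -/

section one_block
variable {M N : Finset ℕ} {L : ℕ}

lemma isBlock_blockFun (hM : ∀ a ∈ M, a ≤ L) (hN : ∀ a ∈ N, a ≤ L) (hMN : Disjoint M N) :
    IsBlock (shiftRoot 0 fun m : Fin (n + 1) => blockFun M N L m) 0 M N 0 := by
  rw [shiftRoot_zero]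
  refine ⟨?_, ?_, ?_⟩
  · rintro m ⟨a, ha, hm⟩
    rw [zero_add] at hm
    rw [hm, blockFun, if_pos (hM a ha), level_of_mem ha]
  · rintro m ⟨a, ha, hm⟩
    rw [zero_add] at hm
    have : a ∉ M := fun h => Finset.disjoint_left.1 hMN h ha
    rw [hm, blockFun, if_pos (hN a ha), level, if_neg this, if_pos ha, zero_add]
  · intro m h1 h2
    have h1' : (m : ℕ) ∉ M := fun h => h1 ⟨m, h, (zero_add _).symm⟩
    have h2' : (m : ℕ) ∉ N := fun h => h2 ⟨m, h, (zero_add _).symm⟩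
    rcases le_or_gt (m : ℕ) L with h | h
    · rw [blockFun, if_pos h, level, if_neg h1', if_neg h2', zero_add]
    · linarith [three_le_blockFun (M := M) (N := N) h]

lemma roots_blockFun (hp : 2 < p) (h0 : 0 ∈ M) (hL : L ∈ M) (hn : L ≤ n)
    {f : Fin (n + 1) → ℝ} (hf : f = fun m : Fin (n + 1) => blockFun M N L m)
    {A B : Set (Fin (n + 1))} (h : IsRootType p (shiftRoot 0 f) A B) :
    {b | shiftRoot b f ∈ singularSpace p n} = {0} := by
  refine Set.Subset.antisymm (fun b hb => ?_) ?_
  · obtain ⟨i, hi, j, hj, hij⟩ := exists_far_argmin hp hb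
    rw [hf] at hi hj
    exact eq_zero_of_argmin_blockFun h0 hL hn (Nat.lt_succ_iff.1 j.2) hij
      (fun m hm => hi.2 ⟨m, Nat.lt_succ_of_le hm⟩ trivial) (eq_of_mem_argminOn hi hj)
  · rintro b rfl
    exact h.mem_singularSpace

end one_block

/-- A point with one double root and three cones of types `τ`. -/
def OneRootConfig (p : ℕ) (S : Finset (Module.Dual ℝ (Fin (n + 1) → ℝ))) (τ : Fin 3 → ConeType) :
    Prop :=
  ∃ f b, {b | shiftRoot b f ∈ singularSpace p n} = {b} ∧ Module.finrank ℝ (dirSpace S f) = 2 ∧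
    ∃ C : Fin 3 → Set (Fin (n + 1) → ℝ), Function.Injective C ∧
      ∀ r, IsMaximalCone (tropHypersurface S) (C r) ∧ f ∈ C r ∧ HasType p (C r) (τ r)

lemma oneRootConfig_tri (hΔ : tropHypersurface S = singularSet p n) (hS : S.Nonempty)
    (hp : 2 < p) (hn : 2 * p ≤ n) :
    OneRootConfig p S ![ConeType.I, ConeType.I, ConeType.II] := by
  have m0 : 0 % p = 0 := Nat.zero_mod p
  have m1 : 1 % p = 1 := Nat.mod_eq_of_lt (by omega)
  have m2 : 2 % p = 2 := Nat.mod_eq_of_lt hp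
  have mp : p % p = 0 := Nat.mod_self p
  have g0 : 0 + 0 ≤ n := by omega
  have g1 : 0 + 1 ≤ n := by omega
  have g2 : 0 + 2 ≤ n := by omega
  have gp : 0 + p ≤ n := by omega
  set i := expo 0 0 g0
  set j := expo 0 p gp
  set k := expo 0 1 g1
  set l := expo 0 2 g2
  have cij : SameClass p i j := by rw [expo_sameClass, m0, mp]
  have cik : ¬ SameClass p i k := by rw [expo_sameClass, m0, m1]; decide
  have cil : ¬ SameClass p i l := by rw [expo_sameClass, m0, m2]; decide
  have ckl : ¬ SameClass p k l := by rw [expo_sameClass, m1, m2]; decide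
  have cjk : ¬ SameClass p j k := fun h => cik (cij.trans' h)
  have cjl : ¬ SameClass p j l := fun h => cil (cij.trans' h)
  have nij : i ≠ j := by rw [Ne, expo_injective]; omega
  have nik := SameClass.ne_of_not cik
  have nil := SameClass.ne_of_not cil
  have nkl := SameClass.ne_of_not ckl
  have njk := SameClass.ne_of_not cjk
  have njl := SameClass.ne_of_not cjl
  have hblock := isBlock_blockFun (n := n) (M := {0, p, 1, 2}) (N := ∅) (L := p)
    (by simp; omega) (by simp) (by simp)
  set f : Fin (n + 1) → ℝ := fun m => blockFun {0, p, 1, 2} ∅ p m with hf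
  have hM : blockSet n 0 {0, p, 1, 2} = {i, j, k, l} := blockSet_quadruple g0 gp g1 g2
  have hu := hblock.argminOn_univ (by rw [hM]; exact ⟨i, by simp⟩)
  rw [hM] at hu
  have htri : IsTri p (shiftRoot 0 f) {i, j, k, l} :=
    ⟨hu.symm, i, by simp, k, by simp, l, by simp, cik, cil, ckl⟩
  have hroots := roots_blockFun hp (by simp) (by simp) (by omega) hf (Or.inl ⟨htri, rfl⟩)
  obtain ⟨h2, C, hinj, hC, hray⟩ := hasCones_of_tri hΔ hS hroots htri nij cij cik cil ckl
  refine ⟨f, 0, hroots, h2, C, hinj, fun r => ?_⟩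
  have hr := (hC (C r)).2 ⟨r, rfl⟩
  refine ⟨hr.1, hr.2, ?_⟩
  have hray := hray r
  fin_cases r
  · refine hasType_I_of_ray hΔ hS (s := 0) (b := 0) hray cjk cjl ckl ?_ ?_ ?_ <;>
      rw [hu, shiftRoot_zero]
    · exact mem_argminOn_of_eq_zero (by simp) (by simp [nij.symm]) (single_one_nonneg i)
    · exact mem_argminOn_of_eq_zero (by simp) (by simp [nik.symm]) (single_one_nonneg i)
    · exact mem_argminOn_of_eq_zero (by simp) (by simp [nil.symm]) (single_one_nonneg i)
  · refine hasType_I_of_ray hΔ hS (s := 0) (b := 0) hray cik cil ckl ?_ ?_ ?_ <;>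
      rw [hu, shiftRoot_zero]
    · exact mem_argminOn_of_eq_zero (by simp) (by simp [nij]) (single_one_nonneg j)
    · exact mem_argminOn_of_eq_zero (by simp) (by simp [njk.symm]) (single_one_nonneg j)
    · exact mem_argminOn_of_eq_zero (by simp) (by simp [njl.symm]) (single_one_nonneg j)
  · have hnn : ∀ m, 0 ≤ (Pi.single k 1 + Pi.single l 1 : Fin (n + 1) → ℝ) m := fun m =>
      add_nonneg (single_one_nonneg k m) (single_one_nonneg l m)
    have hone : ∀ m ∈ ({i, j, k, l} ∩ {m | ¬ SameClass p m i} : Set (Fin (n + 1))),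
        (Pi.single k 1 + Pi.single l 1 : Fin (n + 1) → ℝ) m = 1 := by
      rintro m ⟨rfl | rfl | rfl | rfl, hm⟩
      · exact absurd (SameClass.refl' _) hm
      · exact absurd cij.symm' hm
      · simp [nkl]
      · simp [nkl.symm]
    have hmem : ∀ m ∈ ({i, j, k, l} ∩ {m | ¬ SameClass p m i} : Set (Fin (n + 1))),
        m ∈ argminOn (argminOn {m | ¬ SameClass p m i} (shiftRoot 0 f))
          (shiftRoot 0 (Pi.single k 1 + Pi.single l 1)) := by
      intro m hm
      rw [htri.argminOn_eq, shiftRoot_zero]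
      exact ⟨hm, fun m' hm' => (hone m hm).trans_le (hone m' hm').ge⟩
    refine hasType_II_of_ray hΔ hS (s := 0) (b := 0) hray nij cij (fun h => cik h.symm')
      (fun h => cil h.symm') ckl ?_ ?_ (hmem k ⟨by simp, fun h => cik h.symm'⟩)
      (hmem l ⟨by simp, fun h => cil h.symm'⟩) (Or.inr ⟨?_, ?_⟩)
    · rw [hu, shiftRoot_zero]
      exact mem_argminOn_of_eq_zero (by simp) (by simp [nik, nil]) hnn
    · rw [hu, shiftRoot_zero]
      exact mem_argminOn_of_eq_zero (by simp) (by simp [njk, njl]) hnn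
    · refine eq_of_mem_argminOn (A := Set.univ) ?_ ?_ <;> rw [hu]
      · simp
      · simp
    · rw [shiftRoot_zero]
      simp [nik, nil, nkl]

lemma oneRootConfig_left (hΔ : tropHypersurface S = singularSet p n) (hS : S.Nonempty)
    (hp : 2 < p) (hn : 2 * p ≤ n) :
    OneRootConfig p S ![ConeType.II, ConeType.III, ConeType.II] := by
  have m0 : 0 % p = 0 := Nat.zero_mod p
  have m1 : 1 % p = 1 := Nat.mod_eq_of_lt (by omega)
  have m2 : 2 % p = 2 := Nat.mod_eq_of_lt hp
  have mpp : 2 * p % p = 0 := Nat.mul_mod_left 2 p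
  have mp1 : (1 + p) % p = 1 := by rw [Nat.add_mod_right, m1]
  have g0 : 0 + 0 ≤ n := by omega
  have g1 : 0 + 1 ≤ n := by omega
  have g2 : 0 + 2 ≤ n := by omega
  have gpp : 0 + 2 * p ≤ n := by omega
  have gp1 : 0 + (1 + p) ≤ n := by omega
  set i := expo 0 0 g0
  set j := expo 0 (2 * p) gpp
  set k := expo 0 1 g1
  set l := expo 0 2 g2
  set t := expo 0 (1 + p) gp1
  have cij : SameClass p i j := by rw [expo_sameClass, m0, mpp]
  have cki : ¬ SameClass p k i := by rw [expo_sameClass, m0, m1]; decide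
  have cli : ¬ SameClass p l i := by rw [expo_sameClass, m0, m2]; decide
  have ckl : ¬ SameClass p k l := by rw [expo_sameClass, m1, m2]; decide
  have ckt : SameClass p k t := by rw [expo_sameClass, m1, mp1]
  have cti : ¬ SameClass p t i := fun h => cki (ckt.trans' h)
  have clt : ¬ SameClass p l t := fun h => ckl (ckt.trans' h.symm')
  have nij : i ≠ j := by rw [Ne, expo_injective]; omega
  have nkt : k ≠ t := by rw [Ne, expo_injective]; omega
  have nkl := SameClass.ne_of_not ckl
  have nlt := SameClass.ne_of_not clt
  have hblock := isBlock_blockFun (n := n) (M := {0, 2 * p}) (N := {1, 2, 1 + p}) (L := 2 * p)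
    (by simp) (by simp; omega) (by simp; omega)
  set f : Fin (n + 1) → ℝ := fun m => blockFun {0, 2 * p} {1, 2, 1 + p} (2 * p) m with hf
  have hM : blockSet n 0 {0, 2 * p} = {i, j} := blockSet_pair g0 gpp
  have hN : blockSet n 0 {1, 2, 1 + p} = {k, l, t} := blockSet_triple g1 g2 gp1
  have hMr : ∀ m ∈ blockSet n 0 {0, 2 * p}, SameClass p m i := by
    rw [hM]; rintro m (rfl | rfl)
    · exact SameClass.refl' _
    · exact cij.symm'
  have hNr : ∀ m ∈ blockSet n 0 {1, 2, 1 + p}, ¬ SameClass p m i := by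
    rw [hN]; rintro m (rfl | rfl | rfl) <;> assumption
  have hpair := hblock.isPair (r := i) (by rw [hM]; simp) hMr hNr
    (by rw [hM]; exact Set.nontrivial_pair nij)
    (by rw [hN]; exact ⟨k, by simp, l, by simp, nkl⟩)
  have hu := hblock.argminOn_univ hpair.nontrivM.nonempty
  have hc := hblock.argminOn_compl hMr hNr hpair.nontrivN.nonempty
  have hlt : ∀ m ∈ ({k, l, t} : Set (Fin (n + 1))), shiftRoot 0 f i < shiftRoot 0 f m := by
    intro m hm
    rw [hblock.left i (by rw [hM]; simp), hblock.right m (by rw [hN]; exact hm)]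
    norm_num
  rw [hM] at hu
  rw [hN] at hc
  rw [hM, hN] at hpair
  have hroots := roots_blockFun hp (by simp) (by simp) (by omega) hf (Or.inr ⟨i, hpair⟩)
  obtain ⟨h2, C, hinj, hC, hray⟩ := hasCones_of_pair_left hΔ hS hroots hpair nij nkl nkt nlt
  refine ⟨f, 0, hroots, h2, C, hinj, fun r => ?_⟩
  have hr := (hC (C r)).2 ⟨r, rfl⟩
  refine ⟨hr.1, hr.2, ?_⟩
  have hray := hray r
  have hlow : ∀ m ∈ ({k, l, t} : Set (Fin (n + 1))), ∀ m' ∈ ({i, j} : Set (Fin (n + 1))),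
      m' ∈ argminOn (argminOn Set.univ (shiftRoot 0 f)) (shiftRoot 0 (Pi.single m 1)) := by
    intro m hm m' hm'
    have hne : m' ≠ m := fun h => hpair.disjoint hm' (h ▸ hm)
    rw [hu, shiftRoot_zero]
    exact mem_argminOn_of_eq_zero hm' (by simp [hne]) (single_one_nonneg m)
  have hhigh : ∀ m, ∀ m' ∈ ({k, l, t} : Set (Fin (n + 1))), m' ≠ m →
      m' ∈ argminOn (argminOn {m | ¬ SameClass p m i} (shiftRoot 0 f))
        (shiftRoot 0 (Pi.single m 1)) := by
    intro m m' hm' hne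
    rw [hc, shiftRoot_zero]
    exact mem_argminOn_of_eq_zero hm' (by simp [hne]) (single_one_nonneg m)
  fin_cases r
  · exact hasType_II_of_ray hΔ hS (s := 0) (b := 0) hray nij cij cli cti clt
      (hlow k (by simp) i (by simp)) (hlow k (by simp) j (by simp))
      (hhigh k l (by simp) nkl.symm) (hhigh k t (by simp) nkt.symm) (Or.inl (hlt l (by simp)))
  · exact hasType_III_of_ray hΔ hS (s := 0) (b := 0) hray nij nkt cij cki ckt
      (hlow l (by simp) i (by simp)) (hlow l (by simp) j (by simp))
      (hhigh l k (by simp) nkl) (hhigh l t (by simp) nlt.symm) (Or.inl (hlt k (by simp)))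
  · exact hasType_II_of_ray hΔ hS (s := 0) (b := 0) hray nij cij cki cli ckl
      (hlow t (by simp) i (by simp)) (hlow t (by simp) j (by simp))
      (hhigh t k (by simp) nkt) (hhigh t l (by simp) nlt) (Or.inl (hlt k (by simp)))

lemma oneRootConfig_right (hΔ : tropHypersurface S = singularSet p n) (hS : S.Nonempty)
    (hp : 2 < p) (hn : 2 * p ≤ n) :
    OneRootConfig p S ![ConeType.III, ConeType.III, ConeType.III] := by
  have m0 : 0 % p = 0 := Nat.zero_mod p
  have m1 : 1 % p = 1 := Nat.mod_eq_of_lt (by omega)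
  have mp : p % p = 0 := Nat.mod_self p
  have mpp : 2 * p % p = 0 := Nat.mul_mod_left 2 p
  have mp1 : (1 + p) % p = 1 := by rw [Nat.add_mod_right, m1]
  have g0 : 0 + 0 ≤ n := by omega
  have g1 : 0 + 1 ≤ n := by omega
  have gp : 0 + p ≤ n := by omega
  have gpp : 0 + 2 * p ≤ n := by omega
  have gp1 : 0 + (1 + p) ≤ n := by omega
  set k := expo 0 0 g0
  set l := expo 0 p gp
  set t := expo 0 (2 * p) gpp
  set i := expo 0 1 g1
  set j := expo 0 (1 + p) gp1
  have clk : SameClass p l k := by rw [expo_sameClass, m0, mp]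
  have ctk : SameClass p t k := by rw [expo_sameClass, m0, mpp]
  have cij : SameClass p i j := by rw [expo_sameClass, m1, mp1]
  have cik : ¬ SameClass p i k := by rw [expo_sameClass, m0, m1]; decide
  have cjk : ¬ SameClass p j k := fun h => cik (cij.trans' h)
  have nij : i ≠ j := by rw [Ne, expo_injective]; omega
  have nkl : k ≠ l := by rw [Ne, expo_injective]; omega
  have nkt : k ≠ t := by rw [Ne, expo_injective]; omega
  have nlt : l ≠ t := by rw [Ne, expo_injective]; omega
  have hblock := isBlock_blockFun (n := n) (M := {0, p, 2 * p}) (N := {1, 1 + p}) (L := 2 * p)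
    (by simp; omega) (by simp; omega) (by simp; omega)
  set f : Fin (n + 1) → ℝ := fun m => blockFun {0, p, 2 * p} {1, 1 + p} (2 * p) m with hf
  have hM : blockSet n 0 {0, p, 2 * p} = {k, l, t} := blockSet_triple g0 gp gpp
  have hN : blockSet n 0 {1, 1 + p} = {i, j} := blockSet_pair g1 gp1
  have hMr : ∀ m ∈ blockSet n 0 {0, p, 2 * p}, SameClass p m k := by
    rw [hM]; rintro m (rfl | rfl | rfl)
    · exact SameClass.refl' _
    · exact clk
    · exact ctk
  have hNr : ∀ m ∈ blockSet n 0 {1, 1 + p}, ¬ SameClass p m k := by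
    rw [hN]; rintro m (rfl | rfl) <;> assumption
  have hpair := hblock.isPair (r := k) (by rw [hM]; simp) hMr hNr
    (by rw [hM]; exact ⟨k, by simp, l, by simp, nkl⟩)
    (by rw [hN]; exact Set.nontrivial_pair nij)
  have hu := hblock.argminOn_univ hpair.nontrivM.nonempty
  have hc := hblock.argminOn_compl hMr hNr hpair.nontrivN.nonempty
  have hlt : ∀ m ∈ ({k, l, t} : Set (Fin (n + 1))), shiftRoot 0 f m < shiftRoot 0 f i := by
    intro m hm
    rw [hblock.left m (by rw [hM]; exact hm), hblock.right i (by rw [hN]; simp)]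
    norm_num
  rw [hM] at hu hMr
  rw [hN] at hc
  rw [hM, hN] at hpair
  have hroots := roots_blockFun hp (by simp) (by simp) (by omega) hf (Or.inr ⟨k, hpair⟩)
  obtain ⟨h2, C, hinj, hC, hray⟩ := hasCones_of_pair_right hΔ hS hroots hpair nij nkl nkt nlt
  refine ⟨f, 0, hroots, h2, C, hinj, fun r => ?_⟩
  have hr := (hC (C r)).2 ⟨r, rfl⟩
  refine ⟨hr.1, hr.2, ?_⟩
  have hray := hray r
  have hlow : ∀ m, ∀ m' ∈ ({k, l, t} : Set (Fin (n + 1))), m' ≠ m →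
      m' ∈ argminOn (argminOn Set.univ (shiftRoot 0 f)) (shiftRoot 0 (Pi.single m 1)) := by
    intro m m' hm' hne
    rw [hu, shiftRoot_zero]
    exact mem_argminOn_of_eq_zero hm' (by simp [hne]) (single_one_nonneg m)
  have hhigh : ∀ m ∈ ({k, l, t} : Set (Fin (n + 1))), ∀ r ∈ ({k, l, t} : Set (Fin (n + 1))),
      ∀ m' ∈ ({i, j} : Set (Fin (n + 1))),
      m' ∈ argminOn (argminOn {m | ¬ SameClass p m r} (shiftRoot 0 f))
        (shiftRoot 0 (Pi.single m 1)) := by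
    intro m hm r hr m' hm'
    have hne : m' ≠ m := fun h => hpair.disjoint hm (h ▸ hm')
    rw [hpair.argminOn_eq_right (hMr r hr), shiftRoot_zero]
    exact mem_argminOn_of_eq_zero hm' (by simp [hne]) (single_one_nonneg m)
  have hcl : ∀ m ∈ ({k, l, t} : Set (Fin (n + 1))), ¬ SameClass p i m :=
    fun m hm h => cik (h.trans' (hMr m hm))
  have key : ∀ m ∈ ({k, l, t} : Set (Fin (n + 1))), ∀ a ∈ ({k, l, t} : Set (Fin (n + 1))),
      ∀ a' ∈ ({k, l, t} : Set (Fin (n + 1))), a ≠ m → a' ≠ m → a ≠ a' →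
      ∀ D, (∀ᶠ τ in 𝓝[>] (0 : ℝ), Module.finrank ℝ (dirSpace S (f + τ • Pi.single m (1 : ℝ))) = 1 ∧
        D = minCone S (f + τ • Pi.single m (1 : ℝ))) → HasType p D ConeType.III := by
    intro m hm a ha a' ha' ham ham' haa D hD
    exact hasType_III_of_ray hΔ hS (s := 0) (b := 0) hD haa nij
      ((hMr a ha).trans' (hMr a' ha').symm') (hcl a ha) cij (hlow m a ha ham) (hlow m a' ha' ham')
      (hhigh m hm a ha i (by simp)) (hhigh m hm a ha j (by simp)) (Or.inl (hlt a ha))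
  fin_cases r
  · exact key k (by simp) l (by simp) t (by simp) nkl.symm nkt.symm nlt _ hray
  · exact key l (by simp) k (by simp) t (by simp) nkl nlt.symm nkt _ hray
  · exact key t (by simp) k (by simp) l (by simp) nkt nlt nkl _ hray

/-! ### Points with two double roots -/

section two_blocks
variable {M N M' N' : Finset ℕ} {L L' : ℕ}

lemma isBlock_twoBlockFun_left (hM : ∀ a ∈ M, a ≤ L) (hN : ∀ a ∈ N, a ≤ L) (hMN : Disjoint M N) :
    IsBlock (shiftRoot 0 fun m : Fin (n + 1) => twoBlockFun M N M' N' L L' m) 0 M N 0 := by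
  rw [shiftRoot_zero]
  refine ⟨?_, ?_, ?_⟩
  · rintro m ⟨a, ha, hm⟩
    rw [zero_add] at hm
    rw [hm, twoBlockFun, if_pos (hM a ha), level_of_mem ha]
  · rintro m ⟨a, ha, hm⟩
    rw [zero_add] at hm
    have : a ∉ M := fun h => Finset.disjoint_left.1 hMN h ha
    rw [hm, twoBlockFun, if_pos (hN a ha), level, if_neg this, if_pos ha, zero_add]
  · intro m h1 h2
    have h1' : (m : ℕ) ∉ M := fun h => h1 ⟨m, h, (zero_add _).symm⟩
    have h2' : (m : ℕ) ∉ N := fun h => h2 ⟨m, h, (zero_add _).symm⟩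
    rcases le_or_gt (m : ℕ) L with h | h
    · rw [twoBlockFun, if_pos h, level, if_neg h1', if_neg h2', zero_add]
    · rw [twoBlockFun, if_neg (not_le.2 h)]
      have h3 : ((L + 1 : ℕ) : ℝ) ≤ ((m : ℕ) : ℝ) := by exact_mod_cast h
      linarith [blockFun_nonneg (M := M') (N := N') (L := L') (m - (L + 1))]

lemma isBlock_twoBlockFun_right (hM : ∀ a ∈ M', a ≤ L') (hN : ∀ a ∈ N', a ≤ L')
    (hMN : Disjoint M' N') :
    IsBlock (shiftRoot (-6) fun m : Fin (n + 1) => twoBlockFun M N M' N' L L' m) (L + 1) M' N'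
      (3 - 6 * (L + 1 : ℕ)) := by
  have hval : ∀ (m : Fin (n + 1)) a, (m : ℕ) = L + 1 + a →
      shiftRoot (-6) (fun m : Fin (n + 1) => twoBlockFun M N M' N' L L' m) m =
        3 - 6 * (L + 1 : ℕ) + blockFun M' N' L' a := by
    intro m a hm
    rw [shiftRoot, hm, twoBlockFun, if_neg (by omega), Nat.add_sub_cancel_left, Nat.cast_add]
    ring
  refine ⟨?_, ?_, ?_⟩
  · rintro m ⟨a, ha, hm⟩
    rw [hval m a hm, blockFun, if_pos (hM a ha), level_of_mem ha, add_zero]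
  · rintro m ⟨a, ha, hm⟩
    have : a ∉ M' := fun h => Finset.disjoint_left.1 hMN h ha
    rw [hval m a hm, blockFun, if_pos (hN a ha), level, if_neg this, if_pos ha]
  · intro m h1 h2
    rcases le_or_gt (m : ℕ) L with h | h
    · rw [shiftRoot, twoBlockFun, if_pos h]
      have h3 : ((m : ℕ) : ℝ) ≤ L := by exact_mod_cast h
      push_cast
      linarith [level_nonneg (M := M) (N := N) m]
    · obtain ⟨a, ha⟩ := Nat.exists_eq_add_of_le (show L + 1 ≤ (m : ℕ) from h)
      have h1' : a ∉ M' := fun h => h1 ⟨a, h, ha⟩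
      have h2' : a ∉ N' := fun h => h2 ⟨a, h, ha⟩
      rw [hval m a ha]
      have : 2 ≤ blockFun M' N' L' a := by
        rcases le_or_gt a L' with h | h
        · rw [blockFun, if_pos h, level, if_neg h1', if_neg h2']
        · linarith [three_le_blockFun (M := M') (N := N') h]
      linarith

end two_blocks

/-- For all types `s`, `t` there is a point with two double roots and adjacent cones of these
types. -/
lemma exists_cones_two_blocks (hΔ : tropHypersurface S = singularSet p n) (hS : S.Nonempty)
    (hp : 2 < p) (s t : ConeType) (hn : 4 * p + 1 ≤ n) :
    ∃ f : Fin (n + 1) → ℝ, {b | shiftRoot b f ∈ singularSpace p n} = {-6, 0} ∧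
      Module.finrank ℝ (dirSpace S f) = 2 ∧ ∃ C C' : Set (Fin (n + 1) → ℝ), C ≠ C' ∧
      (IsMaximalCone (tropHypersurface S) C ∧ f ∈ C ∧ HasType p C s) ∧
      (IsMaximalCone (tropHypersurface S) C' ∧ f ∈ C' ∧ HasType p C' t) := by
  have hlow : ∀ s, 0 ∈ blockLow p s ∧ blockLen p s ∈ blockLow p s ∧
      (∀ a ∈ blockLow p s, a ≤ blockLen p s) ∧ (∀ a ∈ blockHigh p s, a ≤ blockLen p s) ∧
      Disjoint (blockLow p s) (blockHigh p s) ∧ blockLen p s ≤ 2 * p := by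
    intro s
    cases s <;> simp [blockLow, blockHigh, blockLen] <;> omega
  obtain ⟨s0, sL, sM, sN, sd, sl⟩ := hlow s
  obtain ⟨t0, tL, tM, tN, td, tl⟩ := hlow t
  set f : Fin (n + 1) → ℝ := fun m => twoBlockFun (blockLow p t) (blockHigh p t) (blockLow p s)
    (blockHigh p s) (blockLen p t) (blockLen p s) m with hf
  obtain ⟨M₂, N₂, r₂, s₂, τ₂⟩ := IsBlock.exists_isRootType hΔ hS hp (f := f) (b := 0)
    (isBlock_twoBlockFun_left tM tN td) (by omega)
  obtain ⟨M₁, N₁, r₁, s₁, τ₁⟩ := IsBlock.exists_isRootType hΔ hS hp (f := f) (b := -6)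
    (isBlock_twoBlockFun_right sM sN sd) (by omega)
  have hroots : {b | shiftRoot b f ∈ singularSpace p n} = {-6, 0} := by
    refine Set.Subset.antisymm (fun b hb => ?_) ?_
    · obtain ⟨i, hi, j, hj, hij⟩ := exists_far_argmin hp hb
      exact (eq_of_argmin_twoBlockFun t0 tL s0 sL (by omega) (Nat.lt_succ_iff.1 j.2) hij
        (fun m hm => hi.2 ⟨m, Nat.lt_succ_of_le hm⟩ trivial) (eq_of_mem_argminOn hi hj)).symm
    · rintro b (rfl | rfl)
      · exact r₁.mem_singularSpace
      · exact r₂.mem_singularSpace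
  obtain ⟨-, h2, w, a₁, a₂, C, hinj, hC, hray⟩ :=
    exists_cones_of_two_roots hΔ hS (by norm_num) hroots r₁ r₂ s₁ s₂
  have hm := fun r => (hC (C r)).2 ⟨r, rfl⟩
  exact ⟨f, hroots, h2, C 0, C 1, hinj.ne (by decide),
    ⟨(hm 0).1, (hm 0).2, τ₁ _ _ a₁ (hray 0)⟩, ⟨(hm 1).1, (hm 1).2, τ₂ _ _ a₂ (hray 1)⟩⟩

end configurations

section main
variable {K : Type*} [Field K] {v : AddValuation K (WithTop ℝ)} {p n : ℕ}
  {S : Finset (Module.Dual ℝ (Fin (n + 1) → ℝ))}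

lemma exists_areAdjacent_oneRoot [Fact p.Prime] (hX : tropDisc v n = tropHypersurface S)
    (hΔ : tropHypersurface S = singularSet p n) (hS : S.Nonempty)
    (hroots : ∀ f : Fin (n + 1) → ℝ, doubleRoots v f = {b | shiftRoot b f ∈ singularSpace p n})
    {τ : Fin 3 → ConeType} (h : OneRootConfig p S τ) {r s : Fin 3} (hrs : r ≠ s) :
    ∃ C₁ C₂ : Set (Fin (n + 1) → ℝ),
      AreAdjacent v C₁ C₂ ∧ HasType p C₁ (τ r) ∧ HasType p C₂ (τ s) ∧ OneRoot v (C₁ ∩ C₂) := by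
  obtain ⟨f, b, hb, h2, C, hinj, hC⟩ := h
  obtain ⟨hadj, hf⟩ := areAdjacent_of_finrank_eq_two (v := v) hX hS h2
    ⟨(hC r).1, (hC r).2.1⟩ ⟨(hC s).1, (hC s).2.1⟩ (hinj.ne hrs)
  refine ⟨C r, C s, hadj, (hC r).2.2, (hC s).2.2, ?_⟩
  refine (areAdjacent_structure p hX hΔ hS hroots hadj).2.1.resolve_left fun htwo => ?_
  obtain ⟨a₁, a₂, hne, ha⟩ := htwo f hf
  rw [hroots f, hb] at ha
  have h₁ : a₁ ∈ ({b} : Set ℝ) := ha ▸ Or.inl rfl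
  have h₂ : a₂ ∈ ({b} : Set ℝ) := ha ▸ Or.inr rfl
  exact hne (h₁.trans h₂.symm)

lemma exists_areAdjacent_twoRoots [Fact p.Prime] (hX : tropDisc v n = tropHypersurface S)
    (hΔ : tropHypersurface S = singularSet p n) (hS : S.Nonempty)
    (hroots : ∀ f : Fin (n + 1) → ℝ, doubleRoots v f = {b | shiftRoot b f ∈ singularSpace p n})
    (hp : 2 < p) (s t : ConeType) (hn : 4 * p + 1 ≤ n) :
    ∃ C₁ C₂ : Set (Fin (n + 1) → ℝ),
      AreAdjacent v C₁ C₂ ∧ HasType p C₁ s ∧ HasType p C₂ t ∧ TwoRoots v (C₁ ∩ C₂) := by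
  obtain ⟨f, hb, h2, C, C', hne, ⟨hC, hfC, hs⟩, hC', hfC', ht⟩ :=
    exists_cones_two_blocks hΔ hS hp s t hn
  obtain ⟨hadj, hf⟩ := areAdjacent_of_finrank_eq_two (v := v) hX hS h2 ⟨hC, hfC⟩ ⟨hC', hfC'⟩ hne
  refine ⟨C, C', hadj, hs, ht, ?_⟩
  refine (areAdjacent_structure p hX hΔ hS hroots hadj).2.1.resolve_right fun hone => ?_
  obtain ⟨a, ha⟩ := hone f hf
  rw [hroots f, hb] at ha
  have h₁ : (-6 : ℝ) ∈ ({a} : Set ℝ) := ha ▸ Or.inl rfl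
  have h₂ : (0 : ℝ) ∈ ({a} : Set ℝ) := ha ▸ Or.inr rfl
  have := h₁.trans h₂.symm
  norm_num at this

end main
theorem mainTheorem4 (p : ℕ) [Fact p.Prime] (hp : 2 < p) {K : Type*} [Field K] [IsAlgClosed K]
    [CharP K p] (v : AddValuation K (WithTop ℝ)) (hv : ∃ x : K, x ≠ 0 ∧ v x ≠ 0) :
    (∀ (n : ℕ) (C₁ C₂ : Set (Fin (n + 1) → ℝ)), AreAdjacent v C₁ C₂ →
      (intrinsicInterior ℝ (C₁ ∩ C₂)).Nonempty ∧
      (TwoRoots v (C₁ ∩ C₂) ∨ OneRoot v (C₁ ∩ C₂)) ∧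
      (TwoRoots v (C₁ ∩ C₂) → (conesWithFace v (C₁ ∩ C₂)).ncard = 4) ∧
      (OneRoot v (C₁ ∩ C₂) →
        ¬ (HasType p C₁ ConeType.I ∧ HasType p C₂ ConeType.III) ∧
        ¬ (HasType p C₁ ConeType.III ∧ HasType p C₂ ConeType.I) ∧
        (FourClassesI p C₁ C₂ → (conesWithFace v (C₁ ∩ C₂)).ncard = 4) ∧
        (¬ FourClassesI p C₁ C₂ → (conesWithFace v (C₁ ∩ C₂)).ncard = 3))) ∧
    (∀ s t : ConeType, ∃ N : ℕ, ∀ n ≥ N, ∃ C₁ C₂ : Set (Fin (n + 1) → ℝ),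
      AreAdjacent v C₁ C₂ ∧ HasType p C₁ s ∧ HasType p C₂ t ∧ TwoRoots v (C₁ ∩ C₂)) ∧
    (∀ s t : ConeType, ¬ (s = ConeType.I ∧ t = ConeType.III) →
      ¬ (s = ConeType.III ∧ t = ConeType.I) →
      ∃ N : ℕ, ∀ n ≥ N, ∃ C₁ C₂ : Set (Fin (n + 1) → ℝ),
        AreAdjacent v C₁ C₂ ∧ HasType p C₁ s ∧ HasType p C₂ t ∧ OneRoot v (C₁ ∩ C₂)) := by
  have key : ∀ n, ∃ S : Finset (Module.Dual ℝ (Fin (n + 1) → ℝ)), S.Nonempty ∧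
      tropDisc v n = tropHypersurface S ∧ tropHypersurface S = singularSet p n := by
    intro n
    obtain ⟨S, hS, hX⟩ := exists_tropDisc_eq_tropHypersurface v p hv n
    exact ⟨S, hS, hX, hX.symm.trans (tropDisc_eq v p hp hv)⟩
  have hroots := fun n => doubleRoots_eq (n := n) v p hp hv
  refine ⟨fun n C₁ C₂ h => ?_, fun s t => ⟨4 * p + 1, fun n hn => ?_⟩,
    fun s t h₁ h₂ => ⟨2 * p, fun n hn => ?_⟩⟩ <;> obtain ⟨S, hS, hX, hΔ⟩ := key n
  · exact areAdjacent_structure p hX hΔ hS (hroots n) h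
  · exact exists_areAdjacent_twoRoots hX hΔ hS (hroots n) hp s t hn
  · have ex := fun {τ} (h : OneRootConfig p S τ) {r s : Fin 3} (hrs : r ≠ s) =>
      exists_areAdjacent_oneRoot hX hΔ hS (hroots n) h hrs
    have tri := oneRootConfig_tri hΔ hS hp hn
    have left := oneRootConfig_left hΔ hS hp hn
    have right := oneRootConfig_right hΔ hS hp hn
    cases s <;> cases t
    · exact ex tri (show (0 : Fin 3) ≠ 1 by decide)
    · exact ex tri (show (0 : Fin 3) ≠ 2 by decide)
    · exact absurd ⟨rfl, rfl⟩ h₁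
    · exact ex tri (show (2 : Fin 3) ≠ 0 by decide)
    · exact ex left (show (0 : Fin 3) ≠ 2 by decide)
    · exact ex left (show (0 : Fin 3) ≠ 1 by decide)
    · exact absurd ⟨rfl, rfl⟩ h₂
    · exact ex left (show (1 : Fin 3) ≠ 0 by decide)
    · exact ex right (show (0 : Fin 3) ≠ 1 by decide)
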